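/- Let $d\ge 0$ be an integer, $\sigma>0$ and $C>0$. Write $\hat f(\xi)=\int_{\mathbb R^d}e^{-ix\cdot\xi}f(x)\,dx$ for the Fourier transform (in the sense of tempered distributions), $\mathcal F^{-1}$ for its inverse, and $\|u\|_{L^q_tL^r_x}=\|u\|_{L^q(\mathbb R;L^r(\mathbb R^d))}$. For a measurable $\lambda:\mathbb R^d\to\mathbb R$ and a bounded measurable $\psi:\mathbb R^d\to\mathbb C$ put $$V(t)f(x)=\frac1{(2\pi)^d}\int_{\mathbb R^d}e^{ix\cdot\xi+it\lambda(\xi)}\psi^2(\xi)\hat f(\xi)\,d\xi,\qquad \tilde V(t)f(x)=\frac1{(2\pi)^d}\int_{\mathbb R^d}e^{ix\cdot\xi+it\lambda(\xi)}\psi(\xi)\hat f(\xi)\,d\xi .$$ Assume that for some $\mu_1,\mu_2>0$, all $t\in\mathbb R$ and all Schwartz functions $f$, both $W=V$ and $W=\tilde V$ satisfy $$\|W(t)f\|_{L^\infty}\le \frac{C\mu_1}{(1+\mu_2|t|)^\sigma}\|f\|_{L^1},\qquad \|W(t)f\|_{L^2}\le C\|f\|_{L^2}.$$ A pair $(q,r)\in[2,\infty]^2$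 is $\sigma$-admissible if $(q,r,\sigma)\ne(2,\infty,1)$ and $\frac2q\le\sigma(1-\frac2r)$, and sharp $\sigma$-admissible if moreover equality holds. For $\sigma>1$ let $P_\sigma=(2,\frac{2\sigma}{\sigma-1})$ be the endpoint; for $\sigma\le1$ there is no endpoint to exclude. Put $$C_1=\|\mathcal F^{-1}(\psi^2)\|_{L^1},\quad C_2=\|\mathcal F^{-1}(\psi)\|_{L^1},\quad C_{4,r}=\|\mathcal F^{-1}(\psi)\|_{L^{(\frac12+\frac1r)^{-1}}},$$ $$C_{5,r,\tilde r}=C_2^{1/2}(1+C_2^{1/2})(1+C_{4,r}+C_{4,\tilde r}),\quad q_0=\frac{2r}{\sigma(r-2)},\quad \theta=\frac{2r}{q\sigma(r-2)}=\frac{q_0}{q},$$ where for $(q,r)=(\infty,2)$ one sets $1/q_0=0$ and $\theta$ may be any number in $[0,1]$. Below, $A\lesssim B$ means $A\le KB$ with a constant $K>0$ depending only on $d,\sigma,C$ and the exponents involved, and not on $\mu_1,\mu_2,\psi,\lambda,f,F$; primes denote conjugate exponents. Then: (i) If $C_1<\infty$, then for every $\sigma$-admissible pair $(q,r)\neq P_\sigma$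 and every $f\in L^2(\mathbb R^d)$, $$\|V(t)f\|_{L^q_tL^r_x}\lesssim C_1^{1/2}\mu_1^{\frac12-\frac1r}\mu_2^{-\frac1q}\|f\|_{L^2}.$$ (ii) If $C_2<\infty$, then for every $\sigma$-admissible $(q,r)\ne P_\sigma$, every sharp $\sigma$-admissible $(\tilde q,\tilde r)\ne P_\sigma$ and every $F\in L^{\tilde q'}_tL^{\tilde r'}_x$, the integral $\int_{-\infty}^tV(t-s)F(s)(x)\,ds$ converges absolutely for every $t$ and almost every $x$, and $$\Big\|\int_{-\infty}^tV(t-s)F(s)\,ds\Big\|_{L^q_tL^r_x}\lesssim C_2^{1/2}(1+C_2^{1/2})^\theta C_{4,r}^{1-\theta}(\mu_1^{1/\sigma}\mu_2^{-1})^{\frac1q+\frac1{\tilde q}}\|F\|_{L^{\tilde q'}_tL^{\tilde r'}_x}.$$ (iii) If $C_2<\infty$, then for all $\sigma$-admissible $(q,r)\ne P_\sigma$ and $(\tilde q,\tilde r)\ne P_\sigma$ and every $F\in L^{\tilde q'}_tL^{\tilde r'}_x$, the integral converges in the same sense and $$\Big\|\int_{-\infty}^tV(t-s)F(s)\,ds\Big\|_{L^q_tL^r_x}\lesssim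 (C_2^{1/2}C_{4,r})^{1-\theta}C_{5,r,\tilde r}^{\theta}\,\mu_1^{(\frac12-\frac1{\tilde r})(1-\theta)+\frac1\sigma(\frac1{q_0}+\frac1{\tilde q})\theta}\mu_2^{-(\frac1{\tilde q}+\frac1q)}\|F\|_{L^{\tilde q'}_tL^{\tilde r'}_x}.$$ -/

import Mathlib

open MeasureTheory Set
open scoped ENNReal SchwartzMap

noncomputable section

namespace Strichartz

/-- The Euclidean space `ℝ^d`. -/
abbrev Space (d : ℕ) : Type := EuclideanSpace ℝ (Fin d)

/-- `1/p` as a real number, with `1/∞ = 0`. -/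
def recip (p : ℝ≥0∞) : ℝ := (p⁻¹).toReal

/-- The Fourier integral `∫ e^{-i x·ξ} φ(ξ) dξ`. -/
def fourierIntegral {d : ℕ} (φ : Space d → ℂ) (x : Space d) : ℂ :=
  ∫ ξ, Complex.exp (-(Complex.I * ((inner ℝ x ξ : ℝ) : ℂ))) * φ ξ

/-- The function `g` is the Fourier transform `∫ e^{-i x·ξ} f(x) dx` of the function `f` in the sense
of tempered distributions: `∫ g φ = ∫ f φ̂` for all Schwartz functions `φ`.  On functions in
`L^p`, `1 ≤ p ≤ 2`, this is the usual Fourier transform. -/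
def IsFourierTransform {d : ℕ} (f g : Space d → ℂ) : Prop :=
  ∀ φ : 𝓢(Space d, ℂ),
    Integrable (fun ξ => g ξ * φ ξ) ∧ Integrable (fun x => f x * fourierIntegral φ x) ∧
      ∫ ξ, g ξ * φ ξ = ∫ x, f x * fourierIntegral φ x

/-- The Fourier transform `f̂` of `f` (determined up to a null set whenever it is a function). -/
def fourier {d : ℕ} (f : Space d → ℂ) : Space d → ℂ :=
  Classical.epsilon fun g => IsFourierTransform f g

/-- The inverse Fourier transform of `g` (determined up to a null set whenever it is a function). -/
def invFourier {d : ℕ} (g : Space d → ℂ) : Space d → ℂ :=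
  Classical.epsilon fun f => IsFourierTransform f g

/-- `(2π)^{-d} ∫ e^{i x·ξ + i t lam(ξ)} m(ξ) f̂(ξ) dξ`. -/
def propagator {d : ℕ} (lam : Space d → ℝ) (m : Space d → ℂ) (t : ℝ) (f : Space d → ℂ)
    (x : Space d) : ℂ :=
  (((2 * Real.pi) ^ d)⁻¹ : ℝ) *
    ∫ ξ, Complex.exp (Complex.I * ((inner ℝ x ξ + t * lam ξ : ℝ) : ℂ)) * m ξ * fourier f ξ

/-- The operator `V(t) = e^{it lam(D)} ψ²(D)`. -/
def V {d : ℕ} (lam : Space d → ℝ) (ψ : Space d → ℂ) (t : ℝ) (f : Space d → ℂ) : Space d → ℂ :=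
  propagator lam (fun ξ => ψ ξ ^ 2) t f

/-- The operator `Ṽ(t) = e^{it lam(D)} ψ(D)`. -/
def Vtilde {d : ℕ} (lam : Space d → ℝ) (ψ : Space d → ℂ) (t : ℝ) (f : Space d → ℂ) :
    Space d → ℂ :=
  propagator lam ψ t f

/-- The retarded integral `∫_{-∞}^t V(t-s) F(s) ds`. -/
def retarded {d : ℕ} (lam : Space d → ℝ) (ψ : Space d → ℂ) (F : ℝ → Space d → ℂ) (t : ℝ)
    (x : Space d) : ℂ :=
  ∫ s in Iic t, V lam ψ (t - s) (F s) x

/-- The mixed norm `‖u‖_{L^q_t L^r_x}`. -/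
def mixedNorm {d : ℕ} (q r : ℝ≥0∞) (u : ℝ → Space d → ℂ) : ℝ≥0∞ :=
  eLpNorm (fun t => eLpNorm (u t) r volume) q volume

/-- `u ∈ L^q_t L^r_x`. -/
def MemMixed {d : ℕ} (q r : ℝ≥0∞) (u : ℝ → Space d → ℂ) : Prop :=
  AEStronglyMeasurable (fun p : ℝ × Space d => u p.1 p.2) volume ∧ mixedNorm q r u < ∞

/-- `(q, r) ∈ [2,∞]²` is `σ`-admissible. -/
def Admissible (σ : ℝ) (q r : ℝ≥0∞) : Prop :=
  2 ≤ q ∧ 2 ≤ r ∧ ¬ (q = 2 ∧ r = ∞ ∧ σ = 1) ∧ 2 * recip q ≤ σ * (1 - 2 * recip r)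

/-- `(q, r)` is sharp `σ`-admissible. -/
def SharpAdmissible (σ : ℝ) (q r : ℝ≥0∞) : Prop :=
  Admissible σ q r ∧ 2 * recip q = σ * (1 - 2 * recip r)

/-- `(q, r)` is the endpoint `P_σ = (2, 2σ/(σ-1))`, which exists for `σ > 1`. -/
def IsEndpoint (σ : ℝ) (q r : ℝ≥0∞) : Prop :=
  1 < σ ∧ q = 2 ∧ r = ENNReal.ofReal (2 * σ / (σ - 1))

/-- The interpolation parameter `θ = 2r / (qσ(r-2))` of a `σ`-admissible pair `(q, r)`, written so
that `r = ∞` and `q = ∞` are covered.  If `r > 2`, this determines `θ`, and `θ ∈ [0,1]` is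
automatic.  For `(q, r) = (∞, 2)` the quotient is undefined and every `θ ∈ [0,1]` is allowed. -/
def IsTheta (σ : ℝ) (q r : ℝ≥0∞) (θ : ℝ) : Prop :=
  0 ≤ θ ∧ θ ≤ 1 ∧ θ * (σ * (1 - 2 * recip r)) = 2 * recip q

/-- The hypotheses on the propagators: `lam` real measurable, `ψ` bounded measurable, the dispersive
estimate and the `L²` estimate for both `V(t)` and `Ṽ(t)`.  The estimates are asked for Schwartz
functions only. -/
structure DispersiveBounds {d : ℕ} (σ C : ℝ) (lam : Space d → ℝ) (ψ : Space d → ℂ)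
    (μ₁ μ₂ : ℝ) : Prop where
  measurable_lam : AEMeasurable lam volume
  bounded_psi : MemLp ψ ∞ volume
  mu_one_pos : 0 < μ₁
  mu_two_pos : 0 < μ₂
  decay_V : ∀ (t : ℝ) (f : 𝓢(Space d, ℂ)),
    eLpNorm (V lam ψ t f) ∞ volume ≤
      ENNReal.ofReal (C * μ₁ / (1 + μ₂ * |t|) ^ σ) * eLpNorm f 1 volume
  decay_Vtilde : ∀ (t : ℝ) (f : 𝓢(Space d, ℂ)),
    eLpNorm (Vtilde lam ψ t f) ∞ volume ≤
      ENNReal.ofReal (C * μ₁ / (1 + μ₂ * |t|) ^ σ) * eLpNorm f 1 volume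
  energy_V : ∀ (t : ℝ) (f : 𝓢(Space d, ℂ)),
    eLpNorm (V lam ψ t f) 2 volume ≤ ENNReal.ofReal C * eLpNorm f 2 volume
  energy_Vtilde : ∀ (t : ℝ) (f : 𝓢(Space d, ℂ)),
    eLpNorm (Vtilde lam ψ t f) 2 volume ≤ ENNReal.ofReal C * eLpNorm f 2 volume

/-- `C₁ = ‖𝓕⁻¹(ψ²)‖_{L¹}`. -/
def C1 {d : ℕ} (ψ : Space d → ℂ) : ℝ≥0∞ := eLpNorm (invFourier fun ξ => ψ ξ ^ 2) 1 volume

/-- `C₂ = ‖𝓕⁻¹(ψ)‖_{L¹}`. -/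
def C2 {d : ℕ} (ψ : Space d → ℂ) : ℝ≥0∞ := eLpNorm (invFourier ψ) 1 volume

/-- `C_{4,r} = ‖𝓕⁻¹(ψ)‖_{L^p}` with `p = (1/2 + 1/r)⁻¹`. -/
def C4 {d : ℕ} (ψ : Space d → ℂ) (r : ℝ≥0∞) : ℝ≥0∞ :=
  eLpNorm (invFourier ψ) (2⁻¹ + r⁻¹)⁻¹ volume

/-- `C_{5,r,r̃} = C₂^{1/2} (1 + C₂^{1/2}) (1 + C_{4,r} + C_{4,r̃})`. -/
def C5 {d : ℕ} (ψ : Space d → ℂ) (r r' : ℝ≥0∞) : ℝ≥0∞ :=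
  C2 ψ ^ (1 / 2 : ℝ) * (1 + C2 ψ ^ (1 / 2 : ℝ)) * (1 + C4 ψ r + C4 ψ r')

end Strichartz

end

/-! Everything is reduced to a single multiplier m: m = ψ² for the homogeneous estimate (i), and m =
ψ for the retarded estimates, where V(t-s) has symbol e^{i(t-s)λ} m·m. Suppose that m is the Fourier
transform of an integrable k. Multiplying the symbol e^{itλ}m by another factor m or m̄ amounts to a
convolution with k or with its conjugate reflection, so the kernels attached to m² and |m|² inherit
the dispersive decay with constant D = C‖k‖_{L¹}. Also |m|² ≤ D, because one factor is at most C by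
the energy estimate and the other at most ‖k‖_{L¹}. This is `MultiplierBounds.exists_kernelBounds`.
One further quantity enters, a number E with ‖m f̂‖_{L²} ≤ E ‖f‖_{L^{r'}} (`SpaceBound`). Young's
inequality gives E = C_{4,r} for m = ψ (`spaceBound_of_isFT`), and the dispersive estimate at time
zero gives E of size √D μ₁^{1/2-1/r} (`exists_spaceBound_of_kernelBounds`).

At a fixed time the pairing of w(D)e^{itλ}f with g, where |w| = |m|², has two bounds. Cauchy–Schwarz
in frequency gives E² for all t. Interpolation between L¹ → L^∞ and L² → L² gives D
μ₁^{1-2/r}(1+μ₂|t|)^{-a} with a = σ(1-2/r). Admissibility says 2/q ≤ a, and θ = 2/(qa), so the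
geometric mean of the two bounds with weights 1-θ and θ decays exactly like |t|^{-2/q}. For 2 < q <
∞ this is summed in time by fractional integration, and q = ∞ is immediate. For q = 2 the kernel
|t|^{-1} is not integrable, but away from the endpoint a > 1; the minimum of the two bounds is then
integrable, its integral is the same geometric mean up to a constant, and Young's inequality in time
suffices (`exists_time_form_le`). The T T* argument (`exists_eLpNorm_wave_le`) and the converse of
Hölder's inequality in mixed norms give the homogeneous estimate with the constant D^{θ/2} E^{1-θ}
(μ₁^{1/σ}/μ₂)^{1/q}, called `strichConst`.

Composing this estimate with its adjoint gives an inhomogeneous estimate over all times s. The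
restriction to s < t is recovered by the Christ–Kiselev lemma (`exists_mixedNorm_ret_le`), which
needs q̃' < q and therefore fails only for q = q̃ = 2. In that case the form estimate carries
absolute values inside both time integrals, so that the cutoff costs nothing; the decay for two
different space exponents comes from logarithmic convexity between L² and L^{r₁}, and a > 1 again
makes it integrable (`exists_form_two_le`).

The three parts differ in the choice of E. Part (i) uses the dispersive value. In (ii) the pair on
the right is sharp, its θ̃ is 1, and its E does not occur. Part (iii) is the geometric mean, with
weights 1-θ and θ, of two retarded estimates: one with the dispersive value of E for the pair on the
right, one with C_{4,r̃}. -/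

noncomputable section

/-! ### Fractional integration and Young's inequality on the line. -/

namespace Strichartz

/-- The integral of `|u|^{-α}` over a translate of a set of given measure is maximal for a ball, up to a
constant. -/
lemma lintegral_riesz_indicator_le {α : ℝ} (hα0 : 0 < α) (hα1 : α < 1) {A : Set ℝ}
    (hA : MeasurableSet A) (t : ℝ) :
    ∫⁻ s, ENNReal.ofReal (|t - s| ^ (-α)) * A.indicator 1 s ≤
      ENNReal.ofReal (2 / (1 - α) + 1) * volume A ^ (1 - α) := by
  have h1α : 0 < 1 - α := by linarith
  have hc : 0 < 2 / (1 - α) + 1 := by positivity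
  have key : ∀ s, ENNReal.ofReal (|t - s| ^ (-α)) * A.indicator 1 s =
      A.indicator (fun s => ENNReal.ofReal (|t - s| ^ (-α))) s := by
    intro s; by_cases h : s ∈ A <;> simp [h]
  simp_rw [key]
  rw [lintegral_indicator hA]
  rcases eq_or_ne (volume A) ∞ with htop | htop
  · rw [htop, ENNReal.top_rpow_of_pos h1α, ENNReal.mul_top]
    · exact le_top
    · simpa using hc
  rcases eq_or_ne (volume A) 0 with h0 | h0
  · rw [Measure.restrict_eq_zero.2 h0]; simp
  -- The window around t has half-width equal to the measure of A. Inside it the kernel is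
  -- integrated outright; outside it the kernel is at most R^{-α} on a set of measure at most R.
  -- Both contributions are of size R^{1-α}.
  set R := (volume A).toReal with hR
  have hRpos : 0 < R := ENNReal.toReal_pos h0 htop
  have hAR : volume A = ENNReal.ofReal R := (ENNReal.ofReal_toReal htop).symm
  have hball : ∫⁻ s in Ioo (t - R) (t + R), ENNReal.ofReal (|t - s| ^ (-α)) ≤
      ENNReal.ofReal (2 / (1 - α) * R ^ (1 - α)) := by
    have e1 : ∫⁻ s in Ioo (t - R) (t + R), ENNReal.ofReal (|t - s| ^ (-α)) =
        ∫⁻ u in Ioo (-R) R, ENNReal.ofReal (|u| ^ (-α)) := by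
      rw [← lintegral_indicator measurableSet_Ioo, ← lintegral_indicator measurableSet_Ioo,
        ← lintegral_sub_left_eq_self _ t]
      refine lintegral_congr fun s => ?_
      by_cases hs : s ∈ Ioo (-R) R
      · rw [indicator_of_mem hs, indicator_of_mem, sub_sub_cancel]
        constructor <;> [linarith [hs.2]; linarith [hs.1]]
      · rw [indicator_of_notMem hs, indicator_of_notMem]
        intro h; apply hs; constructor <;> [linarith [h.2]; linarith [h.1]]
    rw [e1]
    have hpos : ∫⁻ u in Ioc 0 R, ENNReal.ofReal (|u| ^ (-α)) =
        ENNReal.ofReal (R ^ (1 - α) / (1 - α)) := by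
      have hint : IntegrableOn (fun u : ℝ => u ^ (-α)) (Ioc 0 R) :=
        (intervalIntegrable_iff_integrableOn_Ioc_of_le hRpos.le).1
          (intervalIntegral.intervalIntegrable_rpow' (by linarith))
      have : ∫⁻ u in Ioc 0 R, ENNReal.ofReal (|u| ^ (-α)) =
          ∫⁻ u in Ioc 0 R, ENNReal.ofReal (u ^ (-α)) :=
        setLIntegral_congr_fun measurableSet_Ioc fun u hu => by
          simp only [abs_of_pos hu.1]
      rw [this, ← ofReal_integral_eq_lintegral_ofReal hint, ← intervalIntegral.integral_of_le hRpos.le,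
        integral_rpow (Or.inl (by linarith))]
      · congr 1
        rw [Real.zero_rpow (by linarith), sub_zero]
        congr 1 <;> ring_nf
      · filter_upwards [ae_restrict_mem measurableSet_Ioc] with u hu
        exact Real.rpow_nonneg hu.1.le _
    have hneg : ∫⁻ u in Ico (-R) 0, ENNReal.ofReal (|u| ^ (-α)) =
        ∫⁻ u in Ioc 0 R, ENNReal.ofReal (|u| ^ (-α)) := by
      rw [← lintegral_indicator measurableSet_Ico, ← lintegral_indicator measurableSet_Ioc,
        ← lintegral_neg_eq_self]
      refine lintegral_congr fun u => ?_
      by_cases hu : u ∈ Ioc 0 R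
      · rw [indicator_of_mem hu, indicator_of_mem, abs_neg]
        constructor <;> [linarith [hu.2]; linarith [hu.1]]
      · rw [indicator_of_notMem hu, indicator_of_notMem]
        intro h; apply hu; constructor <;> [linarith [h.2]; linarith [h.1]]
    calc ∫⁻ u in Ioo (-R) R, ENNReal.ofReal (|u| ^ (-α))
        ≤ ∫⁻ u in Ico (-R) 0 ∪ ({0} ∪ Ioc 0 R), ENNReal.ofReal (|u| ^ (-α)) := by
          refine lintegral_mono_set ?_
          intro u hu
          rcases lt_trichotomy u 0 with h | h | h
          · exact Or.inl ⟨hu.1.le, h⟩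
          · exact Or.inr (Or.inl h)
          · exact Or.inr (Or.inr ⟨h, hu.2.le⟩)
      _ ≤ ENNReal.ofReal (R ^ (1 - α) / (1 - α)) +
            (0 + ENNReal.ofReal (R ^ (1 - α) / (1 - α))) := by
          refine (lintegral_union_le _ _ _).trans (add_le_add ?_ ?_)
          · rw [hneg, hpos]
          · refine (lintegral_union_le _ _ _).trans (add_le_add ?_ ?_)
            · simp
            · rw [hpos]
      _ = ENNReal.ofReal (2 / (1 - α) * R ^ (1 - α)) := by
          rw [zero_add, ← ENNReal.ofReal_add (by positivity) (by positivity)]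
          congr 1; ring
  calc ∫⁻ s in A, ENNReal.ofReal (|t - s| ^ (-α))
      ≤ ∫⁻ s in Ioo (t - R) (t + R) ∪ (A \ Ioo (t - R) (t + R)),
          ENNReal.ofReal (|t - s| ^ (-α)) := by
        refine lintegral_mono_set fun s hs => ?_
        by_cases h : s ∈ Ioo (t - R) (t + R)
        · exact Or.inl h
        · exact Or.inr ⟨hs, h⟩
    _ ≤ ENNReal.ofReal (2 / (1 - α) * R ^ (1 - α)) +
          ∫⁻ s in A \ Ioo (t - R) (t + R), ENNReal.ofReal (R ^ (-α)) := by
        refine (lintegral_union_le _ _ _).trans (add_le_add hball ?_)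
        refine setLIntegral_mono' (hA.diff measurableSet_Ioo) fun s hs => ?_
        apply ENNReal.ofReal_le_ofReal
        have : R ≤ |t - s| := by
          by_contra hlt
          push Not at hlt
          rw [abs_lt] at hlt
          exact hs.2 ⟨by linarith, by linarith⟩
        exact Real.rpow_le_rpow_of_nonpos hRpos this (by linarith)
    _ ≤ ENNReal.ofReal (2 / (1 - α) * R ^ (1 - α)) + ENNReal.ofReal (R ^ (-α)) * volume A := by
        gcongr
        rw [setLIntegral_const]
        gcongr
        exact sdiff_subset
    _ = _ := by
        rw [hAR, ← ENNReal.ofReal_mul (by positivity), ENNReal.ofReal_rpow_of_pos hRpos,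
          ← ENNReal.ofReal_mul (by positivity), ← ENNReal.ofReal_add (by positivity) (by positivity)]
        congr 1
        rw [add_mul, one_mul, show (1 - α) = -α + 1 by ring, Real.rpow_add_one hRpos.ne']

/-- A layer of the weighted Hölder inequality in the layer cake proof of fractional integration. -/
lemma lintegral_Ioo_rpow_le {α : ℝ} (hα0 : 0 < α) (hα1 : α < 1) (w : ℝ → ℝ≥0∞) (hw : Measurable w)
    {a : ℝ} (ha : 0 < a) :
    ∫⁻ b in Ioc 0 a, w b ^ (1 - α) ≤
      ENNReal.ofReal ((2 - α) ^ α) * ENNReal.ofReal (a ^ (α / (2 - α))) *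
        (∫⁻ b in Ioi 0, w b * ENNReal.ofReal (b ^ (α / (2 - α)))) ^ (1 - α) := by
  have h2 : 0 < 2 - α := by linarith
  have h1 : 0 < 1 - α := by linarith
  -- With p = 2/(2-α) the inserted weight is b^{p-1}, the density in the layer cake formula for the
  -- L^p norm. The compensating power is integrable at 0, and its Hölder factor returns a^{p-1}.
  have hexp : ∀ b ∈ Ioc (0:ℝ) a, w b ^ (1 - α) =
      (w b * ENNReal.ofReal (b ^ (α / (2 - α)))) ^ (1 - α) *
        (ENNReal.ofReal (b ^ (-((1 - α) / (2 - α))))) ^ α := by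
    intro b hb
    have hb0 := hb.1
    rw [ENNReal.mul_rpow_of_nonneg _ _ h1.le, mul_assoc,
      ENNReal.ofReal_rpow_of_pos (by positivity), ENNReal.ofReal_rpow_of_pos (by positivity),
      ← ENNReal.ofReal_mul (by positivity), ← Real.rpow_mul hb0.le, ← Real.rpow_mul hb0.le,
      ← Real.rpow_add hb0]
    have : α / (2 - α) * (1 - α) + -((1 - α) / (2 - α)) * α = 0 := by ring
    rw [this, Real.rpow_zero, ENNReal.ofReal_one, mul_one]
  rw [setLIntegral_congr_fun measurableSet_Ioc hexp]
  have hint : ∫⁻ b in Ioc 0 a, ENNReal.ofReal (b ^ (-((1 - α) / (2 - α)))) =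
      ENNReal.ofReal ((2 - α) * a ^ (1 / (2 - α))) := by
    have hlt : (1 - α) / (2 - α) < 1 := by rw [div_lt_one h2]; linarith
    have hi : IntegrableOn (fun u : ℝ => u ^ (-((1 - α) / (2 - α)))) (Ioc 0 a) :=
      (intervalIntegrable_iff_integrableOn_Ioc_of_le ha.le).1
        (intervalIntegral.intervalIntegrable_rpow' (by linarith))
    rw [← ofReal_integral_eq_lintegral_ofReal hi, ← intervalIntegral.integral_of_le ha.le,
        integral_rpow (Or.inl (by linarith))]
    · congr 1
      have e : -((1 - α) / (2 - α)) + 1 = 1 / (2 - α) := by field_simp; ring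
      rw [e, Real.zero_rpow (by positivity), sub_zero]
      field_simp
    · filter_upwards [ae_restrict_mem measurableSet_Ioc] with u hu
      exact Real.rpow_nonneg hu.1.le _
  calc _ ≤ (∫⁻ b in Ioc 0 a, w b * ENNReal.ofReal (b ^ (α / (2 - α)))) ^ (1 - α) *
        (∫⁻ b in Ioc 0 a, ENNReal.ofReal (b ^ (-((1 - α) / (2 - α))))) ^ α := by
        refine ENNReal.lintegral_mul_norm_pow_le ?_ ?_ h1.le hα0.le (by ring)
        · exact (hw.mul (by fun_prop)).aemeasurable
        · exact Measurable.aemeasurable (by fun_prop)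
    _ ≤ (∫⁻ b in Ioi 0, w b * ENNReal.ofReal (b ^ (α / (2 - α)))) ^ (1 - α) *
        (ENNReal.ofReal ((2 - α) * a ^ (1 / (2 - α)))) ^ α := by
        rw [hint]
        gcongr
        exact Ioc_subset_Ioi_self
    _ = _ := by
        rw [mul_comm]
        congr 1
        rw [ENNReal.ofReal_rpow_of_pos (by positivity), Real.mul_rpow h2.le (by positivity),
          ← Real.rpow_mul ha.le, ENNReal.ofReal_mul (by positivity)]
        congr 3
        ring

lemma lintegral_Ioi_indicator_lt (y : ℝ) :
    ∫⁻ a in Ioi (0:ℝ), (Iio y).indicator 1 a = ENNReal.ofReal y := by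
  rw [lintegral_indicator measurableSet_Iio]
  simp [Measure.restrict_restrict measurableSet_Iio, Iio_inter_Ioi]

/-- The layer cake form of the fractional integration inequality. -/
lemma riesz_form_le {α : ℝ} (hα0 : 0 < α) (hα1 : α < 1) {f g : ℝ → ℝ} (hf : Measurable f)
    (hg : Measurable g) (hf0 : ∀ s, 0 ≤ f s) (hg0 : ∀ s, 0 ≤ g s) :
    ∫⁻ t, ∫⁻ s, ENNReal.ofReal (|t - s| ^ (-α)) * ENNReal.ofReal (f s) * ENNReal.ofReal (g t) ≤
      ENNReal.ofReal ((2 / (1 - α) + 1) * (2 - α) ^ α) *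
       ((∫⁻ s, ENNReal.ofReal (f s ^ (2 / (2 - α)))) * (∫⁻ s, ENNReal.ofReal (g s ^ (2 / (2 - α)))) ^ (1 - α) +
        (∫⁻ s, ENNReal.ofReal (g s ^ (2 / (2 - α)))) * (∫⁻ s, ENNReal.ofReal (f s ^ (2 / (2 - α)))) ^ (1 - α)) := by
  have h2 : 0 < 2 - α := by linarith
  have h1 : 0 < 1 - α := by linarith
  set c := ENNReal.ofReal (2 / (1 - α) + 1) with hc
  have hp : 2 / (2 - α) - 1 = α / (2 - α) := by field_simp; ring
  have hp1 : 1 ≤ 2 / (2 - α) := by rw [le_div_iff₀ h2]; linarith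
  -- distribution functions
  have lay : ∀ {f : ℝ → ℝ}, Measurable f → (∀ s, 0 ≤ f s) →
      ∫⁻ a in Ioi 0, volume {s | a < f s} * ENNReal.ofReal (a ^ (α / (2 - α))) ≤
        ∫⁻ s, ENNReal.ofReal (f s ^ (2 / (2 - α))) := by
    intro f hf hf0
    rw [lintegral_rpow_eq_lintegral_meas_lt_mul volume (Filter.Eventually.of_forall hf0)
      hf.aemeasurable (by positivity : 0 < 2 / (2 - α)), hp]
    refine le_mul_of_one_le_left' ?_
    rw [← ENNReal.ofReal_one]
    exact ENNReal.ofReal_le_ofReal hp1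
  have hmeas : ∀ {f : ℝ → ℝ}, Measurable fun a : ℝ => volume {s | a < f s} := by
    intro f
    have : Antitone fun a : ℝ => volume {s | a < f s} := fun a b hab =>
      measure_mono fun s hs => lt_of_le_of_lt hab hs
    exact this.measurable
  set V := ∫⁻ s, ENNReal.ofReal (f s ^ (2 / (2 - α))) with hV
  set W := ∫⁻ s, ENNReal.ofReal (g s ^ (2 / (2 - α))) with hW
  -- the two one-sided bounds for level sets
  have J1 : ∀ a b : ℝ, ∫⁻ t, ∫⁻ s, ENNReal.ofReal (|t - s| ^ (-α)) * {s | a < f s}.indicator 1 s *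
      {t | b < g t}.indicator 1 t ≤ c * volume {s | a < f s} ^ (1 - α) * volume {t | b < g t} := by
    intro a b
    calc _ ≤ ∫⁻ t, (c * volume {s | a < f s} ^ (1 - α)) * {t | b < g t}.indicator 1 t := by
          refine lintegral_mono fun t => ?_
          rw [lintegral_mul_const _ (by
            refine Measurable.mul (by fun_prop) ?_
            exact measurable_one.indicator (hf measurableSet_Ioi))]
          gcongr
          exact lintegral_riesz_indicator_le hα0 hα1 (hf measurableSet_Ioi) t
      _ = _ := by
          rw [lintegral_const_mul _ (by exact measurable_one.indicator (hg measurableSet_Ioi)),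
            lintegral_indicator_one (by exact hg measurableSet_Ioi)]
  have J2 : ∀ a b : ℝ, ∫⁻ t, ∫⁻ s, ENNReal.ofReal (|t - s| ^ (-α)) * {s | a < f s}.indicator 1 s *
      {t | b < g t}.indicator 1 t ≤ c * volume {t | b < g t} ^ (1 - α) * volume {s | a < f s} := by
    intro a b
    rw [lintegral_lintegral_swap (by
      refine Measurable.aemeasurable ?_
      refine Measurable.mul (Measurable.mul (by fun_prop) ?_) ?_
      · exact (measurable_one.indicator (hf measurableSet_Ioi)).comp measurable_snd
      · exact (measurable_one.indicator (hg measurableSet_Ioi)).comp measurable_fst)]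
    calc _ ≤ ∫⁻ s, (c * volume {t | b < g t} ^ (1 - α)) * {s | a < f s}.indicator 1 s := by
          refine lintegral_mono fun s => ?_
          have : ∀ t, ENNReal.ofReal (|t - s| ^ (-α)) * {s | a < f s}.indicator 1 s *
              {t | b < g t}.indicator 1 t = (ENNReal.ofReal (|s - t| ^ (-α)) *
              {t | b < g t}.indicator 1 t) * {s | a < f s}.indicator 1 s := by
            intro t; rw [abs_sub_comm]; ring
          simp_rw [this]
          rw [lintegral_mul_const _ (by
            refine Measurable.mul (by fun_prop) ?_
            exact measurable_one.indicator (hg measurableSet_Ioi))]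
          gcongr
          exact lintegral_riesz_indicator_le hα0 hα1 (hg measurableSet_Ioi) s
      _ = _ := by
          rw [lintegral_const_mul _ (by exact measurable_one.indicator (hf measurableSet_Ioi)),
            lintegral_indicator_one (by exact hf measurableSet_Ioi)]
  set J : ℝ → ℝ → ℝ≥0∞ := fun a b => ∫⁻ t, ∫⁻ s, ENNReal.ofReal (|t - s| ^ (-α)) *
    {s | a < f s}.indicator 1 s * {t | b < g t}.indicator 1 t with hJ
  have hlayer : ∫⁻ t, ∫⁻ s, ENNReal.ofReal (|t - s| ^ (-α)) * ENNReal.ofReal (f s) *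
      ENNReal.ofReal (g t) = ∫⁻ a in Ioi 0, ∫⁻ b in Ioi 0, J a b := by
    have mF : Measurable fun p : ℝ × ℝ => ({s | p.1 < f s}.indicator 1 p.2 : ℝ≥0∞) := by
      have : (fun p : ℝ × ℝ => ({s | p.1 < f s}.indicator 1 p.2 : ℝ≥0∞)) =
          {p : ℝ × ℝ | p.1 < f p.2}.indicator 1 := by
        ext p; simp [indicator]
      rw [this]
      exact measurable_one.indicator (measurableSet_lt measurable_fst (hf.comp measurable_snd))
    have mG : Measurable fun p : ℝ × ℝ => ({s | p.1 < g s}.indicator 1 p.2 : ℝ≥0∞) := by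
      have : (fun p : ℝ × ℝ => ({s | p.1 < g s}.indicator 1 p.2 : ℝ≥0∞)) =
          {p : ℝ × ℝ | p.1 < g p.2}.indicator 1 := by
        ext p; simp [indicator]
      rw [this]
      exact measurable_one.indicator (measurableSet_lt measurable_fst (hg.comp measurable_snd))
    have e1 : ∀ t s, ENNReal.ofReal (|t - s| ^ (-α)) * ENNReal.ofReal (f s) * ENNReal.ofReal (g t) =
        ∫⁻ a in Ioi 0, ∫⁻ b in Ioi 0, ENNReal.ofReal (|t - s| ^ (-α)) *
          {s | a < f s}.indicator 1 s * {t | b < g t}.indicator 1 t := by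
      intro t s
      rw [← lintegral_Ioi_indicator_lt (f s), ← lintegral_Ioi_indicator_lt (g t)]
      have i1 : ∀ a, ∫⁻ b in Ioi (0:ℝ), ENNReal.ofReal (|t - s| ^ (-α)) *
          {s | a < f s}.indicator 1 s * {t | b < g t}.indicator 1 t =
          (ENNReal.ofReal (|t - s| ^ (-α)) * {s | a < f s}.indicator 1 s) *
            ∫⁻ b in Ioi (0:ℝ), (Iio (g t)).indicator 1 b := by
        intro a
        rw [← lintegral_const_mul _ (measurable_one.indicator measurableSet_Iio)]
        rfl
      simp_rw [i1]
      rw [lintegral_mul_const _ (by exact measurable_const.mul (mF.comp (by fun_prop : Measurable fun a : ℝ => (a, s)))),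
        lintegral_const_mul _ (by exact mF.comp (by fun_prop : Measurable fun a : ℝ => (a, s)))]
      rfl
    simp_rw [e1]
    have M : Measurable fun p : (ℝ × ℝ) × (ℝ × ℝ) => ENNReal.ofReal (|p.1.1 - p.1.2| ^ (-α)) *
          {s | p.2.1 < f s}.indicator 1 p.1.2 * {t | p.2.2 < g t}.indicator 1 p.1.1 := by
      refine Measurable.mul (Measurable.mul (by fun_prop) ?_) ?_
      · exact mF.comp (by fun_prop : Measurable fun p : (ℝ × ℝ) × (ℝ × ℝ) => (p.2.1, p.1.2))
      · exact mG.comp (by fun_prop : Measurable fun p : (ℝ × ℝ) × (ℝ × ℝ) => (p.2.2, p.1.1))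
    -- move both layer integrals outside
    have s1 : ∀ t, ∫⁻ s, ∫⁻ a in Ioi 0, ∫⁻ b in Ioi 0, ENNReal.ofReal (|t - s| ^ (-α)) *
          {s | a < f s}.indicator 1 s * {t | b < g t}.indicator 1 t =
        ∫⁻ a in Ioi 0, ∫⁻ b in Ioi 0, ∫⁻ s, ENNReal.ofReal (|t - s| ^ (-α)) *
          {s | a < f s}.indicator 1 s * {t | b < g t}.indicator 1 t := by
      intro t
      rw [lintegral_lintegral_swap]
      · refine lintegral_congr fun a => ?_
        rw [lintegral_lintegral_swap]
        exact (M.comp (by fun_prop : Measurable fun p : ℝ × ℝ => ((t, p.1), (a, p.2)))).aemeasurable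
      · refine Measurable.aemeasurable ?_
        exact Measurable.lintegral_prod_right'
          (M.comp (by fun_prop : Measurable fun p : (ℝ × ℝ) × ℝ => ((t, p.1.1), (p.1.2, p.2))))
    simp_rw [s1]
    rw [lintegral_lintegral_swap]
    · refine lintegral_congr fun a => ?_
      rw [lintegral_lintegral_swap]
      refine Measurable.aemeasurable ?_
      exact Measurable.lintegral_prod_right'
        (M.comp (by fun_prop : Measurable fun p : (ℝ × ℝ) × ℝ => ((p.1.1, p.2), (a, p.1.2))))
    · refine Measurable.aemeasurable ?_
      refine Measurable.lintegral_prod_right' (f := fun q : (ℝ × ℝ) × ℝ => ∫⁻ s, ENNReal.ofReal (|q.1.1 - s| ^ (-α)) *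
          {s | q.1.2 < f s}.indicator 1 s * {t | q.2 < g t}.indicator 1 q.1.1) ?_
      exact Measurable.lintegral_prod_right'
        (M.comp (by fun_prop : Measurable fun p : ((ℝ × ℝ) × ℝ) × ℝ =>
          ((p.1.1.1, p.2), (p.1.1.2, p.1.2))))
  rw [hlayer]
  -- Summing over the lower levels produces a^{p-1} with p = 2/(2-α), exactly the layer cake density
  -- needed for the remaining integral over the upper level a. For this reason the power 1-α has to
  -- fall on the lower level set, which decides which of `J1` and `J2` is used in each half.
  have c2 : ∀ {f : ℝ → ℝ} (_ : Measurable f) (_ : ∀ s, 0 ≤ f s) {a : ℝ} (_ : 0 < a),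
      ∫⁻ b in Ioc 0 a, volume {s | b < f s} ^ (1 - α) ≤
        ENNReal.ofReal ((2 - α) ^ α) * ENNReal.ofReal (a ^ (α / (2 - α))) *
          (∫⁻ s, ENNReal.ofReal (f s ^ (2 / (2 - α)))) ^ (1 - α) := by
    intro f hf hf0 a ha
    refine (lintegral_Ioo_rpow_le hα0 hα1 _ hmeas ha).trans ?_
    exact mul_le_mul_right (ENNReal.rpow_le_rpow (lay hf hf0) h1.le) _
  -- split according to `b ≤ a` and `a ≤ b`
  have hsplit : ∫⁻ a in Ioi 0, ∫⁻ b in Ioi 0, J a b ≤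
      (∫⁻ a in Ioi 0, ∫⁻ b in Ioc 0 a, c * volume {t | b < g t} ^ (1 - α) * volume {s | a < f s}) +
      ∫⁻ b in Ioi 0, ∫⁻ a in Ioc 0 b, c * volume {s | a < f s} ^ (1 - α) * volume {t | b < g t} := by
    have mG : Measurable fun p : ℝ × ℝ => (c * volume {s | p.1 < f s} ^ (1 - α) *
        volume {t | p.2 < g t}) := by
      have h1 : Measurable fun p : ℝ × ℝ => volume {s | p.1 < f s} := hmeas.comp measurable_fst
      have h2 : Measurable fun p : ℝ × ℝ => volume {s | p.2 < g s} := hmeas.comp measurable_snd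
      exact (measurable_const.mul (h1.pow_const _)).mul h2
    have e2 : ∫⁻ b in Ioi 0, ∫⁻ a in Ioc 0 b, c * volume {s | a < f s} ^ (1 - α) *
        volume {t | b < g t} = ∫⁻ a in Ioi 0, ∫⁻ b in Ioi 0,
          {p : ℝ × ℝ | p.1 ≤ p.2}.indicator (fun p : ℝ × ℝ => (c * volume {s | p.1 < f s} ^ (1 - α) *
        volume {t | p.2 < g t})) (a, b) := by
      rw [lintegral_lintegral_swap]
      · refine lintegral_congr fun b => ?_
        rw [← Iic_inter_Ioi, ← Measure.restrict_restrict measurableSet_Iic, ← lintegral_indicator measurableSet_Iic]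
        rfl
      · exact (mG.indicator (measurableSet_le measurable_fst measurable_snd)).aemeasurable
    rw [e2, ← lintegral_add_right]
    · refine setLIntegral_mono' measurableSet_Ioi fun a ha => ?_
      rw [← Ioc_union_Ioi_eq_Ioi (mem_Ioi.1 ha).le,
        lintegral_union measurableSet_Ioi (Ioc_disjoint_Ioi le_rfl)]
      refine add_le_add ?_ ?_
      · exact lintegral_mono fun b => J2 a b
      · rw [lintegral_union measurableSet_Ioi (Ioc_disjoint_Ioi le_rfl)]
        refine le_add_left ?_
        refine setLIntegral_mono' measurableSet_Ioi fun b hb => ?_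
        rw [indicator_of_mem (show (a, b) ∈ {p : ℝ × ℝ | p.1 ≤ p.2} from (mem_Ioi.1 hb).le)]
        exact J1 a b
    · exact Measurable.lintegral_prod_right'
        (mG.indicator (measurableSet_le measurable_fst measurable_snd))
  refine hsplit.trans ?_
  have fin : ∀ {f g : ℝ → ℝ} (_ : Measurable f) (_ : Measurable g) (_ : ∀ s, 0 ≤ f s)
      (_ : ∀ s, 0 ≤ g s),
      (∫⁻ a in Ioi 0, ∫⁻ b in Ioc 0 a, c * volume {t | b < g t} ^ (1 - α) * volume {s | a < f s}) ≤
      c * ENNReal.ofReal ((2 - α) ^ α) * ((∫⁻ s, ENNReal.ofReal (f s ^ (2 / (2 - α)))) *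
        (∫⁻ s, ENNReal.ofReal (g s ^ (2 / (2 - α)))) ^ (1 - α)) := by
    intro f g hf hg hf0 hg0
    calc _ ≤ ∫⁻ a in Ioi 0, (c * ENNReal.ofReal ((2 - α) ^ α) *
          (∫⁻ s, ENNReal.ofReal (g s ^ (2 / (2 - α)))) ^ (1 - α)) *
          (volume {s | a < f s} * ENNReal.ofReal (a ^ (α / (2 - α)))) := by
          refine setLIntegral_mono' measurableSet_Ioi fun a ha => ?_
          rw [lintegral_mul_const _ (by exact measurable_const.mul (hmeas.pow_const _)),
            lintegral_const_mul _ (by exact hmeas.pow_const _)]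
          calc _ ≤ c * (ENNReal.ofReal ((2 - α) ^ α) * ENNReal.ofReal (a ^ (α / (2 - α))) *
              (∫⁻ s, ENNReal.ofReal (g s ^ (2 / (2 - α)))) ^ (1 - α)) * volume {s | a < f s} := by
                gcongr
                exact c2 hg hg0 ha
            _ = _ := by ring
      _ ≤ (c * ENNReal.ofReal ((2 - α) ^ α) *
          (∫⁻ s, ENNReal.ofReal (g s ^ (2 / (2 - α)))) ^ (1 - α)) *
          ∫⁻ s, ENNReal.ofReal (f s ^ (2 / (2 - α))) := by
          rw [lintegral_const_mul _ (by exact hmeas.mul (by fun_prop))]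
          exact mul_le_mul_right (lay hf hf0) _
      _ = _ := by ring
  rw [ENNReal.ofReal_mul (by positivity), mul_add]
  exact add_le_add (fin hf hg hf0 hg0) (fin hg hf hg0 hf0)

/-- Fractional integration on the line, as a bound for the bilinear form with kernel `|t-s|^{-α}`. -/
lemma exists_riesz_form_le {α : ℝ} (hα0 : 0 < α) (hα1 : α < 1) :
    ∃ K : ℝ, 0 < K ∧ ∀ f g : ℝ → ℝ≥0∞, Measurable f → Measurable g → (∀ s, f s ≠ ∞) →
      (∀ s, g s ≠ ∞) →
      ∫⁻ t, ∫⁻ s, ENNReal.ofReal (|t - s| ^ (-α)) * f s * g t ≤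
        ENNReal.ofReal K * eLpNorm f (ENNReal.ofReal (2 / (2 - α))) volume *
          eLpNorm g (ENNReal.ofReal (2 / (2 - α))) volume := by
  have h2 : 0 < 2 - α := by linarith
  have h1 : 0 < 1 - α := by linarith
  set p := 2 / (2 - α) with hp
  have hp0 : 0 < p := by positivity
  have hpe : ENNReal.ofReal p ≠ 0 := by simpa using hp0
  set c := (2 / (1 - α) + 1) * (2 - α) ^ α with hc
  have hc0 : 0 < c := by positivity
  -- The bound of `riesz_form_le` is not homogeneous. It is applied to f and g divided by their L^p
  -- norms, where each of its two terms equals one; hence the factor 2.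
  refine ⟨c * 2, by positivity, fun f g hf hg hft hgt => ?_⟩
  set x := eLpNorm f (ENNReal.ofReal p) volume with hx
  set y := eLpNorm g (ENNReal.ofReal p) volume with hy
  have zero_of : ∀ {f : ℝ → ℝ≥0∞}, Measurable f → eLpNorm f (ENNReal.ofReal p) volume = 0 →
      f =ᵐ[volume] 0 := fun hf h => (eLpNorm_eq_zero_iff hf.aestronglyMeasurable hpe).1 h
  rcases eq_or_ne x 0 with hx0 | hx0
  · have : ∀ t, ∫⁻ s, ENNReal.ofReal (|t - s| ^ (-α)) * f s * g t = 0 := by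
      intro t
      rw [lintegral_eq_zero_iff (by fun_prop)]
      filter_upwards [zero_of hf hx0] with s hs
      simp [hs]
    simp [this]
  rcases eq_or_ne y 0 with hy0 | hy0
  · have : ∫⁻ t, ∫⁻ s, ENNReal.ofReal (|t - s| ^ (-α)) * f s * g t = 0 := by
      rw [lintegral_eq_zero_iff (by fun_prop)]
      filter_upwards [zero_of hg hy0] with s hs
      simp [hs]
    simp [this]
  rcases eq_or_ne x ∞ with hxt | hxt
  · rw [hxt, ENNReal.mul_top (by simpa using hc0), ENNReal.top_mul hy0]; exact le_top
  rcases eq_or_ne y ∞ with hyt | hyt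
  · rw [hyt, ENNReal.mul_top (mul_ne_zero (by simpa using hc0) hx0)]; exact le_top
  have norm_one : ∀ {f : ℝ → ℝ≥0∞}, Measurable f → (∀ s, f s ≠ ∞) →
      ∀ {x : ℝ≥0∞}, x = eLpNorm f (ENNReal.ofReal p) volume → x ≠ 0 → x ≠ ∞ →
      ∫⁻ s, ENNReal.ofReal ((f s / x).toReal ^ p) = 1 := by
    intro f hf hft x hx hx0 hxt
    have e : ∀ s, ENNReal.ofReal ((f s / x).toReal ^ p) = f s ^ p * (x ^ p)⁻¹ := by
      intro s
      rw [ENNReal.toReal_rpow, ENNReal.ofReal_toReal, div_eq_mul_inv,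
        ENNReal.mul_rpow_of_nonneg _ _ hp0.le, ENNReal.inv_rpow]
      exact ENNReal.rpow_ne_top_of_nonneg hp0.le (ENNReal.div_ne_top (hft s) hx0)
    simp_rw [e]
    rw [lintegral_mul_const _ (by fun_prop)]
    have : x ^ p = ∫⁻ s, f s ^ p := by
      rw [hx, eLpNorm_eq_lintegral_rpow_enorm_toReal hpe ENNReal.ofReal_ne_top,
        ENNReal.toReal_ofReal hp0.le, ← ENNReal.rpow_mul, one_div, inv_mul_cancel₀ hp0.ne',
        ENNReal.rpow_one]
      simp
    rw [← this]
    exact ENNReal.mul_inv_cancel (by simp [hx0, hxt]) (ENNReal.rpow_ne_top_of_nonneg hp0.le hxt)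
  have key := riesz_form_le hα0 hα1 (f := fun s => (f s / x).toReal) (g := fun s => (g s / y).toReal)
    (by fun_prop) (by fun_prop) (fun _ => ENNReal.toReal_nonneg) (fun _ => ENNReal.toReal_nonneg)
  rw [← hp, norm_one hf hft hx hx0 hxt, norm_one hg hgt hy hy0 hyt] at key
  have e : ∀ t s, ENNReal.ofReal (|t - s| ^ (-α)) * f s * g t =
      x * y * (ENNReal.ofReal (|t - s| ^ (-α)) * ENNReal.ofReal (f s / x).toReal *
        ENNReal.ofReal (g t / y).toReal) := by
    intro t s
    rw [ENNReal.ofReal_toReal (ENNReal.div_ne_top (hft s) hx0),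
      ENNReal.ofReal_toReal (ENNReal.div_ne_top (hgt t) hy0)]
    calc _ = ENNReal.ofReal (|t - s| ^ (-α)) * (x * (f s / x)) * (y * (g t / y)) := by
          rw [ENNReal.mul_div_cancel hx0 hxt, ENNReal.mul_div_cancel hy0 hyt]
      _ = _ := by ring
  simp_rw [e]
  have e2 : ∀ t, ∫⁻ s, x * y * (ENNReal.ofReal (|t - s| ^ (-α)) * ENNReal.ofReal (f s / x).toReal *
        ENNReal.ofReal (g t / y).toReal) = x * y * ∫⁻ s, (ENNReal.ofReal (|t - s| ^ (-α)) *
        ENNReal.ofReal (f s / x).toReal * ENNReal.ofReal (g t / y).toReal) :=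
    fun t => lintegral_const_mul _ (by fun_prop)
  simp_rw [e2]
  rw [lintegral_const_mul _ (by fun_prop)]
  calc _ ≤ x * y * (ENNReal.ofReal c * (1 * 1 ^ (1 - α) + 1 * 1 ^ (1 - α))) := by gcongr
    _ = _ := by
      rw [ENNReal.one_rpow, ENNReal.ofReal_mul hc0.le, one_mul, one_add_one_eq_two]
      simp only [ENNReal.ofReal_ofNat]
      ring

/-- Young's inequality `L¹ * L² → L²` as a bound for the bilinear form. -/
lemma lintegral_young_form_le {h f g : ℝ → ℝ≥0∞} (hh : Measurable h) (hf : Measurable f)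
    (hg : Measurable g) :
    ∫⁻ t, ∫⁻ s, h (t - s) * f s * g t ≤ (∫⁻ t, h t) * eLpNorm f 2 volume * eLpNorm g 2 volume := by
  have sq : ∀ {f : ℝ → ℝ≥0∞}, eLpNorm f 2 volume = (∫⁻ s, f s ^ (2:ℝ)) ^ (1 / 2 : ℝ) := by
    intro f
    rw [eLpNorm_eq_lintegral_rpow_enorm_toReal (by norm_num) (by norm_num)]
    simp
  rw [lintegral_lintegral (f := fun t s => h (t - s) * f s * g t)
    (Measurable.aemeasurable (by fun_prop))]
  -- Half of the kernel goes with each function. After Cauchy–Schwarz each double integral contains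
  -- only one of f and g, and translation invariance separates the variables.
  have e : ∀ z : ℝ × ℝ, h (z.1 - z.2) * f z.2 * g z.1 =
      (h (z.1 - z.2) * f z.2 ^ (2:ℝ)) ^ (1 / 2 : ℝ) * (h (z.1 - z.2) * g z.1 ^ (2:ℝ)) ^ (1 / 2 : ℝ) := by
    intro z
    rw [ENNReal.mul_rpow_of_nonneg _ _ (by norm_num), ENNReal.mul_rpow_of_nonneg _ _ (by norm_num),
      ← ENNReal.rpow_mul, ← ENNReal.rpow_mul]
    have : h (z.1 - z.2) = h (z.1 - z.2) ^ (1 / 2 : ℝ) * h (z.1 - z.2) ^ (1 / 2 : ℝ) := by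
      rw [← ENNReal.rpow_add_of_nonneg _ _ (by norm_num) (by norm_num)]; norm_num
    nth_rewrite 1 [this]
    norm_num
    ring
  simp_rw [e]
  refine (ENNReal.lintegral_mul_norm_pow_le (p := 1 / 2) (q := 1 / 2)
    (Measurable.aemeasurable (by fun_prop)) (Measurable.aemeasurable (by fun_prop))
    (by norm_num) (by norm_num) (by norm_num)).trans_eq ?_
  have i1 : ∫⁻ z : ℝ × ℝ, h (z.1 - z.2) * f z.2 ^ (2:ℝ) ∂(volume.prod volume) =
      (∫⁻ t, h t) * ∫⁻ s, f s ^ (2:ℝ) := by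
    rw [lintegral_prod_symm _ (Measurable.aemeasurable (by fun_prop)),
      ← lintegral_const_mul _ (by fun_prop)]
    refine lintegral_congr fun s => ?_
    dsimp only
    rw [lintegral_mul_const _ (by fun_prop), lintegral_sub_right_eq_self h s]
  have i2 : ∫⁻ z : ℝ × ℝ, h (z.1 - z.2) * g z.1 ^ (2:ℝ) ∂(volume.prod volume) =
      (∫⁻ t, h t) * ∫⁻ s, g s ^ (2:ℝ) := by
    rw [lintegral_prod _ (Measurable.aemeasurable (by fun_prop)),
      ← lintegral_const_mul _ (by fun_prop)]
    refine lintegral_congr fun s => ?_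
    dsimp only
    rw [lintegral_mul_const _ (by fun_prop), lintegral_sub_left_eq_self h s]
  rw [i1, i2, sq, sq, ENNReal.mul_rpow_of_nonneg _ _ (by norm_num),
    ENNReal.mul_rpow_of_nonneg _ _ (by norm_num)]
  have : (∫⁻ t, h t) = (∫⁻ t, h t) ^ (1 / 2 : ℝ) * (∫⁻ t, h t) ^ (1 / 2 : ℝ) := by
    rw [← ENNReal.rpow_add_of_nonneg _ _ (by norm_num) (by norm_num)]; norm_num
  nth_rewrite 3 [this]
  ring

end Strichartz

/-! ### Reciprocal and conjugate exponents; time kernels with two competing bounds. -/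

namespace Strichartz

lemma recip_nonneg (p : ℝ≥0∞) : 0 ≤ recip p := ENNReal.toReal_nonneg

@[simp] lemma recip_top : recip ∞ = 0 := by simp [recip]

lemma recip_two : recip 2 = 1 / 2 := by simp [recip]

lemma recip_eq_inv_toReal (p : ℝ≥0∞) : recip p = p.toReal⁻¹ := by simp [recip, ENNReal.toReal_inv]

lemma recip_le_half {p : ℝ≥0∞} (hp : 2 ≤ p) : recip p ≤ 1 / 2 := by
  rw [← recip_two]
  exact ENNReal.toReal_mono (by simp) (ENNReal.inv_le_inv.2 hp)

lemma recip_conjExponent {p : ℝ≥0∞} (hp : 1 ≤ p) : recip p.conjExponent = 1 - recip p := by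
  have h := (ENNReal.HolderConjugate.conjExponent hp).inv_add_inv_eq_one
  have hp' : p⁻¹ ≠ ∞ := by simpa using (zero_lt_one.trans_le hp).ne'
  have hq' : p.conjExponent⁻¹ ≠ ∞ := by
    intro h'; rw [h'] at h; simp at h
  have := congrArg ENNReal.toReal h
  rw [ENNReal.toReal_add hp' hq', ENNReal.toReal_one] at this
  simp only [recip]; linarith

lemma conjExponent_two : (2 : ℝ≥0∞).conjExponent = 2 := by
  rw [ENNReal.conjExponent, show (2:ℝ≥0∞) - 1 = 1 by
    rw [← one_add_one_eq_two]; exact ENNReal.add_sub_cancel_right ENNReal.one_ne_top]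
  norm_num

lemma conjExponent_top : (∞ : ℝ≥0∞).conjExponent = 1 := by simp [ENNReal.conjExponent]

lemma one_le_conjExponent (q : ℝ≥0∞) : 1 ≤ q.conjExponent := by simp [ENNReal.conjExponent]

lemma conjExponent_ne_top {q : ℝ≥0∞} (hq : 2 ≤ q) : q.conjExponent ≠ ∞ := by
  have : (1:ℝ≥0∞) < q := lt_of_lt_of_le (by norm_num) hq
  simp [ENNReal.conjExponent, (tsub_pos_of_lt this).ne']

lemma conjExponent_le_two {q : ℝ≥0∞} (hq : 2 ≤ q) : q.conjExponent ≤ 2 := by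
  rw [ENNReal.conjExponent, ← one_add_one_eq_two]
  gcongr
  rw [ENNReal.inv_le_one]
  refine le_trans ?_ (tsub_le_tsub_right hq 1)
  rw [← one_add_one_eq_two, ENNReal.add_sub_cancel_right ENNReal.one_ne_top]

lemma toReal_conjExponent {q : ℝ≥0∞} (hq : 2 ≤ q) :
    q.conjExponent.toReal = 1 / (1 - recip q) := by
  rw [← recip_conjExponent (le_trans (by norm_num) hq), recip_eq_inv_toReal, one_div, inv_inv]

/-- This is used twice: to trade the uniform bound of the time kernel against its decay, and to
merge two retarded estimates in part (iii). -/
lemma ENNReal_le_rpow_mul_rpow {h a b : ℝ≥0∞} {θ : ℝ} (h0 : 0 ≤ θ) (h1 : θ ≤ 1) (ha : h ≤ a)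
    (hb : h ≤ b) : h ≤ a ^ (1 - θ) * b ^ θ := by
  calc h = h ^ (1 - θ) * h ^ θ := by
        rw [← ENNReal.rpow_add_of_nonneg _ _ (by linarith) h0]; simp
    _ ≤ _ := by gcongr

/-- The integral of `min(X, Y (μ|t|)^{-a})`, `a > 1`. -/
lemma lintegral_min_rpow_le {a : ℝ} (ha : 1 < a) {μ : ℝ} (hμ : 0 < μ) {X Y : ℝ≥0∞} {h : ℝ → ℝ≥0∞}
    (hX : ∀ t, h t ≤ X) (hY : ∀ t, t ≠ 0 → h t ≤ Y * ENNReal.ofReal ((μ * |t|) ^ (-a))) :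
    ∫⁻ t, h t ≤ ENNReal.ofReal (2 + 2 / (a - 1)) * X ^ (1 - 1 / a) * Y ^ (1 / a) *
      ENNReal.ofReal μ⁻¹ := by
  have ha0 : 0 < a := by linarith
  have ha1 : 0 < a - 1 := by linarith
  have h1a : 0 < 1 - 1 / a := by rw [sub_pos, div_lt_one ha0]; exact ha
  have hK : ENNReal.ofReal (2 + 2 / (a - 1)) ≠ 0 := by
    have : 0 < 2 + 2 / (a - 1) := by positivity
    simpa using this
  have hμe : ENNReal.ofReal μ⁻¹ ≠ 0 := by simpa using hμ
  rcases eq_or_ne X 0 with rfl | hX0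
  · have : ∀ t, h t = 0 := fun t => le_antisymm (hX t) bot_le
    simp [this]
  rcases eq_or_ne Y 0 with rfl | hY0
  · have : h =ᵐ[volume] 0 := by
      filter_upwards [compl_mem_ae_iff.2 (measure_singleton (0:ℝ))] with t ht
      simpa using hY t ht
    rw [lintegral_congr_ae this]; simp
  rcases eq_or_ne X ∞ with rfl | hXt
  · rw [ENNReal.top_rpow_of_pos h1a, ENNReal.mul_top hK, ENNReal.top_mul, ENNReal.top_mul hμe]
    · exact le_top
    · simp [hY0, ha0.le]
  rcases eq_or_ne Y ∞ with rfl | hYt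
  · rw [ENNReal.top_rpow_of_pos (by positivity), ENNReal.mul_top, ENNReal.top_mul hμe]
    · exact le_top
    · exact mul_ne_zero hK (by simp [hX0, hXt])
  obtain ⟨x, hx0, rfl⟩ : ∃ x : ℝ, 0 < x ∧ X = ENNReal.ofReal x :=
    ⟨X.toReal, ENNReal.toReal_pos hX0 hXt, (ENNReal.ofReal_toReal hXt).symm⟩
  obtain ⟨y, hy0, rfl⟩ : ∃ y : ℝ, 0 < y ∧ Y = ENNReal.ofReal y :=
    ⟨Y.toReal, ENNReal.toReal_pos hY0 hYt, (ENNReal.ofReal_toReal hYt).symm⟩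
  have hx := hx0.le
  have hy := hy0.le
  -- The crossover time, at which x = y (μR)^{-a}. The constant bound is used for |t| ≤ R and the
  -- decaying one beyond; both pieces are multiples of x R = x^{1-1/a} y^{1/a} μ^{-1}.
  set R := (y / x) ^ (1 / a) / μ with hR
  have hR0 : 0 < R := by positivity
  have hpos : ∫⁻ t in Ioi R, ENNReal.ofReal ((μ * |t|) ^ (-a)) =
      ENNReal.ofReal (μ ^ (-a) * (R ^ (1 - a) / (a - 1))) := by
    have hi : IntegrableOn (fun t : ℝ => t ^ (-a)) (Ioi R) :=
      integrableOn_Ioi_rpow_of_lt (by linarith) hR0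
    have : ∫⁻ t in Ioi R, ENNReal.ofReal ((μ * |t|) ^ (-a)) =
        ∫⁻ t in Ioi R, ENNReal.ofReal (μ ^ (-a)) * ENNReal.ofReal (t ^ (-a)) :=
      setLIntegral_congr_fun measurableSet_Ioi fun t ht => by
        have : 0 < t := hR0.trans ht
        simp only [abs_of_pos this]
        rw [Real.mul_rpow hμ.le this.le, ENNReal.ofReal_mul (by positivity)]
    rw [this, lintegral_const_mul _ (by fun_prop), ← ofReal_integral_eq_lintegral_ofReal hi,
      integral_Ioi_rpow_of_lt (by linarith) hR0, ENNReal.ofReal_mul (by positivity)]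
    · congr 2
      rw [show -a + 1 = -(a - 1) by ring, show (1 - a) = -(a - 1) by ring]
      field_simp
    · filter_upwards [ae_restrict_mem measurableSet_Ioi] with u hu
      exact Real.rpow_nonneg (hR0.trans hu).le _
  have hneg : ∫⁻ t in Iio (-R), ENNReal.ofReal ((μ * |t|) ^ (-a)) =
      ∫⁻ t in Ioi R, ENNReal.ofReal ((μ * |t|) ^ (-a)) := by
    rw [← lintegral_indicator measurableSet_Ioi, ← lintegral_indicator measurableSet_Iio,
        ← lintegral_neg_eq_self]
    refine lintegral_congr fun u => ?_
    by_cases hu : u ∈ Ioi R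
    · rw [indicator_of_mem hu, indicator_of_mem, abs_neg]
      simpa using hu
    · rw [indicator_of_notMem hu, indicator_of_notMem]
      simpa using hu
  calc ∫⁻ t, h t ≤ ∫⁻ t in Icc (-R) R ∪ (Iio (-R) ∪ Ioi R), h t := by
        rw [← setLIntegral_univ]
        refine lintegral_mono_set fun t _ => ?_
        by_cases h1 : t < -R
        · exact Or.inr (Or.inl h1)
        · by_cases h2 : R < t
          · exact Or.inr (Or.inr h2)
          · exact Or.inl ⟨not_lt.1 h1, not_lt.1 h2⟩
    _ ≤ (∫⁻ t in Icc (-R) R, ENNReal.ofReal x) + ((∫⁻ t in Iio (-R), ENNReal.ofReal y *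
          ENNReal.ofReal ((μ * |t|) ^ (-a))) + ∫⁻ t in Ioi R, ENNReal.ofReal y *
          ENNReal.ofReal ((μ * |t|) ^ (-a))) := by
        refine (lintegral_union_le _ _ _).trans (add_le_add (lintegral_mono fun t => hX t)
          ((lintegral_union_le _ _ _).trans (add_le_add ?_ ?_)))
        · exact setLIntegral_mono' measurableSet_Iio fun t ht => hY t (by
            have : t < -R := ht
            intro h; linarith)
        · exact setLIntegral_mono' measurableSet_Ioi fun t ht => hY t (by
            have : R < t := ht
            intro h; linarith)
    _ = ENNReal.ofReal (x * (2 * R) + 2 * (y * (μ ^ (-a) * (R ^ (1 - a) / (a - 1))))) := by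
        rw [setLIntegral_const, lintegral_const_mul _ (by fun_prop),
          lintegral_const_mul _ (by fun_prop), hneg, hpos, Real.volume_Icc,
          ← ENNReal.ofReal_mul hx, ← ENNReal.ofReal_mul hy,
          ← ENNReal.ofReal_add (by positivity) (by positivity),
          ← ENNReal.ofReal_add (by nlinarith [hx0, hR0]) (by positivity)]
        congr 1; ring
    _ = _ := by
        rw [ENNReal.ofReal_rpow_of_pos hx0, ENNReal.ofReal_rpow_of_pos hy0,
          ← ENNReal.ofReal_mul (by positivity), ← ENNReal.ofReal_mul (by positivity),
          ← ENNReal.ofReal_mul (by positivity)]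
        congr 1
        have e1 : x * R = x ^ (1 - 1 / a) * y ^ (1 / a) * μ⁻¹ := by
          rw [hR, Real.div_rpow hy hx, Real.rpow_sub hx0, Real.rpow_one]
          field_simp
        have e2 : y * (μ ^ (-a) * R ^ (1 - a)) = x * R := by
          have : R ^ (1 - a) = R * R ^ (-a) := by
            rw [sub_eq_add_neg, Real.rpow_add hR0, Real.rpow_one]
          rw [this]
          have h3 : R ^ (-a) = x / y * μ ^ a := by
            rw [hR, Real.div_rpow (by positivity) hμ.le, ← Real.rpow_mul (by positivity),
              show 1 / a * -a = -1 by field_simp, Real.rpow_neg_one, Real.rpow_neg hμ.le]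
            field_simp
          rw [h3, Real.rpow_neg hμ.le]
          have : μ ^ a ≠ 0 := by positivity
          field_simp
        calc _ = 2 * (x * R) + 2 / (a - 1) * (y * (μ ^ (-a) * R ^ (1 - a))) := by
              field_simp
          _ = _ := by rw [e2, e1]; ring

/-- The bound for the time kernel `min(X, Y (μ|t|)^{-a})` on `L^{q'} × L^{q'}`. -/
lemma exists_time_form_le {q : ℝ≥0∞} (hq : 2 ≤ q) {a : ℝ} (ha2 : q = 2 → 1 < a) :
    ∃ K : ℝ, 0 < K ∧ ∀ (θ μ : ℝ) (X Y : ℝ≥0∞) (h f g : ℝ → ℝ≥0∞), 0 ≤ θ → θ ≤ 1 →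
      θ * a = 2 * recip q → 0 < μ → Measurable h → (∀ t, h t ≤ X) →
      (∀ t, t ≠ 0 → h t ≤ Y * ENNReal.ofReal ((μ * |t|) ^ (-a))) →
      Measurable f → Measurable g → (∀ s, f s ≠ ∞) → (∀ s, g s ≠ ∞) →
      ∫⁻ t, ∫⁻ s, h (t - s) * f s * g t ≤
        ENNReal.ofReal K * (X ^ (1 - θ) * Y ^ θ * ENNReal.ofReal (μ ^ (-(2 * recip q)))) *
          eLpNorm f q.conjExponent volume * eLpNorm g q.conjExponent volume := by
  -- Since θ a = 2/q, the geometric mean of the two bounds decays at the critical rate |t|^{-2/q}.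
  -- The decaying bound can be asked only for t ≠ 0, because a nonzero real power of 0 is 0 by
  -- convention.
  have pointwise : ∀ (θ μ : ℝ) (X Y : ℝ≥0∞) (h : ℝ → ℝ≥0∞), 0 ≤ θ → θ ≤ 1 →
      θ * a = 2 * recip q → 0 < μ → (∀ t, h t ≤ X) →
      (∀ t, t ≠ 0 → h t ≤ Y * ENNReal.ofReal ((μ * |t|) ^ (-a))) → ∀ t, t ≠ 0 →
      h t ≤ X ^ (1 - θ) * Y ^ θ * ENNReal.ofReal (μ ^ (-(2 * recip q))) *
        ENNReal.ofReal (|t| ^ (-(2 * recip q))) := by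
    intro θ μ X Y h h0 h1 hθ hμ hX hY t ht
    have ht' : 0 < |t| := abs_pos.2 ht
    refine (ENNReal_le_rpow_mul_rpow h0 h1 (hX t) (hY t ht)).trans_eq ?_
    rw [ENNReal.mul_rpow_of_nonneg _ _ h0, ENNReal.ofReal_rpow_of_pos (by positivity),
      ← Real.rpow_mul (by positivity), Real.mul_rpow hμ.le ht'.le, ENNReal.ofReal_mul (by positivity),
      show -a * θ = -(2 * recip q) by rw [← hθ]; ring]
    ring
  rcases eq_or_lt_of_le hq with rfl | hq2
  -- At q = 2 the critical kernel |t|^{-1} is not integrable, so the two bounds are not averaged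
  -- pointwise. The kernel itself is integrated using a > 1, and since θ = 1/a here the result has
  -- the same constant X^{1-θ} Y^θ.
  · have ha := ha2 rfl
    refine ⟨2 + 2 / (a - 1), by have : 0 < a - 1 := by linarith
                                positivity, ?_⟩
    intro θ μ X Y h f g h0 h1 hθ hμ hh hX hY hf hg _ _
    rw [conjExponent_two]
    refine (lintegral_young_form_le hh hf hg).trans ?_
    gcongr
    refine (lintegral_min_rpow_le ha hμ hX hY).trans_eq ?_
    have : θ = 1 / a := by
      rw [recip_two] at hθ
      field_simp; linarith
    rw [this, recip_two]
    norm_num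
    rw [Real.rpow_neg_one]
    ring
  rcases eq_or_ne q ∞ with rfl | hqt
  · refine ⟨1, one_pos, ?_⟩
    intro θ μ X Y h f g h0 h1 hθ hμ hh hX hY hf hg _ _
    rw [conjExponent_top]
    have pw := pointwise θ μ X Y h h0 h1 hθ hμ hX hY
    simp only [recip_top, mul_zero, neg_zero, Real.rpow_zero, ENNReal.ofReal_one, mul_one, one_mul] at pw ⊢
    simp only [eLpNorm_one_eq_lintegral_enorm, enorm_eq_self]
    calc ∫⁻ t, ∫⁻ s, h (t - s) * f s * g t ≤ ∫⁻ t, (X ^ (1 - θ) * Y ^ θ * ∫⁻ s, f s) * g t := by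
          refine lintegral_mono fun t => ?_
          rw [← lintegral_const_mul _ hf, ← lintegral_mul_const _ (by fun_prop)]
          refine lintegral_mono_ae ?_
          filter_upwards [compl_mem_ae_iff.2 (measure_singleton t)] with s hs
          gcongr
          exact pw _ (sub_ne_zero.2 fun h => hs h.symm)
      _ = _ := by rw [lintegral_const_mul _ hg]
  -- The remaining range 0 < 2/q < 1 is fractional integration of order α = 2/q, for which 2/(2-α)
  -- is the conjugate exponent q'.
  · have hqr : 2 < q.toReal := by
      rw [← ENNReal.toReal_ofNat 2]; exact (ENNReal.toReal_lt_toReal (by simp) hqt).2 hq2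
    have hrec : recip q = 1 / q.toReal := by rw [recip_eq_inv_toReal, one_div]
    have hα0 : 0 < 2 * recip q := by rw [hrec]; positivity
    have hα1 : 2 * recip q < 1 := by rw [hrec, mul_one_div, div_lt_one (by linarith)]; exact hqr
    obtain ⟨K, hK, H⟩ := exists_riesz_form_le hα0 hα1
    have hconj : ENNReal.ofReal (2 / (2 - 2 * recip q)) = q.conjExponent := by
      rw [← ENNReal.ofReal_toReal (conjExponent_ne_top hq), toReal_conjExponent hq]
      congr 1
      rw [show 2 - 2 * recip q = 2 * (1 - recip q) by ring, div_mul_eq_div_div]; norm_num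
    rw [hconj] at H
    refine ⟨K, hK, ?_⟩
    intro θ μ X Y h f g h0 h1 hθ hμ hh hX hY hf hg hft hgt
    have pw := pointwise θ μ X Y h h0 h1 hθ hμ hX hY
    set Z := X ^ (1 - θ) * Y ^ θ * ENNReal.ofReal (μ ^ (-(2 * recip q)))
    calc ∫⁻ t, ∫⁻ s, h (t - s) * f s * g t
        ≤ ∫⁻ t, ∫⁻ s, Z * (ENNReal.ofReal (|t - s| ^ (-(2 * recip q))) * f s * g t) := by
          refine lintegral_mono fun t => lintegral_mono_ae ?_
          filter_upwards [compl_mem_ae_iff.2 (measure_singleton t)] with s hs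
          calc h (t - s) * f s * g t ≤ Z * ENNReal.ofReal (|t - s| ^ (-(2 * recip q))) * f s * g t := by
                gcongr
                exact pw _ (sub_ne_zero.2 fun h => hs h.symm)
            _ = _ := by ring
      _ = Z * ∫⁻ t, ∫⁻ s, ENNReal.ofReal (|t - s| ^ (-(2 * recip q))) * f s * g t := by
          rw [← lintegral_const_mul _ (by fun_prop)]
          refine lintegral_congr fun t => ?_
          rw [lintegral_const_mul _ (by fun_prop)]
      _ ≤ Z * (ENNReal.ofReal K * eLpNorm f q.conjExponent volume *
            eLpNorm g q.conjExponent volume) := mul_le_mul_right (H f g hf hg hft hgt) _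
      _ = _ := by ring

end Strichartz

/-! ### Real interpolation between L¹ → L^∞ and L² → L². -/

namespace Strichartz

section Interpolation

variable {α : Type*} [MeasurableSpace α] {μ : Measure α} [SigmaFinite μ]

/-- The real interpolation constant for `L¹ → L^∞`, `L² → L²` at the exponent `r`. -/
def interpConst (r : ℝ) : ℝ := (4 * r / (r - 2) * 2 ^ (r - 2)) ^ (1 / r)

/-- Real interpolation between `L¹ → L^∞` and `L² → L²` gives `L^{r'} → L^r`, `2 < r < ∞`. -/
lemma eLpNorm_interp_le {r p : ℝ} (hr : 2 < r) (hp : p = r / (r - 1)) {B : ℝ} (hB : 0 < B)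
    {N : ℝ≥0∞} {f : α → ℂ} (hf : Measurable f) (hfp : eLpNorm f (ENNReal.ofReal p) μ ≠ ∞)
    (T : (α → ℂ) → α → ℂ)
    (hTm : ∀ A, MeasurableSet A → AEStronglyMeasurable (T (A.indicator f)) μ)
    (hT1 : ∀ A, MeasurableSet A →
      eLpNorm (T (A.indicator f)) ∞ μ ≤ ENNReal.ofReal B * eLpNorm (A.indicator f) 1 μ)
    (hT2 : ∀ A, MeasurableSet A →
      eLpNorm (T (A.indicator f)) 2 μ ≤ N * eLpNorm (A.indicator f) 2 μ)
    (hadd : ∀ A, MeasurableSet A → T f =ᵐ[μ] T (A.indicator f) + T (Aᶜ.indicator f)) :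
    eLpNorm (T f) (ENNReal.ofReal r) μ ≤
      ENNReal.ofReal (interpConst r) * ENNReal.ofReal B ^ (1 - 2 / r) * N ^ (2 / r) *
        eLpNorm f (ENNReal.ofReal p) μ := by
  have hr0 : 0 < r := by linarith
  have hr1 : 0 < r - 1 := by linarith
  have hr2 : 0 < r - 2 := by linarith
  have hp0 : 0 < p := by rw [hp]; positivity
  have hp1 : p - 1 = 1 / (r - 1) := by rw [hp]; field_simp; ring
  have hp1' : 0 < p - 1 := by rw [hp1]; positivity
  have hpe : ENNReal.ofReal p ≠ 0 := by simpa using hp0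
  have hre : ENNReal.ofReal r ≠ 0 := by simpa using hr0
  have hTfm : AEStronglyMeasurable (T f) μ := by simpa using hTm univ MeasurableSet.univ
  have hnorm : Measurable fun x => ‖f x‖ := hf.norm
  -- the case `f = 0`
  rcases eq_or_ne (eLpNorm f (ENNReal.ofReal p) μ) 0 with h0 | h0
  · have hf0 : f =ᵐ[μ] 0 := (eLpNorm_eq_zero_iff hf.aestronglyMeasurable hpe).1 h0
    have h1 := hT1 univ MeasurableSet.univ
    simp only [indicator_univ] at h1
    rw [eLpNorm_congr_ae hf0, eLpNorm_zero, mul_zero] at h1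
    have : T f =ᵐ[μ] 0 := (eLpNorm_eq_zero_iff hTfm (by simp)).1 (le_antisymm h1 bot_le)
    rw [eLpNorm_congr_ae this]; simp
  set I := ∫⁻ x, ENNReal.ofReal (‖f x‖ ^ p) ∂μ with hI
  have hIeq : eLpNorm f (ENNReal.ofReal p) μ = I ^ (1 / p) := by
    rw [eLpNorm_eq_lintegral_rpow_enorm_toReal hpe ENNReal.ofReal_ne_top,
      ENNReal.toReal_ofReal hp0.le]
    congr 1
    refine lintegral_congr fun x => ?_
    rw [← ofReal_norm, ENNReal.ofReal_rpow_of_nonneg (norm_nonneg _) hp0.le]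
  have hIt : I ≠ ∞ := by
    intro h; rw [hIeq, h, ENNReal.top_rpow_of_pos (by positivity)] at hfp; exact hfp rfl
  have hI0 : I ≠ 0 := by
    intro h; rw [hIeq, h, ENNReal.zero_rpow_of_pos (by positivity)] at h0; exact h0 rfl
  set S := I.toReal with hS
  have hS0 : 0 < S := ENNReal.toReal_pos hI0 hIt
  have hIS : I = ENNReal.ofReal S := (ENNReal.ofReal_toReal hIt).symm
  -- distributional estimate
  have hdist : ∀ l : ℝ, 0 < l → μ {x | l < ‖T f x‖} ≤
      ENNReal.ofReal (4 / l ^ 2) * (N ^ 2 *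
        ∫⁻ x, {x | l * ‖f x‖ ^ (p - 1) ≤ 2 * B * S}.indicator (fun x => ENNReal.ofReal (‖f x‖ ^ 2)) x ∂μ) := by
    intro l hl
    -- The height of truncation depends on the level l and is tuned so that the large part of f has
    -- L¹ norm at most l/(2B). Its image is then at most l/2 almost everywhere, and the level set
    -- {|Tf| > l} is controlled by the small part of f, through Chebyshev in L².
    set A := {x | 2 * B * S < l * ‖f x‖ ^ (p - 1)} with hA
    have hAm : MeasurableSet A := measurableSet_lt measurable_const (by fun_prop)
    have hAc : Aᶜ = {x | l * ‖f x‖ ^ (p - 1) ≤ 2 * B * S} := by ext x; simp [hA]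
    have hA1 : eLpNorm (A.indicator f) 1 μ ≤ ENNReal.ofReal (l / (2 * B)) := by
      rw [eLpNorm_one_eq_lintegral_enorm]
      calc ∫⁻ x, ‖A.indicator f x‖ₑ ∂μ
          ≤ ∫⁻ x, ENNReal.ofReal (l / (2 * B * S)) * ENNReal.ofReal (‖f x‖ ^ p) ∂μ := by
            refine lintegral_mono fun x => ?_
            by_cases hx : x ∈ A
            · rw [indicator_of_mem hx, ← ofReal_norm, ← ENNReal.ofReal_mul (by positivity)]
              apply ENNReal.ofReal_le_ofReal
              have hx' : 2 * B * S < l * ‖f x‖ ^ (p - 1) := hx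
              have hfx : 0 < ‖f x‖ := by
                by_contra h
                have : ‖f x‖ = 0 := le_antisymm (not_lt.1 h) (norm_nonneg _)
                rw [this, Real.zero_rpow hp1'.ne', mul_zero] at hx'
                have : 0 < 2 * B * S := by positivity
                linarith
              have : ‖f x‖ ^ p = ‖f x‖ ^ (p - 1) * ‖f x‖ := by
                rw [← Real.rpow_add_one hfx.ne']; congr 1; ring
              rw [this, div_mul_eq_mul_div, le_div_iff₀ (by positivity)]
              nlinarith
            · simp [hx]
        _ = ENNReal.ofReal (l / (2 * B)) := by
            rw [lintegral_const_mul _ (by fun_prop), ← hI, hIS, ← ENNReal.ofReal_mul (by positivity)]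
            congr 1; field_simp
    have hbig : ∀ᵐ x ∂μ, ‖T (A.indicator f) x‖ ≤ l / 2 := by
      have h1 : eLpNorm (T (A.indicator f)) ∞ μ ≤ ENNReal.ofReal (l / 2) := by
        refine (hT1 A hAm).trans ?_
        calc _ ≤ ENNReal.ofReal B * ENNReal.ofReal (l / (2 * B)) := by gcongr
          _ = _ := by rw [← ENNReal.ofReal_mul hB.le]; congr 1; field_simp
      rw [eLpNorm_exponent_top] at h1
      filter_upwards [ae_le_eLpNormEssSup (f := T (A.indicator f)) (μ := μ)] with x hx
      have := hx.trans h1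
      rw [← ofReal_norm] at this
      exact (ENNReal.ofReal_le_ofReal_iff (by positivity)).1 this
    have hε : ENNReal.ofReal (l / 2) ≠ 0 := by simpa using hl
    calc μ {x | l < ‖T f x‖} ≤ μ {x | ENNReal.ofReal (l / 2) ≤ ‖T (Aᶜ.indicator f) x‖ₑ} := by
          refine measure_mono_ae ?_
          filter_upwards [hbig, hadd A hAm] with x hx hx2 hx3
          have hx3' : l < ‖T f x‖ := hx3
          change ENNReal.ofReal (l / 2) ≤ ‖T (Aᶜ.indicator f) x‖ₑ
          rw [← ofReal_norm]
          apply ENNReal.ofReal_le_ofReal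
          rw [hx2] at hx3'
          have := norm_add_le (T (A.indicator f) x) (T (Aᶜ.indicator f) x)
          simp only [Pi.add_apply] at hx3'
          linarith
      _ ≤ (ENNReal.ofReal (l / 2))⁻¹ ^ (2:ℝ≥0∞).toReal *
            eLpNorm (T (Aᶜ.indicator f)) 2 μ ^ (2:ℝ≥0∞).toReal :=
          meas_ge_le_mul_pow_eLpNorm_enorm μ (by norm_num) (by norm_num) (hTm _ hAm.compl) hε
            (by simp)
      _ ≤ (ENNReal.ofReal (l / 2))⁻¹ ^ (2:ℝ≥0∞).toReal *
            (N * eLpNorm (Aᶜ.indicator f) 2 μ) ^ (2:ℝ≥0∞).toReal := by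
          gcongr
          exact hT2 _ hAm.compl
      _ = _ := by
          rw [eLpNorm_eq_lintegral_rpow_enorm_toReal (by norm_num) (by norm_num)]
          simp only [ENNReal.toReal_ofNat]
          rw [ENNReal.mul_rpow_of_nonneg _ _ (by norm_num), ← ENNReal.rpow_mul]
          norm_num
          congr 1
          · rw [← ENNReal.ofReal_inv_of_pos (by positivity), ← ENNReal.ofReal_pow (by positivity)]
            congr 1
            field_simp; norm_num
          · congr 1
            refine lintegral_congr fun x => ?_
            rw [hAc]
            by_cases hx : x ∈ {x | l * ‖f x‖ ^ (p - 1) ≤ 2 * B * S}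
            · rw [indicator_of_mem hx, indicator_of_mem hx, ← ofReal_norm]
            · rw [indicator_of_notMem hx, indicator_of_notMem hx]; simp
  -- integrate over the levels
  have hpow : eLpNorm (T f) (ENNReal.ofReal r) μ ^ r ≤
      ENNReal.ofReal (4 * r / (r - 2) * (2 * B * S) ^ (r - 2) * S) * N ^ 2 := by
    have e : eLpNorm (T f) (ENNReal.ofReal r) μ ^ r = ∫⁻ x, ENNReal.ofReal (‖T f x‖ ^ r) ∂μ := by
      rw [eLpNorm_eq_lintegral_rpow_enorm_toReal hre ENNReal.ofReal_ne_top,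
        ENNReal.toReal_ofReal hr0.le, ← ENNReal.rpow_mul, one_div, inv_mul_cancel₀ hr0.ne',
        ENNReal.rpow_one]
      refine lintegral_congr fun x => ?_
      rw [← ofReal_norm, ENNReal.ofReal_rpow_of_nonneg (norm_nonneg _) hr0.le]
    rw [e, lintegral_rpow_eq_lintegral_meas_lt_mul μ (Filter.Eventually.of_forall fun x => norm_nonneg _)
      hTfm.norm.aemeasurable hr0]
    have mset : MeasurableSet {z : ℝ × α | z.1 * ‖f z.2‖ ^ (p - 1) ≤ 2 * B * S} :=
      measurableSet_le (by fun_prop) measurable_const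
    calc _ ≤ ENNReal.ofReal r * ∫⁻ l in Ioi (0:ℝ), ∫⁻ x, ENNReal.ofReal (4 * l ^ (r - 3)) * (N ^ 2 *
          {z : ℝ × α | z.1 * ‖f z.2‖ ^ (p - 1) ≤ 2 * B * S}.indicator
            (fun z => ENNReal.ofReal (‖f z.2‖ ^ 2)) (l, x)) ∂μ := by
          refine mul_le_mul_right ?_ _
          refine setLIntegral_mono' measurableSet_Ioi fun l hl => ?_
          have hl' : (0:ℝ) < l := hl
          have mm : Measurable fun x => {z : ℝ × α | z.1 * ‖f z.2‖ ^ (p - 1) ≤ 2 * B * S}.indicator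
            (fun z => ENNReal.ofReal (‖f z.2‖ ^ 2)) (l, x) :=
            (Measurable.indicator (by fun_prop) mset).comp (by fun_prop : Measurable fun x : α => (l, x))
          rw [lintegral_const_mul _ (mm.const_mul _), lintegral_const_mul _ mm]
          calc _ ≤ _ := mul_le_mul_left (hdist l hl') _
            _ = _ := by
              rw [mul_right_comm, ← ENNReal.ofReal_mul (by positivity)]
              congr 2
              have : l ^ (r - 3) = l ^ (r - 1) / l ^ 2 := by
                rw [← Real.rpow_natCast, ← Real.rpow_sub hl']; congr 1; push_cast; ring
              rw [this]; ring
      _ = ENNReal.ofReal r * ∫⁻ x, (∫⁻ l in Ioi (0:ℝ), ENNReal.ofReal (4 * l ^ (r - 3)) * (N ^ 2 *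
          {z : ℝ × α | z.1 * ‖f z.2‖ ^ (p - 1) ≤ 2 * B * S}.indicator
            (fun z => ENNReal.ofReal (‖f z.2‖ ^ 2)) (l, x))) ∂μ := by
          rw [lintegral_lintegral_swap]
          refine Measurable.aemeasurable ?_
          exact (by fun_prop : Measurable fun z : ℝ × α => ENNReal.ofReal (4 * z.1 ^ (r - 3))).mul
            ((Measurable.indicator (by fun_prop) mset).const_mul _)
      _ ≤ ENNReal.ofReal r * ∫⁻ x, ENNReal.ofReal (4 / (r - 2) * (2 * B * S) ^ (r - 2)) * N ^ 2 *
            ENNReal.ofReal (‖f x‖ ^ p) ∂μ := by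
          refine mul_le_mul_right (lintegral_mono fun x => ?_) _
          rcases eq_or_ne (f x) 0 with hx | hx
          · have : ∀ l : ℝ, {z : ℝ × α | z.1 * ‖f z.2‖ ^ (p - 1) ≤ 2 * B * S}.indicator
              (fun z => ENNReal.ofReal (‖f z.2‖ ^ 2)) (l, x) = 0 := by
              intro l; simp [indicator, hx]
            simp only [this, mul_zero, lintegral_zero, zero_le]
          have hx0 : 0 < ‖f x‖ := norm_pos_iff.2 hx
          -- For fixed x the condition on the levels reads l ≤ m, and r > 2 makes l^{r-3} integrable
          -- at 0.
          set m := 2 * B * S / ‖f x‖ ^ (p - 1) with hm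
          have hm0 : 0 < m := by positivity
          have hint : ∫⁻ l in Ioc 0 m, ENNReal.ofReal (4 * l ^ (r - 3)) =
              ENNReal.ofReal (4 / (r - 2) * m ^ (r - 2)) := by
            have hi : IntegrableOn (fun u : ℝ => 4 * u ^ (r - 3)) (Ioc 0 m) :=
              ((intervalIntegrable_iff_integrableOn_Ioc_of_le hm0.le).1
                (intervalIntegral.intervalIntegrable_rpow' (by linarith))).const_mul 4
            rw [← ofReal_integral_eq_lintegral_ofReal hi, ← intervalIntegral.integral_of_le hm0.le,
              intervalIntegral.integral_const_mul, integral_rpow (Or.inl (by linarith))]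
            · congr 1
              rw [show r - 3 + 1 = r - 2 by ring, Real.zero_rpow hr2.ne']
              ring
            · filter_upwards [ae_restrict_mem measurableSet_Ioc] with u hu
              exact mul_nonneg (by norm_num) (Real.rpow_nonneg hu.1.le _)
          have e2 : ∀ l ∈ Ioi (0:ℝ), ENNReal.ofReal (4 * l ^ (r - 3)) * (N ^ 2 *
            {z : ℝ × α | z.1 * ‖f z.2‖ ^ (p - 1) ≤ 2 * B * S}.indicator
              (fun z => ENNReal.ofReal (‖f z.2‖ ^ 2)) (l, x)) =
              (Iic m).indicator (fun l => ENNReal.ofReal (4 * l ^ (r - 3)) *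
                (N ^ 2 * ENNReal.ofReal (‖f x‖ ^ 2))) l := by
            intro l hl
            by_cases hlm : l ≤ m
            · rw [indicator_of_mem (mem_Iic.2 hlm), indicator_of_mem]
              change l * ‖f x‖ ^ (p - 1) ≤ 2 * B * S
              rwa [hm, le_div_iff₀ (by positivity)] at hlm
            · rw [indicator_of_notMem (show l ∉ Iic m from hlm), indicator_of_notMem, mul_zero, mul_zero]
              intro h
              apply hlm
              rw [hm, le_div_iff₀ (by positivity)]; exact h
          rw [setLIntegral_congr_fun measurableSet_Ioi e2, lintegral_indicator measurableSet_Iic,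
            Measure.restrict_restrict measurableSet_Iic, Iic_inter_Ioi,
            lintegral_mul_const _ (by fun_prop), hint, mul_comm (N ^ 2), ← mul_assoc,
            ← ENNReal.ofReal_mul (by positivity), mul_right_comm (ENNReal.ofReal _) (N ^ 2),
            ← ENNReal.ofReal_mul (by positivity)]
          refine le_of_eq ?_
          congr 2
          rw [hm, Real.div_rpow (by positivity) (by positivity), ← Real.rpow_mul hx0.le]
          -- The balance 2 - (p-1)(r-2) = p singles out p = r/(r-1), the exponent conjugate to r.
          have : ‖f x‖ ^ p = ‖f x‖ ^ 2 / ‖f x‖ ^ ((p - 1) * (r - 2)) := by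
            rw [← Real.rpow_natCast, ← Real.rpow_sub hx0]
            congr 1
            rw [hp]; field_simp; push_cast; ring
          rw [this]; ring
      _ = _ := by
          rw [lintegral_const_mul _ (by fun_prop), ← hI, hIS, mul_right_comm, ← mul_assoc,
            ← ENNReal.ofReal_mul (by positivity), ← ENNReal.ofReal_mul (by positivity)]
          congr 2
          ring
  -- take the `r`-th root
  have hroot : eLpNorm (T f) (ENNReal.ofReal r) μ =
      (eLpNorm (T f) (ENNReal.ofReal r) μ ^ r) ^ (1 / r) := by
    rw [← ENNReal.rpow_mul, mul_one_div_cancel hr0.ne', ENNReal.rpow_one]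
  rw [hroot]
  refine (ENNReal.rpow_le_rpow hpow (by positivity)).trans_eq ?_
  rw [ENNReal.mul_rpow_of_nonneg _ _ (by positivity), ENNReal.ofReal_rpow_of_pos (by positivity), hIeq,
    hIS, ENNReal.ofReal_rpow_of_pos hS0, ENNReal.ofReal_rpow_of_pos hB]
  have eN : (N ^ 2) ^ (1 / r) = N ^ (2 / r) := by
    rw [← ENNReal.rpow_natCast, ← ENNReal.rpow_mul]; congr 1; push_cast; ring
  have eR : (4 * r / (r - 2) * (2 * B * S) ^ (r - 2) * S) ^ (1 / r) =
      interpConst r * B ^ (1 - 2 / r) * S ^ (1 / p) := by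
    have h3 : (2 * B * S) ^ (r - 2) = 2 ^ (r - 2) * B ^ (r - 2) * S ^ (r - 2) := by
      rw [Real.mul_rpow (by positivity) hS0.le, Real.mul_rpow (by positivity) hB.le]
    rw [h3, show 4 * r / (r - 2) * (2 ^ (r - 2) * B ^ (r - 2) * S ^ (r - 2)) * S =
      4 * r / (r - 2) * 2 ^ (r - 2) * B ^ (r - 2) * S ^ (r - 2) * S by ring, interpConst,
      Real.mul_rpow (by positivity) hS0.le, Real.mul_rpow (by positivity) (by positivity),
      Real.mul_rpow (by positivity) (by positivity), ← Real.rpow_mul hB.le, ← Real.rpow_mul hS0.le]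
    have h1 : (r - 2) * (1 / r) = 1 - 2 / r := by field_simp
    have h2 : (1:ℝ) / p = (1 - 2 / r) + 1 / r := by rw [hp]; field_simp; ring
    rw [h1, h2, Real.rpow_add hS0]
    ring
  rw [eN, eR, ENNReal.ofReal_mul (by unfold interpConst; positivity),
    ENNReal.ofReal_mul (by unfold interpConst; positivity)]
  ring

end Interpolation

end Strichartz

/-! ### Young's convolution inequality with values in L². -/

namespace Strichartz

/-- Young's convolution inequality `L^p * L^ρ → L²`. -/
lemma lintegral_convolution_sq_le {d : ℕ} {p ρ : ℝ} (hp1 : 1 ≤ p) (hp2 : p ≤ 2) (hρ1 : 1 ≤ ρ)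
    (hρ2 : ρ ≤ 2) (hpρ : 1 / p + 1 / ρ = 3 / 2) {k f : Space d → ℝ≥0∞} (hk : Measurable k)
    (hf : Measurable f) :
    ∫⁻ x, (∫⁻ y, k (x - y) * f y) ^ 2 ≤
      ((∫⁻ x, k x ^ p) ^ (1 / p) * (∫⁻ x, f x ^ ρ) ^ (1 / ρ)) ^ 2 := by
  have hp0 : 0 < p := by linarith
  have hρ0 : 0 < ρ := by linarith
  set A := ∫⁻ x, k x ^ p
  set B := ∫⁻ x, f x ^ ρ
  have hsum : (2 - p) / p + (2 - ρ) / ρ = 1 := by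
    have : (2 - p) / p + (2 - ρ) / ρ = 2 * (1 / p + 1 / ρ) - 2 := by field_simp; ring
    rw [this, hpρ]; norm_num
  have inner : ∀ x, (∫⁻ y, k (x - y) * f y) ^ 2 ≤
      (∫⁻ y, k (x - y) ^ p * f y ^ ρ) * (A ^ ((2 - p) / p) * B ^ ((2 - ρ) / ρ)) := by
    intro x
    -- Cauchy–Schwarz with k^p f^ρ kept as one factor, since its double integral is the product of
    -- the two single ones. The other factor k^{2-p} f^{2-ρ} is bounded uniformly in x by Hölder;
    -- its weights (2-p)/p and (2-ρ)/ρ add up to 1 by the scaling relation.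
    have e : ∀ y, k (x - y) * f y = (k (x - y) ^ p * f y ^ ρ) ^ (1 / 2 : ℝ) *
        (k (x - y) ^ (2 - p) * f y ^ (2 - ρ)) ^ (1 / 2 : ℝ) := by
      intro y
      rw [ENNReal.mul_rpow_of_nonneg _ _ (by norm_num), ENNReal.mul_rpow_of_nonneg _ _ (by norm_num),
        ← ENNReal.rpow_mul, ← ENNReal.rpow_mul, ← ENNReal.rpow_mul, ← ENNReal.rpow_mul]
      have h1 : k (x - y) = k (x - y) ^ (p * (1 / 2)) * k (x - y) ^ ((2 - p) * (1 / 2)) := by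
        rw [← ENNReal.rpow_add_of_nonneg _ _ (by linarith) (by linarith)]
        ring_nf; simp
      have h2 : f y = f y ^ (ρ * (1 / 2)) * f y ^ ((2 - ρ) * (1 / 2)) := by
        rw [← ENNReal.rpow_add_of_nonneg _ _ (by linarith) (by linarith)]
        ring_nf; simp
      nth_rewrite 1 [h1]; nth_rewrite 1 [h2]; ring
    simp_rw [e]
    have cs := ENNReal.lintegral_mul_norm_pow_le (μ := (volume : Measure (Space d)))
      (f := fun y => k (x - y) ^ p * f y ^ ρ) (g := fun y => k (x - y) ^ (2 - p) * f y ^ (2 - ρ))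
      (p := 1 / 2) (q := 1 / 2) (Measurable.aemeasurable (by fun_prop))
      (Measurable.aemeasurable (by fun_prop)) (by norm_num) (by norm_num) (by norm_num)
    have half_sq : ∀ z : ℝ≥0∞, (z ^ (1 / 2 : ℝ)) ^ 2 = z := by
      intro z
      rw [← ENNReal.rpow_natCast, ← ENNReal.rpow_mul]; norm_num
    calc _ ≤ ((∫⁻ y, k (x - y) ^ p * f y ^ ρ) ^ (1 / 2 : ℝ) *
          (∫⁻ y, k (x - y) ^ (2 - p) * f y ^ (2 - ρ)) ^ (1 / 2 : ℝ)) ^ 2 := by gcongr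
      _ = (∫⁻ y, k (x - y) ^ p * f y ^ ρ) * ∫⁻ y, k (x - y) ^ (2 - p) * f y ^ (2 - ρ) := by
          rw [mul_pow, half_sq, half_sq]
      _ ≤ _ := by
          gcongr
          have e2 : ∀ y, k (x - y) ^ (2 - p) * f y ^ (2 - ρ) =
              (k (x - y) ^ p) ^ ((2 - p) / p) * (f y ^ ρ) ^ ((2 - ρ) / ρ) := by
            intro y
            rw [← ENNReal.rpow_mul, ← ENNReal.rpow_mul, mul_div_cancel₀ _ hp0.ne',
              mul_div_cancel₀ _ hρ0.ne']
          simp_rw [e2]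
          refine (ENNReal.lintegral_mul_norm_pow_le (Measurable.aemeasurable (by fun_prop))
            (Measurable.aemeasurable (by fun_prop)) (div_nonneg (by linarith) hp0.le)
            (div_nonneg (by linarith) hρ0.le) hsum).trans_eq ?_
          rw [lintegral_sub_left_eq_self (fun y => k y ^ p) x]
  calc _ ≤ ∫⁻ x, (∫⁻ y, k (x - y) ^ p * f y ^ ρ) * (A ^ ((2 - p) / p) * B ^ ((2 - ρ) / ρ)) :=
        lintegral_mono inner
    _ = (∫⁻ x, ∫⁻ y, k (x - y) ^ p * f y ^ ρ) * (A ^ ((2 - p) / p) * B ^ ((2 - ρ) / ρ)) :=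
        lintegral_mul_const _ (by fun_prop)
    _ = (A * B) * (A ^ ((2 - p) / p) * B ^ ((2 - ρ) / ρ)) := by
        congr 1
        rw [lintegral_lintegral_swap (Measurable.aemeasurable (by fun_prop))]
        rw [← lintegral_const_mul _ (by fun_prop)]
        refine lintegral_congr fun y => ?_
        rw [lintegral_mul_const _ (by fun_prop), lintegral_sub_right_eq_self (fun x => k x ^ p) y]
    _ = _ := by
        have pw : ∀ (z : ℝ≥0∞) {p : ℝ}, 0 < p → p ≤ 2 → (z ^ (1 / p)) ^ 2 = z * z ^ ((2 - p) / p) := by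
          intro z p hp hp2
          nth_rewrite 2 [← ENNReal.rpow_one z]
          rw [← ENNReal.rpow_add_of_nonneg _ _ (by norm_num) (div_nonneg (by linarith) hp.le),
            ← ENNReal.rpow_natCast, ← ENNReal.rpow_mul]
          congr 1; field_simp; push_cast; ring
        rw [mul_pow, pw A hp0 hp2, pw B hρ0 hρ2]
        ring

end Strichartz

/-! ### Fourier transforms of functions in the sense of tempered distributions; Plancherel. -/

namespace Strichartz

open scoped FourierTransform

/-- `g` is the Fourier transform of `f` in the normalization `∫ e^{-2πi x·ξ} f(x) dx`, in the sense of
tempered distributions. -/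
def IsFT {d : ℕ} (f g : Space d → ℂ) : Prop :=
  ∀ φ : 𝓢(Space d, ℂ),
    Integrable (fun ξ => g ξ * φ ξ) ∧ Integrable (fun x => f x * (𝓕 φ : 𝓢(Space d, ℂ)) x) ∧
      ∫ ξ, g ξ * φ ξ = ∫ x, f x * (𝓕 φ : 𝓢(Space d, ℂ)) x

variable {d : ℕ}

lemma two_pi_ne_zero : (2 * Real.pi : ℝ) ≠ 0 := by positivity

/-- Dilation of Schwartz functions. -/
def schwartzDilation (c : ℝ) (hc : c ≠ 0) (φ : 𝓢(Space d, ℂ)) : 𝓢(Space d, ℂ) :=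
  SchwartzMap.compCLMOfContinuousLinearEquiv ℂ (ContinuousLinearEquiv.smulLeft (Units.mk0 c hc)) φ

@[simp] lemma schwartzDilation_apply (c : ℝ) (hc : c ≠ 0) (φ : 𝓢(Space d, ℂ)) (x : Space d) :
    schwartzDilation c hc φ x = φ (c • x) := rfl

lemma finrank_space : Module.finrank ℝ (Space d) = d := by simp

lemma integral_comp_two_pi_inv (f : Space d → ℂ) :
    ∫ x, f ((2 * Real.pi)⁻¹ • x) = ((2 * Real.pi) ^ d : ℝ) * ∫ x, f x := by
  rw [Measure.integral_comp_smul, finrank_space, inv_pow, inv_inv, abs_of_pos (by positivity)]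
  simp

lemma fourierIntegral_dilation (φ : 𝓢(Space d, ℂ)) (x : Space d) :
    fourierIntegral (schwartzDilation (2 * Real.pi)⁻¹ (inv_ne_zero two_pi_ne_zero) φ) x =
      ((2 * Real.pi) ^ d : ℝ) * (𝓕 φ : 𝓢(Space d, ℂ)) x := by
  rw [fourierIntegral, SchwartzMap.fourier_coe, Real.fourier_eq', ← integral_comp_two_pi_inv]
  congr 1
  ext ξ
  simp only [schwartzDilation_apply, smul_eq_mul]
  congr 2
  rw [real_inner_smul_left, real_inner_comm]
  push_cast
  field_simp

/-- Testing with dilated Schwartz functions multiplies both sides of the defining identity by the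
same factor (2π)^d, and dilation is a bijection of the Schwartz space. Only the frequency variable
is rescaled, so norms of f are not affected; in the new normalization Plancherel has no constant. -/
lemma isFourierTransform_iff {f g : Space d → ℂ} :
    IsFourierTransform f g ↔ IsFT f fun η => g ((2 * Real.pi) • η) := by
  have hd : ((2 * Real.pi) ^ d : ℝ) ≠ 0 := by positivity
  have hdc : (((2 * Real.pi) ^ d : ℝ) : ℂ) ≠ 0 := by exact_mod_cast hd
  have e0 : ∀ φ : 𝓢(Space d, ℂ), (fun ξ => g ξ *
      schwartzDilation (2 * Real.pi)⁻¹ (inv_ne_zero two_pi_ne_zero) φ ξ) = fun ξ =>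
      (fun η => g ((2 * Real.pi) • η) * φ η) ((2 * Real.pi)⁻¹ • ξ) := by
    intro φ; ext ξ
    rw [schwartzDilation_apply]
    dsimp only
    rw [smul_smul, mul_inv_cancel₀ two_pi_ne_zero, one_smul]
  have e1 : ∀ φ : 𝓢(Space d, ℂ), (fun x => f x *
      fourierIntegral (schwartzDilation (2 * Real.pi)⁻¹ (inv_ne_zero two_pi_ne_zero) φ) x) =
      fun x => (((2 * Real.pi) ^ d : ℝ) : ℂ) * (f x * (𝓕 φ : 𝓢(Space d, ℂ)) x) := by
    intro φ; ext x; rw [fourierIntegral_dilation]; ring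
  have key : ∀ φ : 𝓢(Space d, ℂ),
      (let ψ := schwartzDilation (2 * Real.pi)⁻¹ (inv_ne_zero two_pi_ne_zero) φ
       Integrable (fun ξ => g ξ * ψ ξ) ∧ Integrable (fun x => f x * fourierIntegral ψ x) ∧
      ∫ ξ, g ξ * ψ ξ = ∫ x, f x * fourierIntegral ψ x) ↔
      (Integrable (fun η => g ((2 * Real.pi) • η) * φ η) ∧
        Integrable (fun x => f x * (𝓕 φ : 𝓢(Space d, ℂ)) x) ∧
      ∫ η, g ((2 * Real.pi) • η) * φ η = ∫ x, f x * (𝓕 φ : 𝓢(Space d, ℂ)) x) := by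
    intro φ
    dsimp only
    rw [e0, e1, integral_comp_two_pi_inv (fun η => g ((2 * Real.pi) • η) * φ η), integral_const_mul,
      integrable_comp_smul_iff volume (fun η => g ((2 * Real.pi) • η) * φ η) (inv_ne_zero two_pi_ne_zero),
      integrable_const_mul_iff (IsUnit.mk0 _ hdc), mul_right_inj' hdc]
  constructor
  · intro h φ
    exact (key φ).1 (h _)
  · intro h φ
    have := (key (schwartzDilation (2 * Real.pi) two_pi_ne_zero φ)).2 (h _)
    have e : schwartzDilation (2 * Real.pi)⁻¹ (inv_ne_zero two_pi_ne_zero)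
        (schwartzDilation (2 * Real.pi) two_pi_ne_zero φ) = φ := by
      ext x
      rw [schwartzDilation_apply, schwartzDilation_apply, smul_smul, mul_inv_cancel₀ two_pi_ne_zero, one_smul]
    simpa only [e] using this

lemma IsFT.add {f₁ f₂ g₁ g₂ : Space d → ℂ} (h₁ : IsFT f₁ g₁) (h₂ : IsFT f₂ g₂) :
    IsFT (fun x => f₁ x + f₂ x) (fun x => g₁ x + g₂ x) := by
  intro φ
  obtain ⟨a1, a2, a3⟩ := h₁ φ
  obtain ⟨b1, b2, b3⟩ := h₂ φ
  simp only [add_mul]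
  exact ⟨a1.add b1, a2.add b2, by rw [integral_add a1 b1, integral_add a2 b2, a3, b3]⟩

/-- A function whose products with Schwartz functions are integrable is locally integrable. -/
lemma locallyIntegrable_of_schwartz {g : Space d → ℂ}
    (h : ∀ φ : 𝓢(Space d, ℂ), Integrable fun ξ => g ξ * φ ξ) : LocallyIntegrable g := by
  rw [locallyIntegrable_iff]
  intro K hK
  obtain ⟨φ, hφc, hφs, hφ⟩ : ∃ f : Space d → ℝ, HasCompactSupport f ∧ ContDiff ℝ ((⊤ : ℕ∞) : WithTop ℕ∞) f ∧
      ∀ x ∈ K, f x = 1 := by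
    obtain ⟨R, hR⟩ := hK.isBounded.subset_closedBall 0
    let b : ContDiffBump (0 : Space d) := ⟨max R 1, max R 1 + 1, by positivity, by linarith⟩
    refine ⟨b, b.hasCompactSupport, b.contDiff, fun x hx => b.one_of_mem_closedBall ?_⟩
    exact Metric.closedBall_subset_closedBall (le_max_left _ _) (hR hx)
  have hφc' : HasCompactSupport fun x => (φ x : ℂ) := hφc.comp_left (g := Complex.ofReal) (by simp)
  have hi := h (hφc'.toSchwartzMap (Complex.ofRealCLM.contDiff.comp hφs))
  refine (hi.integrableOn (s := K)).congr ?_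
  filter_upwards [ae_restrict_mem hK.measurableSet] with x hx
  change g x * (φ x : ℂ) = g x
  simp [hφ x hx]

/-- Smooth compactly supported functions are Schwartz, so the difference is locally integrable and
annihilated by all of them. -/
lemma ae_eq_of_integral_schwartz_eq {g₁ g₂ : Space d → ℂ}
    (h₁ : ∀ φ : 𝓢(Space d, ℂ), Integrable fun ξ => g₁ ξ * φ ξ)
    (h₂ : ∀ φ : 𝓢(Space d, ℂ), Integrable fun ξ => g₂ ξ * φ ξ)
    (h : ∀ φ : 𝓢(Space d, ℂ), ∫ ξ, g₁ ξ * φ ξ = ∫ ξ, g₂ ξ * φ ξ) : g₁ =ᵐ[volume] g₂ := by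
  have hl : LocallyIntegrable (g₁ - g₂) :=
    (locallyIntegrable_of_schwartz h₁).sub (locallyIntegrable_of_schwartz h₂)
  have := ae_eq_zero_of_integral_contDiff_smul_eq_zero hl (fun φ hφs hφc => by
    have hφc' : HasCompactSupport fun x => (φ x : ℂ) := hφc.comp_left (g := Complex.ofReal) (by simp)
    have hφs' : ContDiff ℝ ((⊤ : ℕ∞) : WithTop ℕ∞) fun x => (φ x : ℂ) := Complex.ofRealCLM.contDiff.comp hφs
    have e := h (hφc'.toSchwartzMap hφs')
    have i1 := h₁ (hφc'.toSchwartzMap hφs')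
    have i2 := h₂ (hφc'.toSchwartzMap hφs')
    rw [← sub_eq_zero, ← integral_sub i1 i2] at e
    rw [← e]
    congr 1
    ext x
    change φ x • (g₁ x - g₂ x) = g₁ x * (φ x : ℂ) - g₂ x * (φ x : ℂ)
    rw [Complex.real_smul]
    ring)
  filter_upwards [this] with x hx
  exact sub_eq_zero.1 hx

/-- By this uniqueness the function that `Classical.epsilon` picks in `fourier` is irrelevant up to
null sets, as soon as some transform exists. -/
lemma IsFT.ae_eq_right {f g₁ g₂ : Space d → ℂ} (h₁ : IsFT f g₁) (h₂ : IsFT f g₂) :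
    g₁ =ᵐ[volume] g₂ :=
  ae_eq_of_integral_schwartz_eq (fun φ => (h₁ φ).1) (fun φ => (h₂ φ).1)
    (fun φ => (h₁ φ).2.2.trans (h₂ φ).2.2.symm)

/-- This is Fubini: the Fourier integral is symmetric for the bilinear pairing of integrable
functions. -/
lemma isFT_of_integrable {f : Space d → ℂ} (hf : Integrable f) : IsFT f (𝓕 f) := by
  intro φ
  have hb : ∀ x, ‖𝓕 f x‖ ≤ ∫ v, ‖f v‖ := fun x =>
    VectorFourier.norm_fourierIntegral_le_integral_norm _ _ _ _ _
  have hc : Continuous (𝓕 f) := VectorFourier.fourierIntegral_continuous Real.continuous_fourierChar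
    (by exact continuous_inner) hf
  refine ⟨φ.integrable.bdd_mul hc.aestronglyMeasurable (Filter.Eventually.of_forall hb), ?_, ?_⟩
  · refine hf.mul_bdd (c := SchwartzMap.seminorm ℝ 0 0 (𝓕 φ : 𝓢(Space d, ℂ)))
      (𝓕 φ : 𝓢(Space d, ℂ)).continuous.aestronglyMeasurable ?_
    exact Filter.Eventually.of_forall fun x => SchwartzMap.norm_le_seminorm ℝ _ x
  · have := VectorFourier.integral_fourierIntegral_smul_eq_flip (L := innerₗ (Space d)) (μ := volume)
      (ν := volume) Real.continuous_fourierChar (by exact continuous_inner) hf φ.integrable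
    simp only [smul_eq_mul, flip_innerₗ] at this
    rw [SchwartzMap.fourier_coe]
    exact this

lemma isFT_coe_fourier_Lp (f : Lp (α := Space d) ℂ 2) : IsFT f (𝓕 f : Lp (α := Space d) ℂ 2) := by
  intro φ
  have h := congrArg (fun T => T φ) (Lp.fourier_toTemperedDistribution_eq f)
  simp only [TemperedDistribution.fourier_apply, Lp.toTemperedDistribution_apply, smul_eq_mul] at h
  refine ⟨(Lp.memLp _).integrable_mul (φ.memLp 2 volume), (Lp.memLp _).integrable_mul ((𝓕 φ : 𝓢(Space d, ℂ)).memLp 2 volume), ?_⟩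
  simp_rw [mul_comm _ (φ _), mul_comm _ ((𝓕 φ : 𝓢(Space d, ℂ)) _)]
  exact h.symm

lemma IsFT.congr {f f' g g' : Space d → ℂ} (h : IsFT f g) (hf : f =ᵐ[volume] f')
    (hg : g =ᵐ[volume] g') : IsFT f' g' := by
  intro φ
  obtain ⟨h1, h2, h3⟩ := h φ
  have e1 : (fun ξ => g ξ * φ ξ) =ᵐ[volume] fun ξ => g' ξ * φ ξ := by
    filter_upwards [hg] with x hx; rw [hx]
  have e2 : (fun x => f x * (𝓕 φ : 𝓢(Space d, ℂ)) x) =ᵐ[volume]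
      fun x => f' x * (𝓕 φ : 𝓢(Space d, ℂ)) x := by
    filter_upwards [hf] with x hx; rw [hx]
  exact ⟨h1.congr e1, h2.congr e2, by rw [← integral_congr_ae e1, ← integral_congr_ae e2, h3]⟩

/-- Plancherel: an `L²` function has a Fourier transform in `L²` with the same norm. -/
lemma exists_isFT_of_memLp_two {f : Space d → ℂ} (hf : MemLp f 2 volume) :
    ∃ g, IsFT f g ∧ MemLp g 2 volume ∧ eLpNorm g 2 volume = eLpNorm f 2 volume := by
  let F : Lp (α := Space d) ℂ 2 volume := 𝓕 (hf.toLp f)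
  refine ⟨F, ?_, Lp.memLp _, ?_⟩
  · exact (isFT_coe_fourier_Lp (hf.toLp f)).congr hf.coeFn_toLp Filter.EventuallyEq.rfl
  · have h := Lp.norm_fourier_eq (hf.toLp f)
    rw [Lp.norm_def, Lp.norm_def, ENNReal.toReal_eq_toReal_iff' (Lp.memLp _).2.ne (Lp.memLp _).2.ne] at h
    rw [h, eLpNorm_congr_ae hf.coeFn_toLp]

lemma IsFT.memLp_two {f g : Space d → ℂ} (h : IsFT f g) (hf : MemLp f 2 volume) :
    MemLp g 2 volume ∧ eLpNorm g 2 volume = eLpNorm f 2 volume := by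
  obtain ⟨g', h1, h2, h3⟩ := exists_isFT_of_memLp_two hf
  have e := h.ae_eq_right h1
  exact ⟨(memLp_congr_ae e).2 h2, by rw [eLpNorm_congr_ae e, h3]⟩

end Strichartz

/-! ### Duality: multiplication formula, essential bounds, kernels of bounded multipliers. -/

namespace Strichartz

open scoped FourierTransform

variable {d : ℕ}

lemma integral_mul_eq_inner_conj {a : Space d → ℂ} (ha : MemLp (fun x => (starRingEnd ℂ) (a x)) 2 volume)
    (b : Lp (α := Space d) ℂ 2 volume) :
    ∫ x, a x * b x = inner ℂ (ha.toLp _) b := by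
  rw [L2.inner_def]
  refine integral_congr_ae ?_
  filter_upwards [ha.coeFn_toLp] with x hx
  rw [hx]
  simp [mul_comm]

lemma memLp_conj {a : Space d → ℂ} {p : ℝ≥0∞} (ha : MemLp a p volume) :
    MemLp (fun x => (starRingEnd ℂ) (a x)) p volume :=
  ha.of_le (Complex.continuous_conj.comp_aestronglyMeasurable ha.1)
    (Filter.Eventually.of_forall fun x => by simp)

/-- The multiplication formula for the Fourier transform on `L²`. -/
lemma integral_mul_fourier_eq {a A b B : Space d → ℂ} (ha : MemLp a 2 volume)
    (hb : MemLp b 2 volume) (hA : IsFT a A) (hB : IsFT b B) :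
    ∫ x, a x * B x = ∫ x, A x * b x := by
  have hA2 := (hA.memLp_two ha).1
  have key : ∀ b : Lp (α := Space d) ℂ 2 volume,
      ∫ x, a x * (𝓕 b : Lp (α := Space d) ℂ 2 volume) x = ∫ x, A x * b x := by
    intro b
    have hdense : DenseRange (SchwartzMap.toLpCLM ℝ (E := Space d) ℂ 2 volume) :=
      SchwartzMap.denseRange_toLpCLM (by norm_num)
    -- Both sides are continuous in b for the L² norm, and for Schwartz b the identity is the
    -- defining property of A.
    refine hdense.induction_on (p := fun b : Lp (α := Space d) ℂ 2 volume =>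
      ∫ x, a x * (𝓕 b : Lp (α := Space d) ℂ 2 volume) x = ∫ x, A x * b x) b ?_ ?_
    · simp_rw [integral_mul_eq_inner_conj (memLp_conj ha), integral_mul_eq_inner_conj (memLp_conj hA2)]
      refine isClosed_eq ?_ (by fun_prop)
      exact continuous_const.inner (Lp.fourierTransformₗᵢ (Space d) ℂ).continuous
    · intro φ
      have e1 : ((𝓕 (SchwartzMap.toLpCLM ℝ (E := Space d) ℂ 2 volume φ) :
          Lp (α := Space d) ℂ 2 volume) : Space d → ℂ) =ᵐ[volume] (𝓕 φ : 𝓢(Space d, ℂ)) := by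
        have : 𝓕 (SchwartzMap.toLpCLM ℝ (E := Space d) ℂ 2 volume φ) =
          (𝓕 φ : 𝓢(Space d, ℂ)).toLp 2 volume := SchwartzMap.toLp_fourier_eq φ
        rw [this]
        exact SchwartzMap.coeFn_toLp _ _ _
      have e2 : (SchwartzMap.toLpCLM ℝ (E := Space d) ℂ 2 volume φ : Space d → ℂ) =ᵐ[volume] φ :=
        SchwartzMap.coeFn_toLp _ _ _
      rw [integral_congr_ae (g := fun x => a x * (𝓕 φ : 𝓢(Space d, ℂ)) x),
        integral_congr_ae (f := fun x => A x * _) (g := fun x => A x * φ x)]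
      · exact (hA φ).2.2.symm
      · filter_upwards [e2] with x hx; rw [hx]
      · filter_upwards [e1] with x hx; rw [hx]
  have h := key (hb.toLp b)
  have hB' : IsFT b (𝓕 (hb.toLp b) : Lp (α := Space d) ℂ 2 volume) :=
    (isFT_coe_fourier_Lp (hb.toLp b)).congr hb.coeFn_toLp Filter.EventuallyEq.rfl
  have eB := hB.ae_eq_right hB'
  calc ∫ x, a x * B x = ∫ x, a x * (𝓕 (hb.toLp b) : Lp (α := Space d) ℂ 2 volume) x := by
        refine integral_congr_ae ?_
        filter_upwards [eB] with x hx; rw [hx]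
    _ = ∫ x, A x * hb.toLp b x := h
    _ = _ := by
        refine integral_congr_ae ?_
        filter_upwards [hb.coeFn_toLp] with x hx; rw [hx]

/-- A function that is bounded as a functional on Schwartz functions with the `L¹` norm is
essentially bounded. -/
lemma ae_norm_le_of_schwartz {g : Space d → ℂ} {M : ℝ}
    (hi : ∀ φ : 𝓢(Space d, ℂ), Integrable fun ξ => g ξ * φ ξ)
    (hM : ∀ φ : 𝓢(Space d, ℂ), ‖∫ ξ, g ξ * φ ξ‖ ≤ M * ∫ ξ, ‖φ ξ‖) : ∀ᵐ x, ‖g x‖ ≤ M := by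
  have hl := locallyIntegrable_of_schwartz hi
  -- Bumps shrinking to a point, with outer radius twice the inner one. The fixed ratio gives
  -- convergence of the averages of g at almost every point, and each average is the functional
  -- tested on a Schwartz function of L¹ norm one.
  let b : ℕ → ContDiffBump (0 : Space d) := fun n =>
    ⟨1 / (n + 1), 2 / (n + 1), by positivity, by gcongr; norm_num⟩
  have hb : Filter.Tendsto (fun n => (b n).rOut) Filter.atTop (nhds 0) :=
    tendsto_const_div_atTop_nhds_zero_nat (2:ℝ) |>.comp (Filter.tendsto_add_atTop_nat 1) |>.congr
      (fun n => by simp [b])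
  have hb2 : ∀ᶠ n in Filter.atTop, (b n).rOut ≤ 2 * (b n).rIn :=
    Filter.Eventually.of_forall fun n => by simp only [b]; apply le_of_eq; ring
  filter_upwards [ContDiffBump.ae_convolution_tendsto_right_of_locallyIntegrable hb hb2 hl] with x hx
  refine le_of_tendsto hx.norm (Filter.Eventually.of_forall fun n => ?_)
  rw [convolution_eq_swap]
  have hφc : HasCompactSupport fun y => (((b n).normed volume (x - y) : ℝ) : ℂ) := by
    have h1 : HasCompactSupport ((b n).normed volume) := (b n).hasCompactSupport_normed
    have h2 := h1.comp_homeomorph (Homeomorph.subLeft x)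
    exact h2.comp_left (g := Complex.ofReal) (by simp)
  have hφs : ContDiff ℝ ((⊤ : ℕ∞) : WithTop ℕ∞) fun y => (((b n).normed volume (x - y) : ℝ) : ℂ) :=
    Complex.ofRealCLM.contDiff.comp ((b n).contDiff_normed.comp (contDiff_const.sub contDiff_id))
  have := hM (hφc.toSchwartzMap hφs)
  have e1 : ∫ ξ, ‖hφc.toSchwartzMap hφs ξ‖ = 1 := by
    calc ∫ ξ, ‖hφc.toSchwartzMap hφs ξ‖ = ∫ ξ, (b n).normed volume (x - ξ) := by
          refine integral_congr_ae (Filter.Eventually.of_forall fun ξ => ?_)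
          change ‖(((b n).normed volume (x - ξ) : ℝ) : ℂ)‖ = _
          rw [Complex.norm_real, Real.norm_of_nonneg ((b n).nonneg_normed _)]
      _ = 1 := by
          rw [integral_sub_left_eq_self (fun y => (b n).normed volume y) volume x]
          exact (b n).integral_normed
  rw [e1, mul_one] at this
  refine le_trans (le_of_eq ?_) this
  congr 2
  ext ξ
  change (b n).normed volume (x - ξ) • g ξ = g ξ * (((b n).normed volume (x - ξ) : ℝ) : ℂ)
  rw [Complex.real_smul, mul_comm]

lemma exists_ae_norm_le_of_memLp_top {m : Space d → ℂ} (hm : MemLp m ∞ volume) :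
    ∃ c : ℝ, 0 ≤ c ∧ ∀ᵐ x, ‖m x‖ ≤ c := by
  refine ⟨(eLpNorm m ∞ volume).toReal, ENNReal.toReal_nonneg, ?_⟩
  have := ae_le_eLpNormEssSup (f := m) (μ := volume)
  rw [← eLpNorm_exponent_top] at this
  filter_upwards [this] with x hx
  rw [← toReal_enorm]
  exact ENNReal.toReal_mono hm.2.ne hx

lemma integrable_mul_schwartz_of_memLp_top {m : Space d → ℂ} (hm : MemLp m ∞ volume)
    (φ : 𝓢(Space d, ℂ)) : Integrable fun x => m x * φ x := by
  obtain ⟨c, _, hc⟩ := exists_ae_norm_le_of_memLp_top hm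
  exact φ.integrable.bdd_mul hm.1 hc

/-- Reflection of Schwartz functions. -/
lemma fourierInv_eq_fourier_reflect (φ : 𝓢(Space d, ℂ)) :
    (𝓕⁻ φ : 𝓢(Space d, ℂ)) = 𝓕 (schwartzDilation (-1) (by norm_num) φ) := by
  ext x
  rw [SchwartzMap.fourierInv_coe, SchwartzMap.fourier_coe, Real.fourierInv_eq', Real.fourier_eq',
    ← integral_neg_eq_self]
  congr 1
  ext y
  simp

/-- The Riesz representation theorem for functionals on Schwartz functions that are bounded for
the `L²` norm. -/
lemma exists_memLp_two_representing (L : 𝓢(Space d, ℂ) →ₗ[ℂ] ℂ) {c : ℝ}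
    (hL : ∀ h : 𝓢(Space d, ℂ), ‖L h‖ ≤ c * (eLpNorm h 2 volume).toReal) :
    ∃ G : Space d → ℂ, MemLp G 2 volume ∧ ∀ h : 𝓢(Space d, ℂ), ∫ x, G x * h x = L h := by
  let e : 𝓢(Space d, ℂ) →ₗ[ℂ] Lp (α := Space d) ℂ 2 volume :=
    (SchwartzMap.toLpCLM ℂ (E := Space d) ℂ 2 volume).toLinearMap
  have hdense : DenseRange e := SchwartzMap.denseRange_toLpCLM (by norm_num)
  have hcoe : ∀ h : 𝓢(Space d, ℂ), (e h : Space d → ℂ) =ᵐ[volume] h := fun h =>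
    SchwartzMap.coeFn_toLp _ _ _
  have hbound : ∃ c, ∀ h, ‖L h‖ ≤ c * ‖e h‖ := by
    refine ⟨c, fun h => ?_⟩
    rw [Lp.norm_def, eLpNorm_congr_ae (hcoe h)]
    exact hL h
  have hΛ : ∀ h, L.extendOfNorm e (e h) = L h := LinearMap.extendOfNorm_eq hdense hbound
  obtain ⟨G, hG⟩ : ∃ G : Lp (α := Space d) ℂ 2 volume, ∀ f, inner ℂ G f = L.extendOfNorm e f :=
    ⟨(InnerProductSpace.toDual ℂ _).symm (L.extendOfNorm e), fun f =>
      InnerProductSpace.toDual_symm_apply⟩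
  refine ⟨fun x => (starRingEnd ℂ) (G x), memLp_conj (Lp.memLp G), fun h => ?_⟩
  rw [← hΛ, ← hG, L2.inner_def]
  refine integral_congr_ae ?_
  filter_upwards [hcoe h] with x hx
  rw [hx, RCLike.inner_apply, mul_comm]

/-- A bounded function whose Fourier transform is bounded as a functional for the `L¹` norm has an
inverse Fourier transform that is a function. -/
lemma exists_isFT_of_bound {m : Space d → ℂ} (hm : MemLp m ∞ volume) {M : ℝ} (hM0 : 0 ≤ M)
    (hM : ∀ φ : 𝓢(Space d, ℂ), ‖∫ ξ, m ξ * (𝓕 φ : 𝓢(Space d, ℂ)) ξ‖ ≤ M * ∫ x, ‖φ x‖) :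
    ∃ k, IsFT k m := by
  have hMinv : ∀ φ : 𝓢(Space d, ℂ), ‖∫ ξ, m ξ * (𝓕⁻ φ : 𝓢(Space d, ℂ)) ξ‖ ≤ M * ∫ x, ‖φ x‖ := by
    intro φ
    rw [fourierInv_eq_fourier_reflect]
    refine (hM _).trans_eq ?_
    congr 1
    simp only [schwartzDilation_apply, neg_smul, one_smul]
    exact integral_neg_eq_self (fun x => ‖φ x‖) volume
  -- The functional is bounded in L¹, but it is represented through the Hilbert space L².
  -- Multiplication by a weight w in L² maps L² to L¹ by Cauchy–Schwarz, and the representing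
  -- function is divided by w afterwards. With this s the square of w decays like |x|^{-2(d+1)} and
  -- is integrable.
  set s : ℝ := (d + 1 : ℝ) / 2 with hs
  set w : Space d → ℝ := fun x => (1 + ‖x‖ ^ 2) ^ (-s) with hw
  set v : Space d → ℝ := fun x => (1 + ‖x‖ ^ 2) ^ s with hv
  have hpos : ∀ x : Space d, 0 < 1 + ‖x‖ ^ 2 := fun x => by positivity
  have hw0 : ∀ x, 0 < w x := fun x => Real.rpow_pos_of_pos (hpos x) _
  have hwv : ∀ x, w x * v x = 1 := fun x => by
    simp only [hw, hv]; rw [← Real.rpow_add (hpos x)]; simp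
  have hwT : Function.HasTemperateGrowth w := Function.hasTemperateGrowth_one_add_norm_sq_rpow _ _
  have hvT : Function.HasTemperateGrowth v := Function.hasTemperateGrowth_one_add_norm_sq_rpow _ _
  have hwc : Function.HasTemperateGrowth fun x => (w x : ℂ) :=
    Complex.ofRealCLM.hasTemperateGrowth.comp hwT
  have hvc : Function.HasTemperateGrowth fun x => (v x : ℂ) :=
    Complex.ofRealCLM.hasTemperateGrowth.comp hvT
  have hw2 : MemLp w 2 volume := by
    rw [memLp_two_iff_integrable_sq hwT.1.continuous.aestronglyMeasurable]
    have := integrable_rpow_neg_one_add_norm_sq (E := Space d) (μ := volume) (r := 2 * (d + 1))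
      (by rw [finrank_space]; linarith [(Nat.cast_nonneg d : (0:ℝ) ≤ d)])
    refine this.congr (Filter.Eventually.of_forall fun x => ?_)
    simp only [hw]
    rw [sq (_ ^ (-s)), ← Real.rpow_add (hpos x)]
    congr 1; rw [hs]; ring
  -- the functional on Schwartz functions
  let L : 𝓢(Space d, ℂ) →ₗ[ℂ] ℂ :=
    { toFun := fun h => ∫ ξ, m ξ * (𝓕⁻ (SchwartzMap.smulLeftCLM ℂ (fun x => (w x : ℂ)) h) : 𝓢(Space d, ℂ)) ξ
      map_add' := by
        intro h₁ h₂
        rw [map_add, FourierTransform.fourierInv_add, ← integral_add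
          (integrable_mul_schwartz_of_memLp_top hm _) (integrable_mul_schwartz_of_memLp_top hm _)]
        congr 1; ext x; simp [mul_add]
      map_smul' := by
        intro c h
        rw [map_smul, FourierTransform.fourierInv_smul, RingHom.id_apply, smul_eq_mul,
          ← integral_const_mul]
        congr 1; ext x; simp; ring }
  obtain ⟨G, hGm, hG⟩ := exists_memLp_two_representing (c := M * (eLpNorm w 2 volume).toReal) L
    fun h => by
    refine (hMinv _).trans ?_
    rw [mul_assoc]
    refine mul_le_mul_of_nonneg_left ?_ hM0
    have e1 : ∀ x, ‖SchwartzMap.smulLeftCLM ℂ (fun x => (w x : ℂ)) h x‖ = ‖w x‖ * ‖h x‖ := by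
      intro x
      rw [SchwartzMap.smulLeftCLM_apply_apply hwc, norm_smul, Complex.norm_real]
    simp_rw [e1]
    have := integral_mul_le_Lp_mul_Lq_of_nonneg (μ := (volume : Measure (Space d))) (p := 2) (q := 2)
      (f := fun x => ‖w x‖) (g := fun x => ‖h x‖) (by exact Real.HolderConjugate.two_two)
      (Filter.Eventually.of_forall fun x => norm_nonneg _)
      (Filter.Eventually.of_forall fun x => norm_nonneg _) (by simpa using hw2.norm)
      (by simpa using (h.memLp 2 volume).norm)
    refine this.trans_eq ?_
    congr 1
    · rw [hw2.eLpNorm_eq_integral_rpow_norm (by norm_num) (by norm_num),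
        ENNReal.toReal_ofReal (by positivity)]
      norm_num
    · rw [(h.memLp 2 volume).eLpNorm_eq_integral_rpow_norm (by norm_num) (by norm_num),
        ENNReal.toReal_ofReal (by positivity)]
      norm_num
  refine ⟨fun x => G x * v x, fun φ => ?_⟩
  have e2 : ∀ x, G x * v x * (𝓕 φ : 𝓢(Space d, ℂ)) x = G x *
      SchwartzMap.smulLeftCLM ℂ (fun x => (v x : ℂ)) (𝓕 φ : 𝓢(Space d, ℂ)) x := by
    intro x
    rw [SchwartzMap.smulLeftCLM_apply_apply hvc, smul_eq_mul]; ring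
  refine ⟨integrable_mul_schwartz_of_memLp_top hm φ, ?_, ?_⟩
  · simp_rw [e2]
    exact hGm.integrable_mul (SchwartzMap.memLp _ 2 volume)
  · simp_rw [e2]
    rw [hG]
    change _ = ∫ ξ, m ξ * (𝓕⁻ (SchwartzMap.smulLeftCLM ℂ (fun x => (w x : ℂ)) _) : 𝓢(Space d, ℂ)) ξ
    have : SchwartzMap.smulLeftCLM ℂ (fun x => (w x : ℂ))
        (SchwartzMap.smulLeftCLM ℂ (fun x => (v x : ℂ)) (𝓕 φ : 𝓢(Space d, ℂ))) = 𝓕 φ := by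
      ext x
      rw [SchwartzMap.smulLeftCLM_apply_apply hwc, SchwartzMap.smulLeftCLM_apply_apply hvc,
        smul_smul, ← Complex.ofReal_mul, hwv]
      simp
    rw [this, FourierTransform.fourierInv_fourier_eq]

/-- A bounded multiplier with operator norm at most `C` on Schwartz functions is bounded by `C`. -/
lemma ae_norm_le_of_multiplier {m : Space d → ℂ} (hm : MemLp m ∞ volume) {C : ℝ} (hC : 0 ≤ C)
    (h : ∀ φ : 𝓢(Space d, ℂ), eLpNorm (fun x => m x * φ x) 2 volume ≤
      ENNReal.ofReal C * eLpNorm φ 2 volume) : ∀ᵐ x, ‖m x‖ ≤ C := by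
  -- The a priori bound c only controls the error made when an L² function is replaced by a Schwartz
  -- function; it disappears together with ε.
  obtain ⟨c, hc0, hc⟩ := exists_ae_norm_le_of_memLp_top hm
  have hmul : ∀ f : Space d → ℂ, eLpNorm (fun x => m x * f x) 2 volume ≤
      ENNReal.ofReal c * eLpNorm f 2 volume := by
    intro f
    refine eLpNorm_le_mul_eLpNorm_of_ae_le_mul ?_ 2
    filter_upwards [hc] with x hx
    rw [norm_mul]; gcongr
  -- extend to all of `L²`
  have hall : ∀ f : Space d → ℂ, MemLp f 2 volume → eLpNorm (fun x => m x * f x) 2 volume ≤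
      ENNReal.ofReal C * eLpNorm f 2 volume := by
    intro f hf
    refine ENNReal.le_of_forall_pos_le_add fun ε hε _ => ?_
    have hK : 0 < c + C + 1 := by linarith
    have hdense : DenseRange (SchwartzMap.toLpCLM ℝ (E := Space d) ℂ 2 volume) :=
      SchwartzMap.denseRange_toLpCLM (by norm_num)
    obtain ⟨φ, hφ⟩ := hdense.exists_dist_lt (hf.toLp f) (show (0:ℝ) < ε / (c + C + 1) by positivity)
    have hcoe : (SchwartzMap.toLpCLM ℝ (E := Space d) ℂ 2 volume φ : Space d → ℂ) =ᵐ[volume] φ :=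
      SchwartzMap.coeFn_toLp _ _ _
    have hdiff : eLpNorm (fun x => f x - φ x) 2 volume ≤ ENNReal.ofReal (ε / (c + C + 1)) := by
      rw [dist_eq_norm, Lp.norm_def] at hφ
      have e : eLpNorm (fun x => f x - φ x) 2 volume =
          eLpNorm (hf.toLp f - SchwartzMap.toLpCLM ℝ (E := Space d) ℂ 2 volume φ :
            Lp (α := Space d) ℂ 2 volume) 2 volume := by
        refine eLpNorm_congr_ae ?_
        filter_upwards [hcoe, hf.coeFn_toLp, Lp.coeFn_sub (hf.toLp f)
          (SchwartzMap.toLpCLM ℝ (E := Space d) ℂ 2 volume φ)] with x h1 h2 h3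
        rw [h3, Pi.sub_apply, h1, h2]
      rw [e, ← ENNReal.ofReal_toReal (Lp.memLp _).2.ne]
      exact ENNReal.ofReal_le_ofReal hφ.le
    have hfm := hf.1
    have hφm : AEStronglyMeasurable φ volume := φ.continuous.aestronglyMeasurable
    calc eLpNorm (fun x => m x * f x) 2 volume
        = eLpNorm ((fun x => m x * (f x - φ x)) + fun x => m x * φ x) 2 volume := by
          congr 1; ext x; simp [mul_sub]
      _ ≤ eLpNorm (fun x => m x * (f x - φ x)) 2 volume + eLpNorm (fun x => m x * φ x) 2 volume :=
          eLpNorm_add_le (hm.1.mul (hfm.sub hφm)) (hm.1.mul hφm) (by norm_num)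
      _ ≤ ENNReal.ofReal c * eLpNorm (fun x => f x - φ x) 2 volume +
            ENNReal.ofReal C * (eLpNorm f 2 volume + eLpNorm (fun x => f x - φ x) 2 volume) := by
          refine add_le_add (hmul _) ((h φ).trans ?_)
          gcongr
          calc eLpNorm φ 2 volume = eLpNorm (f - fun x => f x - φ x) 2 volume := by
                congr 1; ext x; simp
            _ ≤ _ := eLpNorm_sub_le hfm (hfm.sub hφm) (by norm_num)
      _ ≤ ENNReal.ofReal C * eLpNorm f 2 volume + (ENNReal.ofReal c + ENNReal.ofReal C) *
            ENNReal.ofReal (ε / (c + C + 1)) := by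
          rw [mul_add, add_mul]
          calc _ = ENNReal.ofReal C * eLpNorm f 2 volume +
              (ENNReal.ofReal c * eLpNorm (fun x => f x - φ x) 2 volume +
              ENNReal.ofReal C * eLpNorm (fun x => f x - φ x) 2 volume) := by ring
            _ ≤ _ := by gcongr
      _ ≤ _ := by
          gcongr
          rw [← ENNReal.ofReal_add hc0 hC, ← ENNReal.ofReal_mul (by positivity)]
          rw [← ENNReal.ofReal_coe_nnreal]
          apply ENNReal.ofReal_le_ofReal
          rw [mul_div_assoc', div_le_iff₀ hK]
          nlinarith [NNReal.coe_nonneg ε]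
  -- test on indicator functions
  obtain ⟨m', hm'm, hm'⟩ := hm.1
  suffices ∀ᵐ x, ‖m' x‖ ≤ C by
    filter_upwards [this, hm'] with x hx h2; rwa [h2]
  -- One index serves both as excess over C and as radius. The ball makes the indicator square
  -- integrable, and the union over n is the whole set where |m'| exceeds C.
  have hle : ∀ n : ℕ, volume ({x | C + 1 / (n + 1) < ‖m' x‖} ∩ Metric.ball 0 n) = 0 := by
    intro n
    set A := {x | C + 1 / (n + 1) < ‖m' x‖} ∩ Metric.ball (0 : Space d) n with hA
    have hAm : MeasurableSet A :=
      (measurableSet_lt measurable_const hm'm.norm.measurable).inter measurableSet_ball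
    have hAfin : volume A ≠ ∞ :=
      ((measure_mono inter_subset_right).trans_lt measure_ball_lt_top).ne
    by_contra hA0
    have h1 := hall (A.indicator fun _ => 1) (memLp_indicator_const 2 hAm 1 (Or.inr hAfin))
    have h2 : ENNReal.ofReal (C + 1 / (n + 1)) * eLpNorm (A.indicator fun _ => (1:ℂ)) 2 volume ≤
        eLpNorm (fun x => m x * A.indicator (fun _ => 1) x) 2 volume := by
      have : ENNReal.ofReal (C + 1 / (n + 1)) = ‖((C + 1 / (n + 1) : ℝ) : ℂ)‖ₑ := by
        rw [← ofReal_norm, Complex.norm_real, Real.norm_of_nonneg (by positivity)]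
      rw [this, ← eLpNorm_const_smul]
      refine eLpNorm_mono_ae ?_
      filter_upwards [hm'] with x hx
      by_cases hxA : x ∈ A
      · simp only [Pi.smul_apply, hxA, indicator_of_mem, smul_eq_mul, mul_one, hx]
        rw [Complex.norm_real, Real.norm_of_nonneg (by positivity)]
        exact hxA.1.le
      · simp [hxA]
    have h3 := h2.trans h1
    rw [ENNReal.mul_le_mul_iff_left] at h3
    · have := (ENNReal.ofReal_le_ofReal_iff hC).1 h3
      have : (0:ℝ) < 1 / (n + 1) := by positivity
      linarith
    · rw [eLpNorm_indicator_const hAm (by norm_num) (by norm_num)]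
      simp [hA0, hAfin]
    · exact (memLp_indicator_const 2 hAm 1 (Or.inr hAfin)).2.ne
  rw [ae_iff]
  refine measure_mono_null ?_ (measure_iUnion_null hle)
  intro x hx
  have hx' : C < ‖m' x‖ := not_le.1 hx
  obtain ⟨n₁, hn₁⟩ := exists_nat_one_div_lt (sub_pos.2 hx')
  obtain ⟨n₂, hn₂⟩ := exists_nat_gt ‖x‖
  refine mem_iUnion.2 ⟨max n₁ n₂, ?_, ?_⟩
  · have : (1:ℝ) / ((max n₁ n₂ : ℕ) + 1) ≤ 1 / (n₁ + 1) := by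
      gcongr; exact le_max_left _ _
    change C + 1 / (((max n₁ n₂ : ℕ) : ℝ) + 1) < ‖m' x‖
    linarith
  · rw [mem_ball_zero_iff]
    refine hn₂.trans_le ?_
    exact_mod_cast le_max_right _ _

end Strichartz

/-! ### Plane waves, and kernel bounds inherited from the dispersive hypothesis. -/

namespace Strichartz

open scoped FourierTransform

variable {d : ℕ}

/-- The plane wave `e^{i(2π x·η + t lam(η))}`. -/
def phase (lam : Space d → ℝ) (t : ℝ) (x η : Space d) : ℂ :=
  Complex.exp (Complex.I * ((2 * Real.pi * inner ℝ x η + t * lam η : ℝ) : ℂ))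

/-- The superposition `∫ e^{i(2π x·η + t lam(η))} w(η) dη` of plane waves. -/
def kern (lam : Space d → ℝ) (w : Space d → ℂ) (t : ℝ) (x : Space d) : ℂ :=
  ∫ η, phase lam t x η * w η

@[simp] lemma norm_phase (lam : Space d → ℝ) (t : ℝ) (x η : Space d) : ‖phase lam t x η‖ = 1 := by
  rw [phase, mul_comm, Complex.norm_exp_ofReal_mul_I]

lemma conj_phase (lam : Space d → ℝ) (t : ℝ) (x η : Space d) :
    (starRingEnd ℂ) (phase lam t x η) = phase lam (-t) (-x) η := by
  rw [phase, phase, ← Complex.exp_conj]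
  congr 1
  rw [map_mul, Complex.conj_I, Complex.conj_ofReal, inner_neg_left]
  push_cast
  ring

/-- The group law of the propagators; because of it the composition T T* is a convolution in
space-time. -/
lemma phase_sub (lam : Space d → ℝ) (t s : ℝ) (x y η : Space d) :
    phase lam (t - s) (x - y) η = phase lam t x η * (starRingEnd ℂ) (phase lam s y η) := by
  rw [conj_phase, phase, phase, phase, ← Complex.exp_add, ← mul_add, ← Complex.ofReal_add]
  congr 3
  rw [inner_sub_left, inner_neg_left]
  ring

lemma phase_zero_right (lam : Space d → ℝ) (η : Space d) : phase lam 0 0 η = 1 := by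
  simp [phase]

lemma measurable_phase {lam : Space d → ℝ} (hlam : Measurable lam) :
    Measurable fun p : (ℝ × Space d) × Space d => phase lam p.1.1 p.1.2 p.2 := by
  unfold phase
  have h1 : Measurable fun p : (ℝ × Space d) × Space d => (inner ℝ p.1.2 p.2 : ℝ) :=
    Continuous.measurable (by fun_prop)
  refine Complex.measurable_exp.comp (measurable_const.mul (Complex.measurable_ofReal.comp ?_))
  exact (measurable_const.mul h1).add (measurable_fst.fst.mul (hlam.comp measurable_snd))

lemma measurable_phase_apply {lam : Space d → ℝ} (hlam : Measurable lam) (t : ℝ) (x : Space d) :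
    Measurable fun η => phase lam t x η := by
  have h : Measurable fun η : Space d => (((t, x), η) : (ℝ × Space d) × Space d) := by fun_prop
  have h' := (measurable_phase hlam).comp h
  simp only [Function.comp_def] at h'
  exact h'

lemma integrable_phase_mul {lam : Space d → ℝ} (hlam : Measurable lam) {w : Space d → ℂ}
    (hw : Integrable w) (t : ℝ) (x : Space d) : Integrable fun η => phase lam t x η * w η :=
  hw.bdd_mul (measurable_phase_apply hlam t x).aestronglyMeasurable
    (Filter.Eventually.of_forall fun η => (norm_phase lam t x η).le)

lemma norm_kern_le (lam : Space d → ℝ) (w : Space d → ℂ) (t : ℝ) (x : Space d) :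
    ‖kern lam w t x‖ ≤ ∫ η, ‖w η‖ := by
  refine (norm_integral_le_integral_norm _).trans_eq ?_
  simp

lemma continuous_kern {lam : Space d → ℝ} (hlam : Measurable lam) {w : Space d → ℂ}
    (hw : Integrable w) : Continuous fun p : ℝ × Space d => kern lam w p.1 p.2 := by
  refine continuous_of_dominated (bound := fun η => ‖w η‖)
    (fun p => (integrable_phase_mul hlam hw p.1 p.2).1) (fun p => ?_) hw.norm ?_
  · exact Filter.Eventually.of_forall fun η => by simp
  · refine Filter.Eventually.of_forall fun η => ?_
    unfold phase
    fun_prop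

lemma continuous_kern_apply {lam : Space d → ℝ} (hlam : Measurable lam) {w : Space d → ℂ}
    (hw : Integrable w) (t : ℝ) : Continuous fun x => kern lam w t x := by
  have h : Continuous fun x : Space d => (t, x) := by fun_prop
  have h' := (continuous_kern hlam hw).comp h
  simp only [Function.comp_def] at h'
  exact h'

lemma kern_congr (lam : Space d → ℝ) {w w' : Space d → ℂ} (h : w =ᵐ[volume] w') (t : ℝ)
    (x : Space d) : kern lam w t x = kern lam w' t x := by
  refine integral_congr_ae ?_
  filter_upwards [h] with η hη
  rw [hη]

lemma kern_zero_time (lam : Space d → ℝ) (w : Space d → ℂ) (x : Space d) :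
    kern lam w 0 x = 𝓕 w (-x) := by
  rw [kern, Real.fourier_eq']
  congr 1
  ext η
  rw [smul_eq_mul, phase]
  congr 2
  rw [inner_neg_right, real_inner_comm]
  push_cast; ring

lemma quasiMeasurePreserving_two_pi :
    Measure.QuasiMeasurePreserving (fun x : Space d => (2 * Real.pi) • x) volume volume := by
  refine ⟨measurable_const_smul _, ?_⟩
  rw [Measure.map_addHaar_smul volume two_pi_ne_zero]
  exact Measure.smul_absolutelyContinuous

lemma ae_comp_two_pi {p : Space d → Prop} (h : ∀ᵐ x, p x) : ∀ᵐ x, p ((2 * Real.pi) • x) :=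
  quasiMeasurePreserving_two_pi.ae h

/-- The substitution ξ = 2πη absorbs the factor (2π)^{-d}. Since f has some transform, `fourier f`
satisfies its specification and agrees almost everywhere with the rescaled g. The integral does not
see null sets, so `lam` and `m` may also be replaced by other representatives. -/
lemma propagator_eq_kern {lam lam₀ : Space d → ℝ} {m m₀ f g : Space d → ℂ} (hfg : IsFT f g)
    (hlam : lam₀ =ᵐ[volume] fun η => lam ((2 * Real.pi) • η))
    (hm : m₀ =ᵐ[volume] fun η => m ((2 * Real.pi) • η)) (t : ℝ) (x : Space d) :
    propagator lam m t f x = kern lam₀ (fun η => m₀ η * g η) t x := by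
  have hspec : IsFT f fun η => fourier f ((2 * Real.pi) • η) := by
    refine isFourierTransform_iff.1 (Classical.epsilon_spec (p := fun g => IsFourierTransform f g)
      ⟨fun ξ => g ((2 * Real.pi)⁻¹ • ξ), isFourierTransform_iff.2 ?_⟩)
    simpa only [smul_smul, inv_mul_cancel₀ two_pi_ne_zero, one_smul] using hfg
  have hae := hspec.ae_eq_right hfg
  have key := integral_comp_two_pi_inv (fun η => phase (fun η => lam ((2 * Real.pi) • η)) t x η *
    (m ((2 * Real.pi) • η) * fourier f ((2 * Real.pi) • η)))
  simp only [smul_smul, mul_inv_cancel₀ two_pi_ne_zero, one_smul] at key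
  have e : ∀ ξ, phase (fun η => lam ((2 * Real.pi) • η)) t x ((2 * Real.pi)⁻¹ • ξ) =
      Complex.exp (Complex.I * ((inner ℝ x ξ + t * lam ξ : ℝ) : ℂ)) := by
    intro ξ
    rw [phase, smul_smul, mul_inv_cancel₀ two_pi_ne_zero, one_smul, real_inner_smul_right,
      mul_inv_cancel_left₀ two_pi_ne_zero]
  simp_rw [e, ← mul_assoc] at key
  rw [propagator, key, ← mul_assoc, ← Complex.ofReal_mul, inv_mul_cancel₀ (by positivity),
    Complex.ofReal_one, one_mul, kern]
  refine integral_congr_ae ?_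
  filter_upwards [hae, hlam, hm] with η h1 h2 h3
  rw [h1, h3, phase, phase, h2, mul_assoc]

/-- The dispersive and energy estimates for one propagator, in the normalization of `kern`. -/
structure MultiplierBounds (σ C μ₁ μ₂ : ℝ) (lam : Space d → ℝ) (m : Space d → ℂ) : Prop where
  measurable_lam : Measurable lam
  memLp_top : MemLp m ∞ volume
  decay : ∀ (t : ℝ) (x : Space d) (φ : 𝓢(Space d, ℂ)),
    ‖kern lam (fun η => m η * (𝓕 φ : 𝓢(Space d, ℂ)) η) t x‖ ≤
      C * μ₁ / (1 + μ₂ * |t|) ^ σ * ∫ x, ‖φ x‖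
  energy : ∀ φ : 𝓢(Space d, ℂ),
    eLpNorm (fun x => kern lam (fun η => m η * (𝓕 φ : 𝓢(Space d, ℂ)) η) 0 x) 2 volume ≤
      ENNReal.ofReal C * eLpNorm φ 2 volume

lemma isFT_schwartz (φ : 𝓢(Space d, ℂ)) : IsFT φ (𝓕 φ : 𝓢(Space d, ℂ)) := by
  have := isFT_of_integrable φ.integrable
  rwa [← SchwartzMap.fourier_coe] at this

/-- A set of full measure is dense, so a continuous function obeys an essential bound everywhere. In
this way the decay estimate becomes, for each fixed (t, x), a bound on a linear functional of φ. -/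
lemma norm_le_of_eLpNorm_top_le {u : Space d → ℂ} (hu : Continuous u) {M : ℝ} (hM : 0 ≤ M)
    (h : eLpNorm u ∞ volume ≤ ENNReal.ofReal M) (x : Space d) : ‖u x‖ ≤ M := by
  have h1 : ∀ᵐ x, ‖u x‖ ≤ M := by
    have := ae_le_eLpNormEssSup (f := u) (μ := volume)
    rw [← eLpNorm_exponent_top] at this
    filter_upwards [this] with x hx
    have := hx.trans h
    rwa [← ofReal_norm, ENNReal.ofReal_le_ofReal_iff hM] at this
  have h2 : Dense {x | ‖u x‖ ≤ M} := Measure.dense_of_ae h1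
  have h3 : IsClosed {x | ‖u x‖ ≤ M} := isClosed_le hu.norm continuous_const
  have := h3.closure_eq ▸ h2 x
  exact this

lemma eLpNorm_one_eq_ofReal_integral (φ : 𝓢(Space d, ℂ)) :
    eLpNorm φ 1 volume = ENNReal.ofReal (∫ x, ‖φ x‖) := by
  rw [eLpNorm_one_eq_lintegral_enorm, ofReal_integral_norm_eq_lintegral_enorm φ.integrable]

/-- Besides the change of normalization, `lam` is replaced by a measurable representative and the
essential supremum by a pointwise bound. Of the energy estimate only time zero is kept: the phases
have modulus one, so it already contains the bound on the multiplier. -/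
lemma exists_multiplierBounds {σ C μ₁ μ₂ : ℝ} (hC : 0 ≤ C) (hμ₁ : 0 < μ₁) (hμ₂ : 0 < μ₂)
    {lam : Space d → ℝ} {m : Space d → ℂ} (hlam : AEMeasurable lam volume)
    (hm : MemLp m ∞ volume)
    (hdecay : ∀ (t : ℝ) (f : 𝓢(Space d, ℂ)), eLpNorm (propagator lam m t f) ∞ volume ≤
      ENNReal.ofReal (C * μ₁ / (1 + μ₂ * |t|) ^ σ) * eLpNorm f 1 volume)
    (henergy : ∀ (t : ℝ) (f : 𝓢(Space d, ℂ)),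
      eLpNorm (propagator lam m t f) 2 volume ≤ ENNReal.ofReal C * eLpNorm f 2 volume) :
    ∃ lam₀, lam₀ =ᵐ[volume] (fun η => lam ((2 * Real.pi) • η)) ∧
      MultiplierBounds σ C μ₁ μ₂ lam₀ (fun η => m ((2 * Real.pi) • η)) := by
  have hq := quasiMeasurePreserving_two_pi (d := d)
  obtain ⟨lam₀, hlam₀, hae⟩ : AEMeasurable (fun η => lam ((2 * Real.pi) • η)) volume :=
    hlam.comp_quasiMeasurePreserving hq
  have hm' : MemLp (fun η => m ((2 * Real.pi) • η)) ∞ volume := by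
    obtain ⟨c, _, hc⟩ := exists_ae_norm_le_of_memLp_top hm
    exact memLp_top_of_bound (hm.1.comp_quasiMeasurePreserving hq) c (ae_comp_two_pi hc)
  have heq : ∀ t (φ : 𝓢(Space d, ℂ)), propagator lam m t φ =
      fun x => kern lam₀ (fun η => m ((2 * Real.pi) • η) * (𝓕 φ : 𝓢(Space d, ℂ)) η) t x := by
    intro t φ
    ext x
    exact propagator_eq_kern (isFT_schwartz φ) hae.symm Filter.EventuallyEq.rfl t x
  refine ⟨lam₀, hae.symm, hlam₀, hm', fun t x φ => ?_, fun φ => ?_⟩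
  · have hc : Continuous fun x => kern lam₀
        (fun η => m ((2 * Real.pi) • η) * (𝓕 φ : 𝓢(Space d, ℂ)) η) t x :=
      continuous_kern_apply hlam₀ (integrable_mul_schwartz_of_memLp_top hm' (𝓕 φ)) t
    have h0 : 0 ≤ C * μ₁ / (1 + μ₂ * |t|) ^ σ := by positivity
    refine norm_le_of_eLpNorm_top_le hc (by positivity) ?_ x
    rw [ENNReal.ofReal_mul h0, ← eLpNorm_one_eq_ofReal_integral, ← heq]
    exact hdecay t φ
  · rw [← heq]
    exact henergy 0 φ

/-- The operator estimates behind the Strichartz estimates: `D` bounds both the multiplier and the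
dispersion of the kernels attached to `m²` and `|m|²`. -/
structure KernelBounds (σ D μ₁ μ₂ : ℝ) (lam : Space d → ℝ) (m : Space d → ℂ) : Prop where
  measurable_lam : Measurable lam
  measurable_m : Measurable m
  memLp_two : MemLp m 2 volume
  nonneg : 0 ≤ D
  mu_one_pos : 0 < μ₁
  mu_two_pos : 0 < μ₂
  sq_le : ∀ η, ‖m η‖ ^ 2 ≤ D
  decay_sq : ∀ t x, ‖kern lam (fun η => m η * m η) t x‖ ≤ D * μ₁ / (1 + μ₂ * |t|) ^ σ
  decay_normSq : ∀ t x, ‖kern lam (fun η => m η * (starRingEnd ℂ) (m η)) t x‖ ≤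
    D * μ₁ / (1 + μ₂ * |t|) ^ σ

lemma integrable_of_eLpNorm_one_lt_top {k : Space d → ℂ} (hk : AEStronglyMeasurable k volume)
    (h : eLpNorm k 1 volume < ∞) : Integrable k := memLp_one_iff_integrable.1 ⟨hk, h⟩

lemma fourier_conj_reflect (k : Space d → ℂ) (η : Space d) :
    𝓕 (fun x => (starRingEnd ℂ) (k (-x))) η = (starRingEnd ℂ) (𝓕 k η) := by
  rw [Real.fourier_eq', Real.fourier_eq', ← integral_conj, ← integral_neg_eq_self]
  congr 1
  ext x
  rw [neg_neg, smul_eq_mul, smul_eq_mul, map_mul, ← Complex.exp_conj]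
  congr 2
  rw [map_mul, Complex.conj_I, Complex.conj_ofReal, inner_neg_left]
  push_cast; ring

namespace MultiplierBounds

variable {σ C μ₁ μ₂ : ℝ} {lam : Space d → ℝ} {m : Space d → ℂ}

/-- The decay estimate evaluated at t = 0 and x = 0, where the phase is 1. It supplies the
hypothesis under which m has an inverse transform that is a function. -/
lemma norm_integral_le (h : MultiplierBounds σ C μ₁ μ₂ lam m) (φ : 𝓢(Space d, ℂ)) :
    ‖∫ ξ, m ξ * (𝓕 φ : 𝓢(Space d, ℂ)) ξ‖ ≤ C * μ₁ * ∫ x, ‖φ x‖ := by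
  have := h.decay 0 0 φ
  simpa [kern, phase_zero_right] using this

lemma exists_isFT (h : MultiplierBounds σ C μ₁ μ₂ lam m) (hC : 0 ≤ C) (hμ₁ : 0 < μ₁) :
    ∃ k, IsFT k m :=
  exists_isFT_of_bound h.memLp_top (by positivity : 0 ≤ C * μ₁) h.norm_integral_le

/-- Duality between L¹ and L^∞ turns the bound at time zero into a sup bound for the kernel. An
integrable kernel is therefore also square integrable, which brings the L² theory into play. -/
lemma ae_norm_kernel_le (h : MultiplierBounds σ C μ₁ μ₂ lam m) {k : Space d → ℂ}
    (hk : IsFT k m) : ∀ᵐ x, ‖k x‖ ≤ C * μ₁ := by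
  have e : ∀ φ : 𝓢(Space d, ℂ), (𝓕 (𝓕⁻ φ : 𝓢(Space d, ℂ)) : 𝓢(Space d, ℂ)) = φ := fun φ =>
    FourierTransform.fourier_fourierInv_eq φ
  refine ae_norm_le_of_schwartz (fun φ => ?_) (fun φ => ?_)
  · have := (hk (𝓕⁻ φ)).2.1; rwa [e] at this
  · have := (hk (𝓕⁻ φ)).2.2
    rw [e] at this
    rw [← this, fourierInv_eq_fourier_reflect]
    refine (h.norm_integral_le _).trans_eq ?_
    congr 1
    simp only [schwartzDilation_apply, neg_smul, one_smul]
    exact integral_neg_eq_self (fun x => ‖φ x‖) volume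

lemma aestronglyMeasurable_of_isFT {k m : Space d → ℂ} (hk : IsFT k m) :
    AEStronglyMeasurable k volume := by
  refine (locallyIntegrable_of_schwartz fun φ => ?_).aestronglyMeasurable
  have := (hk (𝓕⁻ φ)).2.1
  rwa [FourierTransform.fourier_fourierInv_eq φ] at this

lemma memLp_two_kernel (h : MultiplierBounds σ C μ₁ μ₂ lam m) {k : Space d → ℂ}
    (hk : IsFT k m) (hk1 : Integrable k) : MemLp k 2 volume := by
  have := aestronglyMeasurable_of_isFT hk
  rw [memLp_two_iff_integrable_sq_norm hk1.1]
  simp_rw [sq]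
  exact hk1.norm.bdd_mul (c := C * μ₁) hk1.1.norm (by simpa using h.ae_norm_kernel_le hk)

/-- By Plancherel on both sides, the energy estimate at time zero says that multiplication by m has
L² operator norm at most C on Schwartz functions. -/
lemma ae_norm_le (h : MultiplierBounds σ C μ₁ μ₂ lam m) (hC : 0 ≤ C) : ∀ᵐ x, ‖m x‖ ≤ C := by
  refine ae_norm_le_of_multiplier h.memLp_top hC fun φ => ?_
  obtain ⟨c, _, hc⟩ := exists_ae_norm_le_of_memLp_top h.memLp_top
  have e : (𝓕 (𝓕⁻ φ : 𝓢(Space d, ℂ)) : 𝓢(Space d, ℂ)) = φ := FourierTransform.fourier_fourierInv_eq φ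
  have hE := h.energy (𝓕⁻ φ)
  have hP := ((isFT_schwartz (𝓕⁻ φ : 𝓢(Space d, ℂ))).memLp_two (SchwartzMap.memLp _ 2 volume)).2
  rw [e] at hE hP
  rw [← hP] at hE
  refine le_trans (le_of_eq ?_) hE
  have hi : Integrable fun x => m x * φ x := integrable_mul_schwartz_of_memLp_top h.memLp_top φ
  have h2 : MemLp (fun x => m x * φ x) 2 volume :=
    (φ.memLp 2 volume).of_le_mul (c := c) hi.1 (by
      filter_upwards [hc] with x hx
      rw [norm_mul]; gcongr)
  rw [← ((isFT_of_integrable hi).memLp_two h2).2]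
  simp_rw [kern_zero_time]
  have hmp : MeasurePreserving (fun x : Space d => -x) volume volume :=
    Measure.measurePreserving_neg volume
  exact (eLpNorm_comp_measurePreserving
    ((isFT_of_integrable hi).memLp_two h2).1.1 hmp).symm

/-- The multiplication formula moves the transform from χ to the phase times m and leaves a pairing
of k with a function A. The dispersive estimate bounds A tested against Schwartz functions in L¹,
hence bounds A in L^∞. An additional factor with integrable kernel thus costs only the L¹ norm of
that kernel. -/
lemma norm_kern_mul_le (h : MultiplierBounds σ C μ₁ μ₂ lam m) (hm2 : MemLp m 2 volume)
    {k χ : Space d → ℂ} (hk1 : Integrable k) (hk2 : MemLp k 2 volume) (hχ : IsFT k χ) (t : ℝ)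
    (x : Space d) : ‖kern lam (fun η => m η * χ η) t x‖ ≤
      C * μ₁ / (1 + μ₂ * |t|) ^ σ * ∫ x, ‖k x‖ := by
  set a : Space d → ℂ := fun η => phase lam t x η * m η with ha
  have ham : AEStronglyMeasurable a volume :=
    (measurable_phase_apply h.measurable_lam t x).aestronglyMeasurable.mul hm2.1
  have ha2 : MemLp a 2 volume := hm2.of_le ham (Filter.Eventually.of_forall fun η => by simp [ha])
  obtain ⟨A, hA, hA2, -⟩ := exists_isFT_of_memLp_two ha2
  have hAle : ∀ᵐ y, ‖A y‖ ≤ C * μ₁ / (1 + μ₂ * |t|) ^ σ := by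
    refine ae_norm_le_of_schwartz (fun φ => (hA φ).1) fun φ => ?_
    rw [(hA φ).2.2]
    refine le_trans (le_of_eq ?_) (h.decay t x φ)
    rw [kern]
    simp only [ha, mul_assoc]
  have e : kern lam (fun η => m η * χ η) t x = ∫ y, A y * k y := by
    rw [← integral_mul_fourier_eq ha2 hk2 hA hχ, kern]
    simp only [ha, mul_assoc]
  rw [e, ← integral_const_mul]
  refine (norm_integral_le_integral_norm _).trans ?_
  refine integral_mono_ae ?_ (hk1.norm.const_mul _) ?_
  · exact (hk1.bdd_mul hA2.1 hAle).norm
  · filter_upwards [hAle] with y hy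
    rw [norm_mul]; gcongr

/-- In m², in |m|², and in the bound for the modulus, one factor is spent on the dispersive or
energy estimate and the other contributes ‖k‖_{L¹}. The conjugate of m is the transform of the
conjugate reflection of k, whose L¹ norm is the same. -/
lemma exists_kernelBounds (h : MultiplierBounds σ C μ₁ μ₂ lam m) (hC : 0 ≤ C) (hμ₁ : 0 < μ₁)
    (hμ₂ : 0 < μ₂) {k : Space d → ℂ} (hk : IsFT k m) (hk1 : Integrable k) :
    ∃ m₀, m₀ =ᵐ[volume] m ∧ KernelBounds σ (C * ∫ x, ‖k x‖) μ₁ μ₂ lam m₀ := by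
  have hk2 := h.memLp_two_kernel hk hk1
  have hm2 := (hk.memLp_two hk2).1
  have hmF : m =ᵐ[volume] 𝓕 k := hk.ae_eq_right (isFT_of_integrable hk1)
  have hb : ∀ x, ‖𝓕 k x‖ ≤ ∫ v, ‖k v‖ := fun x =>
    VectorFourier.norm_fourierIntegral_le_integral_norm _ _ _ _ _
  have hsq : ∀ᵐ x, ‖m x‖ ^ 2 ≤ C * ∫ x, ‖k x‖ := by
    filter_upwards [h.ae_norm_le hC, hmF] with x h1 h2
    rw [sq]
    refine mul_le_mul h1 ?_ (norm_nonneg _) hC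
    rw [h2]; exact hb x
  have hD : 0 ≤ C * ∫ x, ‖k x‖ := mul_nonneg hC (integral_nonneg fun _ => norm_nonneg _)
  set m₁ := hm2.1.mk m with hm₁
  have hm₁m : Measurable m₁ := hm2.1.stronglyMeasurable_mk.measurable
  -- The representative is set to zero where the bound fails, so that it holds at every point and
  -- not only almost everywhere.
  set S : Set (Space d) := {x | ‖m₁ x‖ ^ 2 ≤ C * ∫ x, ‖k x‖} with hS
  have hSm : MeasurableSet S := measurableSet_le (hm₁m.norm.pow_const 2) measurable_const
  have hae : S.indicator m₁ =ᵐ[volume] m := by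
    filter_upwards [hsq, hm2.1.ae_eq_mk] with x h1 h2
    have hx : x ∈ S := by rw [hS, mem_ofPred_eq, hm₁, ← h2]; exact h1
    rw [indicator_of_mem hx, hm₁, ← h2]
  have hχ : IsFT (fun x => (starRingEnd ℂ) (k (-x))) fun η => (starRingEnd ℂ) (m η) := by
    refine (isFT_of_integrable ?_).congr Filter.EventuallyEq.rfl ?_
    · exact Complex.conjLIE.toContinuousLinearEquiv.toContinuousLinearMap.integrable_comp hk1.comp_neg
    · filter_upwards [hmF] with η hη
      rw [fourier_conj_reflect, hη]
  have hki : Integrable fun x => (starRingEnd ℂ) (k (-x)) :=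
    Complex.conjLIE.toContinuousLinearEquiv.toContinuousLinearMap.integrable_comp hk1.comp_neg
  have hk2' : MemLp (fun x => (starRingEnd ℂ) (k (-x))) 2 volume :=
    memLp_conj (hk2.comp_measurePreserving (Measure.measurePreserving_neg volume))
  refine ⟨S.indicator m₁, hae, h.measurable_lam, hm₁m.indicator hSm,
    (memLp_congr_ae hae).2 hm2, hD, hμ₁, hμ₂, fun η => ?_, fun t x => ?_, fun t x => ?_⟩
  · by_cases hη : η ∈ S
    · rw [indicator_of_mem hη]; exact hη
    · rw [indicator_of_notMem hη]; simpa using hD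
  · rw [kern_congr lam (w' := fun η => m η * m η)]
    · refine (h.norm_kern_mul_le hm2 hk1 hk2 hk t x).trans_eq (by ring)
    · filter_upwards [hae] with η hη; rw [hη]
  · rw [kern_congr lam (w' := fun η => m η * (starRingEnd ℂ) (m η))]
    · refine (h.norm_kern_mul_le hm2 hki hk2' hχ t x).trans_eq ?_
      have : ∫ x, ‖(starRingEnd ℂ) (k (-x))‖ = ∫ x, ‖k x‖ := by
        simp only [RCLike.norm_conj]
        exact integral_neg_eq_self (fun x => ‖k x‖) volume
      rw [this]; ring
    · filter_upwards [hae] with η hη; rw [hη]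

end MultiplierBounds

end Strichartz

/-! ### Convolution operators and their decay at a fixed time. -/

namespace Strichartz

open scoped FourierTransform

variable {d : ℕ}

/-- The operator with convolution kernel `kern lam w t`. -/
def conv (lam : Space d → ℝ) (w : Space d → ℂ) (t : ℝ) (f : Space d → ℂ) (x : Space d) : ℂ :=
  ∫ y, kern lam w t (x - y) * f y

lemma kern_sub_eq_fourier (lam : Space d → ℝ) (w : Space d → ℂ) (t : ℝ) (x y : Space d) :
    kern lam w t (x - y) = 𝓕 (fun η => phase lam t x η * w η) y := by
  rw [kern, Real.fourier_eq']
  congr 1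
  ext η
  rw [smul_eq_mul, ← mul_assoc, phase, phase, ← Complex.exp_add]
  congr 2
  rw [inner_sub_left, real_inner_comm η y]
  push_cast; ring

/-- For fixed x the convolution kernel, as a function of y, is itself a Fourier transform.
Plancherel and the multiplication formula therefore apply to `conv` directly. -/
lemma isFT_kern {lam : Space d → ℝ} (hlam : Measurable lam) {w : Space d → ℂ} (hw : Integrable w)
    (t : ℝ) (x : Space d) :
    IsFT (fun η => phase lam t x η * w η) (fun y => kern lam w t (x - y)) := by
  have := isFT_of_integrable (integrable_phase_mul hlam hw t x)
  refine this.congr Filter.EventuallyEq.rfl (Filter.Eventually.of_forall fun y => ?_)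
  exact (kern_sub_eq_fourier lam w t x y).symm

lemma memLp_phase_mul {lam : Space d → ℝ} (hlam : Measurable lam) {w : Space d → ℂ} {p : ℝ≥0∞}
    (hw : MemLp w p volume) (t : ℝ) (x : Space d) :
    MemLp (fun η => phase lam t x η * w η) p volume :=
  hw.of_le ((measurable_phase_apply hlam t x).aestronglyMeasurable.mul hw.1)
    (Filter.Eventually.of_forall fun η => by simp)

lemma eLpNorm_phase_mul (lam : Space d → ℝ) (w : Space d → ℂ) (p : ℝ≥0∞)
    (t : ℝ) (x : Space d) :
    eLpNorm (fun η => phase lam t x η * w η) p volume = eLpNorm w p volume :=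
  eLpNorm_congr_norm_ae (Filter.Eventually.of_forall fun η => by simp)

/-- Plancherel for superpositions of plane waves. -/
lemma eLpNorm_kern_two {lam : Space d → ℝ} (hlam : Measurable lam) {w : Space d → ℂ}
    (hw : Integrable w) (hw2 : MemLp w 2 volume) (t : ℝ) :
    eLpNorm (fun x => kern lam w t x) 2 volume = eLpNorm w 2 volume := by
  have h := (isFT_kern hlam hw t 0).memLp_two (memLp_phase_mul hlam hw2 t 0)
  simp only [zero_sub] at h
  rw [← eLpNorm_phase_mul lam w 2 t 0, ← h.2]
  have hmp : MeasurePreserving (fun x : Space d => -x) volume volume :=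
    Measure.measurePreserving_neg volume
  rw [← eLpNorm_comp_measurePreserving
    (continuous_kern_apply hlam hw t).aestronglyMeasurable hmp]
  rfl

lemma memLp_two_kern {lam : Space d → ℝ} (hlam : Measurable lam) {w : Space d → ℂ}
    (hw : Integrable w) (hw2 : MemLp w 2 volume) (t : ℝ) (x : Space d) :
    MemLp (fun y => kern lam w t (x - y)) 2 volume :=
  ((isFT_kern hlam hw t x).memLp_two (memLp_phase_mul hlam hw2 t x)).1

lemma integrable_kern_mul_of_integrable {lam : Space d → ℝ} (hlam : Measurable lam)
    {w f : Space d → ℂ} (hw : Integrable w) (hf : Integrable f) (t : ℝ) (x : Space d) :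
    Integrable fun y => kern lam w t (x - y) * f y := by
  refine hf.bdd_mul (c := ∫ η, ‖w η‖) ?_ (Filter.Eventually.of_forall fun y => norm_kern_le _ _ _ _)
  exact ((continuous_kern_apply hlam hw t).comp (continuous_const.sub continuous_id)).aestronglyMeasurable

lemma integrable_kern_mul_of_memLp_two {lam : Space d → ℝ} (hlam : Measurable lam)
    {w f : Space d → ℂ} (hw : Integrable w) (hw2 : MemLp w 2 volume) (hf : MemLp f 2 volume)
    (t : ℝ) (x : Space d) : Integrable fun y => kern lam w t (x - y) * f y :=
  (memLp_two_kern hlam hw hw2 t x).integrable_mul hf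

lemma conv_eq_kern_of_memLp_two {lam : Space d → ℝ} (hlam : Measurable lam)
    {w f g : Space d → ℂ} (hw : Integrable w) (hw2 : MemLp w 2 volume) (hf : MemLp f 2 volume)
    (hfg : IsFT f g) (t : ℝ) (x : Space d) :
    conv lam w t f x = kern lam (fun η => w η * g η) t x := by
  rw [conv, ← integral_mul_fourier_eq (memLp_phase_mul hlam hw2 t x) hf (isFT_kern hlam hw t x) hfg,
    kern]
  simp only [mul_assoc]

lemma conv_eq_kern_of_integrable {lam : Space d → ℝ} (hlam : Measurable lam)
    {w f : Space d → ℂ} (hw : Integrable w) (hf : Integrable f) (t : ℝ) (x : Space d) :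
    conv lam w t f x = kern lam (fun η => w η * 𝓕 f η) t x := by
  have := VectorFourier.integral_fourierIntegral_smul_eq_flip (L := innerₗ (Space d)) (μ := volume)
    (ν := volume) Real.continuous_fourierChar (by exact continuous_inner)
    (integrable_phase_mul hlam hw t x) hf
  simp only [smul_eq_mul, flip_innerₗ] at this
  rw [conv, kern]
  simp_rw [kern_sub_eq_fourier]
  refine Eq.trans this ?_
  congr 1
  ext η
  rw [mul_assoc]
  rfl

/-- Splitting of `L^p`, `1 ≤ p ≤ 2`, into `L¹ + L²` by the size of the function. -/
lemma integrable_indicator_one_lt {f : Space d → ℂ} (hf : Measurable f) {p : ℝ≥0∞} (h1 : 1 ≤ p)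
    (h2 : p ≤ 2) (hfp : eLpNorm f p volume < ∞) :
    Integrable ({x | 1 < ‖f x‖}.indicator f) ∧ MemLp ({x | 1 < ‖f x‖}ᶜ.indicator f) 2 volume := by
  have hS : MeasurableSet {x | 1 < ‖f x‖} := measurableSet_lt measurable_const hf.norm
  have hp0 : p ≠ 0 := (zero_lt_one.trans_le h1).ne'
  have hpt : p ≠ ∞ := (h2.trans_lt (by norm_num)).ne
  have hpr1 : 1 ≤ p.toReal := by
    simpa using ENNReal.toReal_mono hpt h1
  have hpr2 : p.toReal ≤ 2 := by
    simpa using ENNReal.toReal_mono (by norm_num) h2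
  have hfin : ∫⁻ x, ‖f x‖ₑ ^ p.toReal < ∞ := by
    rwa [eLpNorm_lt_top_iff_lintegral_rpow_enorm_lt_top hp0 hpt] at hfp
  constructor
  · refine ⟨(hf.indicator hS).aestronglyMeasurable, (lintegral_mono fun x => ?_).trans_lt hfin⟩
    by_cases hx : 1 < ‖f x‖
    · rw [indicator_of_mem (by exact hx)]
      have : (1:ℝ≥0∞) ≤ ‖f x‖ₑ := by
        rw [← ofReal_norm, ← ENNReal.ofReal_one]; exact ENNReal.ofReal_le_ofReal hx.le
      simpa using ENNReal.rpow_le_rpow_of_exponent_le this hpr1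
    · rw [indicator_of_notMem (by exact hx)]; simp
  · refine ⟨(hf.indicator hS.compl).aestronglyMeasurable, ?_⟩
    rw [eLpNorm_lt_top_iff_lintegral_rpow_enorm_lt_top (by norm_num) (by norm_num)]
    refine (lintegral_mono fun x => ?_).trans_lt hfin
    by_cases hx : 1 < ‖f x‖
    · rw [indicator_of_notMem (by simpa using hx)]; simp
    · rw [indicator_of_mem (by exact hx)]
      have : ‖f x‖ₑ ≤ 1 := by
        rw [← ofReal_norm, ← ENNReal.ofReal_one]; exact ENNReal.ofReal_le_ofReal (not_lt.1 hx)
      exact ENNReal.rpow_le_rpow_of_exponent_ge this (by simpa using hpr2)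

lemma integrable_kern_mul {lam : Space d → ℝ} (hlam : Measurable lam)
    {w f : Space d → ℂ} (hw : Integrable w) (hw2 : MemLp w 2 volume) (hf : Measurable f) {p : ℝ≥0∞}
    (h1 : 1 ≤ p) (h2 : p ≤ 2) (hfp : eLpNorm f p volume < ∞)
    (t : ℝ) (x : Space d) : Integrable fun y => kern lam w t (x - y) * f y := by
  obtain ⟨ha, hb⟩ := integrable_indicator_one_lt hf h1 h2 hfp
  have := (integrable_kern_mul_of_integrable hlam hw ha t x).add
    (integrable_kern_mul_of_memLp_two hlam hw hw2 hb t x)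
  refine this.congr (Filter.Eventually.of_forall fun y => ?_)
  simp only [Pi.add_apply]
  rw [← mul_add]
  congr 1
  exact congrFun (indicator_self_add_compl _ f) y

/-- The convolution operators on `L^p`, `1 ≤ p ≤ 2`, on the Fourier side. -/
lemma exists_isFT_conv_eq_kern {lam : Space d → ℝ} (hlam : Measurable lam)
    {w f : Space d → ℂ} (hw : Integrable w) (hw2 : MemLp w 2 volume) (hf : Measurable f) {p : ℝ≥0∞}
    (h1 : 1 ≤ p) (h2 : p ≤ 2) (hfp : eLpNorm f p volume < ∞) (hwb : ∃ D, ∀ η, ‖w η‖ ≤ D) :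
    ∃ g, IsFT f g ∧ ∀ t x, conv lam w t f x = kern lam (fun η => w η * g η) t x := by
  obtain ⟨D, hD⟩ := hwb
  obtain ⟨ha, hb⟩ := integrable_indicator_one_lt hf h1 h2 hfp
  obtain ⟨g₂, hg₂, hg₂m, -⟩ := exists_isFT_of_memLp_two hb
  have e : (fun x => {x | 1 < ‖f x‖}.indicator f x + {x | 1 < ‖f x‖}ᶜ.indicator f x) = f :=
    indicator_self_add_compl _ f
  refine ⟨fun η => 𝓕 ({x | 1 < ‖f x‖}.indicator f) η + g₂ η, ?_, fun t x => ?_⟩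
  · have := (isFT_of_integrable ha).add hg₂
    rwa [e] at this
  · have i1 := integrable_kern_mul_of_integrable hlam hw ha t x
    have i2 := integrable_kern_mul_of_memLp_two hlam hw hw2 hb t x
    have e1 : conv lam w t f x = conv lam w t ({x | 1 < ‖f x‖}.indicator f) x +
        conv lam w t ({x | 1 < ‖f x‖}ᶜ.indicator f) x := by
      rw [conv, conv, conv, ← integral_add i1 i2]
      congr 1; ext y; rw [← mul_add]; congr 1
      exact (congrFun e y).symm
    rw [e1, conv_eq_kern_of_integrable hlam hw ha, conv_eq_kern_of_memLp_two hlam hw hw2 hb hg₂,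
      kern, kern, kern, ← integral_add]
    · congr 1; ext η; ring
    · refine integrable_phase_mul hlam ?_ t x
      have hc : Continuous (𝓕 ({x | 1 < ‖f x‖}.indicator f)) :=
        VectorFourier.fourierIntegral_continuous Real.continuous_fourierChar
          (by exact continuous_inner) ha
      exact hw.mul_bdd (c := ∫ v, ‖{x | 1 < ‖f x‖}.indicator f v‖) hc.aestronglyMeasurable
        (Filter.Eventually.of_forall fun η =>
          VectorFourier.norm_fourierIntegral_le_integral_norm _ _ _ _ _)
    · exact integrable_phase_mul hlam (hw2.integrable_mul hg₂m) t x

lemma enorm_conv_le {lam : Space d → ℝ} {w : Space d → ℂ} {t B : ℝ}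
    (hB : ∀ x, ‖kern lam w t x‖ ≤ B) (f : Space d → ℂ) (x : Space d) :
    ‖conv lam w t f x‖ₑ ≤ ENNReal.ofReal B * eLpNorm f 1 volume := by
  rw [conv, eLpNorm_one_eq_lintegral_enorm, ← lintegral_const_mul' _ _ ENNReal.ofReal_ne_top]
  refine (enorm_integral_le_lintegral_enorm _).trans (lintegral_mono fun y => ?_)
  rw [enorm_mul]
  gcongr
  rw [← ofReal_norm]
  exact ENNReal.ofReal_le_ofReal (hB _)

lemma eLpNorm_conv_two_le {lam : Space d → ℝ} (hlam : Measurable lam)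
    {w f : Space d → ℂ} (hw : Integrable w) (hw2 : MemLp w 2 volume) {D : ℝ}
    (hD : ∀ η, ‖w η‖ ≤ D) (hf : MemLp f 2 volume) (t : ℝ) :
    eLpNorm (conv lam w t f) 2 volume ≤ ENNReal.ofReal D * eLpNorm f 2 volume := by
  obtain ⟨g, hg, hgm, hgn⟩ := exists_isFT_of_memLp_two hf
  have e : conv lam w t f = fun x => kern lam (fun η => w η * g η) t x := by
    ext x; exact conv_eq_kern_of_memLp_two hlam hw hw2 hf hg t x
  have hle : ∀ᵐ η, ‖w η * g η‖ ≤ D * ‖g η‖ := Filter.Eventually.of_forall fun η => by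
    rw [norm_mul]; gcongr; exact hD η
  have h2 : MemLp (fun η => w η * g η) 2 volume :=
    hgm.of_le_mul (hw.1.mul hgm.1) hle
  have h1 : Integrable fun η => w η * g η := hw2.integrable_mul hgm
  rw [e, eLpNorm_kern_two hlam h1 h2, ← hgn]
  exact eLpNorm_le_mul_eLpNorm_of_ae_le_mul hle 2

lemma stronglyMeasurable_conv {lam : Space d → ℝ} (hlam : Measurable lam) {w f : Space d → ℂ}
    (hw : Integrable w) (hf : Measurable f) (t : ℝ) : StronglyMeasurable (conv lam w t f) := by
  have h : Continuous fun p : Space d × Space d => kern lam w t (p.1 - p.2) := by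
    have h' := (continuous_kern_apply hlam hw t).comp
      (by fun_prop : Continuous fun p : Space d × Space d => p.1 - p.2)
    simp only [Function.comp_def] at h'
    exact h'
  have hm : StronglyMeasurable fun p : Space d × Space d => kern lam w t (p.1 - p.2) * f p.2 :=
    h.stronglyMeasurable.mul (hf.comp measurable_snd).stronglyMeasurable
  exact hm.integral_prod_right

/-- The interpolated decay estimate. -/
lemma exists_eLpNorm_conv_le (d : ℕ) {r : ℝ≥0∞} (hr : 2 ≤ r) : ∃ K : ℝ, 0 < K ∧
    ∀ {lam : Space d → ℝ} {w f : Space d → ℂ} {D B t : ℝ}, Measurable lam → Integrable w →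
      MemLp w 2 volume → 0 ≤ D → 0 ≤ B → (∀ η, ‖w η‖ ≤ D) → (∀ x, ‖kern lam w t x‖ ≤ B) →
      Measurable f → eLpNorm f r.conjExponent volume < ∞ →
      eLpNorm (conv lam w t f) r volume ≤ ENNReal.ofReal K *
        (ENNReal.ofReal B ^ (1 - 2 * recip r) * ENNReal.ofReal D ^ (2 * recip r)) *
          eLpNorm f r.conjExponent volume := by
  -- Real interpolation covers 2 < r < ∞. At r = 2 and r = ∞ the two given estimates apply as they
  -- are, with constant one.
  have hK : ∃ K : ℝ, 0 < K ∧ (r ≠ 2 → r ≠ ∞ → K = interpConst r.toReal) ∧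
      (r = 2 ∨ r = ∞ → K = 1) := by
    by_cases h : r = 2 ∨ r = ∞
    · refine ⟨1, one_pos, fun h1 h2 => ?_, fun _ => rfl⟩
      rcases h with h | h
      · exact absurd h h1
      · exact absurd h h2
    · push Not at h
      refine ⟨_, ?_, fun _ _ => rfl, fun h' => ?_⟩
      · have : 2 < r.toReal := by
          have := ENNReal.toReal_strict_mono h.2 (lt_of_le_of_ne hr (Ne.symm h.1))
          simpa using this
        have h2 : 0 < r.toReal - 2 := by linarith
        rw [interpConst]; positivity
      · rcases h' with h' | h'
        · exact absurd h' h.1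
        · exact absurd h' h.2
  obtain ⟨K, hK0, hK1, hK2⟩ := hK
  refine ⟨K, hK0, ?_⟩
  intro lam w f D B t hlam hw hw2 hD0 hB0 hD hB hf hfr
  -- degenerate constants
  by_cases hzero : D = 0 ∨ B = 0
  · have hk : ∀ x, kern lam w t x = 0 := by
      intro x
      rcases hzero with h | h
      · have : w = 0 := by ext η; simpa [h] using hD η
        rw [kern, this]; simp
      · simpa [h] using hB x
    have : conv lam w t f = 0 := by ext x; simp [conv, hk]
    rw [this, eLpNorm_zero]; exact zero_le
  push Not at hzero
  have hD' : 0 < D := lt_of_le_of_ne hD0 (Ne.symm hzero.1)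
  have hB' : 0 < B := lt_of_le_of_ne hB0 (Ne.symm hzero.2)
  have htop : ∀ f : Space d → ℂ,
      eLpNorm (conv lam w t f) ∞ volume ≤ ENNReal.ofReal B * eLpNorm f 1 volume := by
    intro f
    rw [eLpNorm_exponent_top]
    exact eLpNormEssSup_le_of_ae_enorm_bound (Filter.Eventually.of_forall fun x => enorm_conv_le hB f x)
  by_cases h2 : r = 2
  · subst h2
    rw [hK2 (Or.inl rfl), recip_two]
    rw [conjExponent_two] at hfr ⊢
    have := eLpNorm_conv_two_le hlam hw hw2 hD ⟨hf.aestronglyMeasurable, hfr⟩ t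
    simpa using this
  by_cases ht : r = ∞
  · subst ht
    rw [hK2 (Or.inr rfl), recip_top, conjExponent_top]
    simpa using htop f
  rw [hK1 h2 ht]
  have hr2 : 2 < r.toReal := by
    have := ENNReal.toReal_strict_mono ht (lt_of_le_of_ne hr (Ne.symm h2))
    simpa using this
  have hre : ENNReal.ofReal r.toReal = r := ENNReal.ofReal_toReal ht
  have hce : ENNReal.ofReal (r.toReal / (r.toReal - 1)) = r.conjExponent := by
    rw [← ENNReal.ofReal_toReal (conjExponent_ne_top hr), toReal_conjExponent hr,
      recip_eq_inv_toReal]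
    congr 1
    have : r.toReal - 1 ≠ 0 := by linarith
    have h0 : r.toReal ≠ 0 := by linarith
    field_simp
  have main := eLpNorm_interp_le (μ := (volume : Measure (Space d))) hr2 rfl hB'
    (N := ENNReal.ofReal D) hf
    (by rw [hce]; exact hfr.ne) (conv lam w t)
    (fun A hA => (stronglyMeasurable_conv hlam hw (hf.indicator hA) t).aestronglyMeasurable)
    (fun A hA => htop _) (fun A hA => ?_) (fun A hA => ?_)
  · rw [hre, hce] at main
    rw [recip_eq_inv_toReal, ← div_eq_mul_inv, ← mul_assoc]
    exact main
  -- A restriction of f need not be square integrable. In that case the right-hand side is infinite,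
  -- because D > 0.
  · by_cases hfin : eLpNorm (A.indicator f) 2 volume = ∞
    · rw [hfin, ENNReal.mul_top (by simpa using hD')]; exact le_top
    · exact eLpNorm_conv_two_le hlam hw hw2 hD
        ⟨(hf.indicator hA).aestronglyMeasurable, lt_top_iff_ne_top.2 hfin⟩ t
  · refine Filter.Eventually.of_forall fun x => ?_
    have hi : ∀ A, MeasurableSet A →
        Integrable fun y => kern lam w t (x - y) * A.indicator f y := fun A hA =>
      integrable_kern_mul hlam hw hw2 (hf.indicator hA) (one_le_conjExponent r)
        (conjExponent_le_two hr) ((eLpNorm_indicator_le f).trans_lt hfr) t x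
    rw [Pi.add_apply, conv, conv, conv, ← integral_add (hi A hA) (hi _ hA.compl)]
    congr 1; ext y; rw [← mul_add]; congr 1
    exact (congrFun (indicator_self_add_compl A f) y).symm

end Strichartz

/-! ### Pairings on the frequency side and bounds from L^{r'} to L². -/

namespace Strichartz

open scoped FourierTransform

/-- Bounded measurable functions with bounded support. -/
structure Nice {X : Type*} [NormedAddCommGroup X] [MeasurableSpace X] (f : X → ℂ) : Prop where
  measurable : Measurable f
  bounded : ∃ B : ℝ, ∀ x, ‖f x‖ ≤ B
  support : ∃ R : ℝ, ∀ x, R < ‖x‖ → f x = 0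

namespace Nice

variable {X : Type*} [NormedAddCommGroup X] [MeasurableSpace X] {f : X → ℂ}

lemma memLp [ProperSpace X] [OpensMeasurableSpace X] (hf : Nice f) (p : ℝ≥0∞) (μ : Measure X)
    [IsFiniteMeasureOnCompacts μ] : MemLp f p μ := by
  obtain ⟨B, hB⟩ := hf.bounded
  obtain ⟨R, hR⟩ := hf.support
  have hfin : μ (Metric.closedBall 0 R) < ∞ := (isCompact_closedBall (0 : X) R).measure_lt_top
  have e : f = (Metric.closedBall 0 R).indicator f := by
    refine (indicator_eq_self.2 fun x hx => ?_).symm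
    by_contra h
    exact hx (hR x (by simpa using h))
  rw [e, memLp_indicator_iff_restrict Metric.isClosed_closedBall.measurableSet]
  have : IsFiniteMeasure (μ.restrict (Metric.closedBall 0 R)) := ⟨by simpa using hfin⟩
  exact (memLp_top_of_bound hf.measurable.aestronglyMeasurable B
    (Filter.Eventually.of_forall hB)).mono_exponent le_top

lemma integrable [ProperSpace X] [OpensMeasurableSpace X] (hf : Nice f) (μ : Measure X)
    [IsFiniteMeasureOnCompacts μ] : Integrable f μ :=
  memLp_one_iff_integrable.1 (hf.memLp 1 μ)

lemma conj (hf : Nice f) : Nice fun x => (starRingEnd ℂ) (f x) := by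
  obtain ⟨B, hB⟩ := hf.bounded
  obtain ⟨R, hR⟩ := hf.support
  exact ⟨Complex.continuous_conj.measurable.comp hf.measurable, ⟨B, fun x => by simpa using hB x⟩,
    ⟨R, fun x hx => by simp [hR x hx]⟩⟩

lemma reflect [MeasurableNeg X] (hf : Nice f) : Nice fun x => f (-x) := by
  obtain ⟨B, hB⟩ := hf.bounded
  obtain ⟨R, hR⟩ := hf.support
  exact ⟨hf.measurable.comp measurable_neg, ⟨B, fun x => hB _⟩,
    ⟨R, fun x hx => hR _ (by simpa using hx)⟩⟩

end Nice

variable {d : ℕ}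

/-- The bound `‖m f̂‖_{L²} ≤ E ‖f‖_{L^{r'}}`. -/
def SpaceBound (m : Space d → ℂ) (r E : ℝ≥0∞) : Prop :=
  ∀ f : Space d → ℂ, Nice f →
    eLpNorm (fun η => m η * 𝓕 f η) 2 volume ≤ E * eLpNorm f r.conjExponent volume

lemma eLpNorm_conj (f : Space d → ℂ) (p : ℝ≥0∞) :
    eLpNorm (fun x => (starRingEnd ℂ) (f x)) p volume = eLpNorm f p volume :=
  eLpNorm_congr_norm_ae (Filter.Eventually.of_forall fun x => by simp)

/-- Hölder's inequality for the pairing of two functions. -/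
lemma enorm_integral_mul_le {X : Type*} [MeasurableSpace X] {μ : Measure X} {u g : X → ℂ}
    (hu : AEStronglyMeasurable u μ) (hg : AEStronglyMeasurable g μ) {r : ℝ≥0∞} (hr : 1 ≤ r) :
    ‖∫ x, u x * g x ∂μ‖ₑ ≤ eLpNorm u r μ * eLpNorm g r.conjExponent μ := by
  have := ENNReal.HolderConjugate.conjExponent hr
  have h := eLpNorm_smul_le_mul_eLpNorm (p := r) (q := r.conjExponent) (r := 1) hg hu
  refine le_trans ?_ h
  rw [eLpNorm_one_eq_lintegral_enorm]
  exact enorm_integral_le_lintegral_enorm _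

lemma continuous_fourier {f : Space d → ℂ} (hf : Integrable f) : Continuous (𝓕 f) :=
  VectorFourier.fourierIntegral_continuous Real.continuous_fourierChar (by exact continuous_inner) hf

lemma norm_fourier_le (f : Space d → ℂ) (η : Space d) : ‖𝓕 f η‖ ≤ ∫ x, ‖f x‖ :=
  VectorFourier.norm_fourierIntegral_le_integral_norm _ _ _ _ _

lemma integrable_mul_fourier {w f : Space d → ℂ} (hw : Integrable w) (hf : Integrable f) :
    Integrable fun η => w η * 𝓕 f η :=
  hw.mul_bdd (continuous_fourier hf).aestronglyMeasurable
    (Filter.Eventually.of_forall fun η => norm_fourier_le f η)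

/-- The pairing `⟨w(D) e^{it lam(D)} f, g⟩` on the Fourier side. -/
lemma integral_conv_mul_eq {lam : Space d → ℝ} (hlam : Measurable lam) {w f g : Space d → ℂ}
    (hw : Integrable w) (hf : Integrable f) (hg : Integrable g) (t : ℝ) :
    ∫ x, conv lam w t f x * g x = ∫ η, phase lam t 0 η * (w η * 𝓕 f η) *
      (starRingEnd ℂ) (𝓕 (fun x => (starRingEnd ℂ) (g x)) η) := by
  have hwf := integrable_mul_fourier hw hf
  have e1 : ∀ x, conv lam w t f x * g x =
      (fun y => 𝓕 (fun η => phase lam t 0 η * (w η * 𝓕 f η)) y * g (-y)) (-x) := by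
    intro x
    simp only [neg_neg]
    rw [conv_eq_kern_of_integrable hlam hw hf, ← kern_sub_eq_fourier, zero_sub, neg_neg]
  simp_rw [e1]
  rw [integral_neg_eq_self
    (fun y => 𝓕 (fun η => phase lam t 0 η * (w η * 𝓕 f η)) y * g (-y)) volume]
  have := VectorFourier.integral_fourierIntegral_smul_eq_flip (L := innerₗ (Space d)) (μ := volume)
    (ν := volume) Real.continuous_fourierChar (by exact continuous_inner)
    (integrable_phase_mul hlam hwf t 0) hg.comp_neg
  simp only [smul_eq_mul, flip_innerₗ] at this
  refine Eq.trans this ?_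
  congr 1
  ext η
  congr 1
  rw [← fourier_conj_reflect]
  simp only [RingHomCompTriple.comp_apply, RingHom.id_apply]
  rfl

/-- Cauchy–Schwarz in frequency with |w| split as |m|·|m|. The phase has modulus one and drops out,
so the bound is uniform in time, and the two space exponents are independent of each other. -/
lemma enorm_integral_conv_mul_le {lam : Space d → ℝ} (hlam : Measurable lam)
    {m w f g : Space d → ℂ} (hm : Measurable m) (hw : Integrable w)
    (hwm : ∀ η, ‖w η‖ = ‖m η‖ ^ 2) {r r₁ E E₁ : ℝ≥0∞} (hE : SpaceBound m r E)
    (hE₁ : SpaceBound m r₁ E₁) (hf : Nice f) (hg : Nice g) (t : ℝ) :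
    ‖∫ x, conv lam w t f x * g x‖ₑ ≤ E * E₁ * eLpNorm f r₁.conjExponent volume *
      eLpNorm g r.conjExponent volume := by
  have hfi := hf.integrable volume
  have hgi := hg.integrable volume
  rw [integral_conv_mul_eq hlam hw hfi hgi]
  refine (enorm_integral_le_lintegral_enorm _).trans ?_
  have hmf : AEStronglyMeasurable (fun η => m η * 𝓕 f η) volume :=
    hm.aestronglyMeasurable.mul (continuous_fourier hfi).aestronglyMeasurable
  have hmg : AEStronglyMeasurable (fun η => m η * 𝓕 (fun x => (starRingEnd ℂ) (g x)) η) volume :=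
    hm.aestronglyMeasurable.mul
      (continuous_fourier (hg.conj.integrable volume)).aestronglyMeasurable
  have h := eLpNorm_smul_le_mul_eLpNorm (p := 2) (q := 2) (r := 1) hmg hmf
  rw [eLpNorm_one_eq_lintegral_enorm] at h
  calc _ ≤ ∫⁻ η, ‖((fun η => m η * 𝓕 f η) • fun η =>
        m η * 𝓕 (fun x => (starRingEnd ℂ) (g x)) η) η‖ₑ := by
        refine lintegral_mono fun η => ?_
        rw [← ofReal_norm, ← ofReal_norm]
        refine ENNReal.ofReal_le_ofReal (le_of_eq ?_)
        simp only [norm_mul, norm_phase, hwm, RCLike.norm_conj, Pi.smul_apply', smul_eq_mul]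
        ring
    _ ≤ _ := h
    _ ≤ (E₁ * eLpNorm f r₁.conjExponent volume) * (E * eLpNorm g r.conjExponent volume) := by
        refine mul_le_mul' (hE₁ f hf) ((hE _ hg.conj).trans_eq ?_)
        rw [eLpNorm_conj]
    _ = _ := by ring

lemma KernelBounds.norm_mul_le {σ D μ₁ μ₂ : ℝ} {lam : Space d → ℝ} {m : Space d → ℂ}
    (h : KernelBounds σ D μ₁ μ₂ lam m) (u : Space d → ℂ) (η : Space d) :
    ‖m η * u η‖ ≤ √D * ‖u η‖ := by
  rw [norm_mul]
  gcongr
  exact Real.le_sqrt_of_sq_le (h.sq_le η)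

lemma KernelBounds.integrable_mul {σ D μ₁ μ₂ : ℝ} {lam : Space d → ℝ} {m : Space d → ℂ}
    (h : KernelBounds σ D μ₁ μ₂ lam m) {χ : Space d → ℂ} (hχ : MemLp χ 2 volume) :
    Integrable (fun η => m η * χ η) ∧ MemLp (fun η => m η * χ η) 2 volume :=
  ⟨h.memLp_two.integrable_mul hχ, hχ.of_le_mul (h.memLp_two.1.mul hχ.1)
    (Filter.Eventually.of_forall fun η => h.norm_mul_le χ η)⟩

/-- The bound from `L^{r'}` given by the dispersive estimate at time zero. -/
lemma exists_spaceBound_of_kernelBounds (d : ℕ) (σ : ℝ) {r : ℝ≥0∞} (hr : 2 ≤ r) :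
    ∃ K : ℝ, 0 < K ∧ ∀ {D μ₁ μ₂ : ℝ} {lam : Space d → ℝ} {m : Space d → ℂ},
      KernelBounds σ D μ₁ μ₂ lam m →
      SpaceBound m r (ENNReal.ofReal (K * √D * μ₁ ^ (1 / 2 - recip r))) := by
  obtain ⟨K, hK, hKb⟩ := exists_eLpNorm_conv_le d hr
  refine ⟨√K, by positivity, ?_⟩
  intro D μ₁ μ₂ lam m h f hf
  have hμ := h.mu_one_pos
  have hD := h.nonneg
  obtain ⟨hwi, hw2⟩ := h.integrable_mul (memLp_conj h.memLp_two)
  have hfi := hf.integrable volume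
  have h1 := hKb (t := 0) (f := f) (B := D * μ₁) h.measurable_lam hwi hw2 hD (by positivity)
    (fun η => by simpa [← sq] using h.sq_le η) (fun x => by simpa using h.decay_normSq 0 x)
    hf.measurable (hf.memLp _ volume).2
  have h2 := enorm_integral_mul_le (μ := volume) (r := r)
    (stronglyMeasurable_conv h.measurable_lam hwi hf.measurable 0).aestronglyMeasurable
    hf.conj.measurable.aestronglyMeasurable (le_trans (by norm_num) hr)
  rw [integral_conv_mul_eq h.measurable_lam hwi hfi (hf.conj.integrable volume), eLpNorm_conj] at h2
  -- At time zero the pairing of conj f with the image of f under |m|²(D) is the square of ‖m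
  -- f̂‖_{L²}. The desired constant is therefore the square root of the one for L^{r'} → L^r.
  have e1 : ‖∫ η, phase lam 0 0 η * (m η * (starRingEnd ℂ) (m η) * 𝓕 f η) *
      (starRingEnd ℂ) (𝓕 (fun x => (starRingEnd ℂ) ((starRingEnd ℂ) (f x))) η)‖ₑ =
      eLpNorm (fun η => m η * 𝓕 f η) 2 volume ^ 2 := by
    have e2 : ∀ η, phase lam 0 0 η * (m η * (starRingEnd ℂ) (m η) * 𝓕 f η) *
      (starRingEnd ℂ) (𝓕 (fun x => (starRingEnd ℂ) ((starRingEnd ℂ) (f x))) η) =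
        ((‖m η * 𝓕 f η‖ ^ 2 : ℝ) : ℂ) := by
      intro η
      simp only [RingHomCompTriple.comp_apply, RingHom.id_apply]
      rw [phase_zero_right, Complex.ofReal_pow, ← Complex.mul_conj']
      simp only [map_mul]
      have : (fun x => f x) = f := rfl
      rw [this]
      ring
    simp_rw [e2]
    rw [integral_complex_ofReal, ← ofReal_norm, Complex.norm_real, ofReal_norm,
      Real.enorm_eq_ofReal (integral_nonneg fun _ => by positivity)]
    have hmem : MemLp (fun η => m η * 𝓕 f η) 2 volume :=
      (h.integrable_mul ((isFT_of_integrable hfi).memLp_two (hf.memLp 2 volume)).1).2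
    rw [ofReal_integral_eq_lintegral_ofReal
      ((memLp_two_iff_integrable_sq_norm hmem.1).1 hmem)
      (Filter.Eventually.of_forall fun _ => by positivity),
      eLpNorm_eq_lintegral_rpow_enorm_toReal (by norm_num) (by norm_num), ← ENNReal.rpow_natCast,
      ← ENNReal.rpow_mul]
    norm_num
    refine lintegral_congr fun η => ?_
    rw [← norm_mul, ← enorm_mul, ← ofReal_norm, ENNReal.ofReal_pow (norm_nonneg _)]
  rw [e1] at h2
  have h3 := h2.trans (mul_le_mul_left h1 _)
  have e3 : ENNReal.ofReal K * (ENNReal.ofReal (D * μ₁) ^ (1 - 2 * recip r) *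
      ENNReal.ofReal D ^ (2 * recip r)) = ENNReal.ofReal (√K * √D * μ₁ ^ (1 / 2 - recip r)) ^ 2 := by
    have hr' := recip_le_half hr
    have hr0 := recip_nonneg r
    rw [ENNReal.ofReal_rpow_of_nonneg (by positivity) (by linarith),
      ENNReal.ofReal_rpow_of_nonneg (by positivity) (by linarith),
      ← ENNReal.ofReal_mul (by positivity), ← ENNReal.ofReal_mul (by positivity),
      ← ENNReal.ofReal_pow (by positivity), mul_pow, mul_pow, Real.sq_sqrt hK.le, Real.sq_sqrt hD,
      Real.mul_rpow hD hμ.le, ← Real.rpow_natCast (μ₁ ^ _), ← Real.rpow_mul hμ.le]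
    congr 1
    have : D ^ (1 - 2 * recip r) * D ^ (2 * recip r) = D := by
      rw [← Real.rpow_add_of_nonneg hD (by linarith) (by linarith)]; simp
    calc _ = K * (D ^ (1 - 2 * recip r) * D ^ (2 * recip r)) * μ₁ ^ (1 - 2 * recip r) := by ring
      _ = _ := by rw [this]; congr 2; push_cast; ring
  rw [e3] at h3
  have h4 : eLpNorm (fun η => m η * 𝓕 f η) 2 volume ^ 2 ≤
      (ENNReal.ofReal (√K * √D * μ₁ ^ (1 / 2 - recip r)) * eLpNorm f r.conjExponent volume) ^ 2 :=
    h3.trans_eq (by ring)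
  exact (ENNReal.pow_le_pow_left_iff two_ne_zero).1 h4

/-- The bound from `L^{r'}` given by Young's inequality. -/
lemma spaceBound_of_isFT {k m : Space d → ℂ} (hk : Integrable k) (hkm : IsFT k m) {r : ℝ≥0∞}
    (hr : 2 ≤ r) : SpaceBound m r (eLpNorm k (2⁻¹ + r⁻¹)⁻¹ volume) := by
  intro f hf
  obtain ⟨k₀, hk₀, hkk₀⟩ := hk.1
  have hk₀i : Integrable k₀ := hk.congr hkk₀
  have hfi := hf.integrable volume
  rw [eLpNorm_congr_ae hkk₀]
  have hm : m =ᵐ[volume] 𝓕 k₀ :=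
    (hkm.congr hkk₀ Filter.EventuallyEq.rfl).ae_eq_right (isFT_of_integrable hk₀i)
  open scoped Convolution in
  set c : Space d → ℂ := f ⋆[ContinuousLinearMap.mul ℂ ℂ, volume] k₀ with hc
  have hci : Integrable c := hfi.integrable_convolution (ContinuousLinearMap.mul ℂ ℂ) hk₀i
  have hcle : ∀ x, ‖c x‖ₑ ≤ ∫⁻ y, ‖k₀ (x - y)‖ₑ * ‖f y‖ₑ := by
    intro x
    refine (enorm_integral_le_lintegral_enorm _).trans_eq (lintegral_congr fun y => ?_)
    rw [ContinuousLinearMap.mul_apply', enorm_mul, mul_comm]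
  have young : ∀ {p ρ : ℝ}, 1 ≤ p → p ≤ 2 → 1 ≤ ρ → ρ ≤ 2 → 1 / p + 1 / ρ = 3 / 2 →
      eLpNorm c 2 volume ≤ eLpNorm k₀ (ENNReal.ofReal p) volume *
        eLpNorm f (ENNReal.ofReal ρ) volume := by
    intro p ρ hp1 hp2 hρ1 hρ2 hpρ
    have hp0 : 0 < p := by linarith
    have hρ0 : 0 < ρ := by linarith
    have h := lintegral_convolution_sq_le hp1 hp2 hρ1 hρ2 hpρ hk₀.measurable.enorm
      hf.measurable.enorm
    have e : eLpNorm c 2 volume ^ 2 = ∫⁻ x, ‖c x‖ₑ ^ 2 := by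
      rw [eLpNorm_eq_lintegral_rpow_enorm_toReal (by norm_num) (by norm_num),
        ← ENNReal.rpow_natCast, ← ENNReal.rpow_mul]
      norm_num
    have h' : eLpNorm c 2 volume ^ 2 ≤ (eLpNorm k₀ (ENNReal.ofReal p) volume *
        eLpNorm f (ENNReal.ofReal ρ) volume) ^ 2 := by
      rw [e, eLpNorm_eq_lintegral_rpow_enorm_toReal (by simpa using hp0) (by simp),
        eLpNorm_eq_lintegral_rpow_enorm_toReal (by simpa using hρ0) (by simp),
        ENNReal.toReal_ofReal hp0.le, ENNReal.toReal_ofReal hρ0.le]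
      refine le_trans (lintegral_mono fun x => ?_) h
      gcongr
      exact hcle x
    exact (ENNReal.pow_le_pow_left_iff two_ne_zero).1 h'
  -- Membership in L² is obtained from the exponents 1 and 2, for which finiteness is known; the
  -- right-hand side of the final inequality may be infinite.
  have hc2 : MemLp c 2 volume := by
    refine ⟨hci.1, ?_⟩
    have := young (p := 1) (ρ := 2) le_rfl (by norm_num) (by norm_num) le_rfl (by norm_num)
    refine this.trans_lt (ENNReal.mul_lt_top ?_ ?_)
    · simpa using (memLp_one_iff_integrable.2 hk₀i).2
    · simpa using (hf.memLp 2 volume).2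
  have e1 : (fun η => m η * 𝓕 f η) =ᵐ[volume] 𝓕 c := by
    filter_upwards [hm] with η hη
    rw [hη, hc, Real.fourier_mul_convolution_eq hfi hk₀i, mul_comm]
  rw [eLpNorm_congr_ae e1, ((isFT_of_integrable hci).memLp_two hc2).2]
  have hr0 := recip_nonneg r
  have hrh := recip_le_half hr
  have hinv : r⁻¹ ≠ ∞ := by simpa using (lt_of_lt_of_le (by norm_num) hr).ne'
  have ep : ENNReal.ofReal (1 / (1 / 2 + recip r)) = (2⁻¹ + r⁻¹)⁻¹ := by
    rw [one_div, ENNReal.ofReal_inv_of_pos (by positivity), recip, ENNReal.ofReal_add (by norm_num)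
      ENNReal.toReal_nonneg, ENNReal.ofReal_toReal hinv]
    congr 2
    rw [one_div, ENNReal.ofReal_inv_of_pos (by norm_num)]
    simp
  have eρ : ENNReal.ofReal (1 / (1 - recip r)) = r.conjExponent := by
    rw [← toReal_conjExponent hr, ENNReal.ofReal_toReal (conjExponent_ne_top hr)]
  rw [← ep, ← eρ]
  refine young ?_ ?_ ?_ ?_ ?_
  · rw [le_div_iff₀ (by positivity)]; linarith
  · rw [div_le_iff₀ (by positivity)]; linarith
  · rw [le_div_iff₀ (by linarith)]; linarith
  · rw [div_le_iff₀ (by linarith)]; linarith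
  · rw [one_div_one_div, one_div_one_div]; ring

/-- Logarithmic convexity of the `L^r` norms between `2` and `r₁`. -/
lemma eLpNorm_le_rpow_mul_rpow {X : Type*} [MeasurableSpace X] {μ : Measure X} {u : X → ℂ}
    (hu : AEStronglyMeasurable u μ) {r r₁ : ℝ≥0∞} (h2 : 2 < r) (hr : r ≤ r₁) {ϑ : ℝ}
    (hϑ : ϑ * (1 - 2 * recip r₁) = 1 - 2 * recip r) :
    eLpNorm u r μ ≤ eLpNorm u r₁ μ ^ ϑ * eLpNorm u 2 μ ^ (1 - ϑ) := by
  have hlt : ∀ {p : ℝ≥0∞}, 2 < p → recip p < 1 / 2 := by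
    intro p hp
    rw [recip_eq_inv_toReal]
    by_cases hpt : p = ∞
    · simp [hpt]
    · have : 2 < p.toReal := by simpa using ENNReal.toReal_strict_mono hpt hp
      rw [one_div]
      exact inv_strictAnti₀ (by norm_num) this
  have hr₁h := hlt (h2.trans_le hr)
  rcases eq_or_lt_of_le hr with rfl | hlt'
  · have : ϑ = 1 := by
      have h0 : (1 - 2 * recip r) ≠ 0 := by linarith
      exact mul_right_cancel₀ h0 (by rw [hϑ, one_mul])
    simp [this]
  have hrt : r ≠ ∞ := hlt'.ne_top
  have hr2 : 2 < r.toReal := by simpa using ENNReal.toReal_strict_mono hrt h2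
  have hr0 : r ≠ 0 := (lt_trans (by norm_num) h2).ne'
  have hrr := recip_eq_inv_toReal r
  set ρ := r.toReal with hρ
  have hρ0 : 0 < ρ := by linarith
  have e2 : ∫⁻ x, ‖u x‖ₑ ^ (2:ℝ) ∂μ = eLpNorm u 2 μ ^ (2:ℝ) := by
    rw [eLpNorm_eq_lintegral_rpow_enorm_toReal (by norm_num) (by norm_num), ← ENNReal.rpow_mul]
    norm_num
  have er : eLpNorm u r μ = (∫⁻ x, ‖u x‖ₑ ^ ρ ∂μ) ^ (1 / ρ) :=
    eLpNorm_eq_lintegral_rpow_enorm_toReal hr0 hrt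
  have key : ∫⁻ x, ‖u x‖ₑ ^ ρ ∂μ ≤ eLpNorm u r₁ μ ^ (ϑ * ρ) * eLpNorm u 2 μ ^ ((1 - ϑ) * ρ) := by
    by_cases hr₁t : r₁ = ∞
    · subst hr₁t
      have hϑ' : ϑ * ρ = ρ - 2 := by
        rw [recip_top, hrr] at hϑ
        have : ϑ = 1 - 2 * ρ⁻¹ := by linarith
        rw [this]; field_simp
      rw [show (1 - ϑ) * ρ = 2 by linarith, hϑ', ← e2]
      calc ∫⁻ x, ‖u x‖ₑ ^ ρ ∂μ ≤ ∫⁻ x, eLpNorm u ∞ μ ^ (ρ - 2) * ‖u x‖ₑ ^ (2:ℝ) ∂μ := by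
            refine lintegral_mono_ae ?_
            have := ae_le_eLpNormEssSup (f := u) (μ := μ)
            rw [← eLpNorm_exponent_top] at this
            filter_upwards [this] with x hx
            calc ‖u x‖ₑ ^ ρ = ‖u x‖ₑ ^ (ρ - 2) * ‖u x‖ₑ ^ (2:ℝ) := by
                  rw [← ENNReal.rpow_add_of_nonneg _ _ (by linarith) (by norm_num)]; congr 1; ring
              _ ≤ _ := by
                  gcongr
        _ = _ := by
            rw [lintegral_const_mul'' _ (by exact hu.enorm.pow_const _)]
    · have hr₁2 : 2 < r₁.toReal := by
        simpa using ENNReal.toReal_strict_mono hr₁t (h2.trans hlt')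
      have hρρ : ρ < r₁.toReal := ENNReal.toReal_strict_mono hr₁t hlt'
      have hr₁r := recip_eq_inv_toReal r₁
      have hr₁0 : r₁ ≠ 0 := (lt_trans (by norm_num) (h2.trans hlt')).ne'
      set ρ₁ := r₁.toReal with hρ₁
      have hρ₁0 : 0 < ρ₁ := by linarith
      have h12 : ρ₁ - 2 ≠ 0 := by linarith
      have eϑ : ϑ * ρ = ρ₁ * ((ρ - 2) / (ρ₁ - 2)) := by
        rw [hr₁r, hrr] at hϑ
        have h3 : 1 - 2 * ρ₁⁻¹ = (ρ₁ - 2) / ρ₁ := by field_simp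
        rw [h3] at hϑ
        have : ϑ = (1 - 2 * ρ⁻¹) / ((ρ₁ - 2) / ρ₁) := by
          rw [eq_div_iff (by positivity)]; exact hϑ
        rw [this]; field_simp
      set P := (ρ - 2) / (ρ₁ - 2) with hP
      have hP0 : 0 ≤ P := div_nonneg (by linarith) (by linarith)
      have hP1 : P ≤ 1 := by rw [hP, div_le_one (by linarith)]; linarith
      have hρP : ρ = ρ₁ * P + 2 * (1 - P) := by rw [hP]; field_simp; ring
      have h := ENNReal.lintegral_mul_norm_pow_le (μ := μ) (f := fun x => ‖u x‖ₑ ^ ρ₁)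
        (g := fun x => ‖u x‖ₑ ^ (2:ℝ)) (hu.enorm.pow_const _) (hu.enorm.pow_const _) hP0
        (sub_nonneg.2 hP1) (by ring)
      rw [e2] at h
      have e₁ : ∫⁻ x, ‖u x‖ₑ ^ ρ₁ ∂μ = eLpNorm u r₁ μ ^ ρ₁ := by
        rw [eLpNorm_eq_lintegral_rpow_enorm_toReal hr₁0 hr₁t, ← ENNReal.rpow_mul]
        rw [one_div, ← hρ₁, inv_mul_cancel₀ hρ₁0.ne', ENNReal.rpow_one]
      rw [e₁, ← ENNReal.rpow_mul, ← ENNReal.rpow_mul] at h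
      rw [eϑ, show (1 - ϑ) * ρ = 2 * (1 - P) by linarith]
      refine le_trans (le_of_eq (lintegral_congr fun x => ?_)) h
      rw [← ENNReal.rpow_mul, ← ENNReal.rpow_mul, ← ENNReal.rpow_add_of_nonneg _ _
        (by positivity) (mul_nonneg (by norm_num) (sub_nonneg.2 hP1)), ← hρP]
  rw [er]
  calc _ ≤ (eLpNorm u r₁ μ ^ (ϑ * ρ) * eLpNorm u 2 μ ^ ((1 - ϑ) * ρ)) ^ (1 / ρ) := by gcongr
    _ = _ := by
      rw [ENNReal.mul_rpow_of_nonneg _ _ (by positivity), ← ENNReal.rpow_mul, ← ENNReal.rpow_mul]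
      congr 2 <;> field_simp

end Strichartz

/-! ### Space-time superpositions and space-time convolutions. -/

namespace Strichartz

open scoped FourierTransform

variable {d : ℕ}

/-- For finite p this is measurability of a partial integral. For p = ∞ the essential supremum of a
slice exceeds c exactly when the corresponding slice of {|u| > c} has positive measure, which is a
measurable condition on t. -/
lemma measurable_eLpNorm_slice {u : ℝ → Space d → ℂ}
    (hu : Measurable fun p : ℝ × Space d => u p.1 p.2) (p : ℝ≥0∞) :
    Measurable fun t => eLpNorm (u t) p volume := by
  by_cases h0 : p = 0
  · simp [h0]
  by_cases ht : p = ∞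
  · subst ht
    refine measurable_of_Ioi fun c => ?_
    have e : (fun t => eLpNorm (u t) ∞ volume) ⁻¹' Ioi c =
        {t | volume (Prod.mk t ⁻¹' {p : ℝ × Space d | c < ‖u p.1 p.2‖ₑ}) ≠ 0} := by
      ext t
      simp only [mem_preimage, mem_Ioi, mem_ofPred_eq, eLpNorm_exponent_top]
      constructor
      · intro h hv
        refine absurd h (not_lt.2 ?_)
        refine essSup_le_of_ae_le c ?_
        have : ∀ᵐ x, ¬ c < ‖u t x‖ₑ := by
          rw [ae_iff]; simpa using hv
        filter_upwards [this] with x hx using not_lt.1 hx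
      · intro h
        by_contra hc
        apply h
        have := ae_le_eLpNormEssSup (f := u t) (μ := volume)
        rw [← nonpos_iff_eq_zero]
        have h2 : ∀ᵐ x, ¬ c < ‖u t x‖ₑ := by
          filter_upwards [this] with x hx using not_lt.2 (hx.trans (not_lt.1 hc))
        rw [ae_iff] at h2
        simpa using h2
    rw [e]
    have hS : MeasurableSet {p : ℝ × Space d | c < ‖u p.1 p.2‖ₑ} :=
      measurableSet_lt measurable_const hu.enorm
    exact (measurable_measure_prodMk_left hS) (measurableSet_singleton 0).compl
  · simp_rw [eLpNorm_eq_lintegral_rpow_enorm_toReal h0 ht]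
    have : Measurable fun z : ℝ × Space d => ‖u z.1 z.2‖ₑ ^ p.toReal := hu.enorm.pow_const _
    exact (this.lintegral_prod_right').pow_const _

/-- Bounded measurable functions on space-time with bounded support. -/
abbrev NiceST (F : ℝ → Space d → ℂ) : Prop := Nice fun p : ℝ × Space d => F p.1 p.2

namespace NiceST

variable {F : ℝ → Space d → ℂ}

lemma slice (hF : NiceST F) (t : ℝ) : Nice (F t) := by
  obtain ⟨B, hB⟩ := hF.bounded
  obtain ⟨R, hR⟩ := hF.support
  refine ⟨?_, ⟨B, fun x => hB (t, x)⟩, ⟨R, fun x hx => hR (t, x) (hx.trans_le ?_)⟩⟩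
  · have h' := hF.measurable.comp (measurable_prodMk_left (x := t))
    simp only [Function.comp_def] at h'
    exact h'
  · exact le_max_right _ _

lemma restrict (hF : NiceST F) {S : Set ℝ} (hS : MeasurableSet S) :
    NiceST (S.indicator F) := by
  classical
  obtain ⟨B, hB⟩ := hF.bounded
  obtain ⟨R, hR⟩ := hF.support
  have e : (fun p : ℝ × Space d => S.indicator F p.1 p.2) =
      (Prod.fst ⁻¹' S).indicator fun p : ℝ × Space d => F p.1 p.2 := by
    ext p
    by_cases hp : p.1 ∈ S <;> simp [hp, indicator]
  refine ⟨?_, ⟨B, fun x => ?_⟩, ⟨R, fun x hx => ?_⟩⟩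
  · rw [e]; exact hF.measurable.indicator (measurable_fst hS)
  · rw [congrFun e x]
    exact (norm_indicator_le_norm_self _ _).trans (hB x)
  · rw [congrFun e x]
    simp [indicator, hR x hx]

end NiceST

/-- The space-time superposition `∫∫ e^{i(2π x·η + t lam(η))} F(t,x) dx dt`. -/
def wave (lam : Space d → ℝ) (F : ℝ → Space d → ℂ) (η : Space d) : ℂ :=
  ∫ z : ℝ × Space d, phase lam z.1 z.2 η * F z.1 z.2

lemma measurable_phase_swap {lam : Space d → ℝ} (hlam : Measurable lam) :
    Measurable fun p : Space d × (ℝ × Space d) => phase lam p.2.1 p.2.2 p.1 := by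
  have h' := (measurable_phase hlam).comp
    (measurable_swap : Measurable (Prod.swap : Space d × (ℝ × Space d) → _))
  simp only [Function.comp_def] at h'
  exact h'

lemma integrable_phase_prod {lam : Space d → ℝ} (hlam : Measurable lam) {u : Space d → ℂ}
    (hu : Integrable u) {F : ℝ → Space d → ℂ} (hF : NiceST F) :
    Integrable (fun p : Space d × (ℝ × Space d) =>
      phase lam p.2.1 p.2.2 p.1 * (u p.1 * F p.2.1 p.2.2)) (volume.prod volume) := by
  have h := hu.mul_prod (hF.integrable volume)
  refine h.bdd_mul (c := 1) (measurable_phase_swap hlam).aestronglyMeasurable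
    (Filter.Eventually.of_forall fun p => (norm_phase _ _ _ _).le)

lemma stronglyMeasurable_wave {lam : Space d → ℝ} (hlam : Measurable lam) {F : ℝ → Space d → ℂ}
    (hF : NiceST F) : StronglyMeasurable (wave lam F) := by
  have hm : StronglyMeasurable fun p : Space d × (ℝ × Space d) =>
      phase lam p.2.1 p.2.2 p.1 * F p.2.1 p.2.2 :=
    ((measurable_phase_swap hlam).mul (hF.measurable.comp measurable_snd)).stronglyMeasurable
  exact hm.integral_prod_right

lemma norm_wave_le (lam : Space d → ℝ) (F : ℝ → Space d → ℂ) (η : Space d) :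
    ‖wave lam F η‖ ≤ ∫ z : ℝ × Space d, ‖F z.1 z.2‖ := by
  refine (norm_integral_le_integral_norm _).trans_eq ?_
  simp

/-- Duality between `kern` and `wave`. -/
lemma integral_kern_mul {lam : Space d → ℝ} (hlam : Measurable lam) {u : Space d → ℂ}
    (hu : Integrable u) {F : ℝ → Space d → ℂ} (hF : NiceST F) :
    ∫ z : ℝ × Space d, kern lam u z.1 z.2 * F z.1 z.2 = ∫ η, u η * wave lam F η := by
  have hI := integrable_phase_prod hlam hu hF
  have h := integral_integral_swap (f := fun (η : Space d) (z : ℝ × Space d) =>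
    phase lam z.1 z.2 η * (u η * F z.1 z.2)) hI
  calc _ = ∫ z : ℝ × Space d, ∫ η, phase lam z.1 z.2 η * (u η * F z.1 z.2) := by
        congr 1; ext z
        rw [kern, ← integral_mul_const]
        congr 1; ext η; ring
    _ = ∫ η, ∫ z : ℝ × Space d, phase lam z.1 z.2 η * (u η * F z.1 z.2) := h.symm
    _ = _ := by
        congr 1; ext η
        rw [wave, ← integral_const_mul]
        congr 1; ext z; ring

/-- The space-time convolution `∫∫ K(t-s, x-y) F(s,y) dy ds` with kernel `K = kern lam w`. -/
def full (lam : Space d → ℝ) (w : Space d → ℂ) (F : ℝ → Space d → ℂ) (t : ℝ) (x : Space d) : ℂ :=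
  ∫ z : ℝ × Space d, kern lam w (t - z.1) (x - z.2) * F z.1 z.2

/-- By `phase_sub` the kernel is a plane wave at (t, x) times the conjugate of a plane wave at (s,
y), so the integral over (s, y) can be carried out first. The pairings are bilinear, so the adjoint
appears through a pair of conjugations. -/
lemma full_eq_kern {lam : Space d → ℝ} (hlam : Measurable lam) {w : Space d → ℂ}
    (hw : Integrable w) {F : ℝ → Space d → ℂ} (hF : NiceST F) (t : ℝ) (x : Space d) :
    full lam w F t x = kern lam (fun η => w η *
      (starRingEnd ℂ) (wave lam (fun s y => (starRingEnd ℂ) (F s y)) η)) t x := by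
  have hF' : NiceST fun s y => (starRingEnd ℂ) (F s y) := Nice.conj hF
  have h := integral_kern_mul hlam (u := fun η => (starRingEnd ℂ) (phase lam t x η * w η))
    (Complex.conjLIE.toContinuousLinearEquiv.toContinuousLinearMap.integrable_comp
      (integrable_phase_mul hlam hw t x)) hF'
  have e1 : ∀ z : ℝ × Space d, (starRingEnd ℂ)
      (kern lam (fun η => (starRingEnd ℂ) (phase lam t x η * w η)) z.1 z.2 *
        (starRingEnd ℂ) (F z.1 z.2)) = kern lam w (t - z.1) (x - z.2) * F z.1 z.2 := by
    intro z
    rw [map_mul, RingHomCompTriple.comp_apply, RingHom.id_apply]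
    congr 1
    rw [kern, ← integral_conj, kern]
    congr 1; ext η
    rw [phase_sub]
    simp only [map_mul, RingHomCompTriple.comp_apply, RingHom.id_apply]
    ring
  have h' := congrArg (starRingEnd ℂ) h
  rw [← integral_conj, ← integral_conj] at h'
  simp_rw [e1] at h'
  rw [full, h', kern]
  congr 1; ext η
  simp only [map_mul, RingHomCompTriple.comp_apply, RingHom.id_apply]
  ring

lemma continuous_kern_comp_sub {lam : Space d → ℝ} (hlam : Measurable lam) {w : Space d → ℂ}
    (hw : Integrable w) : Continuous fun p : (ℝ × Space d) × (ℝ × Space d) =>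
      kern lam w (p.1.1 - p.2.1) (p.1.2 - p.2.2) := by
  have h' := (continuous_kern hlam hw).comp
    (continuous_sub : Continuous fun p : (ℝ × Space d) × (ℝ × Space d) => p.1 - p.2)
  simp only [Function.comp_def] at h'
  exact h'

lemma integrable_kern_sub_mul {lam : Space d → ℝ} (hlam : Measurable lam) {w : Space d → ℂ}
    (hw : Integrable w) {F : ℝ → Space d → ℂ} (hF : NiceST F) (t : ℝ) (x : Space d) :
    Integrable fun z : ℝ × Space d => kern lam w (t - z.1) (x - z.2) * F z.1 z.2 := by
  refine (hF.integrable volume).bdd_mul (c := ∫ η, ‖w η‖) ?_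
    (Filter.Eventually.of_forall fun y => norm_kern_le _ _ _ _)
  have h' := (continuous_kern_comp_sub hlam hw).comp
    (by fun_prop : Continuous fun z : ℝ × Space d => ((t, x), z))
  simp only [Function.comp_def] at h'
  exact h'.aestronglyMeasurable

lemma full_eq_integral_conv {lam : Space d → ℝ} (hlam : Measurable lam) {w : Space d → ℂ}
    (hw : Integrable w) {F : ℝ → Space d → ℂ} (hF : NiceST F) (t : ℝ) (x : Space d) :
    full lam w F t x = ∫ s, conv lam w (t - s) (F s) x := by
  rw [full]
  exact integral_prod _ (integrable_kern_sub_mul hlam hw hF t x)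

lemma norm_full_le (lam : Space d → ℝ) (w : Space d → ℂ) {F : ℝ → Space d → ℂ} (hF : NiceST F)
    (t : ℝ) (x : Space d) :
    ‖full lam w F t x‖ ≤ (∫ η, ‖w η‖) * ∫ z : ℝ × Space d, ‖F z.1 z.2‖ := by
  refine (norm_integral_le_integral_norm _).trans ?_
  rw [← integral_const_mul]
  refine integral_mono_of_nonneg (Filter.Eventually.of_forall fun _ => norm_nonneg _)
    ((hF.integrable volume).norm.const_mul _) (Filter.Eventually.of_forall fun z => ?_)
  simp only [norm_mul]
  gcongr
  exact norm_kern_le _ _ _ _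

lemma integral_full_mul {lam : Space d → ℝ} (hlam : Measurable lam) {w : Space d → ℂ}
    (hw : Integrable w) {F : ℝ → Space d → ℂ} (hF : NiceST F) {g : Space d → ℂ} (hg : Nice g)
    (t : ℝ) :
    ∫ x, full lam w F t x * g x = ∫ s, ∫ x, conv lam w (t - s) (F s) x * g x := by
  have hgi := hg.integrable volume
  have hI : Integrable (fun p : Space d × (ℝ × Space d) =>
      kern lam w (t - p.2.1) (p.1 - p.2.2) * (g p.1 * F p.2.1 p.2.2)) (volume.prod volume) := by
    refine (hgi.mul_prod (hF.integrable volume)).bdd_mul (c := ∫ η, ‖w η‖) ?_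
      (Filter.Eventually.of_forall fun y => norm_kern_le _ _ _ _)
    have h' := (continuous_kern_comp_sub hlam hw).comp
      (by fun_prop : Continuous fun p : Space d × (ℝ × Space d) => ((t, p.1), p.2))
    simp only [Function.comp_def] at h'
    exact h'.aestronglyMeasurable
  have hI' := hI.swap
  have h1 : ∫ x, full lam w F t x * g x = ∫ z : ℝ × Space d, ∫ x,
      kern lam w (t - z.1) (x - z.2) * (g x * F z.1 z.2) := by
    rw [← integral_integral_swap hI]
    congr 1; ext x
    rw [full, ← integral_mul_const]
    congr 1; ext z; ring
  rw [h1]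
  have h2 := integral_prod (μ := (volume : Measure ℝ)) (ν := (volume : Measure (Space d))) _
    hI'.integral_prod_left
  refine Eq.trans h2 ?_
  congr 1; ext s
  have hIs : Integrable (fun p : Space d × Space d =>
      kern lam w (t - s) (p.1 - p.2) * (g p.1 * F s p.2)) (volume.prod volume) := by
    refine (hgi.mul_prod ((hF.slice s).integrable volume)).bdd_mul (c := ∫ η, ‖w η‖) ?_
      (Filter.Eventually.of_forall fun y => norm_kern_le _ _ _ _)
    have h' := (continuous_kern_apply hlam hw (t - s)).comp
      (by fun_prop : Continuous fun p : Space d × Space d => p.1 - p.2)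
    simp only [Function.comp_def] at h'
    exact h'.aestronglyMeasurable
  have h3 := integral_integral_swap (f := fun x y => kern lam w (t - s) (x - y) * (g x * F s y)) hIs
  refine Eq.trans h3.symm ?_
  congr 1; ext x
  rw [conv, ← integral_mul_const]
  congr 1; ext y; ring

end Strichartz

/-! ### The T T* argument. -/

namespace Strichartz

open scoped FourierTransform

variable {d : ℕ}

/-- The symbols `w` with `|w| = |m|²` whose kernel satisfies the dispersive estimate. -/
structure IsWeight (σ D μ₁ μ₂ : ℝ) (lam : Space d → ℝ) (m w : Space d → ℂ) : Prop where
  integrable : Integrable w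
  memLp_two : MemLp w 2 volume
  norm_eq : ∀ η, ‖w η‖ = ‖m η‖ ^ 2
  decay : ∀ t x, ‖kern lam w t x‖ ≤ D * μ₁ / (1 + μ₂ * |t|) ^ σ

lemma KernelBounds.isWeight_sq {σ D μ₁ μ₂ : ℝ} {lam : Space d → ℝ} {m : Space d → ℂ}
    (h : KernelBounds σ D μ₁ μ₂ lam m) : IsWeight σ D μ₁ μ₂ lam m fun η => m η * m η :=
  ⟨(h.integrable_mul h.memLp_two).1, (h.integrable_mul h.memLp_two).2,
    fun η => by rw [norm_mul, sq], h.decay_sq⟩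

lemma KernelBounds.isWeight_normSq {σ D μ₁ μ₂ : ℝ} {lam : Space d → ℝ} {m : Space d → ℂ}
    (h : KernelBounds σ D μ₁ μ₂ lam m) :
    IsWeight σ D μ₁ μ₂ lam m fun η => m η * (starRingEnd ℂ) (m η) :=
  ⟨(h.integrable_mul (memLp_conj h.memLp_two)).1, (h.integrable_mul (memLp_conj h.memLp_two)).2,
    fun η => by rw [norm_mul, RCLike.norm_conj, sq], h.decay_normSq⟩

/-- D bounds the multiplier as well as the decay constant, so its powers 1-2/r and 2/r from the
interpolation recombine to D. -/
lemma exists_eLpNorm_conv_decay (d : ℕ) (σ : ℝ) {r : ℝ≥0∞} (hr : 2 ≤ r) : ∃ K : ℝ, 0 < K ∧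
    ∀ {D μ₁ μ₂ : ℝ} {lam : Space d → ℝ} {m w : Space d → ℂ}, KernelBounds σ D μ₁ μ₂ lam m →
      IsWeight σ D μ₁ μ₂ lam m w → ∀ {f : Space d → ℂ}, Measurable f →
      eLpNorm f r.conjExponent volume < ∞ → ∀ t : ℝ,
      eLpNorm (conv lam w t f) r volume ≤ ENNReal.ofReal (K * (D * μ₁ ^ (1 - 2 * recip r))) *
        ENNReal.ofReal ((1 + μ₂ * |t|) ^ (-(σ * (1 - 2 * recip r)))) *
          eLpNorm f r.conjExponent volume := by
  obtain ⟨K, hK, hKb⟩ := exists_eLpNorm_conv_le d hr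
  refine ⟨K, hK, ?_⟩
  intro D μ₁ μ₂ lam m w h hw f hf hfr t
  have hμ₁ := h.mu_one_pos
  have hμ₂ := h.mu_two_pos
  have hD := h.nonneg
  have hr' := recip_le_half hr
  have hr0 := recip_nonneg r
  refine (hKb h.measurable_lam hw.integrable hw.memLp_two hD (by positivity)
    (fun η => (hw.norm_eq η).trans_le (h.sq_le η)) (hw.decay t) hf hfr).trans_eq ?_
  congr 1
  have hp : 0 < 1 + μ₂ * |t| := by positivity
  rw [ENNReal.ofReal_rpow_of_nonneg (by positivity) (by linarith),
    ENNReal.ofReal_rpow_of_nonneg (by positivity) (by linarith),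
    ← ENNReal.ofReal_mul (by positivity), ← ENNReal.ofReal_mul (by positivity),
    ← ENNReal.ofReal_mul (by positivity), Real.div_rpow (by positivity) (by positivity),
    Real.mul_rpow hD hμ₁.le, ← Real.rpow_mul hp.le, Real.rpow_neg hp.le]
  congr 1
  have : D ^ (1 - 2 * recip r) * D ^ (2 * recip r) = D := by
    rw [← Real.rpow_add_of_nonneg hD (by linarith) (by linarith)]; simp
  calc _ = K * ((D ^ (1 - 2 * recip r) * D ^ (2 * recip r)) * μ₁ ^ (1 - 2 * recip r)) *
      ((1 + μ₂ * |t|) ^ (σ * (1 - 2 * recip r)))⁻¹ := by ring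
    _ = _ := by rw [this]

lemma one_add_rpow_neg_le {μ t a : ℝ} (hμ : 0 < μ) (ht : t ≠ 0) (ha : 0 ≤ a) :
    (1 + μ * |t|) ^ (-a) ≤ (μ * |t|) ^ (-a) := by
  have : 0 < |t| := abs_pos.2 ht
  rw [Real.rpow_neg (by positivity), Real.rpow_neg (by positivity)]
  gcongr
  linarith

/-- The space-time form estimate following from two estimates at fixed time. -/
lemma exists_form_le (d : ℕ) {q : ℝ≥0∞} (hq : 2 ≤ q) {a : ℝ} (ha2 : q = 2 → 1 < a) :
    ∃ K : ℝ, 0 < K ∧ ∀ {θ μ : ℝ} {X Y p p₁ : ℝ≥0∞} {lam : Space d → ℝ} {w : Space d → ℂ},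
      0 ≤ θ → θ ≤ 1 → θ * a = 2 * recip q → 0 < μ →
      (∀ t f g, Nice f → Nice g → ‖∫ x, conv lam w t f x * g x‖ₑ ≤
        X * eLpNorm f p₁ volume * eLpNorm g p volume) →
      (∀ t f g, t ≠ 0 → Nice f → Nice g → ‖∫ x, conv lam w t f x * g x‖ₑ ≤
        Y * ENNReal.ofReal ((μ * |t|) ^ (-a)) * eLpNorm f p₁ volume * eLpNorm g p volume) →
      ∀ {F G : ℝ → Space d → ℂ}, NiceST F → NiceST G →
        ∫⁻ t, ∫⁻ s, ‖∫ x, conv lam w (t - s) (F s) x * G t x‖ₑ ≤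
          ENNReal.ofReal K * (X ^ (1 - θ) * Y ^ θ * ENNReal.ofReal (μ ^ (-(2 * recip q)))) *
            mixedNorm q.conjExponent p₁ F * mixedNorm q.conjExponent p G := by
  obtain ⟨K, hK, hKb⟩ := exists_time_form_le hq ha2
  refine ⟨K, hK, ?_⟩
  intro θ μ X Y p p₁ lam w hθ0 hθ1 hθ hμ hX hY F G hF hG
  -- The value ∞ at t = 0 leaves X as the minimum there, since the decaying bound is asserted for t
  -- ≠ 0 only.
  set h : ℝ → ℝ≥0∞ := fun t => min X (if t = 0 then ∞ else Y * ENNReal.ofReal ((μ * |t|) ^ (-a)))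
    with hh
  have hm : Measurable h := by
    refine measurable_const.min (Measurable.ite (measurableSet_singleton 0) measurable_const ?_)
    refine measurable_const.mul (ENNReal.measurable_ofReal.comp ?_)
    exact (measurable_const.mul continuous_abs.measurable).pow_const _
  have := hKb θ μ X Y h (fun s => eLpNorm (F s) p₁ volume) (fun s => eLpNorm (G s) p volume) hθ0 hθ1
    hθ hμ hm (fun t => min_le_left _ _)
    (fun t ht => (min_le_right _ _).trans_eq (by rw [if_neg ht]))
    (measurable_eLpNorm_slice hF.measurable p₁)
    (measurable_eLpNorm_slice hG.measurable p) (fun s => ((hF.slice s).memLp p₁ volume).2.ne)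
    (fun s => ((hG.slice s).memLp p volume).2.ne)
  refine le_trans (lintegral_mono fun t => lintegral_mono fun s => ?_) this
  have h1 := hX (t - s) _ _ (hF.slice s) (hG.slice t)
  simp only [hh]
  rcases le_total X (if t - s = 0 then ∞ else Y * ENNReal.ofReal ((μ * |t - s|) ^ (-a))) with hle | hle
  · rw [min_eq_left hle]; exact h1
  · rw [min_eq_right hle]
    by_cases hts : t - s = 0
    · rw [if_pos hts] at hle ⊢
      rw [top_le_iff] at hle
      rw [← hle]; exact h1
    · rw [if_neg hts]
      exact hY (t - s) _ _ hts (hF.slice s) (hG.slice t)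

/-- The constant of the homogeneous Strichartz estimate, up to a numerical factor. -/
def strichConst (σ D μ₁ μ₂ θ : ℝ) (q E : ℝ≥0∞) : ℝ≥0∞ :=
  ENNReal.ofReal D ^ (θ / 2) * E ^ (1 - θ) * ENNReal.ofReal ((μ₁ ^ (1 / σ) * μ₂⁻¹) ^ recip q)

/-- At q = 2 admissibility reads 1 ≤ σ(1-2/r). Equality is impossible for σ < 1, is the forbidden
pair (2,∞) for σ = 1, and is P_σ for σ > 1. The strict inequality is integrability in time of the
decay for large |t|, which replaces fractional integration in this case. -/
lemma one_lt_of_admissible {σ : ℝ} {q r : ℝ≥0∞} (hσ : 0 < σ) (h : Admissible σ q r)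
    (he : ¬ IsEndpoint σ q r) (hq : q = 2) : 1 < σ * (1 - 2 * recip r) := by
  obtain ⟨_, hr, h3, h4⟩ := h
  subst hq
  rw [recip_two] at h4
  have hr0 := recip_nonneg r
  refine lt_of_le_of_ne (by linarith) fun heq => ?_
  have hr2 : recip r = (1 - 1 / σ) / 2 := by field_simp; linarith
  rcases lt_trichotomy σ 1 with h1 | h1 | h1
  · nlinarith
  · refine h3 ⟨rfl, ?_, h1⟩
    rw [h1] at hr2
    norm_num at hr2
    rw [recip, ENNReal.toReal_eq_zero_iff] at hr2
    rcases hr2 with h5 | h5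
    · simpa using h5
    · rw [ENNReal.inv_eq_top] at h5
      rw [h5] at hr; norm_num at hr
  · refine he ⟨h1, rfl, ?_⟩
    have hrt : r ≠ ∞ := by
      rintro rfl
      rw [recip_top] at hr2
      have : 1 / σ < 1 := by rw [div_lt_one hσ]; exact h1
      linarith
    rw [← ENNReal.ofReal_toReal hrt]
    congr 1
    rw [recip_eq_inv_toReal] at hr2
    rw [← inv_inv r.toReal, hr2]
    have : σ - 1 ≠ 0 := by linarith
    field_simp

/-- The adjoint homogeneous Strichartz estimate, by the `T T*` method. -/
lemma exists_eLpNorm_wave_le (d : ℕ) {σ : ℝ} (hσ : 0 < σ) {q r : ℝ≥0∞} (hqr : Admissible σ q r)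
    (he : ¬ IsEndpoint σ q r) : ∃ K : ℝ, 0 < K ∧ ∀ {θ : ℝ}, IsTheta σ q r θ →
      ∀ {D μ₁ μ₂ : ℝ} {lam : Space d → ℝ} {m : Space d → ℂ}, KernelBounds σ D μ₁ μ₂ lam m →
      ∀ {E : ℝ≥0∞}, SpaceBound m r E → ∀ {F : ℝ → Space d → ℂ}, NiceST F →
        eLpNorm (fun η => m η * wave lam F η) 2 volume ≤
          ENNReal.ofReal K * strichConst σ D μ₁ μ₂ θ q E *
            mixedNorm q.conjExponent r.conjExponent F := by
  obtain ⟨hq, hr, -, -⟩ := id hqr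
  obtain ⟨K₁, hK₁, h₁⟩ := exists_eLpNorm_conv_decay d σ hr
  obtain ⟨K₂, hK₂, h₂⟩ := exists_form_le d hq (a := σ * (1 - 2 * recip r))
    (one_lt_of_admissible hσ hqr he)
  have hr' := recip_le_half hr
  have hr0 := recip_nonneg r
  have ha : 0 ≤ σ * (1 - 2 * recip r) := mul_nonneg hσ.le (by linarith)
  -- The argument controls the square of the norm, hence the root. The maximum absorbs K₁^θ for
  -- every θ in [0,1], so that the constant does not depend on θ.
  refine ⟨√(K₂ * max 1 K₁), by positivity, ?_⟩
  intro θ ⟨hθ0, hθ1, hθ⟩ D μ₁ μ₂ lam m h E hE F hF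
  have hμ₁ := h.mu_one_pos
  have hμ₂ := h.mu_two_pos
  have hD := h.nonneg
  have hw := h.isWeight_normSq
  have hF' : NiceST fun s y => (starRingEnd ℂ) (F s y) := Nice.conj hF
  have hform := h₂ (θ := θ) (μ := μ₂) (X := E * E)
    (Y := ENNReal.ofReal (K₁ * (D * μ₁ ^ (1 - 2 * recip r))))
    (p := r.conjExponent) (p₁ := r.conjExponent) (lam := lam) hθ0 hθ1 hθ hμ₂
    (fun t f g hf hg => enorm_integral_conv_mul_le h.measurable_lam h.measurable_m hw.integrable
      hw.norm_eq hE hE hf hg t)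
    (fun t f g ht hf hg => by
      refine (enorm_integral_mul_le (stronglyMeasurable_conv h.measurable_lam hw.integrable
        hf.measurable t).aestronglyMeasurable hg.measurable.aestronglyMeasurable
        (le_trans (by norm_num) hr)).trans ?_
      gcongr
      refine (h₁ h hw hf.measurable (hf.memLp _ volume).2 t).trans ?_
      exact mul_le_mul_left (mul_le_mul_right (ENNReal.ofReal_le_ofReal
        (one_add_rpow_neg_le hμ₂ ht ha)) _) _)
    hF' hF
  have emix : mixedNorm q.conjExponent r.conjExponent (fun s y => (starRingEnd ℂ) (F s y)) =
      mixedNorm q.conjExponent r.conjExponent F := by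
    simp only [mixedNorm, eLpNorm_conj]
  rw [emix] at hform
  -- the square of the norm
  have hmem : MemLp (fun η => m η * wave lam F η) 2 volume :=
    h.memLp_two.of_le_mul (c := ∫ z : ℝ × Space d, ‖F z.1 z.2‖)
      (h.memLp_two.1.mul (stronglyMeasurable_wave h.measurable_lam hF).aestronglyMeasurable)
      (Filter.Eventually.of_forall fun η => by
        rw [norm_mul, mul_comm]; gcongr; exact norm_wave_le _ _ _)
  have hint : Integrable fun η => m η * (starRingEnd ℂ) (m η) * (starRingEnd ℂ) (wave lam F η) :=
    hw.integrable.mul_bdd (Complex.continuous_conj.comp_aestronglyMeasurable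
      (stronglyMeasurable_wave h.measurable_lam hF).aestronglyMeasurable)
      (Filter.Eventually.of_forall fun η => by simpa using norm_wave_le lam F η)
  have e1 : eLpNorm (fun η => m η * wave lam F η) 2 volume ^ 2 =
      ‖∫ η, (m η * (starRingEnd ℂ) (m η) * (starRingEnd ℂ) (wave lam F η)) * wave lam F η‖ₑ := by
    have e2 : ∀ η, (m η * (starRingEnd ℂ) (m η) * (starRingEnd ℂ) (wave lam F η)) * wave lam F η =
        ((‖m η * wave lam F η‖ ^ 2 : ℝ) : ℂ) := by
      intro η
      rw [Complex.ofReal_pow, ← Complex.mul_conj', map_mul]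
      ring
    simp_rw [e2]
    rw [integral_complex_ofReal, ← ofReal_norm, Complex.norm_real, ofReal_norm,
      Real.enorm_eq_ofReal (integral_nonneg fun _ => by positivity)]
    rw [ofReal_integral_eq_lintegral_ofReal
      ((memLp_two_iff_integrable_sq_norm hmem.1).1 hmem)
      (Filter.Eventually.of_forall fun _ => by positivity),
      eLpNorm_eq_lintegral_rpow_enorm_toReal (by norm_num) (by norm_num), ← ENNReal.rpow_natCast,
      ← ENNReal.rpow_mul]
    norm_num
    refine lintegral_congr fun η => ?_
    rw [← norm_mul, ← enorm_mul, ← ofReal_norm, ENNReal.ofReal_pow (norm_nonneg _)]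
  -- The T T* identity: the squared norm is a double time integral of pairings with the operators of
  -- symbol e^{i(t-s)λ}|m|², to which the form estimate applies.
  have e3 : ∫ η, (m η * (starRingEnd ℂ) (m η) * (starRingEnd ℂ) (wave lam F η)) * wave lam F η =
      ∫ t, ∫ s, ∫ x, conv lam (fun η => m η * (starRingEnd ℂ) (m η)) (t - s)
        ((fun s y => (starRingEnd ℂ) (F s y)) s) x * F t x := by
    rw [← integral_kern_mul h.measurable_lam hint hF]
    have e4 : ∀ t x, kern lam (fun η => m η * (starRingEnd ℂ) (m η) *
        (starRingEnd ℂ) (wave lam F η)) t x =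
        full lam (fun η => m η * (starRingEnd ℂ) (m η)) (fun s y => (starRingEnd ℂ) (F s y)) t x := by
      intro t x
      rw [full_eq_kern h.measurable_lam hw.integrable hF']
      simp only [RingHomCompTriple.comp_apply, RingHom.id_apply]
    simp_rw [e4]
    have hI : Integrable (fun z : ℝ × Space d => full lam (fun η => m η * (starRingEnd ℂ) (m η))
        (fun s y => (starRingEnd ℂ) (F s y)) z.1 z.2 * F z.1 z.2) (volume.prod volume) := by
      simp_rw [← e4]
      exact (hF.integrable volume).bdd_mul
        (continuous_kern h.measurable_lam hint).aestronglyMeasurable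
        (Filter.Eventually.of_forall fun z => norm_kern_le _ _ _ _)
    refine (integral_prod _ hI).trans ?_
    congr 1; ext t
    exact integral_full_mul h.measurable_lam hw.integrable hF' (hF.slice t) t
  have h5 : eLpNorm (fun η => m η * wave lam F η) 2 volume ^ 2 ≤
      (ENNReal.ofReal √(K₂ * max 1 K₁) * strichConst σ D μ₁ μ₂ θ q E *
            mixedNorm q.conjExponent r.conjExponent F) ^ 2 := by
    rw [e1, e3]
    refine (enorm_integral_le_lintegral_enorm _).trans ?_
    refine (lintegral_mono fun t => enorm_integral_le_lintegral_enorm _).trans ?_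
    refine hform.trans ?_
    have e6 : (E * E) ^ (1 - θ) = (E ^ (1 - θ)) ^ 2 := by
      rw [ENNReal.mul_rpow_of_nonneg _ _ (by linarith), sq]
    have e7 : ENNReal.ofReal (K₁ * (D * μ₁ ^ (1 - 2 * recip r))) ^ θ *
        ENNReal.ofReal (μ₂ ^ (-(2 * recip q))) ≤ ENNReal.ofReal (max 1 K₁) *
          (ENNReal.ofReal D ^ (θ / 2) * ENNReal.ofReal ((μ₁ ^ (1 / σ) * μ₂⁻¹) ^ recip q)) ^ 2 := by
      rw [ENNReal.ofReal_rpow_of_nonneg (by positivity) hθ0,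
        ENNReal.ofReal_rpow_of_nonneg hD (by positivity), ← ENNReal.ofReal_mul (by positivity),
        ← ENNReal.ofReal_mul (by positivity), ← ENNReal.ofReal_pow (by positivity),
        ← ENNReal.ofReal_mul (by positivity)]
      apply ENNReal.ofReal_le_ofReal
      have hk : K₁ ^ θ ≤ max 1 K₁ := by
        calc K₁ ^ θ ≤ (max 1 K₁) ^ θ := by gcongr; exact le_max_right _ _
          _ ≤ (max 1 K₁) ^ (1:ℝ) := Real.rpow_le_rpow_of_exponent_le (le_max_left _ _) hθ1
          _ = _ := Real.rpow_one _
      have hd : (D ^ (θ / 2)) ^ 2 = D ^ θ := by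
        rw [← Real.rpow_natCast, ← Real.rpow_mul hD]; congr 1; push_cast; ring
      -- By θσ(1-2/r) = 2/q the power of μ₁ from the decay estimate becomes a power of μ₁^{1/σ},
      -- with the same exponent 2/q as the power of μ₂^{-1}.
      have hm1 : ((μ₁ ^ (1 / σ) * μ₂⁻¹) ^ recip q) ^ 2 =
          (μ₁ ^ (1 - 2 * recip r)) ^ θ * μ₂ ^ (-(2 * recip q)) := by
        rw [← Real.rpow_natCast, ← Real.rpow_mul (by positivity),
          Real.mul_rpow (by positivity) (by positivity), ← Real.rpow_mul hμ₁.le,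
          ← Real.rpow_mul hμ₁.le, Real.inv_rpow hμ₂.le, Real.rpow_neg hμ₂.le]
        congr 2
        · push_cast
          field_simp
          linarith
        · push_cast; ring_nf
      rw [mul_pow, hd, hm1, Real.mul_rpow hK₁.le (by positivity), Real.mul_rpow hD (by positivity)]
      calc _ = K₁ ^ θ * (D ^ θ * ((μ₁ ^ (1 - 2 * recip r)) ^ θ * μ₂ ^ (-(2 * recip q)))) := by ring
        _ ≤ _ := by gcongr
    have e8 : ENNReal.ofReal √(K₂ * max 1 K₁) ^ 2 = ENNReal.ofReal K₂ * ENNReal.ofReal (max 1 K₁) := by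
      rw [← ENNReal.ofReal_pow (by positivity), Real.sq_sqrt (by positivity),
        ENNReal.ofReal_mul hK₂.le]
    calc _ = ENNReal.ofReal K₂ * ((E ^ (1 - θ)) ^ 2 *
          (ENNReal.ofReal (K₁ * (D * μ₁ ^ (1 - 2 * recip r))) ^ θ *
            ENNReal.ofReal (μ₂ ^ (-(2 * recip q))))) *
            mixedNorm q.conjExponent r.conjExponent F * mixedNorm q.conjExponent r.conjExponent F := by
          rw [e6]; ring
      _ ≤ ENNReal.ofReal K₂ * ((E ^ (1 - θ)) ^ 2 * (ENNReal.ofReal (max 1 K₁) *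
          (ENNReal.ofReal D ^ (θ / 2) * ENNReal.ofReal ((μ₁ ^ (1 / σ) * μ₂⁻¹) ^ recip q)) ^ 2)) *
            mixedNorm q.conjExponent r.conjExponent F * mixedNorm q.conjExponent r.conjExponent F := by
          gcongr
      _ = _ := by
          rw [strichConst]
          calc _ = (ENNReal.ofReal K₂ * ENNReal.ofReal (max 1 K₁)) * (ENNReal.ofReal D ^ (θ / 2) *
                E ^ (1 - θ) * ENNReal.ofReal ((μ₁ ^ (1 / σ) * μ₂⁻¹) ^ recip q) *
                mixedNorm q.conjExponent r.conjExponent F) ^ 2 := by ring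
            _ = _ := by rw [← e8]; ring
  exact (ENNReal.pow_le_pow_left_iff two_ne_zero).1 h5

end Strichartz

/-! ### Fatou's lemma and the converse of Hölder's inequality in time. -/

namespace Strichartz

variable {d : ℕ}

/-- Fatou's lemma for `L^q` norms of nonnegative functions. -/
lemma eLpNorm_le_of_le_liminf {X : Type*} [MeasurableSpace X] {μ : Measure X} {N : X → ℝ≥0∞}
    {f : ℕ → X → ℝ≥0∞} (hf : ∀ n, Measurable (f n)) {q A : ℝ≥0∞}
    (hA : ∀ n, eLpNorm (f n) q μ ≤ A) (hN : ∀ x, N x ≤ Filter.liminf (fun n => f n x) Filter.atTop) :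
    eLpNorm N q μ ≤ A := by
  by_cases h0 : q = 0
  · simp [h0]
  by_cases ht : q = ∞
  · subst ht
    rw [eLpNorm_exponent_top]
    refine essSup_le_of_ae_le A ?_
    have : ∀ᵐ x ∂μ, ∀ n, f n x ≤ A := by
      rw [ae_all_iff]
      intro n
      have := ae_le_eLpNormEssSup (f := f n) (μ := μ)
      rw [← eLpNorm_exponent_top] at this
      filter_upwards [this] with x hx using hx.trans (hA n)
    filter_upwards [this] with x hx
    refine (hN x).trans ?_
    refine (Filter.liminf_le_liminf (Filter.Eventually.of_forall hx)).trans_eq ?_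
    simp
  · have hq0 : 0 < q.toReal := ENNReal.toReal_pos h0 ht
    rw [eLpNorm_eq_lintegral_rpow_enorm_toReal h0 ht]
    rw [one_div, ENNReal.rpow_inv_le_iff hq0]
    calc ∫⁻ x, ‖N x‖ₑ ^ q.toReal ∂μ
        ≤ ∫⁻ x, Filter.liminf (fun n => f n x ^ q.toReal) Filter.atTop ∂μ := by
          refine lintegral_mono fun x => ?_
          have := (ENNReal.orderIsoRpow q.toReal hq0).liminf_apply (f := Filter.atTop)
            (u := fun n => f n x)
          simp only [ENNReal.orderIsoRpow_apply] at this
          rw [← this]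
          exact ENNReal.rpow_le_rpow (hN x) hq0.le
      _ ≤ Filter.liminf (fun n => ∫⁻ x, f n x ^ q.toReal ∂μ) Filter.atTop :=
          lintegral_liminf_le fun n => (hf n).pow_const _
      _ ≤ Filter.liminf (fun _ : ℕ => A ^ q.toReal) Filter.atTop := by
          refine Filter.liminf_le_liminf (Filter.Eventually.of_forall fun n => ?_)
          have := hA n
          rw [eLpNorm_eq_lintegral_rpow_enorm_toReal h0 ht, one_div, ENNReal.rpow_inv_le_iff hq0] at this
          exact this
      _ = _ := by simp

/-- The converse of Hölder's inequality in time. -/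
lemma eLpNorm_le_of_forall_lintegral_mul_le {N : ℝ → ℝ≥0∞} (hN : Measurable N) {q A : ℝ≥0∞}
    (hq : 2 ≤ q) (h : ∀ φ : ℝ → ℝ≥0∞, Measurable φ → (∃ B, B ≠ ∞ ∧ ∀ t, φ t ≤ B) →
      (∃ R : ℝ, ∀ t, R < |t| → φ t = 0) → ∫⁻ t, N t * φ t ≤ A * eLpNorm φ q.conjExponent volume) :
    eLpNorm N q volume ≤ A := by
  by_cases ht : q = ∞
  · subst ht
    rw [conjExponent_top] at h
    rw [eLpNorm_exponent_top]
    refine essSup_le_of_ae_le A ?_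
    refine ae_le_of_forall_setLIntegral_le_of_sigmaFinite hN fun s hs _ => ?_
    -- Test functions must have bounded support, so the set is cut to [-n, n] and recovered by
    -- monotone convergence.
    have hmono : ∀ n : ℕ, ∫⁻ t in s ∩ Icc (-n : ℝ) n, N t ≤ A * volume s := by
      intro n
      have hm : MeasurableSet (s ∩ Icc (-n : ℝ) n) := hs.inter measurableSet_Icc
      have := h ((s ∩ Icc (-n : ℝ) n).indicator 1) (measurable_one.indicator hm)
        ⟨1, by simp, fun t => indicator_le_self' (fun _ _ => zero_le) t⟩
        ⟨n, fun t htn => indicator_of_notMem (fun hmem => by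
          have := abs_le.2 hmem.2
          linarith) _⟩
      rw [eLpNorm_one_eq_lintegral_enorm] at this
      simp only [enorm_eq_self] at this
      rw [lintegral_indicator_one hm] at this
      calc _ = ∫⁻ t, N t * (s ∩ Icc (-n : ℝ) n).indicator 1 t := by
            rw [← lintegral_indicator hm]
            refine lintegral_congr fun t => ?_
            by_cases htm : t ∈ s ∩ Icc (-n : ℝ) n <;> simp [indicator, htm]
        _ ≤ _ := this
        _ ≤ _ := by gcongr; exact inter_subset_left
    have hU : s = ⋃ n : ℕ, s ∩ Icc (-n : ℝ) n := by
      ext t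
      simp only [mem_iUnion, mem_inter_iff, mem_Icc, exists_and_left]
      refine ⟨fun hts => ⟨hts, ?_⟩, fun hts => hts.1⟩
      obtain ⟨n, hn⟩ := exists_nat_gt |t|
      exact ⟨n, abs_le.1 hn.le⟩
    have hdir : Directed (· ⊆ ·) fun n : ℕ => s ∩ Icc (-n : ℝ) n := by
      refine Monotone.directed_le (f := fun n : ℕ => s ∩ Icc (-n : ℝ) n) fun a b hab => ?_
      have : (a:ℝ) ≤ b := by exact_mod_cast hab
      exact inter_subset_inter_right _ (Icc_subset_Icc (by linarith) this)
    rw [setLIntegral_const]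
    conv_lhs => rw [hU]
    rw [setLIntegral_iUnion_of_directed _ hdir]
    exact iSup_le hmono
  · have hq0 : q ≠ 0 := (lt_of_lt_of_le (by norm_num) hq).ne'
    have hp2 : 2 ≤ q.toReal := by simpa using ENNReal.toReal_mono ht hq
    have hc := toReal_conjExponent hq
    rw [recip_eq_inv_toReal] at hc
    set p := q.toReal with hp
    have hp0 : 0 < p := by linarith
    have hc' : q.conjExponent.toReal = p / (p - 1) := by
      rw [hc]
      have : p - 1 ≠ 0 := by linarith
      field_simp
    have hp1 : 0 < p - 1 := by linarith
    refine eLpNorm_le_of_le_liminf (f := fun n t =>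
      (Icc (-n : ℝ) n).indicator (fun t => min (N t) n) t)
      (fun n => (hN.min measurable_const).indicator measurableSet_Icc) (fun n => ?_) (fun t => ?_)
    · set f : ℝ → ℝ≥0∞ := (Icc (-n : ℝ) n).indicator (fun t => min (N t) n) with hf
      have hfm : Measurable f := (hN.min measurable_const).indicator measurableSet_Icc
      have hfN : ∀ t, f t ≤ N t := fun t => by
        by_cases htm : t ∈ Icc (-n : ℝ) n
        · simp [hf, htm]
        · simp only [hf, indicator_of_notMem htm]; exact zero_le
      have hfn : ∀ t, f t ≤ n := fun t => by
        by_cases htm : t ∈ Icc (-n : ℝ) n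
        · simp [hf, htm]
        · simp only [hf, indicator_of_notMem htm]; exact zero_le
      have hf0 : ∀ t, (n:ℝ) < |t| → f t = 0 := fun t htn =>
        indicator_of_notMem (fun hmem => by have := abs_le.2 hmem; linarith) _
      -- The extremal test function for the truncation f of N. It yields I ≤ A I^{1-1/p}, and since
      -- the truncation makes I finite one may divide.
      have h1 := h (fun t => f t ^ (p - 1)) (hfm.pow_const _)
        ⟨(n:ℝ≥0∞) ^ (p - 1), ENNReal.rpow_ne_top_of_nonneg hp1.le (by simp),
          fun t => ENNReal.rpow_le_rpow (hfn t) hp1.le⟩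
        ⟨n, fun t htn => by rw [hf0 t htn, ENNReal.zero_rpow_of_pos hp1]⟩
      set I := ∫⁻ t, f t ^ p with hI
      have hIfin : I ≠ ∞ := by
        have : I ≤ ∫⁻ t, (Icc (-n : ℝ) n).indicator (fun _ => (n:ℝ≥0∞) ^ p) t := by
          refine lintegral_mono fun t => ?_
          by_cases htm : t ∈ Icc (-n : ℝ) n
          · rw [indicator_of_mem htm]; exact ENNReal.rpow_le_rpow (hfn t) hp0.le
          · rw [hf, indicator_of_notMem htm, ENNReal.zero_rpow_of_pos hp0]; exact zero_le
        refine (this.trans_lt ?_).ne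
        rw [lintegral_indicator_const measurableSet_Icc]
        refine ENNReal.mul_lt_top (lt_top_iff_ne_top.2
          (ENNReal.rpow_ne_top_of_nonneg hp0.le (by simp))) (by simp)
      have h2 : I ≤ A * I ^ (1 - 1 / p) := by
        calc I ≤ ∫⁻ t, N t * f t ^ (p - 1) := by
              refine lintegral_mono fun t => ?_
              calc f t ^ p = f t ^ (1:ℝ) * f t ^ (p - 1) := by
                    rw [← ENNReal.rpow_add_of_nonneg _ _ (by norm_num) hp1.le]; congr 1; ring
                _ ≤ _ := by rw [ENNReal.rpow_one]; gcongr; exact hfN t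
          _ ≤ _ := h1
          _ = _ := by
              congr 1
              rw [eLpNorm_eq_lintegral_rpow_enorm_toReal
                (zero_lt_one.trans_le (one_le_conjExponent q)).ne' (conjExponent_ne_top hq), hc']
              simp only [enorm_eq_self, ← ENNReal.rpow_mul]
              rw [mul_div_cancel₀ _ hp1.ne']
              congr 1
              field_simp
      rw [eLpNorm_eq_lintegral_rpow_enorm_toReal hq0 ht]
      simp only [enorm_eq_self]
      change I ^ (1 / p) ≤ A
      by_cases hI0 : I = 0
      · rw [hI0, ENNReal.zero_rpow_of_pos (by positivity)]; exact zero_le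
      · have hne : I ^ (1 - 1 / p) ≠ 0 := by
          rw [Ne, ENNReal.rpow_eq_zero_iff]
          simp [hI0, hIfin]
        have hnt : I ^ (1 - 1 / p) ≠ ∞ := by
          rw [Ne, ENNReal.rpow_eq_top_iff]
          simp [hI0, hIfin]
        refine (ENNReal.mul_le_mul_iff_left hne hnt).1 (le_trans (le_of_eq ?_) h2)
        rw [← ENNReal.rpow_add _ _ hI0 hIfin]
        simp
    · have hev : (fun n : ℕ => min (N t) n) =ᶠ[Filter.atTop]
          fun n : ℕ => (Icc (-n : ℝ) n).indicator (fun t => min (N t) n) t := by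
        obtain ⟨n₀, hn₀⟩ := exists_nat_gt |t|
        filter_upwards [Filter.eventually_ge_atTop n₀] with n hn
        have : |t| ≤ n := hn₀.le.trans (by exact_mod_cast hn)
        rw [indicator_of_mem (show t ∈ Icc (-n : ℝ) n from abs_le.1 this)]
      rw [← Filter.liminf_congr hev]
      have htend : Filter.Tendsto (fun n : ℕ => min (N t) n) Filter.atTop (nhds (min (N t) ∞)) :=
        tendsto_const_nhds.min ENNReal.tendsto_nat_nhds_top
      rw [htend.liminf_eq, min_eq_left le_top]

lemma measurable_sign {X : Type*} [MeasurableSpace X] {u : X → ℂ} (hu : Measurable u) :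
    Measurable fun x => (starRingEnd ℂ) (u x) / (‖u x‖ : ℂ) :=
  (Complex.continuous_conj.measurable.comp hu).div (Complex.measurable_ofReal.comp hu.norm)

/-- Pairing with normalized weights in space, integrated in time. -/
lemma eLpNorm_lintegral_mul_weight_le {u : ℝ → Space d → ℂ}
    (hu : Measurable fun p : ℝ × Space d => u p.1 p.2) {q r A : ℝ≥0∞} (hq : 2 ≤ q)
    (h : ∀ G : ℝ → Space d → ℂ, NiceST G → ‖∫ z : ℝ × Space d, u z.1 z.2 * G z.1 z.2‖ₑ ≤
      A * mixedNorm q.conjExponent r.conjExponent G) (hub : ∃ B, ∀ t x, ‖u t x‖ ≤ B)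
    {g : ℝ → Space d → ℝ≥0∞} (hg : Measurable fun p : ℝ × Space d => g p.1 p.2)
    (hgb : ∃ B, B ≠ ∞ ∧ ∀ t x, g t x ≤ B) (hgs : ∃ R : ℝ, ∀ t x, R < ‖x‖ → g t x = 0)
    (hg1 : ∀ t, eLpNorm (g t) r.conjExponent volume ≤ 1) :
    eLpNorm (fun t => ∫⁻ x, ‖u t x‖ₑ * g t x) q volume ≤ A := by
  obtain ⟨B, hB, hgB⟩ := hgb
  obtain ⟨R, hR⟩ := hgs
  obtain ⟨U, hU⟩ := hub
  have hmu : Measurable fun p : ℝ × Space d => ‖u p.1 p.2‖ₑ * g p.1 p.2 := hu.enorm.mul hg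
  refine eLpNorm_le_of_forall_lintegral_mul_le hmu.lintegral_prod_right' hq fun φ hφ hφb hφs => ?_
  obtain ⟨Bφ, hBφ, hφB⟩ := hφb
  obtain ⟨Rφ, hRφ⟩ := hφs
  -- The conjugate sign of u turns the pairing into the integral of |u| g φ. Where u vanishes the
  -- quotient is 0 by the convention on division, which does no harm.
  set G : ℝ → Space d → ℂ := fun t x =>
    (starRingEnd ℂ) (u t x) / (‖u t x‖ : ℂ) * ((g t x * φ t).toReal : ℂ) with hG
  have hfin : ∀ t x, g t x * φ t ≠ ∞ := fun t x =>
    ((mul_le_mul' (hgB t x) (hφB t)).trans_lt (ENNReal.mul_lt_top (lt_top_iff_ne_top.2 hB)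
      (lt_top_iff_ne_top.2 hBφ))).ne
  have hsgn : ∀ t x, ‖(starRingEnd ℂ) (u t x) / (‖u t x‖ : ℂ)‖ ≤ 1 := fun t x => by
    rw [norm_div, RCLike.norm_conj, Complex.norm_real, norm_norm]
    exact div_self_le_one _
  have hGn : ∀ t x, ‖G t x‖ₑ ≤ g t x * φ t := fun t x => by
    rw [← ENNReal.ofReal_toReal (hfin t x), ← ofReal_norm]
    apply ENNReal.ofReal_le_ofReal
    rw [hG, norm_mul, Complex.norm_real, Real.norm_of_nonneg ENNReal.toReal_nonneg]
    exact mul_le_of_le_one_left ENNReal.toReal_nonneg (hsgn t x)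
  have hGnice : NiceST G := by
    refine ⟨?_, ⟨(B * Bφ).toReal, fun p => ?_⟩, ⟨max R Rφ, fun p hp => ?_⟩⟩
    · exact (measurable_sign hu).mul (Complex.measurable_ofReal.comp
        (hg.mul (hφ.comp measurable_fst)).ennreal_toReal)
    · rw [← toReal_enorm]
      exact ENNReal.toReal_mono (ENNReal.mul_ne_top hB hBφ)
        ((hGn p.1 p.2).trans (mul_le_mul' (hgB _ _) (hφB _)))
    · rw [Prod.norm_def, lt_max_iff] at hp
      have : g p.1 p.2 * φ p.1 = 0 := by
        rcases hp with hp | hp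
        · rw [hRφ p.1 (lt_of_le_of_lt (le_max_right _ _) hp), mul_zero]
        · rw [hR p.1 p.2 (lt_of_le_of_lt (le_max_left _ _) hp), zero_mul]
      simp only [hG, this, ENNReal.toReal_zero, Complex.ofReal_zero, mul_zero]
  have huG : ∀ t x, u t x * G t x = ((‖u t x‖ * (g t x * φ t).toReal : ℝ) : ℂ) := by
    intro t x
    simp only [hG]
    rw [← mul_assoc, mul_div_assoc', Complex.mul_conj', sq, Complex.ofReal_mul]
    congr 1
    by_cases h0 : (‖u t x‖ : ℂ) = 0
    · rw [h0]; simp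
    · field_simp
  have e1 : ‖∫ z : ℝ × Space d, u z.1 z.2 * G z.1 z.2‖ₑ =
      ∫⁻ t, (∫⁻ x, ‖u t x‖ₑ * g t x) * φ t := by
    simp_rw [huG]
    have hnn : 0 ≤ ∫ z : ℝ × Space d, ‖u z.1 z.2‖ * (g z.1 z.2 * φ z.1).toReal :=
      integral_nonneg fun z => by positivity
    rw [integral_complex_ofReal, ← ofReal_norm, Complex.norm_real, Real.norm_of_nonneg hnn,
      ofReal_integral_eq_lintegral_ofReal]
    · have hpt : ∀ z : ℝ × Space d, ENNReal.ofReal (‖u z.1 z.2‖ * (g z.1 z.2 * φ z.1).toReal) =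
          ‖u z.1 z.2‖ₑ * g z.1 z.2 * φ z.1 := fun z => by
        rw [ENNReal.ofReal_mul (norm_nonneg _), ENNReal.ofReal_toReal (hfin _ _), ofReal_norm,
          mul_assoc]
      simp_rw [hpt]
      have hmm : Measurable fun z : ℝ × Space d => ‖u z.1 z.2‖ₑ * g z.1 z.2 * φ z.1 :=
        hmu.mul (hφ.comp measurable_fst)
      rw [Measure.volume_eq_prod, lintegral_prod _ hmm.aemeasurable]
      refine lintegral_congr fun t => ?_
      dsimp only
      rw [lintegral_mul_const]
      have h' := hmu.comp (measurable_prodMk_left (x := t))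
      simp only [Function.comp_def] at h'
      exact h'
    · have hI : Integrable fun z : ℝ × Space d => u z.1 z.2 * G z.1 z.2 :=
        (hGnice.integrable volume).bdd_mul hu.aestronglyMeasurable
          (Filter.Eventually.of_forall fun z => hU z.1 z.2)
      have := hI.norm
      refine this.congr (Filter.Eventually.of_forall fun z => ?_)
      simp only [huG]
      rw [Complex.norm_real, Real.norm_of_nonneg (by positivity)]
    · exact Filter.Eventually.of_forall fun z => by positivity
  rw [← e1]
  refine (h G hGnice).trans ?_
  gcongr
  rw [mixedNorm]
  refine eLpNorm_mono_enorm fun t => ?_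
  simp only [enorm_eq_self]
  calc eLpNorm (G t) r.conjExponent volume ≤ φ t * eLpNorm (g t) r.conjExponent volume := by
        have hφt : φ t ≠ ∞ := ((hφB t).trans_lt (lt_top_iff_ne_top.2 hBφ)).ne
        have := eLpNorm_le_nnreal_smul_eLpNorm_of_ae_le_mul' (f := G t) (g := g t) (c := (φ t).toNNReal)
          (μ := volume) (Filter.Eventually.of_forall fun x => by
            rw [enorm_eq_self, ENNReal.coe_toNNReal hφt, mul_comm]
            exact hGn t x) r.conjExponent
        rwa [ENNReal.smul_def, ENNReal.coe_toNNReal hφt, smul_eq_mul] at this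
    _ ≤ φ t * 1 := by gcongr; exact hg1 t
    _ = φ t := mul_one _

end Strichartz

/-! ### The converse of Hölder's inequality in mixed norms, and the homogeneous estimate. -/

namespace Strichartz

variable {d : ℕ}

lemma monotone_indicator_closedBall (f : Space d → ℝ≥0∞) (x : Space d) :
    Monotone fun n : ℕ => (Metric.closedBall (0 : Space d) n).indicator f x := by
  intro a b hab
  refine indicator_le_indicator_of_subset (Metric.closedBall_subset_closedBall ?_)
    (fun _ => zero_le) x
  exact_mod_cast hab

lemma tendsto_lintegral_closedBall {f : Space d → ℝ≥0∞} (hf : Measurable f) :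
    Filter.Tendsto (fun n : ℕ => ∫⁻ x, (Metric.closedBall (0 : Space d) n).indicator f x)
      Filter.atTop (nhds (∫⁻ x, f x)) := by
  refine lintegral_tendsto_of_tendsto_of_monotone
    (fun n => (hf.indicator Metric.isClosed_closedBall.measurableSet).aemeasurable)
    (Filter.Eventually.of_forall fun x => monotone_indicator_closedBall f x)
    (Filter.Eventually.of_forall fun x => ?_)
  obtain ⟨n₀, hn₀⟩ := exists_nat_gt ‖x‖
  refine tendsto_const_nhds.congr' ?_
  filter_upwards [Filter.eventually_ge_atTop n₀] with n hn
  have : ‖x‖ ≤ n := hn₀.le.trans (by exact_mod_cast hn)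
  rw [indicator_of_mem (by simpa using this)]

lemma tendsto_inv_nat_succ :
    Filter.Tendsto (fun n : ℕ => ((n + 1 : ℕ) : ℝ≥0∞)⁻¹) Filter.atTop (nhds 0) :=
  ENNReal.tendsto_inv_nat_nhds_zero.comp (Filter.tendsto_add_atTop_nat 1)

/-- The converse of Hölder's inequality for mixed norms, finite exponent in space. -/
lemma mixedNorm_le_of_forall_pairing_aux {u : ℝ → Space d → ℂ}
    (hu : Measurable fun p : ℝ × Space d => u p.1 p.2) {q r A : ℝ≥0∞} (hq : 2 ≤ q) (hr : 2 ≤ r)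
    (hrt : r ≠ ∞)
    (h : ∀ G : ℝ → Space d → ℂ, NiceST G → ‖∫ z : ℝ × Space d, u z.1 z.2 * G z.1 z.2‖ₑ ≤
      A * mixedNorm q.conjExponent r.conjExponent G) (hub : ∃ B, ∀ t x, ‖u t x‖ ≤ B) :
    mixedNorm q r u ≤ A := by
  have hr0 : r ≠ 0 := (lt_of_lt_of_le (by norm_num) hr).ne'
  have hρ2 : 2 ≤ r.toReal := by simpa using ENNReal.toReal_mono hrt hr
  have hc := toReal_conjExponent hr
  rw [recip_eq_inv_toReal] at hc
  have hp0 : r.conjExponent ≠ 0 := (zero_lt_one.trans_le (one_le_conjExponent r)).ne'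
  have hpt := conjExponent_ne_top hr
  obtain ⟨B, hB⟩ := id hub
  have hB0 : ∀ t x, ‖u t x‖ₑ ≤ ENNReal.ofReal B := fun t x => by
    rw [← ofReal_norm]; exact ENNReal.ofReal_le_ofReal (hB t x)
  set ρ := r.toReal with hρ
  have hρ0 : 0 < ρ := by linarith
  have hρ1 : 0 < ρ - 1 := by linarith
  have hc' : r.conjExponent.toReal = ρ / (ρ - 1) := by rw [hc]; field_simp
  set κ : ℝ := 1 - 1 / ρ with hκ
  have hκ0 : 0 < κ := by
    rw [hκ, sub_pos, div_lt_one hρ0]; linarith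
  set v : ℕ → ℝ → Space d → ℝ≥0∞ := fun n t =>
    (Metric.closedBall (0 : Space d) n).indicator fun x => ‖u t x‖ₑ with hv
  have hvle : ∀ n t x, v n t x ≤ ‖u t x‖ₑ := fun n t x => indicator_le_self _ _ x
  have hvm : ∀ n, Measurable fun p : ℝ × Space d => v n p.1 p.2 := by
    intro n
    have e : (fun p : ℝ × Space d => v n p.1 p.2) =
        (Prod.snd ⁻¹' Metric.closedBall (0 : Space d) n).indicator fun p => ‖u p.1 p.2‖ₑ := by
      ext p; simp only [hv, indicator]; rfl
    rw [e]
    exact hu.enorm.indicator (measurable_snd Metric.isClosed_closedBall.measurableSet)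
  set J : ℕ → ℝ → ℝ≥0∞ := fun n t => ∫⁻ x, v n t x ^ ρ with hJ
  have hJm : ∀ n, Measurable (J n) := fun n => by
    have : Measurable fun p : ℝ × Space d => v n p.1 p.2 ^ ρ := (hvm n).pow_const ρ
    exact this.lintegral_prod_right'
  have hJfin : ∀ n t, J n t ≠ ∞ := by
    intro n t
    have : J n t ≤ ∫⁻ x, (Metric.closedBall (0 : Space d) n).indicator
        (fun _ => ENNReal.ofReal B ^ ρ) x := by
      refine lintegral_mono fun x => ?_
      simp only [hv]
      by_cases hx : x ∈ Metric.closedBall (0 : Space d) n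
      · rw [indicator_of_mem hx, indicator_of_mem hx]
        exact ENNReal.rpow_le_rpow (hB0 t x) hρ0.le
      · rw [indicator_of_notMem hx, ENNReal.zero_rpow_of_pos hρ0]; exact zero_le
    refine (this.trans_lt ?_).ne
    rw [lintegral_indicator_const Metric.isClosed_closedBall.measurableSet]
    exact ENNReal.mul_lt_top (ENNReal.rpow_lt_top_of_nonneg hρ0.le ENNReal.ofReal_ne_top)
      measure_closedBall_lt_top
  -- This factor normalizes the extremal weight v^{ρ-1} in L^{r'} at each time. It is put to zero
  -- where J < 1/(n+1) in order to stay bounded; as n grows, that cutoff only affects times at which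
  -- the slice of u vanishes.
  set c : ℕ → ℝ → ℝ≥0∞ := fun n t =>
    {t | ((n + 1 : ℕ) : ℝ≥0∞)⁻¹ ≤ J n t}.indicator (fun t => (J n t ^ κ)⁻¹) t with hcdef
  have hcm : ∀ n, Measurable (c n) := fun n =>
    ((hJm n).pow_const κ).inv.indicator (measurableSet_le measurable_const (hJm n))
  have hcb : ∀ n t, c n t ≤ ((n + 1 : ℕ) : ℝ≥0∞) ^ κ := by
    intro n t
    simp only [hcdef, indicator]
    split_ifs with hmem
    · rw [← ENNReal.inv_rpow]
      refine ENNReal.rpow_le_rpow ?_ hκ0.le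
      rw [ENNReal.inv_le_iff_inv_le]; exact hmem
    · exact zero_le
  have hcJ : ∀ n t, c n t * J n t ^ κ ≤ 1 := by
    intro n t
    simp only [hcdef, indicator]
    split_ifs with hmem
    · exact ENNReal.inv_mul_le_one _
    · simp
  set g : ℕ → ℝ → Space d → ℝ≥0∞ := fun n t x => v n t x ^ (ρ - 1) * c n t with hg
  have hN := fun n => eLpNorm_lintegral_mul_weight_le hu (r := r) hq h hub (g := g n)
    (((hvm n).pow_const _).mul ((hcm n).comp measurable_fst))
    ⟨ENNReal.ofReal B ^ (ρ - 1) * ((n + 1 : ℕ) : ℝ≥0∞) ^ κ,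
      ENNReal.mul_ne_top (ENNReal.rpow_ne_top_of_nonneg hρ1.le ENNReal.ofReal_ne_top)
        (ENNReal.rpow_ne_top_of_nonneg hκ0.le (by simp)),
      fun t x => mul_le_mul' (ENNReal.rpow_le_rpow ((hvle n t x).trans (hB0 t x)) hρ1.le)
        (hcb n t)⟩
    ⟨n, fun t x hx => by
      have : x ∉ Metric.closedBall (0 : Space d) n := by simpa using hx
      simp only [hg, hv]
      rw [indicator_of_notMem this, ENNReal.zero_rpow_of_pos hρ1, zero_mul]⟩
    (fun t => by
      rw [eLpNorm_eq_lintegral_rpow_enorm_toReal hp0 hpt, hc']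
      simp only [enorm_eq_self, hg]
      have hpow : ∀ x, (v n t x ^ (ρ - 1) * c n t) ^ (ρ / (ρ - 1)) =
          v n t x ^ ρ * c n t ^ (ρ / (ρ - 1)) := fun x => by
        rw [ENNReal.mul_rpow_of_nonneg _ _ (by positivity), ← ENNReal.rpow_mul,
          mul_div_cancel₀ _ hρ1.ne']
      simp_rw [hpow]
      have hvt : Measurable fun x => v n t x := by
        have h' := (hvm n).comp (measurable_prodMk_left (x := t))
        simp only [Function.comp_def] at h'
        exact h'
      rw [lintegral_mul_const _ (by exact hvt.pow_const _),
        ENNReal.mul_rpow_of_nonneg _ _ (by positivity), ← ENNReal.rpow_mul]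
      rw [show ρ / (ρ - 1) * (1 / (ρ / (ρ - 1))) = 1 by field_simp, ENNReal.rpow_one,
        show 1 / (ρ / (ρ - 1)) = κ by rw [hκ]; field_simp, mul_comm]
      exact hcJ n t)
  refine eLpNorm_le_of_le_liminf (f := fun n t => ∫⁻ x, ‖u t x‖ₑ * g n t x)
    (fun n => ?_) hN (fun t => ?_)
  · have : Measurable fun p : ℝ × Space d => ‖u p.1 p.2‖ₑ * g n p.1 p.2 :=
      hu.enorm.mul (((hvm n).pow_const _).mul ((hcm n).comp measurable_fst))
    exact this.lintegral_prod_right'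
  · have hut : Measurable fun x => u t x := by
      have h' := hu.comp (measurable_prodMk_left (x := t))
      simp only [Function.comp_def] at h'
      exact h'
    rw [eLpNorm_eq_lintegral_rpow_enorm_toReal hr0 hrt, ← hρ]
    set I := ∫⁻ x, ‖u t x‖ₑ ^ ρ with hI
    have hJI : Filter.Tendsto (fun n => J n t) Filter.atTop (nhds I) := by
      refine (tendsto_lintegral_closedBall (hut.enorm.pow_const ρ)).congr fun n => ?_
      refine lintegral_congr fun x => ?_
      simp only [hv, indicator]
      split_ifs
      · rfl
      · rw [ENNReal.zero_rpow_of_pos hρ0]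
    by_cases hI0 : I = 0
    · rw [hI0, ENNReal.zero_rpow_of_pos (by positivity)]; exact zero_le
    have hev : ∀ᶠ n in Filter.atTop, J n t ^ (1 / ρ) ≤ ∫⁻ x, ‖u t x‖ₑ * g n t x := by
      filter_upwards [tendsto_inv_nat_succ.eventually_lt hJI (pos_iff_ne_zero.2 hI0)] with n hn
      have hcn : c n t = (J n t ^ κ)⁻¹ := by
        simp only [hcdef]
        rw [indicator_of_mem (show t ∈ {t | ((n + 1 : ℕ) : ℝ≥0∞)⁻¹ ≤ J n t} from hn.le)]
      have hJ0 : J n t ≠ 0 := (lt_of_le_of_lt zero_le hn).ne'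
      calc J n t ^ (1 / ρ) = J n t * c n t := by
            rw [hcn, ← ENNReal.rpow_neg]
            nth_rewrite 2 [← ENNReal.rpow_one (J n t)]
            rw [← ENNReal.rpow_add _ _ hJ0 (hJfin n t)]
            congr 1; rw [hκ]; ring
        _ ≤ ∫⁻ x, v n t x ^ ρ * c n t := by
            have hvt : Measurable fun x => v n t x := by
              have h' := (hvm n).comp (measurable_prodMk_left (x := t))
              simp only [Function.comp_def] at h'
              exact h'
            rw [lintegral_mul_const _ (by exact hvt.pow_const _)]
        _ ≤ _ := by
            refine lintegral_mono fun x => ?_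
            simp only [hg, ← mul_assoc]
            gcongr
            calc v n t x ^ ρ = v n t x ^ (1:ℝ) * v n t x ^ (ρ - 1) := by
                  rw [← ENNReal.rpow_add_of_nonneg _ _ (by norm_num) hρ1.le]; congr 1; ring
              _ ≤ _ := by rw [ENNReal.rpow_one]; gcongr; exact hvle n t x
    have hlim : Filter.Tendsto (fun n => J n t ^ (1 / ρ)) Filter.atTop (nhds (I ^ (1 / ρ))) :=
      (ENNReal.continuous_rpow_const.tendsto I).comp hJI
    rw [← hlim.liminf_eq]
    exact Filter.liminf_le_liminf hev

/-- The converse of Hölder's inequality for mixed norms, `r = ∞`. -/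
lemma mixedNorm_top_le_of_forall_pairing {u : ℝ → Space d → ℂ}
    (hu : Measurable fun p : ℝ × Space d => u p.1 p.2) {q A : ℝ≥0∞} (hq : 2 ≤ q)
    (h : ∀ G : ℝ → Space d → ℂ, NiceST G → ‖∫ z : ℝ × Space d, u z.1 z.2 * G z.1 z.2‖ₑ ≤
      A * mixedNorm q.conjExponent 1 G) (hub : ∃ B, ∀ t x, ‖u t x‖ ≤ B) :
    mixedNorm q ∞ u ≤ A := by
  obtain ⟨B, hB⟩ := id hub
  set M : ℝ → ℝ≥0∞ := fun t => eLpNorm (u t) ∞ volume with hM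
  have hMm : Measurable M := measurable_eLpNorm_slice hu ∞
  have hMfin : ∀ t, M t ≠ ∞ := fun t => by
    refine ((eLpNormEssSup_le_of_ae_bound (C := B)
      (Filter.Eventually.of_forall fun x => hB t x)).trans_lt ENNReal.ofReal_lt_top).ne
  have hk : ∀ k : ℕ, eLpNorm (fun t => M t - ((k + 1 : ℕ) : ℝ≥0∞)⁻¹) q volume ≤ A := by
    intro k
    -- In L^∞ no extremal weight exists. Slightly below the essential supremum the superlevel set
    -- has positive measure, and its normalized indicator is nearly extremal; the loss 1/(k+1) is
    -- removed by Fatou in the limit k → ∞.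
    set b : ℝ → ℝ≥0∞ := fun t => M t - ((k + 1 : ℕ) : ℝ≥0∞)⁻¹ with hb
    have hbm : Measurable b := hMm.sub measurable_const
    set S : ℕ → Set (ℝ × Space d) := fun n =>
      {p | b p.1 < ‖u p.1 p.2‖ₑ} ∩ Prod.snd ⁻¹' Metric.closedBall (0 : Space d) n with hS
    have hSm : ∀ n, MeasurableSet (S n) := fun n =>
      (measurableSet_lt (hbm.comp measurable_fst) hu.enorm).inter
        (measurable_snd Metric.isClosed_closedBall.measurableSet)
    set J : ℕ → ℝ → ℝ≥0∞ := fun n t => volume (Prod.mk t ⁻¹' S n) with hJ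
    have hJm : ∀ n, Measurable (J n) := fun n => measurable_measure_prodMk_left (hSm n)
    have hJfin : ∀ n t, J n t ≠ ∞ := fun n t =>
      ((measure_mono (fun x hx => hx.2)).trans_lt (measure_closedBall_lt_top
        (x := (0 : Space d)) (r := n))).ne
    set c : ℕ → ℝ → ℝ≥0∞ := fun n t =>
      {t | ((n + 1 : ℕ) : ℝ≥0∞)⁻¹ ≤ J n t}.indicator (fun t => (J n t)⁻¹) t with hcdef
    have hcm : ∀ n, Measurable (c n) := fun n =>
      (hJm n).inv.indicator (measurableSet_le measurable_const (hJm n))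
    have hcb : ∀ n t, c n t ≤ ((n + 1 : ℕ) : ℝ≥0∞) := by
      intro n t
      simp only [hcdef, indicator]
      split_ifs with hmem
      · rw [ENNReal.inv_le_iff_inv_le]; exact hmem
      · exact zero_le
    set g : ℕ → ℝ → Space d → ℝ≥0∞ := fun n t x => (S n).indicator 1 (t, x) * c n t with hg
    have hind : ∀ n p, (S n).indicator (1 : ℝ × Space d → ℝ≥0∞) p ≤ 1 := fun n p =>
      indicator_le_self' (fun _ _ => zero_le) p
    have hslice : ∀ n t, ∫⁻ x, (S n).indicator (1 : ℝ × Space d → ℝ≥0∞) (t, x) = J n t := by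
      intro n t
      exact (lintegral_indicator_one (measurable_prodMk_left (hSm n)) :)
    have hindm : ∀ n t, Measurable fun x => (S n).indicator (1 : ℝ × Space d → ℝ≥0∞) (t, x) := by
      intro n t
      have h' := (measurable_one.indicator (hSm n)
        : Measurable ((S n).indicator (1 : ℝ × Space d → ℝ≥0∞))).comp
          (measurable_prodMk_left (x := t))
      simp only [Function.comp_def] at h'
      exact h'
    have hgm : ∀ n, Measurable fun p : ℝ × Space d => g n p.1 p.2 := fun n =>
      (measurable_one.indicator (hSm n)).mul ((hcm n).comp measurable_fst)
    have hN := fun n => eLpNorm_lintegral_mul_weight_le hu (r := ∞) hq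
      (by simpa only [conjExponent_top] using h) hub (g := g n) (hgm n)
      ⟨((n + 1 : ℕ) : ℝ≥0∞), by simp, fun t x =>
        (mul_le_mul' (hind n _) (hcb n t)).trans_eq (one_mul _)⟩
      ⟨n, fun t x hx => by
        have : (t, x) ∉ S n := fun hmem => by
          have := hmem.2
          simp only [mem_preimage, Metric.mem_closedBall, dist_zero_right] at this
          linarith
        simp only [hg]
        rw [indicator_of_notMem this, zero_mul]⟩
      (fun t => by
        rw [conjExponent_top, eLpNorm_one_eq_lintegral_enorm]
        simp only [enorm_eq_self, hg]
        rw [lintegral_mul_const _ (hindm n t), hslice]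
        simp only [hcdef, indicator]
        split_ifs
        · exact ENNReal.mul_inv_le_one _
        · simp)
    refine eLpNorm_le_of_le_liminf (f := fun n t => ∫⁻ x, ‖u t x‖ₑ * g n t x)
      (fun n => ?_) hN (fun t => ?_)
    · have : Measurable fun p : ℝ × Space d => ‖u p.1 p.2‖ₑ * g n p.1 p.2 := hu.enorm.mul (hgm n)
      exact this.lintegral_prod_right'
    · by_cases hM0 : M t = 0
      · simp [hM0, hb]
      have hut : Measurable fun x => u t x := by
        have h' := hu.comp (measurable_prodMk_left (x := t))
        simp only [Function.comp_def] at h'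
        exact h'
      have hblt : b t < M t := ENNReal.sub_lt_self (hMfin t) hM0 (by simp)
      set T : Set (Space d) := {x | b t < ‖u t x‖ₑ} with hT
      have hTm : MeasurableSet T := measurableSet_lt measurable_const hut.enorm
      have hT0 : volume T ≠ 0 := by
        intro h0
        refine absurd hblt (not_lt.2 ?_)
        refine essSup_le_of_ae_le (b t) ?_
        have : ∀ᵐ x, ¬ b t < ‖u t x‖ₑ := by rw [ae_iff]; simpa using h0
        filter_upwards [this] with x hx using not_lt.1 hx
      have hJT : Filter.Tendsto (fun n => J n t) Filter.atTop (nhds (volume T)) := by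
        have := tendsto_lintegral_closedBall (measurable_one.indicator hTm
          : Measurable (T.indicator (1 : Space d → ℝ≥0∞)))
        rw [lintegral_indicator_one hTm] at this
        refine this.congr fun n => ?_
        rw [← hslice]
        refine lintegral_congr fun x => ?_
        have hiff : (t, x) ∈ S n ↔ x ∈ T ∧ x ∈ Metric.closedBall (0 : Space d) n := Iff.rfl
        by_cases h1 : x ∈ Metric.closedBall (0 : Space d) n
        · rw [indicator_of_mem h1]
          by_cases h2 : x ∈ T
          · rw [indicator_of_mem h2, indicator_of_mem (hiff.2 ⟨h2, h1⟩)]; rfl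
          · rw [indicator_of_notMem h2, indicator_of_notMem fun h3 => h2 (hiff.1 h3).1]
        · rw [indicator_of_notMem h1, indicator_of_notMem fun h3 => h1 (hiff.1 h3).2]
      have hev : ∀ᶠ n in Filter.atTop, b t ≤ ∫⁻ x, ‖u t x‖ₑ * g n t x := by
        filter_upwards [tendsto_inv_nat_succ.eventually_lt hJT (pos_iff_ne_zero.2 hT0)] with n hn
        have hcn : c n t = (J n t)⁻¹ := by
          simp only [hcdef]
          rw [indicator_of_mem (show t ∈ {t | ((n + 1 : ℕ) : ℝ≥0∞)⁻¹ ≤ J n t} from hn.le)]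
        have hJ0 : J n t ≠ 0 := (lt_of_le_of_lt zero_le hn).ne'
        calc b t = b t * (J n t * c n t) := by
              rw [hcn, ENNReal.mul_inv_cancel hJ0 (hJfin n t), mul_one]
          _ = ∫⁻ x, b t * ((S n).indicator 1 (t, x) * c n t) := by
              rw [lintegral_const_mul _ (by exact (hindm n t).mul_const _),
                lintegral_mul_const _ (hindm n t), hslice]
          _ ≤ _ := by
              refine lintegral_mono fun x => ?_
              simp only [hg]
              by_cases hx : (t, x) ∈ S n
              · exact mul_le_mul_left hx.1.le _
              · rw [indicator_of_notMem hx]; simp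
      have := Filter.liminf_le_liminf hev
      simpa using this
  refine eLpNorm_le_of_le_liminf (f := fun k t => M t - ((k + 1 : ℕ) : ℝ≥0∞)⁻¹)
    (fun k => hMm.sub measurable_const) hk fun t => ?_
  have : Filter.Tendsto (fun k : ℕ => M t - ((k + 1 : ℕ) : ℝ≥0∞)⁻¹) Filter.atTop
      (nhds (M t - 0)) :=
    ENNReal.Tendsto.sub tendsto_const_nhds tendsto_inv_nat_succ (Or.inl (hMfin t))
  rw [this.liminf_eq, tsub_zero]

/-- The converse of Hölder's inequality for mixed norms. -/
lemma mixedNorm_le_of_forall_pairing {u : ℝ → Space d → ℂ}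
    (hu : Measurable fun p : ℝ × Space d => u p.1 p.2) {q r A : ℝ≥0∞} (hq : 2 ≤ q) (hr : 2 ≤ r)
    (hub : ∃ B, ∀ t x, ‖u t x‖ ≤ B)
    (h : ∀ G : ℝ → Space d → ℂ, NiceST G → ‖∫ z : ℝ × Space d, u z.1 z.2 * G z.1 z.2‖ₑ ≤
      A * mixedNorm q.conjExponent r.conjExponent G) :
    mixedNorm q r u ≤ A := by
  by_cases hrt : r = ∞
  · subst hrt
    rw [conjExponent_top] at h
    exact mixedNorm_top_le_of_forall_pairing hu hq h hub
  · exact mixedNorm_le_of_forall_pairing_aux hu hq hr hrt h hub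

/-- The homogeneous Strichartz estimate. -/
lemma exists_mixedNorm_kern_le (d : ℕ) {σ : ℝ} (hσ : 0 < σ) {q r : ℝ≥0∞}
    (hqr : Admissible σ q r) (he : ¬ IsEndpoint σ q r) : ∃ K : ℝ, 0 < K ∧
      ∀ {θ : ℝ}, IsTheta σ q r θ →
      ∀ {D μ₁ μ₂ : ℝ} {lam : Space d → ℝ} {m : Space d → ℂ}, KernelBounds σ D μ₁ μ₂ lam m →
      ∀ {E : ℝ≥0∞}, SpaceBound m r E → ∀ {g : Space d → ℂ}, MemLp g 2 volume →
        mixedNorm q r (kern lam fun η => m η * g η) ≤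
          ENNReal.ofReal K * strichConst σ D μ₁ μ₂ θ q E * eLpNorm g 2 volume := by
  obtain ⟨K, hK, hKb⟩ := exists_eLpNorm_wave_le d hσ hqr he
  refine ⟨K, hK, ?_⟩
  intro θ hθ D μ₁ μ₂ lam m h E hE g hg
  have hmg : Integrable fun η => m η * g η := (h.integrable_mul hg).1
  refine mixedNorm_le_of_forall_pairing (continuous_kern h.measurable_lam hmg).measurable hqr.1
    hqr.2.1 ⟨_, fun t x => norm_kern_le _ _ t x⟩ fun G hG => ?_
  -- After this duality the estimate is Cauchy–Schwarz in frequency together with the adjoint bound.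
  rw [integral_kern_mul h.measurable_lam hmg hG]
  have e : ∀ η, m η * g η * wave lam G η = g η * (m η * wave lam G η) := fun η => by ring
  simp_rw [e]
  have hw := stronglyMeasurable_wave h.measurable_lam hG
  refine (enorm_integral_mul_le (r := 2) hg.1
    (h.memLp_two.1.mul hw.aestronglyMeasurable) (by norm_num)).trans ?_
  rw [conjExponent_two]
  calc _ ≤ eLpNorm g 2 volume * (ENNReal.ofReal K * strichConst σ D μ₁ μ₂ θ q E *
            mixedNorm q.conjExponent r.conjExponent G) := by gcongr; exact hKb hθ h hE hG
    _ = _ := by ring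

end Strichartz

/-! ### Time cutoffs, and the inhomogeneous estimate without time ordering. -/

namespace Strichartz

variable {d : ℕ}

/-- The space-time convolution restricted to the pairs of times `(t, s) ∈ S`. -/
def cut (lam : Space d → ℝ) (w : Space d → ℂ) (S : Set (ℝ × ℝ)) (F : ℝ → Space d → ℂ) (t : ℝ)
    (x : Space d) : ℂ :=
  full lam w ((Prod.mk t ⁻¹' S).indicator F) t x

lemma indicator_apply_apply (T : Set ℝ) (F : ℝ → Space d → ℂ) (s : ℝ) (y : Space d) :
    T.indicator F s y = T.indicator (fun s => F s y) s := by
  classical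
  by_cases hs : s ∈ T <;> simp [hs]

lemma measurable_cut {lam : Space d → ℝ} (hlam : Measurable lam) {w : Space d → ℂ}
    (hw : Integrable w) {S : Set (ℝ × ℝ)} (hS : MeasurableSet S) {F : ℝ → Space d → ℂ}
    (hF : NiceST F) : Measurable fun p : ℝ × Space d => cut lam w S F p.1 p.2 := by
  have e : (fun q : (ℝ × Space d) × (ℝ × Space d) => kern lam w (q.1.1 - q.2.1) (q.1.2 - q.2.2) *
      (Prod.mk q.1.1 ⁻¹' S).indicator F q.2.1 q.2.2) =
      {q : (ℝ × Space d) × (ℝ × Space d) | (q.1.1, q.2.1) ∈ S}.indicator fun q =>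
        kern lam w (q.1.1 - q.2.1) (q.1.2 - q.2.2) * F q.2.1 q.2.2 := by
    ext q
    by_cases hq : (q.1.1, q.2.1) ∈ S
    · rw [indicator_of_mem (show q ∈ {q : (ℝ × Space d) × (ℝ × Space d) | (q.1.1, q.2.1) ∈ S} from hq),
        indicator_of_mem (show q.2.1 ∈ Prod.mk q.1.1 ⁻¹' S from hq)]
    · rw [indicator_of_notMem (show q ∉ {q : (ℝ × Space d) × (ℝ × Space d) | (q.1.1, q.2.1) ∈ S} from hq),
        indicator_of_notMem (show q.2.1 ∉ Prod.mk q.1.1 ⁻¹' S from hq)]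
      simp
  have hm : StronglyMeasurable fun q : (ℝ × Space d) × (ℝ × Space d) =>
      kern lam w (q.1.1 - q.2.1) (q.1.2 - q.2.2) * (Prod.mk q.1.1 ⁻¹' S).indicator F q.2.1 q.2.2 := by
    rw [e]
    refine StronglyMeasurable.indicator ?_ ?_
    · exact (continuous_kern_comp_sub hlam hw).stronglyMeasurable.mul
        (hF.measurable.comp measurable_snd).stronglyMeasurable
    · have : Measurable fun q : (ℝ × Space d) × (ℝ × Space d) => (q.1.1, q.2.1) := by fun_prop
      exact this hS
  exact hm.integral_prod_right.measurable

lemma norm_indicator_apply_le (T : Set ℝ) (F : ℝ → Space d → ℂ) (s : ℝ) (y : Space d) :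
    ‖T.indicator F s y‖ ≤ ‖F s y‖ := by
  rw [indicator_apply_apply]; exact norm_indicator_le_norm_self _ _

lemma norm_cut_le (lam : Space d → ℝ) (w : Space d → ℂ) {S : Set (ℝ × ℝ)} (hS : MeasurableSet S)
    {F : ℝ → Space d → ℂ} (hF : NiceST F) (t : ℝ) (x : Space d) :
    ‖cut lam w S F t x‖ ≤ (∫ η, ‖w η‖) * ∫ z : ℝ × Space d, ‖F z.1 z.2‖ := by
  have hF' := hF.restrict (measurable_prodMk_left (x := t) hS)
  refine (norm_full_le lam w hF' t x).trans ?_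
  have h0 : 0 ≤ ∫ η, ‖w η‖ := integral_nonneg fun _ => norm_nonneg _
  refine mul_le_mul_of_nonneg_left ?_ h0
  exact integral_mono (hF'.integrable volume).norm (hF.integrable volume).norm
    fun z => norm_indicator_apply_le _ _ _ _

/-- The modulus is taken after the space integration but inside both time integrals, so a cutoff in
(t, s) can simply be discarded. This settles the time ordering when both time exponents are 2. -/
lemma enorm_integral_cut_mul_le {lam : Space d → ℝ} (hlam : Measurable lam) {w : Space d → ℂ}
    (hw : Integrable w) {S : Set (ℝ × ℝ)} (hS : MeasurableSet S) {F G : ℝ → Space d → ℂ}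
    (hF : NiceST F) (hG : NiceST G) :
    ‖∫ z : ℝ × Space d, cut lam w S F z.1 z.2 * G z.1 z.2‖ₑ ≤
      ∫⁻ t, ∫⁻ s, ‖∫ x, conv lam w (t - s) (F s) x * G t x‖ₑ := by
  have hI : Integrable (fun z : ℝ × Space d => cut lam w S F z.1 z.2 * G z.1 z.2)
      (volume.prod volume) :=
    (hG.integrable volume).bdd_mul (measurable_cut hlam hw hS hF).aestronglyMeasurable
      (Filter.Eventually.of_forall fun z => norm_cut_le lam w hS hF z.1 z.2)
  have e := integral_prod _ hI
  rw [Measure.volume_eq_prod, e]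
  refine (enorm_integral_le_lintegral_enorm _).trans (lintegral_mono fun t => ?_)
  have hF' := hF.restrict (measurable_prodMk_left (x := t) hS)
  have := integral_full_mul hlam hw hF' (hG.slice t) t
  simp only [cut]
  rw [this]
  refine (enorm_integral_le_lintegral_enorm _).trans (lintegral_mono fun s => ?_)
  by_cases hs : s ∈ Prod.mk t ⁻¹' S
  · rw [indicator_of_mem hs]
  · rw [indicator_of_notMem hs]
    simp [conv]

lemma mixedNorm_add_le {u v : ℝ → Space d → ℂ}
    (hu : Measurable fun p : ℝ × Space d => u p.1 p.2)
    (hv : Measurable fun p : ℝ × Space d => v p.1 p.2) {q r : ℝ≥0∞} (hq : 1 ≤ q) (hr : 1 ≤ r) :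
    mixedNorm q r (fun t x => u t x + v t x) ≤ mixedNorm q r u + mixedNorm q r v := by
  have hs : ∀ {u : ℝ → Space d → ℂ}, (Measurable fun p : ℝ × Space d => u p.1 p.2) → ∀ t,
      AEStronglyMeasurable (u t) volume := fun {u} hu t => by
    have h' := hu.comp (measurable_prodMk_left (x := t))
    simp only [Function.comp_def] at h'
    exact h'.aestronglyMeasurable
  refine le_trans ?_ (eLpNorm_add_le (measurable_eLpNorm_slice hu r).aestronglyMeasurable
    (measurable_eLpNorm_slice hv r).aestronglyMeasurable hq)
  refine eLpNorm_mono_enorm fun t => ?_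
  simp only [enorm_eq_self, Pi.add_apply]
  exact eLpNorm_add_le (hs hu t) (hs hv t) hr

/-- Fatou's lemma in space and then in time. -/
lemma mixedNorm_le_of_tendsto {u : ℝ → Space d → ℂ} {f : ℕ → ℝ → Space d → ℂ}
    (hf : ∀ n, Measurable fun p : ℝ × Space d => f n p.1 p.2) {q r A : ℝ≥0∞}
    (hA : ∀ n, mixedNorm q r (f n) ≤ A)
    (hlim : ∀ t, ∀ᵐ x, Filter.Tendsto (fun n => f n t x) Filter.atTop (nhds (u t x))) :
    mixedNorm q r u ≤ A := by
  refine eLpNorm_le_of_le_liminf (f := fun n t => eLpNorm (f n t) r volume)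
    (fun n => measurable_eLpNorm_slice (hf n) r) hA fun t => ?_
  refine Lp.eLpNorm_lim_le_liminf_eLpNorm (fun n => ?_) _ (hlim t)
  have h' := (hf n).comp (measurable_prodMk_left (x := t))
  simp only [Function.comp_def] at h'
  exact h'.aestronglyMeasurable

/-- The untruncated inhomogeneous estimate. -/
lemma exists_mixedNorm_full_le (d : ℕ) {σ : ℝ} (hσ : 0 < σ) {q r q₁ r₁ : ℝ≥0∞}
    (hqr : Admissible σ q r) (he : ¬ IsEndpoint σ q r) (hqr₁ : Admissible σ q₁ r₁)
    (he₁ : ¬ IsEndpoint σ q₁ r₁) : ∃ K : ℝ, 0 < K ∧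
      ∀ {θ θ₁ : ℝ}, IsTheta σ q r θ → IsTheta σ q₁ r₁ θ₁ →
      ∀ {D μ₁ μ₂ : ℝ} {lam : Space d → ℝ} {m : Space d → ℂ}, KernelBounds σ D μ₁ μ₂ lam m →
      ∀ {E E₁ : ℝ≥0∞}, SpaceBound m r E → SpaceBound m r₁ E₁ →
      ∀ {F : ℝ → Space d → ℂ}, NiceST F →
        mixedNorm q r (full lam (fun η => m η * m η) F) ≤
          ENNReal.ofReal K * (strichConst σ D μ₁ μ₂ θ q E * strichConst σ D μ₁ μ₂ θ₁ q₁ E₁) *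
            mixedNorm q₁.conjExponent r₁.conjExponent F := by
  obtain ⟨K, hK, hKb⟩ := exists_mixedNorm_kern_le d hσ hqr he
  obtain ⟨K₁, hK₁, hKb₁⟩ := exists_eLpNorm_wave_le d hσ hqr₁ he₁
  refine ⟨K * K₁, by positivity, ?_⟩
  intro θ θ₁ hθ hθ₁ D μ₁ μ₂ lam m h E E₁ hE hE₁ F hF
  have hF' : NiceST fun s y => (starRingEnd ℂ) (F s y) := Nice.conj hF
  set W := wave lam fun s y => (starRingEnd ℂ) (F s y) with hW
  have hWm : AEStronglyMeasurable W volume :=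
    (stronglyMeasurable_wave h.measurable_lam hF').aestronglyMeasurable
  have hg : MemLp (fun η => m η * (starRingEnd ℂ) (W η)) 2 volume :=
    h.memLp_two.of_le_mul (c := ∫ z : ℝ × Space d, ‖(starRingEnd ℂ) (F z.1 z.2)‖)
      (h.memLp_two.1.mul (Complex.continuous_conj.comp_aestronglyMeasurable hWm))
      (Filter.Eventually.of_forall fun η => by
        rw [norm_mul, mul_comm, RCLike.norm_conj]; gcongr; exact norm_wave_le _ _ _)
  -- One factor of m belongs to the adjoint estimate and produces an L² datum; the other belongs to
  -- the homogeneous estimate applied to that datum.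
  have e1 : full lam (fun η => m η * m η) F =
      kern lam fun η => m η * (m η * (starRingEnd ℂ) (W η)) := by
    ext t x
    rw [full_eq_kern h.measurable_lam h.isWeight_sq.integrable hF]
    simp only [mul_assoc]
    rfl
  have e2 : eLpNorm (fun η => m η * (starRingEnd ℂ) (W η)) 2 volume =
      eLpNorm (fun η => m η * W η) 2 volume :=
    eLpNorm_congr_norm_ae (Filter.Eventually.of_forall fun η => by simp)
  have e3 : mixedNorm q₁.conjExponent r₁.conjExponent (fun s y => (starRingEnd ℂ) (F s y)) =
      mixedNorm q₁.conjExponent r₁.conjExponent F := by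
    simp only [mixedNorm, eLpNorm_conj]
  rw [e1]
  refine (hKb hθ h hE hg).trans ?_
  rw [e2, ENNReal.ofReal_mul hK.le]
  have h2 := hKb₁ hθ₁ h hE₁ hF'
  rw [e3] at h2
  calc _ ≤ ENNReal.ofReal K * strichConst σ D μ₁ μ₂ θ q E * (ENNReal.ofReal K₁ *
        strichConst σ D μ₁ μ₂ θ₁ q₁ E₁ * mixedNorm q₁.conjExponent r₁.conjExponent F) := by gcongr
    _ = _ := by ring

end Strichartz

/-! ### Dyadic decomposition of the set of ordered pairs of times. -/

namespace Strichartz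

variable {d : ℕ}

/-- The index of the dyadic interval of length `2^{-n}` that contains `Φ s`. -/
def dyad (Φ : ℝ → ℝ) (n : ℕ) (s : ℝ) : ℕ := ⌊2 ^ n * Φ s⌋₊

/-- The pairs of times in neighbouring dyadic intervals of generation `n` with the same parent. -/
def levelSet (Φ : ℝ → ℝ) (n : ℕ) : Set (ℝ × ℝ) :=
  {p | Odd (dyad Φ n p.1) ∧ dyad Φ n p.2 + 1 = dyad Φ n p.1}

/-- The index of the k-th ancestor of a dyadic interval is obtained by integer division, so that
generations are compared by integer arithmetic. -/
lemma dyad_add_div (Φ : ℝ → ℝ) (n k : ℕ) (s : ℝ) : dyad Φ (n + k) s / 2 ^ k = dyad Φ n s := by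
  rw [dyad, dyad]
  have := Nat.floor_div_natCast (2 ^ (n + k) * Φ s) (2 ^ k)
  rw [← this]
  congr 1
  push_cast
  rw [pow_add]
  field_simp

lemma dyad_mono {Φ : ℝ → ℝ} (hΦ : StrictMono Φ) (n : ℕ) : Monotone (dyad Φ n) := fun a b hab =>
  Nat.floor_mono (mul_le_mul_of_nonneg_left (hΦ.monotone hab) (by positivity))

lemma measurable_dyad {Φ : ℝ → ℝ} (hΦ : StrictMono Φ) (n : ℕ) : Measurable (dyad Φ n) :=
  (dyad_mono hΦ n).measurable

lemma measurableSet_levelSet {Φ : ℝ → ℝ} (hΦ : StrictMono Φ) (n : ℕ) :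
    MeasurableSet (levelSet Φ n) := by
  have h1 : Measurable fun p : ℝ × ℝ => dyad Φ n p.1 := (measurable_dyad hΦ n).comp measurable_fst
  have h2 : Measurable fun p : ℝ × ℝ => dyad Φ n p.2 := (measurable_dyad hΦ n).comp measurable_snd
  have h3 : MeasurableSet {k : ℕ | Odd k} := .of_discrete
  exact (h1 h3).inter (measurableSet_eq_fun (h2.add_const 1) h1)

lemma lt_of_mem_levelSet {Φ : ℝ → ℝ} (hΦ : StrictMono Φ) {n : ℕ} {t s : ℝ}
    (h : (t, s) ∈ levelSet Φ n) : s < t := by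
  by_contra hts
  have h1 := dyad_mono hΦ n (not_lt.1 hts)
  have h2 : dyad Φ n s + 1 = dyad Φ n t := h.2
  omega

/-- The siblings 2c and 2c+1 have a common parent, hence all ancestors in common. It follows that a
pair of times belongs to at most one level set. -/
lemma dyad_eq_of_mem_levelSet {Φ : ℝ → ℝ} {n k : ℕ} {t s : ℝ}
    (h : (t, s) ∈ levelSet Φ n) (hk : k < n) : dyad Φ k s = dyad Φ k t := by
  obtain ⟨⟨c, hc⟩, h2⟩ := h
  simp only at hc h2
  obtain ⟨j, rfl⟩ : ∃ j, n = k + (1 + j) := ⟨n - k - 1, by omega⟩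
  have e : k + (1 + j) = (k + j) + 1 := by ring
  rw [e] at hc h2
  have hs := dyad_add_div Φ (k + j) 1 s
  have ht := dyad_add_div Φ (k + j) 1 t
  rw [pow_one] at hs ht
  have : dyad Φ (k + j) s = dyad Φ (k + j) t := by omega
  rw [← dyad_add_div Φ k j s, ← dyad_add_div Φ k j t, this]

lemma eq_of_mem_levelSet {Φ : ℝ → ℝ} {n k : ℕ} {t s : ℝ}
    (h : (t, s) ∈ levelSet Φ n) (h' : (t, s) ∈ levelSet Φ k) : n = k := by
  rcases lt_trichotomy n k with hlt | heq | hlt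
  · have h1 := dyad_eq_of_mem_levelSet h' hlt
    have h2 : dyad Φ n s + 1 = dyad Φ n t := h.2
    omega
  · exact heq
  · have h1 := dyad_eq_of_mem_levelSet h hlt
    have h2 : dyad Φ k s + 1 = dyad Φ k t := h'.2
    omega

/-- Strict monotonicity separates the two times in some generation, but not in generation 0, which
has the single index 0 because Φ < 1. In the first generation that separates them they have the same
parent, so they are siblings and the later time has the odd index. -/
lemma exists_mem_levelSet {Φ : ℝ → ℝ} (hΦ : StrictMono Φ) (h0 : ∀ s, 0 ≤ Φ s) (h1 : ∀ s, Φ s < 1)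
    {t s : ℝ} (hst : s < t) : ∃ n, (t, s) ∈ levelSet Φ n := by
  classical
  have hex : ∃ n, dyad Φ n s ≠ dyad Φ n t := by
    have hpos : 0 < Φ t - Φ s := sub_pos.2 (hΦ hst)
    obtain ⟨n, hn⟩ := pow_unbounded_of_one_lt (1 / (Φ t - Φ s)) (by norm_num : (1:ℝ) < 2)
    refine ⟨n, fun heq => ?_⟩
    rw [div_lt_iff₀ hpos] at hn
    have a1 := Nat.lt_floor_add_one (2 ^ n * Φ t)
    have a2 := Nat.floor_le (mul_nonneg (by positivity : (0:ℝ) ≤ 2 ^ n) (h0 s))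
    rw [dyad, dyad] at heq
    rw [heq] at a2
    nlinarith
  have hz : ∀ s, dyad Φ 0 s = 0 := fun s => by
    rw [dyad, pow_zero, one_mul, Nat.floor_eq_zero]; exact h1 s
  have hspec := Nat.find_spec hex
  obtain ⟨k, hk⟩ : ∃ k, Nat.find hex = k + 1 := by
    refine Nat.exists_eq_succ_of_ne_zero fun hzero => ?_
    rw [hzero] at hspec
    exact hspec (by rw [hz, hz])
  have hprev : dyad Φ k s = dyad Φ k t := by
    by_contra hne
    have := Nat.find_min' hex hne
    omega
  rw [hk] at hspec
  have es := dyad_add_div Φ k 1 s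
  have et := dyad_add_div Φ k 1 t
  rw [pow_one] at es et
  have hm := dyad_mono hΦ (k + 1) hst.le
  refine ⟨k + 1, ?_, ?_⟩
  · simp only
    rw [Nat.odd_iff]; omega
  · simp only; omega

/-- A strictly increasing normalized distribution function that dominates a given density. -/
lemma exists_distribution {f : ℝ → ℝ≥0∞} (hf : Measurable f) (h0 : ∫⁻ s, f s ≠ 0)
    (hfin : ∫⁻ s, f s ≠ ∞) : ∃ Φ : ℝ → ℝ, StrictMono Φ ∧ (∀ s, 0 ≤ Φ s) ∧ (∀ s, Φ s < 1) ∧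
      ∀ a b : ℝ, a ≤ b → ∫⁻ s in {s | a ≤ Φ s ∧ Φ s < b}, f s ≤
        ENNReal.ofReal (b - a) * (2 * ∫⁻ s, f s) := by
  set I := ∫⁻ s, f s with hI
  -- Adding a positive density makes the distribution function strictly increasing even where f
  -- vanishes. Its weight I makes the total mass 2I, which is the source of the factor 2 in the
  -- bound.
  set ρ : ℝ → ℝ≥0∞ := ProbabilityTheory.gaussianPDF 0 1 with hρ
  have hρm : Measurable ρ := ProbabilityTheory.measurable_gaussianPDF 0 1
  have hρ1 : ∫⁻ s, ρ s = 1 := ProbabilityTheory.lintegral_gaussianPDF_eq_one 0 one_ne_zero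
  have hρ0 : ∀ s, 0 < ρ s := fun s => ProbabilityTheory.gaussianPDF_pos 0 one_ne_zero s
  have hgm : Measurable fun s => f s + I * ρ s := hf.add (hρm.const_mul I)
  set ν : Measure ℝ := volume.withDensity fun s => f s + I * ρ s with hν
  have hν1 : ν univ = 2 * I := by
    rw [hν, withDensity_apply _ MeasurableSet.univ, Measure.restrict_univ,
      lintegral_add_left hf, lintegral_const_mul _ hρm, hρ1, mul_one, two_mul]
  have h2I : 2 * I ≠ ∞ := ENNReal.mul_ne_top (by norm_num) hfin
  have h2I0 : 2 * I ≠ 0 := mul_ne_zero two_ne_zero h0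
  have hνf : IsFiniteMeasure ν := ⟨by rw [hν1]; exact lt_top_iff_ne_top.2 h2I⟩
  have hνpos : ∀ s t, s < t → 0 < ν (Ioc s t) := by
    intro s t hst
    rw [hν, withDensity_apply _ measurableSet_Ioc, setLIntegral_pos_iff hgm]
    have : Function.support (fun s => f s + I * ρ s) = univ := by
      ext x
      simp [h0, (hρ0 x).ne']
    rw [this, univ_inter, Real.volume_Ioc]
    simpa using hst
  have hatom : ∀ s, ν {s} = 0 := fun s =>
    (withDensity_absolutelyContinuous volume _) (by simp)
  set c := (2 * I).toReal with hc
  have hc0 : 0 < c := ENNReal.toReal_pos h2I0 h2I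
  have hsplit : ∀ s t, s ≤ t → ν.real (Iic t) = ν.real (Iic s) + ν.real (Ioc s t) := by
    intro s t hst
    rw [← measureReal_union _ measurableSet_Ioc, Iic_union_Ioc_eq_Iic hst]
    exact Set.disjoint_left.2 fun x hx hx' => absurd hx'.1 (not_lt.2 hx)
  have hIoc : ∀ s t, s < t → 0 < ν.real (Ioc s t) := fun s t hst =>
    ENNReal.toReal_pos (hνpos s t hst).ne' (measure_ne_top _ _)
  have hmono : StrictMono fun s => ν.real (Iic s) / c := by
    intro s t hst
    have := hIoc s t hst
    simp only
    rw [hsplit s t hst.le]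
    gcongr
    linarith
  have hle1 : ∀ s, ν.real (Iic s) / c ≤ 1 := fun s => by
    rw [div_le_one hc0, hc, ← hν1]
    exact measureReal_mono (subset_univ _)
  refine ⟨fun s => ν.real (Iic s) / c, hmono, fun s => by positivity, fun s => ?_, ?_⟩
  · exact (hmono (lt_add_one s)).trans_le (hle1 _)
  · intro a b hab
    set T : Set ℝ := {s | a ≤ ν.real (Iic s) / c ∧ ν.real (Iic s) / c < b} with hT
    have hTm : MeasurableSet T := by
      have hm := hmono.monotone.measurable
      exact (measurableSet_le measurable_const hm).inter (measurableSet_lt hm measurable_const)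
    have h1 : ∫⁻ s in T, f s ≤ ν T := by
      rw [hν, withDensity_apply _ hTm]
      exact lintegral_mono fun s => le_self_add
    refine h1.trans ?_
    -- A compact subset of T has a least and a greatest point, both in T, so its measure is at most
    -- an increment of the distribution function between two points of T. This avoids a discussion
    -- of the end points of T.
    rw [hTm.measure_eq_iSup_isCompact]
    refine iSup₂_le fun K hKT => iSup_le fun hK => ?_
    rcases K.eq_empty_or_nonempty with rfl | hne
    · simp
    obtain ⟨s, hsK, hs⟩ := hK.exists_isLeast hne
    obtain ⟨t, htK, ht⟩ := hK.exists_isGreatest hne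
    have hst : s ≤ t := hs htK
    have hKsub : K ⊆ Icc s t := fun x hx => ⟨hs hx, ht hx⟩
    have hIcc : ν (Icc s t) = ν (Ioc s t) := by
      refine le_antisymm ?_ (measure_mono Ioc_subset_Icc_self)
      rw [← Icc_union_Ioc_eq_Icc le_rfl hst, Icc_self]
      refine (measure_union_le _ _).trans ?_
      rw [hatom, zero_add]
    calc ν K ≤ ν (Ioc s t) := (measure_mono hKsub).trans_eq hIcc
      _ = ENNReal.ofReal (ν.real (Ioc s t)) := (ofReal_measureReal).symm
      _ ≤ ENNReal.ofReal ((b - a) * c) := by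
          apply ENNReal.ofReal_le_ofReal
          have h2 := (hKT hsK).1
          have h3 := (hKT htK).2
          rw [le_div_iff₀ hc0] at h2
          rw [div_lt_iff₀ hc0] at h3
          have := hsplit s t hst
          nlinarith
      _ = _ := by
          rw [ENNReal.ofReal_mul (by linarith), hc, ENNReal.ofReal_toReal h2I]

/-- The `L^q` norm of a function that is dominated at each point by one of `M` functions. -/
lemma eLpNorm_le_of_exists_le {N : ℝ → ℝ≥0∞} {M : ℕ} {f : ℕ → ℝ → ℝ≥0∞}
    (hf : ∀ j, Measurable (f j)) {q B : ℝ≥0∞} (hq : 1 ≤ q) (hB : ∀ j, eLpNorm (f j) q volume ≤ B)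
    (hN : ∀ t, N t = 0 ∨ ∃ j < M, N t ≤ f j t) :
    eLpNorm N q volume ≤ (M : ℝ≥0∞) ^ recip q * B := by
  by_cases ht : q = ∞
  · subst ht
    rw [recip_top, ENNReal.rpow_zero, one_mul, eLpNorm_exponent_top]
    refine essSup_le_of_ae_le B ?_
    have : ∀ᵐ x, ∀ j, f j x ≤ B := by
      rw [ae_all_iff]
      intro j
      have := ae_le_eLpNormEssSup (f := f j) (μ := volume)
      rw [← eLpNorm_exponent_top] at this
      filter_upwards [this] with x hx using hx.trans (hB j)
    filter_upwards [this] with t htB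
    rcases hN t with h | ⟨j, -, hj⟩
    · rw [h]; exact zero_le
    · exact hj.trans (htB j)
  · have hq0 : q ≠ 0 := (zero_lt_one.trans_le hq).ne'
    have hp0 : 0 < q.toReal := ENNReal.toReal_pos hq0 ht
    rw [eLpNorm_eq_lintegral_rpow_enorm_toReal hq0 ht, one_div, ENNReal.rpow_inv_le_iff hp0,
      ENNReal.mul_rpow_of_nonneg _ _ hp0.le, ← ENNReal.rpow_mul, recip_eq_inv_toReal,
      inv_mul_cancel₀ hp0.ne', ENNReal.rpow_one]
    calc ∫⁻ t, ‖N t‖ₑ ^ q.toReal ≤ ∫⁻ t, ∑ j ∈ Finset.range M, f j t ^ q.toReal := by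
          refine lintegral_mono fun t => ?_
          rw [enorm_eq_self]
          rcases hN t with h | ⟨j, hjM, hj⟩
          · rw [h, ENNReal.zero_rpow_of_pos hp0]; exact zero_le
          · exact (ENNReal.rpow_le_rpow hj hp0.le).trans
              (Finset.single_le_sum (f := fun j => f j t ^ q.toReal) (fun _ _ => zero_le)
                (Finset.mem_range.2 hjM))
      _ = ∑ j ∈ Finset.range M, ∫⁻ t, f j t ^ q.toReal :=
          lintegral_finsetSum _ fun j _ => (hf j).pow_const _
      _ ≤ ∑ _j ∈ Finset.range M, B ^ q.toReal := by
          refine Finset.sum_le_sum fun j _ => ?_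
          have := hB j
          rw [eLpNorm_eq_lintegral_rpow_enorm_toReal hq0 ht, one_div, ENNReal.rpow_inv_le_iff hp0] at this
          exact this
      _ = _ := by rw [Finset.sum_const, Finset.card_range, nsmul_eq_mul]

end Strichartz

/-! ### The Christ–Kiselev lemma. -/

namespace Strichartz

variable {d : ℕ}

/-- The retarded space-time convolution. -/
def ret (lam : Space d → ℝ) (w : Space d → ℂ) (F : ℝ → Space d → ℂ) : ℝ → Space d → ℂ :=
  cut lam w {p | p.2 < p.1} F

lemma measurableSet_snd_lt_fst : MeasurableSet {p : ℝ × ℝ | p.2 < p.1} :=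
  measurableSet_lt measurable_snd measurable_fst

lemma mixedNorm_indicator {p p₁ : ℝ≥0∞} (hp : p ≠ 0) (hpt : p ≠ ∞) (F : ℝ → Space d → ℂ)
    {T : Set ℝ} (hT : MeasurableSet T) :
    mixedNorm p p₁ (T.indicator F) =
      (∫⁻ s in T, eLpNorm (F s) p₁ volume ^ p.toReal) ^ (1 / p.toReal) := by
  have hp0 : 0 < p.toReal := ENNReal.toReal_pos hp hpt
  rw [mixedNorm, eLpNorm_eq_lintegral_rpow_enorm_toReal hp hpt, ← lintegral_indicator hT]
  congr 2
  ext s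
  by_cases hs : s ∈ T
  · rw [indicator_of_mem hs, indicator_of_mem hs, enorm_eq_self]
  · rw [indicator_of_notMem hs, indicator_of_notMem hs]
    simp [hp0]

lemma cut_eq_zero_of_mixedNorm_eq_zero {lam : Space d → ℝ} {w : Space d → ℂ}
    {S : Set (ℝ × ℝ)} {F : ℝ → Space d → ℂ} (hF : NiceST F) {p p₁ : ℝ≥0∞} (hp : p ≠ 0)
    (hp₁ : p₁ ≠ 0) (h : mixedNorm p p₁ F = 0) (t : ℝ) (x : Space d) : cut lam w S F t x = 0 := by
  have h1 : ∀ᵐ s, eLpNorm (F s) p₁ volume = 0 := by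
    rw [mixedNorm, eLpNorm_eq_zero_iff (measurable_eLpNorm_slice hF.measurable p₁).aestronglyMeasurable
      hp] at h
    exact h
  have h2 : ∀ᵐ z : ℝ × Space d ∂(volume.prod volume), F z.1 z.2 = 0 := by
    refine (Measure.ae_prod_mem_iff_ae_ae_mem (s := {z : ℝ × Space d | F z.1 z.2 = 0})
      (hF.measurable (measurableSet_singleton 0))).2 ?_
    filter_upwards [h1] with s hs
    exact (eLpNorm_eq_zero_iff (hF.slice s).measurable.aestronglyMeasurable hp₁).1 hs
  rw [cut, full, Measure.volume_eq_prod]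
  refine integral_eq_zero_of_ae ?_
  filter_upwards [h2] with z hz
  have : ‖(Prod.mk t ⁻¹' S).indicator F z.1 z.2‖ ≤ 0 :=
    (norm_indicator_apply_le _ _ _ _).trans (by rw [hz, norm_zero])
  rw [norm_le_zero_iff.1 this, mul_zero]; rfl

lemma cut_union {lam : Space d → ℝ} (hlam : Measurable lam) {w : Space d → ℂ}
    (hw : Integrable w) {S T : Set (ℝ × ℝ)} (hS : MeasurableSet S) (hT : MeasurableSet T)
    (hST : Disjoint S T) {F : ℝ → Space d → ℂ} (hF : NiceST F) (t : ℝ) (x : Space d) :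
    cut lam w (S ∪ T) F t x = cut lam w S F t x + cut lam w T F t x := by
  rw [cut, cut, cut, full, full, full, ← integral_add
    (integrable_kern_sub_mul hlam hw (hF.restrict (measurable_prodMk_left (x := t) hS)) t x)
    (integrable_kern_sub_mul hlam hw (hF.restrict (measurable_prodMk_left (x := t) hT)) t x)]
  congr 1; ext z
  rw [← mul_add]; congr 1
  rw [preimage_union, indicator_union_of_disjoint (hST.preimage _)]
  rfl

lemma measurable_full {lam : Space d → ℝ} (hlam : Measurable lam) {w : Space d → ℂ}
    (hw : Integrable w) {F : ℝ → Space d → ℂ} (hF : NiceST F) :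
    Measurable fun p : ℝ × Space d => full lam w F p.1 p.2 := by
  have := measurable_cut hlam hw MeasurableSet.univ hF
  simpa only [cut, preimage_univ, indicator_univ] using this

lemma NiceST.lintegral_eLpNorm_rpow_ne_top {F : ℝ → Space d → ℂ} (hF : NiceST F) (p₁ : ℝ≥0∞)
    {p : ℝ} (hp : 0 < p) : ∫⁻ s, eLpNorm (F s) p₁ volume ^ p ≠ ∞ := by
  obtain ⟨B, hB⟩ := hF.bounded
  obtain ⟨R, hR⟩ := hF.support
  set b : Space d → ℝ := (Metric.closedBall (0 : Space d) R).indicator fun _ => B with hb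
  have hbm : MemLp b p₁ volume :=
    memLp_indicator_const p₁ Metric.isClosed_closedBall.measurableSet B
      (Or.inr measure_closedBall_lt_top.ne)
  have hle : ∀ s, eLpNorm (F s) p₁ volume ^ p ≤
      (Icc (-R) R).indicator (fun _ => eLpNorm b p₁ volume ^ p) s := by
    intro s
    by_cases hs : s ∈ Icc (-R) R
    · rw [indicator_of_mem hs]
      refine ENNReal.rpow_le_rpow (eLpNorm_mono_real fun x => ?_) hp.le
      by_cases hx : x ∈ Metric.closedBall (0 : Space d) R
      · rw [hb, indicator_of_mem hx]; exact hB (s, x)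
      · rw [hb, indicator_of_notMem hx]
        have : R < ‖x‖ := by simpa using hx
        have := hR (s, x) (this.trans_le (le_max_right _ _))
        simp only at this
        rw [this, norm_zero]
    · have : F s = 0 := by
        ext x
        refine hR (s, x) (lt_of_lt_of_le ?_ (le_max_left _ _))
        by_contra hc
        exact hs (abs_le.1 (not_lt.1 hc))
      rw [this, eLpNorm_zero, ENNReal.zero_rpow_of_pos hp]; exact zero_le
  refine ((lintegral_mono hle).trans_lt ?_).ne
  rw [lintegral_indicator_const measurableSet_Icc]
  exact ENNReal.mul_lt_top (ENNReal.rpow_lt_top_of_nonneg hp.le hbm.2.ne) (by simp)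

/-- The Christ–Kiselev lemma: restriction to `s < t` preserves `L^p → L^q` bounds if `p < q`. -/
lemma exists_mixedNorm_ret_le (d : ℕ) {p q : ℝ≥0∞} (hp : 1 ≤ p) (hpq : p < q) :
    ∃ K : ℝ, 0 < K ∧ ∀ {lam : Space d → ℝ} {w : Space d → ℂ} {r p₁ A : ℝ≥0∞}, Measurable lam →
      Integrable w → 1 ≤ r → 1 ≤ p₁ →
      (∀ F : ℝ → Space d → ℂ, NiceST F → mixedNorm q r (full lam w F) ≤ A * mixedNorm p p₁ F) →
      ∀ {F : ℝ → Space d → ℂ}, NiceST F →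
        mixedNorm q r (ret lam w F) ≤ ENNReal.ofReal K * A * mixedNorm p p₁ F := by
  have hp0 : p ≠ 0 := (zero_lt_one.trans_le hp).ne'
  have hpt : p ≠ ∞ := hpq.ne_top
  have hpr : 0 < p.toReal := ENNReal.toReal_pos hp0 hpt
  have hpr1 : 1 ≤ p.toReal := by simpa using ENNReal.toReal_mono hpt hp
  have hq1 : 1 ≤ q := hp.trans hpq.le
  -- Generation n has 2^n intervals, each carrying at most about 2^{-n} of the p-th power of the
  -- norm. The gain 2^{-n/p} beats the loss 2^{n/q} by the factor 2^{-nδ}, and the sum over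
  -- generations is geometric because p < q.
  set δ : ℝ := 1 / p.toReal - recip q with hδ
  have hδ0 : 0 < δ := by
    rw [hδ, sub_pos, recip_eq_inv_toReal, one_div]
    by_cases hqt : q = ∞
    · simp [hqt, hpr]
    · exact inv_strictAnti₀ hpr (ENNReal.toReal_strict_mono hqt hpq)
  set ω : ℝ := 2 ^ (-δ) with hω
  have hω0 : 0 < ω := by positivity
  have hω1 : ω < 1 := Real.rpow_lt_one_of_one_lt_of_neg (by norm_num) (by linarith)
  refine ⟨2 * (1 - ω)⁻¹, by have : 0 < 1 - ω := by linarith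
                            positivity, ?_⟩
  intro lam w r p₁ A hlam hw hr hp₁ hA F hF
  set I := ∫⁻ s, eLpNorm (F s) p₁ volume ^ p.toReal with hI
  have hmix : mixedNorm p p₁ F = I ^ (1 / p.toReal) := by
    rw [mixedNorm, eLpNorm_eq_lintegral_rpow_enorm_toReal hp0 hpt]
    simp only [enorm_eq_self]
    rw [hI]
  by_cases hI0 : I = 0
  · have h0 : mixedNorm p p₁ F = 0 := by
      rw [hmix, hI0, ENNReal.zero_rpow_of_pos (by positivity)]
    have hp₁0 : p₁ ≠ 0 := (zero_lt_one.trans_le hp₁).ne'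
    have : ret lam w F = fun _ _ => 0 := by
      ext t x
      exact cut_eq_zero_of_mixedNorm_eq_zero hF hp0 hp₁0 h0 t x
    rw [this]
    have hz : mixedNorm q r (fun (_ : ℝ) (_ : Space d) => (0:ℂ)) = 0 := by
      simp only [mixedNorm]
      have : (fun _ : ℝ => eLpNorm (fun _ : Space d => (0:ℂ)) r volume) = 0 := by
        ext t; exact eLpNorm_zero
      rw [this, eLpNorm_zero]
    rw [hz]; exact zero_le
  have hIt : I ≠ ∞ := hF.lintegral_eLpNorm_rpow_ne_top p₁ hpr
  obtain ⟨Φ, hΦ, hΦ0, hΦ1, hΦb⟩ := exists_distribution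
    ((measurable_eLpNorm_slice hF.measurable p₁).pow_const p.toReal) hI0 hIt
  -- one generation
  have hlevel : ∀ n, mixedNorm q r (cut lam w (levelSet Φ n) F) ≤
      ENNReal.ofReal (2 * ω ^ n) * A * mixedNorm p p₁ F := by
    intro n
    set T : ℕ → Set ℝ := fun j => {s | dyad Φ n s = j} with hT
    have hTm : ∀ j, MeasurableSet (T j) := fun j =>
      measurable_dyad hΦ n (measurableSet_singleton j)
    have hTint : ∀ j, ∫⁻ s in T j, eLpNorm (F s) p₁ volume ^ p.toReal ≤
        ENNReal.ofReal ((1 / 2) ^ n) * (2 * I) := by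
      intro j
      have h2 : (0:ℝ) < 2 ^ n := by positivity
      have hsub : T j ⊆ {s | (j:ℝ) / 2 ^ n ≤ Φ s ∧ Φ s < ((j:ℝ) + 1) / 2 ^ n} := by
        intro s hs
        have hs' : ⌊2 ^ n * Φ s⌋₊ = j := hs
        rw [Nat.floor_eq_iff (mul_nonneg h2.le (hΦ0 s))] at hs'
        refine ⟨?_, ?_⟩
        · rw [div_le_iff₀ h2]; linarith [hs'.1]
        · rw [lt_div_iff₀ h2]; linarith [hs'.2]
      refine (lintegral_mono_set hsub).trans ((hΦb _ _ (by gcongr; linarith)).trans_eq ?_)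
      congr 2
      rw [← sub_div, add_sub_cancel_left, div_pow, one_pow]
    have hbound : ∀ j, eLpNorm (fun t => eLpNorm (full lam w ((T j).indicator F) t) r volume) q volume ≤
        A * (ENNReal.ofReal ((1 / 2) ^ n) * (2 * I)) ^ (1 / p.toReal) := by
      intro j
      refine (hA _ (hF.restrict (hTm j))).trans ?_
      rw [mixedNorm_indicator hp0 hpt F (hTm j)]
      gcongr
      exact hTint j
    -- At a time of odd index only the sibling interval contributes, and at other times nothing
    -- does. At each time the cut operator is thus zero or one of 2^n unrestricted operators, which
    -- costs (2^n)^{1/q} in the norm.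
    have hmain := eLpNorm_le_of_exists_le (M := 2 ^ n)
      (N := fun t => eLpNorm (cut lam w (levelSet Φ n) F t) r volume)
      (fun j => measurable_eLpNorm_slice (measurable_full hlam hw (hF.restrict (hTm j))) r) hq1 hbound
      (fun t => by
        by_cases ht : Odd (dyad Φ n t)
        · right
          obtain ⟨j, hj⟩ : ∃ j, dyad Φ n t = j + 1 :=
            Nat.exists_eq_succ_of_ne_zero ht.pos.ne'
          have hset : Prod.mk t ⁻¹' levelSet Φ n = T j := by
            ext s
            simp only [levelSet, hT, mem_preimage, mem_ofPred_eq, hj]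
            constructor
            · intro hs; have := hs.2; omega
            · intro hs; exact ⟨hj ▸ ht, by omega⟩
          refine ⟨j, ?_, le_of_eq ?_⟩
          · have h1 : dyad Φ n t < 2 ^ n := by
              rw [dyad, Nat.floor_lt (mul_nonneg (by positivity) (hΦ0 t))]
              push_cast
              have h2 : (0:ℝ) < 2 ^ n := by positivity
              nlinarith [hΦ1 t]
            omega
          · congr 1
            ext x
            rw [cut, hset]
        · left
          have hset : Prod.mk t ⁻¹' levelSet Φ n = ∅ := by
            ext s
            simp only [levelSet, mem_preimage, mem_ofPred_eq, mem_empty_iff_false, iff_false]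
            exact fun h => ht h.1
          have : cut lam w (levelSet Φ n) F t = 0 := by
            ext x
            rw [cut, hset, indicator_empty, full]
            simp
          rw [this, eLpNorm_zero])
    refine hmain.trans ?_
    rw [hmix]
    have e1 : (ENNReal.ofReal ((1 / 2) ^ n) * (2 * I)) ^ (1 / p.toReal) =
        ENNReal.ofReal (((1 / 2 : ℝ) ^ n * 2) ^ (1 / p.toReal)) * I ^ (1 / p.toReal) := by
      rw [← mul_assoc, ENNReal.mul_rpow_of_nonneg _ _ (by positivity)]
      congr 1
      rw [← ENNReal.ofReal_rpow_of_nonneg (by positivity) (by positivity),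
        ENNReal.ofReal_mul (by positivity)]
      norm_num
    have e2 : (((2 ^ n : ℕ) : ℝ≥0∞)) ^ recip q = ENNReal.ofReal (((2:ℝ) ^ n) ^ recip q) := by
      rw [← ENNReal.ofReal_rpow_of_nonneg (by positivity) (recip_nonneg q)]
      congr 1
      rw [ENNReal.ofReal_pow (by norm_num)]
      simp
    have e3 : ((2:ℝ) ^ n) ^ recip q * ((1 / 2 : ℝ) ^ n * 2) ^ (1 / p.toReal) ≤ 2 * ω ^ n := by
      rw [Real.mul_rpow (by positivity) (by norm_num)]
      have h1 : (2:ℝ) ^ (1 / p.toReal) ≤ 2 := by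
        calc (2:ℝ) ^ (1 / p.toReal) ≤ 2 ^ (1:ℝ) :=
              Real.rpow_le_rpow_of_exponent_le (by norm_num) (by rw [div_le_one hpr]; exact hpr1)
          _ = 2 := Real.rpow_one 2
      have h2 : ((2:ℝ) ^ n) ^ recip q * ((1 / 2 : ℝ) ^ n) ^ (1 / p.toReal) = ω ^ n := by
        rw [hω, one_div_pow, one_div, Real.inv_rpow (by positivity), ← Real.rpow_neg (by positivity),
          ← Real.rpow_add (by positivity), ← Real.rpow_natCast, ← Real.rpow_natCast,
          ← Real.rpow_mul (by norm_num), ← Real.rpow_mul (by norm_num)]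
        congr 1
        rw [hδ]; ring
      calc _ = (((2:ℝ) ^ n) ^ recip q * ((1 / 2 : ℝ) ^ n) ^ (1 / p.toReal)) * 2 ^ (1 / p.toReal) := by
            ring
        _ ≤ ω ^ n * 2 := by rw [h2]; gcongr
        _ = _ := by ring
    rw [e1, e2]
    calc _ = ENNReal.ofReal (((2:ℝ) ^ n) ^ recip q) *
          ENNReal.ofReal (((1 / 2 : ℝ) ^ n * 2) ^ (1 / p.toReal)) * A * I ^ (1 / p.toReal) := by ring
      _ ≤ _ := by
          rw [← ENNReal.ofReal_mul (by positivity)]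
          gcongr
  -- the finite unions of generations
  set U : ℕ → Set (ℝ × ℝ) := fun M => ⋃ n ∈ Finset.range M, levelSet Φ n with hU
  have hUm : ∀ M, MeasurableSet (U M) := fun M =>
    Finset.measurableSet_biUnion _ fun n _ => measurableSet_levelSet hΦ n
  have hsum : ∀ M, mixedNorm q r (cut lam w (U M) F) ≤
      ENNReal.ofReal (∑ n ∈ Finset.range M, 2 * ω ^ n) * A * mixedNorm p p₁ F := by
    intro M
    induction M with
    | zero =>
      have : cut lam w (U 0) F = fun _ _ => 0 := by
        ext t x
        simp [cut, hU, full]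
      rw [this]
      have hz : mixedNorm q r (fun (_ : ℝ) (_ : Space d) => (0:ℂ)) = 0 := by
        simp only [mixedNorm]
        have : (fun _ : ℝ => eLpNorm (fun _ : Space d => (0:ℂ)) r volume) = 0 := by
          ext t; exact eLpNorm_zero
        rw [this, eLpNorm_zero]
      rw [hz]; exact zero_le
    | succ M ih =>
      have hUs : U (M + 1) = U M ∪ levelSet Φ M := by
        simp only [hU, Finset.range_add_one, Finset.set_biUnion_insert]
        exact union_comm _ _
      have hdisj : Disjoint (U M) (levelSet Φ M) := by
        rw [Set.disjoint_left]
        rintro ⟨t, s⟩ h1 h2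
        simp only [hU, mem_iUnion, Finset.mem_range] at h1
        obtain ⟨n, hn, h1⟩ := h1
        exact absurd (eq_of_mem_levelSet h1 h2) hn.ne
      have e : cut lam w (U (M + 1)) F = fun t x =>
          cut lam w (U M) F t x + cut lam w (levelSet Φ M) F t x := by
        ext t x
        rw [hUs, cut_union hlam hw (hUm M) (measurableSet_levelSet hΦ M) hdisj hF]
      rw [e, Finset.sum_range_succ, ENNReal.ofReal_add (Finset.sum_nonneg fun _ _ => by positivity)
        (by positivity), add_mul, add_mul]
      exact (mixedNorm_add_le (measurable_cut hlam hw (hUm M) hF)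
        (measurable_cut hlam hw (measurableSet_levelSet hΦ M) hF) hq1 hr).trans
        (add_le_add ih (hlevel M))
  refine mixedNorm_le_of_tendsto (f := fun M => cut lam w (U M) F)
    (fun M => measurable_cut hlam hw (hUm M) hF) (fun M => (hsum M).trans ?_) (fun t => ?_)
  · gcongr
    rw [← Finset.mul_sum]
    gcongr
    rw [← tsum_geometric_of_lt_one hω0.le hω1]
    exact (summable_geometric_of_lt_one hω0.le hω1).sum_le_tsum _ fun _ _ => by positivity
  · refine Filter.Eventually.of_forall fun x => ?_
    refine tendsto_integral_of_dominated_convergence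
      (bound := fun z : ℝ × Space d => ‖kern lam w (t - z.1) (x - z.2) * F z.1 z.2‖)
      (fun M => (integrable_kern_sub_mul hlam hw
        (hF.restrict (measurable_prodMk_left (x := t) (hUm M))) t x).1)
      (integrable_kern_sub_mul hlam hw hF t x).norm (fun M => ?_) ?_
    · refine Filter.Eventually.of_forall fun z => ?_
      rw [norm_mul, norm_mul]
      gcongr
      exact norm_indicator_apply_le _ _ _ _
    · refine Filter.Eventually.of_forall fun z => ?_
      refine Filter.Tendsto.const_mul _ ?_
      by_cases hz : z.1 < t
      · obtain ⟨n, hn⟩ := exists_mem_levelSet hΦ hΦ0 hΦ1 hz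
        refine tendsto_const_nhds.congr' ?_
        filter_upwards [Filter.eventually_gt_atTop n] with M hM
        rw [indicator_of_mem (show z.1 ∈ Prod.mk t ⁻¹' {p : ℝ × ℝ | p.2 < p.1} from hz),
          indicator_of_mem]
        simp only [hU, mem_preimage, mem_iUnion, Finset.mem_range]
        exact ⟨n, hM, hn⟩
      · refine tendsto_const_nhds.congr fun M => ?_
        rw [indicator_of_notMem (show z.1 ∉ Prod.mk t ⁻¹' {p : ℝ × ℝ | p.2 < p.1} from hz),
          indicator_of_notMem]
        simp only [hU, mem_preimage, mem_iUnion, Finset.mem_range]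
        rintro ⟨n, -, hn⟩
        exact hz (lt_of_mem_levelSet hΦ hn)

end Strichartz

/-! ### The retarded estimate, including the case of two time exponents equal to 2. -/

namespace Strichartz

open scoped FourierTransform

variable {d : ℕ}

lemma eLpNorm_comp_neg {f : Space d → ℂ} (hf : Measurable f) (p : ℝ≥0∞) :
    eLpNorm (fun x => f (-x)) p volume = eLpNorm f p volume := by
  have hmp : MeasurePreserving (fun x : Space d => -x) volume volume :=
    Measure.measurePreserving_neg volume
  exact eLpNorm_comp_measurePreserving hf.aestronglyMeasurable hmp

/-- The pairing with a convolution operator is symmetric up to reflections. -/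
lemma integral_conv_mul_swap {lam : Space d → ℝ} (hlam : Measurable lam) {w f g : Space d → ℂ}
    (hw : Integrable w) (hf : Nice f) (hg : Nice g) (t : ℝ) :
    ∫ x, conv lam w t f x * g x = ∫ x, conv lam w t (fun x => g (-x)) x * f (-x) := by
  rw [integral_conv_mul_eq hlam hw (hf.integrable volume) (hg.integrable volume),
    integral_conv_mul_eq hlam hw (hg.reflect.integrable volume) (hf.reflect.integrable volume)]
  congr 1; ext η
  have e : ∀ h : Space d → ℂ, (starRingEnd ℂ) (𝓕 (fun x => (starRingEnd ℂ) (h x)) η) =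
      𝓕 (fun x => h (-x)) η := by
    intro h
    rw [← fourier_conj_reflect]
    simp
  rw [e, e]
  simp only [neg_neg]
  ring

/-- Decay of the pairing for two different exponents. -/
lemma exists_enorm_integral_conv_mul_decay (d : ℕ) (σ : ℝ) {r r₁ : ℝ≥0∞} (h2 : 2 < r)
    (hr : r ≤ r₁) : ∃ K : ℝ, 0 < K ∧
    ∀ {ϑ D μ₁ μ₂ : ℝ} {lam : Space d → ℝ} {m : Space d → ℂ}, 0 ≤ ϑ → ϑ ≤ 1 →
      ϑ * (1 - 2 * recip r₁) = 1 - 2 * recip r → KernelBounds σ D μ₁ μ₂ lam m →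
      ∀ {E₁ : ℝ≥0∞}, SpaceBound m r₁ E₁ → ∀ (t : ℝ) (f g : Space d → ℂ), Nice f → Nice g →
      ‖∫ x, conv lam (fun η => m η * m η) t f x * g x‖ₑ ≤
        ENNReal.ofReal (K * (D * μ₁ ^ (1 - 2 * recip r₁))) ^ ϑ *
          (ENNReal.ofReal √D * E₁) ^ (1 - ϑ) *
          ENNReal.ofReal ((1 + μ₂ * |t|) ^ (-(σ * (1 - 2 * recip r)))) *
          eLpNorm f r₁.conjExponent volume * eLpNorm g r.conjExponent volume := by
  obtain ⟨K, hK, hKb⟩ := exists_eLpNorm_conv_decay d σ (h2.le.trans hr)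
  refine ⟨K, hK, ?_⟩
  intro ϑ D μ₁ μ₂ lam m h0 h1 hϑ h E₁ hE₁ t f g hf hg
  have hw := h.isWeight_sq
  have hμ₂ := h.mu_two_pos
  have hp : 0 < 1 + μ₂ * |t| := by positivity
  have hfi := hf.integrable volume
  have hc := stronglyMeasurable_conv h.measurable_lam hw.integrable hf.measurable t
  refine (enorm_integral_mul_le hc.aestronglyMeasurable hg.measurable.aestronglyMeasurable
    (le_trans (by norm_num) h2.le)).trans ?_
  gcongr
  have hdec := hKb h hw hf.measurable (hf.memLp _ volume).2 t
  -- The estimate without decay: one factor of m gives E₁, the other is bounded by √D.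
  have hen : eLpNorm (conv lam (fun η => m η * m η) t f) 2 volume ≤
      ENNReal.ofReal √D * E₁ * eLpNorm f r₁.conjExponent volume := by
    have e : conv lam (fun η => m η * m η) t f =
        fun x => kern lam (fun η => m η * (m η * 𝓕 f η)) t x := by
      ext x
      rw [conv_eq_kern_of_integrable h.measurable_lam hw.integrable hfi]
      simp only [mul_assoc]
    have hmf : MemLp (fun η => m η * 𝓕 f η) 2 volume :=
      (h.integrable_mul ((isFT_of_integrable hfi).memLp_two (hf.memLp 2 volume)).1).2
    rw [e, eLpNorm_kern_two h.measurable_lam (h.integrable_mul hmf).1 (h.integrable_mul hmf).2,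
      mul_assoc]
    refine (eLpNorm_le_mul_eLpNorm_of_ae_le_mul
      (Filter.Eventually.of_forall fun η => h.norm_mul_le (fun η => m η * 𝓕 f η) η) 2).trans ?_
    gcongr
    exact hE₁ f hf
  -- The input stays in L^{r₁'}; only the output is interpolated, between L^{r₁} with decay and L²
  -- without. The weight ϑ reduces the decay rate from σ(1-2/r₁) to σ(1-2/r).
  refine (eLpNorm_le_rpow_mul_rpow hc.aestronglyMeasurable h2 hr hϑ).trans ?_
  have h1' : 0 ≤ 1 - ϑ := by linarith
  calc _ ≤ (ENNReal.ofReal (K * (D * μ₁ ^ (1 - 2 * recip r₁))) *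
        ENNReal.ofReal ((1 + μ₂ * |t|) ^ (-(σ * (1 - 2 * recip r₁)))) *
          eLpNorm f r₁.conjExponent volume) ^ ϑ *
        (ENNReal.ofReal √D * E₁ * eLpNorm f r₁.conjExponent volume) ^ (1 - ϑ) := by gcongr
    _ = _ := by
      rw [ENNReal.mul_rpow_of_nonneg _ _ h0, ENNReal.mul_rpow_of_nonneg _ _ h0,
        ENNReal.mul_rpow_of_nonneg _ _ h1']
      have e1 : ENNReal.ofReal ((1 + μ₂ * |t|) ^ (-(σ * (1 - 2 * recip r₁)))) ^ ϑ =
          ENNReal.ofReal ((1 + μ₂ * |t|) ^ (-(σ * (1 - 2 * recip r)))) := by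
        rw [ENNReal.ofReal_rpow_of_nonneg (by positivity) h0, ← Real.rpow_mul hp.le, ← hϑ]
        congr 2; ring
      have e2 : eLpNorm f r₁.conjExponent volume ^ ϑ * eLpNorm f r₁.conjExponent volume ^ (1 - ϑ) =
          eLpNorm f r₁.conjExponent volume := by
        rw [← ENNReal.rpow_add_of_nonneg _ _ h0 h1']; simp
      rw [e1]
      calc _ = ENNReal.ofReal (K * (D * μ₁ ^ (1 - 2 * recip r₁))) ^ ϑ *
          (ENNReal.ofReal √D * E₁) ^ (1 - ϑ) *
          ENNReal.ofReal ((1 + μ₂ * |t|) ^ (-(σ * (1 - 2 * recip r)))) *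
          (eLpNorm f r₁.conjExponent volume ^ ϑ * eLpNorm f r₁.conjExponent volume ^ (1 - ϑ)) := by
            ring
        _ = _ := by rw [e2]

lemma rpow_le_max_one {K θ : ℝ} (hK : 0 ≤ K) (hθ0 : 0 ≤ θ) (hθ1 : θ ≤ 1) : K ^ θ ≤ max 1 K := by
  calc K ^ θ ≤ (max 1 K) ^ θ := by gcongr; exact le_max_right _ _
    _ ≤ (max 1 K) ^ (1:ℝ) := Real.rpow_le_rpow_of_exponent_le (le_max_left _ _) hθ1
    _ = _ := Real.rpow_one _

/-- With θ₁ = θϑ the powers of E₁ add up to 1-θ₁ and those of D to (θ+θ₁)/2. The form estimate at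
time exponent 2 therefore has the product of the two homogeneous constants, like the estimate
without time ordering. -/
lemma rpow_mul_le_strichConst_mul {σ K D μ₁ μ₂ θ θ₁ ϑ β : ℝ} (hσ : 0 < σ) (hK : 0 ≤ K) (hD : 0 ≤ D)
    (hμ₁ : 0 < μ₁) (hμ₂ : 0 < μ₂) (hθ0 : 0 ≤ θ) (hθ1 : θ ≤ 1) (hϑ0 : 0 ≤ ϑ) (hϑ1 : ϑ ≤ 1)
    (hθ₁ : θ₁ = θ * ϑ) (hβ : θ₁ * (σ * β) = 1) (E E₁ : ℝ≥0∞) :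
    (E * E₁) ^ (1 - θ) * (ENNReal.ofReal (K * (D * μ₁ ^ β)) ^ ϑ *
      (ENNReal.ofReal √D * E₁) ^ (1 - ϑ)) ^ θ * ENNReal.ofReal (μ₂ ^ (-(2 * recip 2))) ≤
      ENNReal.ofReal (max 1 K) *
        (strichConst σ D μ₁ μ₂ θ 2 E * strichConst σ D μ₁ μ₂ θ₁ 2 E₁) := by
  have hθ₁0 : 0 ≤ θ₁ := by rw [hθ₁]; positivity
  have hθ₁θ : θ₁ ≤ θ := by rw [hθ₁]; nlinarith
  have e1 : E₁ ^ (1 - θ) * E₁ ^ (θ - θ₁) = E₁ ^ (1 - θ₁) := by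
    rw [← ENNReal.rpow_add_of_nonneg _ _ (by linarith) (by linarith)]; congr 1; ring
  have e2 : (ENNReal.ofReal (K * (D * μ₁ ^ β)) ^ ϑ * (ENNReal.ofReal √D * E₁) ^ (1 - ϑ)) ^ θ =
      ENNReal.ofReal (K ^ θ₁ * (D ^ θ₁ * μ₁ ^ (1 / σ)) * D ^ ((θ - θ₁) / 2)) * E₁ ^ (θ - θ₁) := by
    rw [ENNReal.mul_rpow_of_nonneg _ _ hθ0, ← ENNReal.rpow_mul, ← ENNReal.rpow_mul,
      show ϑ * θ = θ₁ by rw [hθ₁]; ring, show (1 - ϑ) * θ = θ - θ₁ by rw [hθ₁]; ring,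
      ENNReal.mul_rpow_of_nonneg _ _ (by linarith),
      ENNReal.ofReal_rpow_of_nonneg (by positivity) hθ₁0,
      ENNReal.ofReal_rpow_of_nonneg (by positivity) (by linarith), ← mul_assoc,
      ← ENNReal.ofReal_mul (by positivity), Real.mul_rpow hK (by positivity),
      Real.mul_rpow hD (by positivity), ← Real.rpow_mul hμ₁.le, Real.sqrt_eq_rpow,
      ← Real.rpow_mul hD]
    congr 3
    · congr 3
      rw [eq_div_iff hσ.ne']; linarith
    · congr 1; ring
  have e3 : ENNReal.ofReal (K ^ θ₁ * (D ^ θ₁ * μ₁ ^ (1 / σ)) * D ^ ((θ - θ₁) / 2)) *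
      ENNReal.ofReal (μ₂ ^ (-(2 * recip 2))) ≤ ENNReal.ofReal (max 1 K) *
        ((ENNReal.ofReal D ^ (θ / 2) * ENNReal.ofReal ((μ₁ ^ (1 / σ) * μ₂⁻¹) ^ recip 2)) *
        (ENNReal.ofReal D ^ (θ₁ / 2) * ENNReal.ofReal ((μ₁ ^ (1 / σ) * μ₂⁻¹) ^ recip 2))) := by
    rw [ENNReal.ofReal_rpow_of_nonneg hD (by positivity),
      ENNReal.ofReal_rpow_of_nonneg hD (by positivity), ← ENNReal.ofReal_mul (by positivity),
      ← ENNReal.ofReal_mul (by positivity), ← ENNReal.ofReal_mul (by positivity),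
      ← ENNReal.ofReal_mul (by positivity), ← ENNReal.ofReal_mul (by positivity)]
    apply ENNReal.ofReal_le_ofReal
    have hd : D ^ θ₁ * D ^ ((θ - θ₁) / 2) = D ^ (θ / 2) * D ^ (θ₁ / 2) := by
      rw [← Real.rpow_add_of_nonneg hD hθ₁0 (by linarith),
        ← Real.rpow_add_of_nonneg hD (by linarith) (by linarith)]
      congr 1; ring
    have hμ : (μ₁ ^ (1 / σ) * μ₂⁻¹) ^ recip 2 * (μ₁ ^ (1 / σ) * μ₂⁻¹) ^ recip 2 =
        μ₁ ^ (1 / σ) * μ₂ ^ (-(2 * recip 2)) := by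
      have hx : 0 < μ₁ ^ (1 / σ) * μ₂⁻¹ := by positivity
      rw [← Real.rpow_add hx, recip_two]
      norm_num
      exact Or.inl (Real.rpow_neg_one μ₂).symm
    calc _ = K ^ θ₁ * ((D ^ θ₁ * D ^ ((θ - θ₁) / 2)) * (μ₁ ^ (1 / σ) * μ₂ ^ (-(2 * recip 2)))) := by
          ring
      _ ≤ max 1 K * ((D ^ θ₁ * D ^ ((θ - θ₁) / 2)) * (μ₁ ^ (1 / σ) * μ₂ ^ (-(2 * recip 2)))) := by
          gcongr
          exact rpow_le_max_one hK hθ₁0 (hθ₁θ.trans hθ1)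
      _ = _ := by rw [hd, ← hμ]; ring
  rw [e2, ENNReal.mul_rpow_of_nonneg _ _ (by linarith)]
  calc _ = (ENNReal.ofReal (K ^ θ₁ * (D ^ θ₁ * μ₁ ^ (1 / σ)) * D ^ ((θ - θ₁) / 2)) *
      ENNReal.ofReal (μ₂ ^ (-(2 * recip 2)))) * (E ^ (1 - θ) * (E₁ ^ (1 - θ) * E₁ ^ (θ - θ₁))) := by
        ring
    _ ≤ _ := mul_le_mul_left e3 _
    _ = _ := by rw [e1, strichConst, strichConst]; ring

/-- The form estimate for two pairs with time exponent `2`, in both orders. -/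
lemma exists_form_two_le (d : ℕ) {σ : ℝ} (hσ : 0 < σ) {r r₁ : ℝ≥0∞} (h2 : 2 < r) (hr : r ≤ r₁)
    (ha : 1 < σ * (1 - 2 * recip r)) : ∃ K : ℝ, 0 < K ∧
      ∀ {θ θ₁ : ℝ}, IsTheta σ 2 r θ → IsTheta σ 2 r₁ θ₁ →
      ∀ {D μ₁ μ₂ : ℝ} {lam : Space d → ℝ} {m : Space d → ℂ}, KernelBounds σ D μ₁ μ₂ lam m →
      ∀ {E E₁ : ℝ≥0∞}, SpaceBound m r E → SpaceBound m r₁ E₁ →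
      ∀ {F G : ℝ → Space d → ℂ}, NiceST F → NiceST G →
        (∫⁻ t, ∫⁻ s, ‖∫ x, conv lam (fun η => m η * m η) (t - s) (F s) x * G t x‖ₑ ≤
          ENNReal.ofReal K * (strichConst σ D μ₁ μ₂ θ 2 E * strichConst σ D μ₁ μ₂ θ₁ 2 E₁) *
            mixedNorm (ENNReal.conjExponent 2) r₁.conjExponent F *
            mixedNorm (ENNReal.conjExponent 2) r.conjExponent G) ∧
        (∫⁻ t, ∫⁻ s, ‖∫ x, conv lam (fun η => m η * m η) (t - s) (F s) x * G t x‖ₑ ≤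
          ENNReal.ofReal K * (strichConst σ D μ₁ μ₂ θ 2 E * strichConst σ D μ₁ μ₂ θ₁ 2 E₁) *
            mixedNorm (ENNReal.conjExponent 2) r.conjExponent F *
            mixedNorm (ENNReal.conjExponent 2) r₁.conjExponent G) := by
  obtain ⟨K₁, hK₁, h₁⟩ := exists_enorm_integral_conv_mul_decay d σ h2 hr
  obtain ⟨K₂, hK₂, h₂⟩ := exists_form_le d (q := 2) le_rfl (a := σ * (1 - 2 * recip r))
    (fun _ => ha)
  refine ⟨K₂ * max 1 K₁, by positivity, ?_⟩
  intro θ θ₁ ⟨hθ0, hθ1, hθ⟩ ⟨hθ₁0, hθ₁1, hθ₁⟩ D μ₁ μ₂ lam m h E E₁ hE hE₁ F G hF hG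
  have hμ₁ := h.mu_one_pos
  have hμ₂ := h.mu_two_pos
  have hD := h.nonneg
  have hw := h.isWeight_sq
  have hrh := recip_le_half h2.le
  have hr₁h := recip_le_half (h2.le.trans hr)
  have hrr : recip r₁ ≤ recip r := by
    rw [recip, recip]
    exact ENNReal.toReal_mono (by simpa using (lt_trans (by norm_num) h2).ne')
      (ENNReal.inv_le_inv.2 hr)
  have hβ : 0 < 1 - 2 * recip r := by
    by_contra hc
    nlinarith
  have hβ₁ : 0 < 1 - 2 * recip r₁ := by linarith
  rw [recip_two] at hθ hθ₁
  -- The position of r between 2 and r₁. As both time exponents are 2, it is also the ratio θ₁/θ.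
  set ϑ := (1 - 2 * recip r) / (1 - 2 * recip r₁) with hϑd
  have hϑ0 : 0 ≤ ϑ := by positivity
  have hϑ1 : ϑ ≤ 1 := by rw [hϑd, div_le_one hβ₁]; linarith
  have hϑ : ϑ * (1 - 2 * recip r₁) = 1 - 2 * recip r := by rw [hϑd]; field_simp
  have hθθ : θ₁ = θ * ϑ := by
    have h3 : σ * (1 - 2 * recip r₁) ≠ 0 := by positivity
    apply mul_right_cancel₀ h3
    rw [hθ₁, ← hθ, ← hϑ]; ring
  have hY : ∀ t f g, t ≠ 0 → Nice f → Nice g →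
      ‖∫ x, conv lam (fun η => m η * m η) t f x * g x‖ₑ ≤
        ENNReal.ofReal (K₁ * (D * μ₁ ^ (1 - 2 * recip r₁))) ^ ϑ *
          (ENNReal.ofReal √D * E₁) ^ (1 - ϑ) *
          ENNReal.ofReal ((μ₂ * |t|) ^ (-(σ * (1 - 2 * recip r)))) *
          eLpNorm f r₁.conjExponent volume * eLpNorm g r.conjExponent volume := by
    intro t f g ht hf hg
    refine (h₁ hϑ0 hϑ1 hϑ h hE₁ t f g hf hg).trans ?_
    refine mul_le_mul_left (mul_le_mul_left (mul_le_mul_right (ENNReal.ofReal_le_ofReal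
        (one_add_rpow_neg_le hμ₂ ht (by positivity))) _) _) _
  have hX : ∀ t f g, Nice f → Nice g → ‖∫ x, conv lam (fun η => m η * m η) t f x * g x‖ₑ ≤
      E * E₁ * eLpNorm f r₁.conjExponent volume * eLpNorm g r.conjExponent volume :=
    fun t f g hf hg => enorm_integral_conv_mul_le h.measurable_lam h.measurable_m hw.integrable
      hw.norm_eq hE hE₁ hf hg t
  have hconst := rpow_mul_le_strichConst_mul (μ₂ := μ₂) hσ hK₁.le hD hμ₁ hμ₂ hθ0 hθ1 hϑ0 hϑ1 hθθ
    (by rw [hθ₁]; norm_num) E E₁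
  rw [ENNReal.ofReal_mul hK₂.le]
  constructor
  · refine (h₂ hθ0 hθ1 (by rw [hθ, recip_two]) hμ₂ hX hY hF hG).trans ?_
    rw [mul_assoc (ENNReal.ofReal K₂) (ENNReal.ofReal (max 1 K₁))]
    gcongr
  -- The other order follows by transposition: the pairing is symmetric up to reflections, and these
  -- preserve all norms.
  · refine (h₂ (X := E * E₁) (Y := ENNReal.ofReal (K₁ * (D * μ₁ ^ (1 - 2 * recip r₁))) ^ ϑ *
          (ENNReal.ofReal √D * E₁) ^ (1 - ϑ)) (p := r₁.conjExponent) (p₁ := r.conjExponent)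
      hθ0 hθ1 (by rw [hθ, recip_two]) hμ₂ (fun t f g hf hg => ?_)
      (fun t f g ht hf hg => ?_) hF hG).trans ?_
    · rw [integral_conv_mul_swap h.measurable_lam hw.integrable hf hg]
      refine (hX t _ _ hg.reflect hf.reflect).trans_eq ?_
      rw [eLpNorm_comp_neg hf.measurable, eLpNorm_comp_neg hg.measurable]; ring
    · rw [integral_conv_mul_swap h.measurable_lam hw.integrable hf hg]
      refine (hY t _ _ ht hg.reflect hf.reflect).trans_eq ?_
      rw [eLpNorm_comp_neg hf.measurable, eLpNorm_comp_neg hg.measurable]; ring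
    · rw [mul_assoc (ENNReal.ofReal K₂) (ENNReal.ofReal (max 1 K₁))]
      gcongr

lemma two_lt_of_one_lt {σ : ℝ} {r : ℝ≥0∞} (hr : 2 ≤ r) (h : 1 < σ * (1 - 2 * recip r)) :
    2 < r := by
  refine lt_of_le_of_ne hr ?_
  rintro rfl
  rw [recip_two] at h
  norm_num at h

/-- Since q₁' ≤ 2 ≤ q, the strict inequality required by the Christ–Kiselev lemma fails only if both
exponents are 2. -/
lemma conjExponent_lt_of_ne {q q₁ : ℝ≥0∞} (hq : 2 ≤ q) (hq₁ : 2 ≤ q₁) (h : ¬ (q = 2 ∧ q₁ = 2)) :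
    q₁.conjExponent < q := by
  have h1 := conjExponent_le_two hq₁
  rcases eq_or_lt_of_le hq with rfl | hlt
  · have h3 : q₁ ≠ 2 := fun h' => h ⟨rfl, h'⟩
    refine lt_of_le_of_ne h1 fun h4 => h3 ?_
    have h5 := recip_conjExponent (le_trans (by norm_num) hq₁)
    rw [h4, recip_two] at h5
    have h6 : recip q₁ = 1 / 2 := by linarith
    rw [recip_eq_inv_toReal] at h6
    have h7 : q₁.toReal = 2 := by rw [← inv_inv q₁.toReal, h6]; norm_num
    have h8 : q₁ ≠ ∞ := by rintro rfl; norm_num at h7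
    rw [← ENNReal.ofReal_toReal h8, h7]; norm_num
  · exact h1.trans_lt hlt

/-- The retarded estimate for bounded functions with bounded support. -/
lemma exists_mixedNorm_ret_strichConst_le (d : ℕ) {σ : ℝ} (hσ : 0 < σ) {q r q₁ r₁ : ℝ≥0∞}
    (hqr : Admissible σ q r) (he : ¬ IsEndpoint σ q r) (hqr₁ : Admissible σ q₁ r₁)
    (he₁ : ¬ IsEndpoint σ q₁ r₁) : ∃ K : ℝ, 0 < K ∧
      ∀ {θ θ₁ : ℝ}, IsTheta σ q r θ → IsTheta σ q₁ r₁ θ₁ →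
      ∀ {D μ₁ μ₂ : ℝ} {lam : Space d → ℝ} {m : Space d → ℂ}, KernelBounds σ D μ₁ μ₂ lam m →
      ∀ {E E₁ : ℝ≥0∞}, SpaceBound m r E → SpaceBound m r₁ E₁ →
      ∀ {F : ℝ → Space d → ℂ}, NiceST F →
        mixedNorm q r (ret lam (fun η => m η * m η) F) ≤
          ENNReal.ofReal K * (strichConst σ D μ₁ μ₂ θ q E * strichConst σ D μ₁ μ₂ θ₁ q₁ E₁) *
            mixedNorm q₁.conjExponent r₁.conjExponent F := by
  have hq := hqr.1
  have hr := hqr.2.1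
  have hq₁ := hqr₁.1
  have hr₁ := hqr₁.2.1
  by_cases h2 : q = 2 ∧ q₁ = 2
  · obtain ⟨rfl, rfl⟩ := h2
    have ha := one_lt_of_admissible hσ hqr he rfl
    have ha₁ := one_lt_of_admissible hσ hqr₁ he₁ rfl
    -- The double endpoint in time, outside the reach of Christ–Kiselev. The retarded operator is
    -- bounded by duality from the form estimate, in which the cutoff s < t is discarded.
    have hdual : ∀ {K : ℝ} {S : ℝ≥0∞} {D μ₁ μ₂ : ℝ} {lam : Space d → ℝ} {m : Space d → ℂ},
        KernelBounds σ D μ₁ μ₂ lam m → ∀ {F : ℝ → Space d → ℂ}, NiceST F →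
        (∀ G : ℝ → Space d → ℂ, NiceST G →
          ∫⁻ t, ∫⁻ s, ‖∫ x, conv lam (fun η => m η * m η) (t - s) (F s) x * G t x‖ₑ ≤
          ENNReal.ofReal K * S * mixedNorm (ENNReal.conjExponent 2) r₁.conjExponent F *
            mixedNorm (ENNReal.conjExponent 2) r.conjExponent G) →
        mixedNorm 2 r (ret lam (fun η => m η * m η) F) ≤
          ENNReal.ofReal K * S * mixedNorm (ENNReal.conjExponent 2) r₁.conjExponent F := by
      intro K S D μ₁ μ₂ lam m h F hF hform
      have hw := h.isWeight_sq.integrable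
      exact mixedNorm_le_of_forall_pairing
        (measurable_cut h.measurable_lam hw measurableSet_snd_lt_fst hF) le_rfl hr
        ⟨_, norm_cut_le lam _ measurableSet_snd_lt_fst hF⟩ fun G hG =>
        (enorm_integral_cut_mul_le h.measurable_lam hw measurableSet_snd_lt_fst hF hG).trans
          (hform G hG)
    rcases le_total r r₁ with hrr | hrr
    · obtain ⟨K, hK, hKb⟩ := exists_form_two_le d hσ (two_lt_of_one_lt hr ha) hrr ha
      refine ⟨K, hK, ?_⟩
      intro θ θ₁ hθ hθ₁ D μ₁ μ₂ lam m h E E₁ hE hE₁ F hF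
      exact hdual h hF fun G hG => (hKb hθ hθ₁ h hE hE₁ hF hG).1
    · obtain ⟨K, hK, hKb⟩ := exists_form_two_le d hσ (two_lt_of_one_lt hr₁ ha₁) hrr ha₁
      refine ⟨K, hK, ?_⟩
      intro θ θ₁ hθ hθ₁ D μ₁ μ₂ lam m h E E₁ hE hE₁ F hF
      refine hdual h hF fun G hG => ?_
      rw [mul_comm (strichConst σ D μ₁ μ₂ θ 2 E)]
      exact (hKb hθ₁ hθ h hE₁ hE hF hG).2
  · obtain ⟨K, hK, hKb⟩ := exists_mixedNorm_full_le d hσ hqr he hqr₁ he₁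
    obtain ⟨K₁, hK₁, hKb₁⟩ := exists_mixedNorm_ret_le d (one_le_conjExponent q₁)
      (conjExponent_lt_of_ne hq hq₁ h2)
    refine ⟨K₁ * K, by positivity, ?_⟩
    intro θ θ₁ hθ hθ₁ D μ₁ μ₂ lam m h E E₁ hE hE₁ F hF
    rw [ENNReal.ofReal_mul hK₁.le, mul_assoc (ENNReal.ofReal K₁)]
    exact hKb₁ h.measurable_lam h.isWeight_sq.integrable (le_trans (by norm_num) hr)
      (one_le_conjExponent r₁) (fun F hF => hKb hθ hθ₁ h hE hE₁ hF) hF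

end Strichartz

/-! ### Truncations, and local integrability of the retarded integral. -/

namespace Strichartz

variable {d : ℕ}

/-- Dominated convergence to zero in `L^p`. -/
lemma tendsto_eLpNorm_zero_of_dominated {X : Type*} [MeasurableSpace X] {μ : Measure X}
    {f : ℕ → X → ℝ≥0∞} {g : X → ℝ≥0∞} (hf : ∀ n, Measurable (f n)) {p : ℝ≥0∞} (hp : p ≠ 0)
    (hpt : p ≠ ∞) (hfg : ∀ n, ∀ᵐ x ∂μ, f n x ≤ g x) (hg : eLpNorm g p μ < ∞)
    (hlim : ∀ᵐ x ∂μ, Filter.Tendsto (fun n => f n x) Filter.atTop (nhds 0)) :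
    Filter.Tendsto (fun n => eLpNorm (f n) p μ) Filter.atTop (nhds 0) := by
  have hp0 : 0 < p.toReal := ENNReal.toReal_pos hp hpt
  rw [eLpNorm_lt_top_iff_lintegral_rpow_enorm_lt_top hp hpt] at hg
  simp only [eLpNorm_eq_lintegral_rpow_enorm_toReal hp hpt, enorm_eq_self] at hg ⊢
  have h := tendsto_lintegral_of_dominated_convergence (F := fun n x => f n x ^ p.toReal)
    (f := fun _ => 0) (μ := μ) (fun x => g x ^ p.toReal) (fun n => (hf n).pow_const _)
    (fun n => by filter_upwards [hfg n] with x hx using ENNReal.rpow_le_rpow hx hp0.le) hg.ne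
    (by
      filter_upwards [hlim] with x hx
      have := (ENNReal.continuous_rpow_const (y := p.toReal)).tendsto 0
      rw [ENNReal.zero_rpow_of_pos hp0] at this
      exact this.comp hx)
  rw [lintegral_zero] at h
  have h2 := (ENNReal.continuous_rpow_const (y := 1 / p.toReal)).tendsto 0
  rw [ENNReal.zero_rpow_of_pos (by positivity)] at h2
  exact h2.comp h

/-- The truncation of a space-time function in size and support. -/
def trunc (F : ℝ → Space d → ℂ) (n : ℕ) (t : ℝ) (x : Space d) : ℂ :=
  {p : ℝ × Space d | ‖F p.1 p.2‖ ≤ n ∧ ‖p‖ ≤ n}.indicator (fun p => F p.1 p.2) (t, x)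

lemma niceST_trunc {F : ℝ → Space d → ℂ} (hF : Measurable fun p : ℝ × Space d => F p.1 p.2)
    (n : ℕ) : NiceST (trunc F n) := by
  have hS : MeasurableSet {p : ℝ × Space d | ‖F p.1 p.2‖ ≤ n ∧ ‖p‖ ≤ n} :=
    (measurableSet_le hF.norm measurable_const).inter (measurableSet_le measurable_norm measurable_const)
  refine ⟨hF.indicator hS, ⟨n, fun p => ?_⟩, ⟨n, fun p hp => ?_⟩⟩
  · by_cases h : p ∈ {p : ℝ × Space d | ‖F p.1 p.2‖ ≤ n ∧ ‖p‖ ≤ n}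
    · rw [trunc, indicator_of_mem h]; exact h.1
    · rw [trunc, indicator_of_notMem h]; simp
  · rw [trunc, indicator_of_notMem]
    exact fun h => absurd h.2 (not_le.2 hp)

lemma enorm_trunc_le (F : ℝ → Space d → ℂ) (n : ℕ) (t : ℝ) (x : Space d) :
    ‖trunc F n t x‖ₑ ≤ ‖F t x‖ₑ := enorm_indicator_le_enorm_self _ _

lemma enorm_sub_trunc_le (F : ℝ → Space d → ℂ) (n : ℕ) (t : ℝ) (x : Space d) :
    ‖F t x - trunc F n t x‖ₑ ≤ ‖F t x‖ₑ := by
  by_cases h : (t, x) ∈ {p : ℝ × Space d | ‖F p.1 p.2‖ ≤ n ∧ ‖p‖ ≤ n}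
  · rw [trunc, indicator_of_mem h]; simp
  · rw [trunc, indicator_of_notMem h]; simp

lemma tendsto_sub_trunc (F : ℝ → Space d → ℂ) (t : ℝ) (x : Space d) :
    Filter.Tendsto (fun n => ‖F t x - trunc F n t x‖ₑ) Filter.atTop (nhds 0) := by
  obtain ⟨N, hN⟩ := exists_nat_ge (max ‖F t x‖ ‖(t, x)‖)
  refine tendsto_const_nhds.congr' ?_
  filter_upwards [Filter.eventually_ge_atTop N] with n hn
  have hn' : (N : ℝ) ≤ n := by exact_mod_cast hn
  rw [trunc, indicator_of_mem]
  · simp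
  · exact ⟨(le_max_left _ _).trans (hN.trans hn'), (le_max_right _ _).trans (hN.trans hn')⟩

lemma mixedNorm_mono {u v : ℝ → Space d → ℂ} (h : ∀ t x, ‖u t x‖ₑ ≤ ‖v t x‖ₑ) (q r : ℝ≥0∞) :
    mixedNorm q r u ≤ mixedNorm q r v :=
  eLpNorm_mono_enorm fun t => by
    simp only [enorm_eq_self]; exact eLpNorm_mono_enorm fun x => h t x

lemma ae_eLpNorm_lt_top_of_mixedNorm {F : ℝ → Space d → ℂ}
    (hF : Measurable fun p : ℝ × Space d => F p.1 p.2) {p p₁ : ℝ≥0∞} (hp : p ≠ 0)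
    (h : mixedNorm p p₁ F < ∞) : ∀ᵐ s, eLpNorm (F s) p₁ volume < ∞ := by
  by_cases hpt : p = ∞
  · subst hpt
    rw [mixedNorm, eLpNorm_exponent_top] at h
    filter_upwards [ae_le_eLpNormEssSup (f := fun t => eLpNorm (F t) p₁ volume)] with s hs
    exact lt_of_le_of_lt hs h
  · rw [mixedNorm, eLpNorm_lt_top_iff_lintegral_rpow_enorm_lt_top hp hpt] at h
    have := ae_lt_top ((measurable_eLpNorm_slice hF p₁).enorm.pow_const _) h.ne
    filter_upwards [this] with s hs
    simpa [enorm_eq_self, ENNReal.rpow_lt_top_iff_of_pos (ENNReal.toReal_pos hp hpt)] using hs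

lemma tendsto_mixedNorm_sub_trunc {F : ℝ → Space d → ℂ}
    (hF : Measurable fun p : ℝ × Space d => F p.1 p.2) {p p₁ : ℝ≥0∞} (hp : p ≠ 0) (hpt : p ≠ ∞)
    (hp₁ : p₁ ≠ 0) (hp₁t : p₁ ≠ ∞) (h : mixedNorm p p₁ F < ∞) :
    Filter.Tendsto (fun n => mixedNorm p p₁ fun t x => F t x - trunc F n t x)
      Filter.atTop (nhds 0) := by
  have hm : ∀ n, Measurable fun p : ℝ × Space d => F p.1 p.2 - trunc F n p.1 p.2 :=
    fun n => hF.sub (niceST_trunc hF n).measurable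
  refine tendsto_eLpNorm_zero_of_dominated (g := fun t => eLpNorm (F t) p₁ volume)
    (fun n => measurable_eLpNorm_slice (hm n) p₁) hp hpt (fun n => Filter.Eventually.of_forall
      fun t => eLpNorm_mono_enorm fun x => enorm_sub_trunc_le F n t x) h ?_
  filter_upwards [ae_eLpNorm_lt_top_of_mixedNorm hF hp h] with t ht
  have := tendsto_eLpNorm_zero_of_dominated (μ := (volume : Measure (Space d)))
    (f := fun n x => ‖F t x - trunc F n t x‖ₑ)
    (g := fun x => ‖F t x‖ₑ) (fun n => by
      have h' := (hm n).comp (measurable_prodMk_left (x := t))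
      simp only [Function.comp_def] at h'
      exact h'.enorm) hp₁ hp₁t
    (fun n => Filter.Eventually.of_forall fun x => enorm_sub_trunc_le F n t x)
    (by rwa [eLpNorm_enorm]) (Filter.Eventually.of_forall fun x => tendsto_sub_trunc F t x)
  simpa only [eLpNorm_enorm] using this

lemma lintegral_one_add_rpow_lt_top {μ b : ℝ} (hμ : 0 < μ) (hb : 1 < b) (t : ℝ) :
    ∫⁻ s, ENNReal.ofReal ((1 + μ * |t - s|) ^ (-b)) =
      ∫⁻ s, ENNReal.ofReal ((1 + μ * |s|) ^ (-b)) ∧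
    ∫⁻ s, ENNReal.ofReal ((1 + μ * |s|) ^ (-b)) < ∞ := by
  constructor
  · exact lintegral_sub_left_eq_self (fun s : ℝ => ENNReal.ofReal ((1 + μ * |s|) ^ (-b))) t
  · have h := integrable_one_add_norm (E := ℝ) (μ := volume) (r := b) (by simpa using hb)
    have h2 := h.comp_mul_left' hμ.ne'
    have h3 := h2.2
    rw [hasFiniteIntegral_iff_ofReal (Filter.Eventually.of_forall fun x => by positivity)] at h3
    refine lt_of_eq_of_lt (lintegral_congr fun s => ?_) h3
    rw [Real.norm_eq_abs, abs_mul, abs_of_pos hμ]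

/-- Hölder's inequality in time against the decay factor. -/
lemma exists_lintegral_one_add_rpow_mul_le {q : ℝ≥0∞} (hq : 2 ≤ q) {μ a : ℝ} (hμ : 0 < μ)
    (ha0 : 0 ≤ a) (ha : 2 * recip q ≤ a) : ∃ M : ℝ≥0∞, M ≠ ∞ ∧ ∀ (t : ℝ) (φ : ℝ → ℝ≥0∞),
      Measurable φ → ∫⁻ s, ENNReal.ofReal ((1 + μ * |t - s|) ^ (-a)) * φ s ≤
        M * eLpNorm φ q.conjExponent volume := by
  by_cases hqt : q = ∞
  · subst hqt
    refine ⟨1, by simp, fun t φ hφ => ?_⟩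
    rw [conjExponent_top, eLpNorm_one_eq_lintegral_enorm, one_mul]
    refine lintegral_mono fun s => ?_
    rw [enorm_eq_self]
    calc _ ≤ 1 * φ s := by
          gcongr
          rw [← ENNReal.ofReal_one]
          exact ENNReal.ofReal_le_ofReal (Real.rpow_le_one_of_one_le_of_nonpos
            (by nlinarith [abs_nonneg (t - s)]) (by linarith))
      _ = _ := one_mul _
  · have hq2 : 2 ≤ q.toReal := by simpa using ENNReal.toReal_mono hqt hq
    have hc := toReal_conjExponent hq
    have hrq := recip_eq_inv_toReal q
    set ρ := q.toReal with hρ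
    have hρ0 : 0 < ρ := by linarith
    have hconj : ρ.HolderConjugate q.conjExponent.toReal := by
      rw [hc, hrq, Real.holderConjugate_iff]
      refine ⟨by linarith, ?_⟩
      rw [one_div, inv_inv]; ring
    -- Admissibility puts the decay factor into L^q: its q-th power decays at a rate a q ≥ 2.
    have hb : 1 < a * ρ := by
      rw [hrq] at ha
      have : 2 ≤ a * ρ := by
        calc (2:ℝ) = 2 * ρ⁻¹ * ρ := by field_simp
          _ ≤ _ := by gcongr
      linarith
    refine ⟨(∫⁻ s, ENNReal.ofReal ((1 + μ * |s|) ^ (-(a * ρ)))) ^ (1 / ρ), ?_, fun t φ hφ => ?_⟩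
    · exact ENNReal.rpow_ne_top_of_nonneg (by positivity)
        (lintegral_one_add_rpow_lt_top hμ hb 0).2.ne
    · have hmf : AEMeasurable (fun s => ENNReal.ofReal ((1 + μ * |t - s|) ^ (-a))) volume := by
        refine (ENNReal.measurable_ofReal.comp ?_).aemeasurable
        exact (measurable_const.add (measurable_const.mul
          (by fun_prop : Continuous fun s : ℝ => |t - s|).measurable)).pow_const _
      have h := ENNReal.lintegral_mul_le_Lp_mul_Lq volume hconj hmf hφ.aemeasurable
      refine h.trans_eq ?_
      rw [eLpNorm_eq_lintegral_rpow_enorm_toReal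
        (zero_lt_one.trans_le (one_le_conjExponent q)).ne' (conjExponent_ne_top hq),
        ← (lintegral_one_add_rpow_lt_top hμ hb t).1]
      simp only [enorm_eq_self]
      congr 3
      ext s
      rw [ENNReal.ofReal_rpow_of_nonneg (by positivity) hρ0.le, ← Real.rpow_mul (by positivity)]
      congr 2; ring

lemma stronglyMeasurable_conv_sub {lam : Space d → ℝ} (hlam : Measurable lam) {w : Space d → ℂ}
    (hw : Integrable w) {F : ℝ → Space d → ℂ} (hF : Measurable fun p : ℝ × Space d => F p.1 p.2)
    (t : ℝ) : StronglyMeasurable fun p : Space d × ℝ => conv lam w (t - p.2) (F p.2) p.1 := by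
  have h : Continuous fun p : (Space d × ℝ) × Space d => kern lam w (t - p.1.2) (p.1.1 - p.2) := by
    have h' := (continuous_kern hlam hw).comp
      (by fun_prop : Continuous fun p : (Space d × ℝ) × Space d => (t - p.1.2, p.1.1 - p.2))
    simp only [Function.comp_def] at h'
    exact h'
  have hm : StronglyMeasurable fun p : (Space d × ℝ) × Space d =>
      kern lam w (t - p.1.2) (p.1.1 - p.2) * F p.1.2 p.2 := by
    refine h.stronglyMeasurable.mul ?_
    have h' := hF.comp (by fun_prop : Measurable fun p : (Space d × ℝ) × Space d => (p.1.2, p.2))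
    simp only [Function.comp_def] at h'
    exact h'.stronglyMeasurable
  exact hm.integral_prod_right

/-- Local integrability of the time integral. -/
lemma exists_lintegral_ball_conv_le (d : ℕ) {σ : ℝ} (hσ : 0 < σ) {q r : ℝ≥0∞}
    (hqr : Admissible σ q r) {D μ₁ μ₂ : ℝ} {lam : Space d → ℝ} {m : Space d → ℂ}
    (h : KernelBounds σ D μ₁ μ₂ lam m) (R : ℝ) : ∃ M : ℝ≥0∞, M ≠ ∞ ∧
      ∀ (t : ℝ) (F : ℝ → Space d → ℂ), (Measurable fun p : ℝ × Space d => F p.1 p.2) →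
        mixedNorm q.conjExponent r.conjExponent F < ∞ →
        ∫⁻ x in Metric.ball 0 R, ∫⁻ s, ‖conv lam (fun η => m η * m η) (t - s) (F s) x‖ₑ ≤
          M * mixedNorm q.conjExponent r.conjExponent F := by
  obtain ⟨hq, hr, -, ha⟩ := id hqr
  have hrh := recip_le_half hr
  obtain ⟨K, hK, hKb⟩ := exists_eLpNorm_conv_decay d σ hr
  obtain ⟨M, hM, hMb⟩ := exists_lintegral_one_add_rpow_mul_le hq h.mu_two_pos
    (mul_nonneg hσ.le (by linarith : 0 ≤ 1 - 2 * recip r)) ha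
  have hw := h.isWeight_sq
  -- Integration over the ball is a pairing with its indicator, which lies in L^{r'}. Decay at a
  -- fixed time and Hölder in time then give a bound independent of t.
  set χ : Space d → ℂ := (Metric.ball 0 R).indicator fun _ => 1 with hχ
  have hχn : Nice χ := by
    refine ⟨measurable_const.indicator Metric.isOpen_ball.measurableSet, ⟨1, fun x => ?_⟩,
      ⟨R, fun x hx => ?_⟩⟩
    · exact (norm_indicator_le_norm_self _ _).trans (by simp)
    · rw [hχ, indicator_of_notMem]; simpa using hx.le
  have hχt := (hχn.memLp r.conjExponent volume).2.ne
  set A := ENNReal.ofReal (K * (D * μ₁ ^ (1 - 2 * recip r))) with hA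
  refine ⟨eLpNorm χ r.conjExponent volume * A * M, ENNReal.mul_ne_top
    (ENNReal.mul_ne_top hχt ENNReal.ofReal_ne_top) hM, fun t F hF hFt => ?_⟩
  have hmeas := (stronglyMeasurable_conv_sub h.measurable_lam hw.integrable hF t).measurable.enorm
  have hslice : ∀ s, Measurable (F s) := fun s => by
    have h' := hF.comp (measurable_prodMk_left (x := s))
    simp only [Function.comp_def] at h'
    exact h'
  rw [lintegral_lintegral_swap hmeas.aemeasurable]
  have hp0 : q.conjExponent ≠ 0 := (zero_lt_one.trans_le (one_le_conjExponent q)).ne'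
  calc _ ≤ ∫⁻ s, eLpNorm χ r.conjExponent volume * A *
        (ENNReal.ofReal ((1 + μ₂ * |t - s|) ^ (-(σ * (1 - 2 * recip r)))) *
          eLpNorm (F s) r.conjExponent volume) := by
        refine lintegral_mono_ae ?_
        filter_upwards [ae_eLpNorm_lt_top_of_mixedNorm hF hp0 hFt] with s hs
        have hc := (stronglyMeasurable_conv h.measurable_lam hw.integrable (hslice s)
          (t - s)).aestronglyMeasurable (μ := volume)
        have := ENNReal.HolderConjugate.conjExponent (le_trans (by norm_num) hr : 1 ≤ r)
        have h1 := eLpNorm_smul_le_mul_eLpNorm (p := r) (q := r.conjExponent) (r := 1)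
          hχn.measurable.aestronglyMeasurable hc
        rw [eLpNorm_one_eq_lintegral_enorm] at h1
        have e1 : ∫⁻ x in Metric.ball 0 R, ‖conv lam (fun η => m η * m η) (t - s) (F s) x‖ₑ =
            ∫⁻ x, ‖(conv lam (fun η => m η * m η) (t - s) (F s) • χ) x‖ₑ := by
          rw [← lintegral_indicator Metric.isOpen_ball.measurableSet]
          refine lintegral_congr fun x => ?_
          by_cases hx : x ∈ Metric.ball 0 R
          · simp [hχ, hx, indicator_of_mem, -Metric.mem_ball]
          · simp [hχ, hx, indicator_of_notMem, -Metric.mem_ball]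
        rw [e1]
        refine h1.trans ((mul_le_mul_left (hKb h hw (hslice s) hs (t - s)) _).trans_eq ?_)
        ring
    _ = eLpNorm χ r.conjExponent volume * A *
        ∫⁻ s, ENNReal.ofReal ((1 + μ₂ * |t - s|) ^ (-(σ * (1 - 2 * recip r)))) *
          eLpNorm (F s) r.conjExponent volume :=
        lintegral_const_mul' _ _ (ENNReal.mul_ne_top hχt ENNReal.ofReal_ne_top)
    _ ≤ _ := by
        rw [mul_assoc _ M]
        gcongr
        exact hMb t _ (measurable_eLpNorm_slice hF _)

end Strichartz

/-! ### Absolute convergence, and passage from truncations to general F. -/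

namespace Strichartz

variable {d : ℕ}

lemma measurable_slice {F : ℝ → Space d → ℂ} (hF : Measurable fun p : ℝ × Space d => F p.1 p.2)
    (s : ℝ) : Measurable (F s) := by
  have h' := hF.comp (measurable_prodMk_left (x := s))
  simp only [Function.comp_def] at h'
  exact h'

/-- Null sets may be checked on balls. -/
lemma ae_of_forall_ball {P : Space d → Prop}
    (h : ∀ n : ℕ, ∀ᵐ x ∂volume.restrict (Metric.ball 0 (n : ℝ)), P x) : ∀ᵐ x : Space d, P x := by
  have h2 := (ae_restrict_iUnion_iff (μ := (volume : Measure (Space d)))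
    (fun n : ℕ => Metric.ball 0 (n : ℝ)) P).2 h
  rwa [Metric.iUnion_ball_nat, Measure.restrict_univ] at h2

lemma measurable_lintegral_conv {lam : Space d → ℝ} (hlam : Measurable lam) {w : Space d → ℂ}
    (hw : Integrable w) {F : ℝ → Space d → ℂ} (hF : Measurable fun p : ℝ × Space d => F p.1 p.2)
    (t : ℝ) : Measurable fun x => ∫⁻ s, ‖conv lam w (t - s) (F s) x‖ₑ := by
  have h : Measurable fun p : Space d × ℝ => ‖conv lam w (t - p.2) (F p.2) p.1‖ₑ :=
    (stronglyMeasurable_conv_sub hlam hw hF t).measurable.enorm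
  exact h.lintegral_prod_right'

/-- The time integral converges absolutely at almost every point. -/
lemma ae_integrable_conv {σ : ℝ} (hσ : 0 < σ) {q r : ℝ≥0∞}
    (hqr : Admissible σ q r) {D μ₁ μ₂ : ℝ} {lam : Space d → ℝ} {m : Space d → ℂ}
    (h : KernelBounds σ D μ₁ μ₂ lam m) {F : ℝ → Space d → ℂ}
    (hF : Measurable fun p : ℝ × Space d => F p.1 p.2)
    (hFt : mixedNorm q.conjExponent r.conjExponent F < ∞) (t : ℝ) :
    ∀ᵐ x, Integrable fun s => conv lam (fun η => m η * m η) (t - s) (F s) x := by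
  have hsm := stronglyMeasurable_conv_sub h.measurable_lam h.isWeight_sq.integrable hF t
  refine ae_of_forall_ball fun n => ?_
  obtain ⟨M, hM, hMb⟩ := exists_lintegral_ball_conv_le d hσ hqr h n
  have hfin := (hMb t F hF hFt).trans_lt (ENNReal.mul_lt_top hM.lt_top hFt)
  have hmeas := measurable_lintegral_conv h.measurable_lam h.isWeight_sq.integrable hF t
  filter_upwards [ae_lt_top hmeas hfin.ne] with x hx
  refine ⟨?_, hx⟩
  have h' := hsm.measurable.comp (measurable_prodMk_left (x := x))
  simp only [Function.comp_def] at h'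
  exact h'.aestronglyMeasurable

lemma conv_sub {lam : Space d → ℝ} (hlam : Measurable lam)
    {w f g : Space d → ℂ} (hw : Integrable w) (hw2 : MemLp w 2 volume) (hf : Measurable f)
    (hg : Measurable g) {p : ℝ≥0∞}
    (h1 : 1 ≤ p) (h2 : p ≤ 2) (hfp : eLpNorm f p volume < ∞) (hgp : eLpNorm g p volume < ∞)
    (t : ℝ) (x : Space d) :
    conv lam w t (fun y => f y - g y) x = conv lam w t f x - conv lam w t g x := by
  rw [conv, conv, conv, ← integral_sub (integrable_kern_mul hlam hw hw2 hf h1 h2 hfp t x)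
    (integrable_kern_mul hlam hw hw2 hg h1 h2 hgp t x)]
  congr 1; ext y; ring

/-- The time s = t is a null set, so the strict cutoff of `ret` and the closed half-line give the
same integral. -/
lemma ret_eq_integral {lam : Space d → ℝ} (hlam : Measurable lam) {w : Space d → ℂ}
    (hw : Integrable w) {F : ℝ → Space d → ℂ} (hF : NiceST F) (t : ℝ) (x : Space d) :
    ret lam w F t x = ∫ s in Iic t, conv lam w (t - s) (F s) x := by
  have hS := measurable_prodMk_left (x := t) measurableSet_snd_lt_fst
  have e : Prod.mk t ⁻¹' {p : ℝ × ℝ | p.2 < p.1} = Iio t := by ext s; simp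
  rw [ret, cut, full_eq_integral_conv hlam hw (hF.restrict hS), e, integral_Iic_eq_integral_Iio,
    ← integral_indicator measurableSet_Iio]
  congr 1; ext s
  by_cases hs : s ∈ Iio t
  · rw [indicator_of_mem hs, indicator_of_mem hs]
  · rw [indicator_of_notMem hs, indicator_of_notMem hs]; simp [conv]

/-- The retarded integral is the pointwise limit of the integrals of suitable truncations. -/
lemma exists_tendsto_ret_trunc {σ : ℝ} (hσ : 0 < σ) {q r : ℝ≥0∞}
    (hqr : Admissible σ q r) {D μ₁ μ₂ : ℝ} {lam : Space d → ℝ} {m : Space d → ℂ}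
    (h : KernelBounds σ D μ₁ μ₂ lam m) {F : ℝ → Space d → ℂ}
    (hF : Measurable fun p : ℝ × Space d => F p.1 p.2)
    (hFt : mixedNorm q.conjExponent r.conjExponent F < ∞) :
    ∃ N : ℕ → ℕ, ∀ t, ∀ᵐ x, Filter.Tendsto
      (fun k => ret lam (fun η => m η * m η) (trunc F (N k)) t x) Filter.atTop
      (nhds (∫ s in Iic t, conv lam (fun η => m η * m η) (t - s) (F s) x)) := by
  obtain ⟨hq, hr, -, -⟩ := id hqr
  have hw := h.isWeight_sq
  have hp0 : q.conjExponent ≠ 0 := (zero_lt_one.trans_le (one_le_conjExponent q)).ne'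
  have hp₁0 : r.conjExponent ≠ 0 := (zero_lt_one.trans_le (one_le_conjExponent r)).ne'
  have hlim := tendsto_mixedNorm_sub_trunc hF hp0 (conjExponent_ne_top hq) hp₁0
    (conjExponent_ne_top hr) hFt
  -- Errors 2^{-k} have summable local L¹ norms, so the pointwise errors tend to zero almost
  -- everywhere. The choice depends only on F, and one subsequence serves all t.
  have hex : ∀ k : ℕ, ∃ n : ℕ, mixedNorm q.conjExponent r.conjExponent
      (fun t x => F t x - trunc F n t x) ≤ (2⁻¹ : ℝ≥0∞) ^ k := fun k => by
    have h0 : (0:ℝ≥0∞) < 2⁻¹ ^ k := ENNReal.pow_pos (by simp) k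
    exact ((ENNReal.tendsto_nhds_zero.1 hlim _ h0)).exists
  choose N hN using hex
  refine ⟨N, fun t => ?_⟩
  have hdm : ∀ k, Measurable fun p : ℝ × Space d => F p.1 p.2 - trunc F (N k) p.1 p.2 :=
    fun k => hF.sub (niceST_trunc hF (N k)).measurable
  have hdt : ∀ k, mixedNorm q.conjExponent r.conjExponent
      (fun t x => F t x - trunc F (N k) t x) < ∞ := fun k =>
    (mixedNorm_mono (enorm_sub_trunc_le F (N k)) _ _).trans_lt hFt
  set A : ℕ → Space d → ℝ≥0∞ := fun k x =>
    ∫⁻ s, ‖conv lam (fun η => m η * m η) (t - s) (fun y => F s y - trunc F (N k) s y) x‖ₑ with hA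
  have hAm : ∀ k, Measurable (A k) := fun k =>
    measurable_lintegral_conv h.measurable_lam hw.integrable
      (F := fun s y => F s y - trunc F (N k) s y) (hdm k) t
  have hA0 : ∀ᵐ x, Filter.Tendsto (fun k => A k x) Filter.atTop (nhds 0) := by
    refine ae_of_forall_ball fun n => ?_
    obtain ⟨M, hM, hMb⟩ := exists_lintegral_ball_conv_le d hσ hqr h n
    have hsum : ∫⁻ x in Metric.ball 0 (n : ℝ), ∑' k, A k x ≠ ∞ := by
      rw [lintegral_tsum fun k => (hAm k).aemeasurable]
      refine ne_top_of_le_ne_top (b := M * 2) (ENNReal.mul_ne_top hM (by norm_num)) ?_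
      calc _ ≤ ∑' k : ℕ, M * (2⁻¹ : ℝ≥0∞) ^ k := by
            refine ENNReal.tsum_le_tsum fun k => (hMb t (fun s y => F s y - trunc F (N k) s y) (hdm k) (hdt k)).trans ?_
            gcongr
            exact hN k
        _ = _ := by
            rw [ENNReal.tsum_mul_left, ENNReal.tsum_geometric, ENNReal.one_sub_inv_two, inv_inv]
    filter_upwards [ae_lt_top (Measurable.tsum hAm) hsum] with x hx
    exact ENNReal.tendsto_atTop_zero_of_tsum_ne_top hx.ne
  have hint : ∀ k, ∀ᵐ x, Integrable fun s =>
      conv lam (fun η => m η * m η) (t - s) (trunc F (N k) s) x := fun k =>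
    ae_integrable_conv hσ hqr h (niceST_trunc hF (N k)).measurable
      ((mixedNorm_mono (enorm_trunc_le F (N k)) _ _).trans_lt hFt) t
  filter_upwards [hA0, ae_integrable_conv hσ hqr h hF hFt t, ae_all_iff.2 hint]
    with x hx0 hxF hxk
  rw [tendsto_iff_edist_tendsto_0]
  refine tendsto_of_tendsto_of_tendsto_of_le_of_le tendsto_const_nhds hx0 (fun _ => zero_le)
    fun k => ?_
  dsimp only
  rw [ret_eq_integral h.measurable_lam hw.integrable (niceST_trunc hF (N k)), edist_comm,
    edist_eq_enorm_sub, ← integral_sub hxF.integrableOn (hxk k).integrableOn]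
  refine (enorm_integral_le_lintegral_enorm _).trans ((setLIntegral_le_lintegral _ _).trans ?_)
  refine lintegral_mono_ae ?_
  filter_upwards [ae_eLpNorm_lt_top_of_mixedNorm hF hp0 hFt] with s hs
  rw [conv_sub h.measurable_lam hw.integrable hw.memLp_two (measurable_slice hF s)
    (measurable_slice (niceST_trunc hF (N k)).measurable s) (one_le_conjExponent r)
    (conjExponent_le_two hr) hs (((niceST_trunc hF (N k)).slice s).memLp _ volume).2]

/-- The retarded estimate for convolution operators. -/
lemma exists_mixedNorm_integral_conv_le (d : ℕ) {σ : ℝ} (hσ : 0 < σ) {q r q₁ r₁ : ℝ≥0∞}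
    (hqr : Admissible σ q r) (he : ¬ IsEndpoint σ q r) (hqr₁ : Admissible σ q₁ r₁)
    (he₁ : ¬ IsEndpoint σ q₁ r₁) : ∃ K : ℝ, 0 < K ∧
      ∀ {θ θ₁ : ℝ}, IsTheta σ q r θ → IsTheta σ q₁ r₁ θ₁ →
      ∀ {D μ₁ μ₂ : ℝ} {lam : Space d → ℝ} {m : Space d → ℂ}, KernelBounds σ D μ₁ μ₂ lam m →
      ∀ {E E₁ : ℝ≥0∞}, SpaceBound m r E → SpaceBound m r₁ E₁ →
      ∀ {F : ℝ → Space d → ℂ}, (Measurable fun p : ℝ × Space d => F p.1 p.2) →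
        mixedNorm q₁.conjExponent r₁.conjExponent F < ∞ →
        mixedNorm q r (fun t x => ∫ s in Iic t, conv lam (fun η => m η * m η) (t - s) (F s) x) ≤
          ENNReal.ofReal K * (strichConst σ D μ₁ μ₂ θ q E * strichConst σ D μ₁ μ₂ θ₁ q₁ E₁) *
            mixedNorm q₁.conjExponent r₁.conjExponent F := by
  obtain ⟨K, hK, hKb⟩ := exists_mixedNorm_ret_strichConst_le d hσ hqr he hqr₁ he₁
  refine ⟨K, hK, ?_⟩
  intro θ θ₁ hθ hθ₁ D μ₁ μ₂ lam m h E E₁ hE hE₁ F hF hFt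
  obtain ⟨N, hN⟩ := exists_tendsto_ret_trunc hσ hqr₁ h hF hFt
  refine mixedNorm_le_of_tendsto (fun k => measurable_cut h.measurable_lam
    h.isWeight_sq.integrable measurableSet_snd_lt_fst (niceST_trunc hF (N k))) (fun k => ?_) hN
  refine (hKb hθ hθ₁ h hE hE₁ (niceST_trunc hF (N k))).trans ?_
  gcongr
  exact mixedNorm_mono (enorm_trunc_le F (N k)) _ _

end Strichartz

/-! ### Comparison of the constants. -/

namespace Strichartz

variable {d : ℕ}

/-- If σ(1-2/r) = 0 then 1/q = 0 as well, every value is allowed, and 1 is taken. -/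
lemma exists_isTheta {σ : ℝ} {q r : ℝ≥0∞} (hσ : 0 < σ) (h : Admissible σ q r) :
    ∃ θ, IsTheta σ q r θ := by
  obtain ⟨hq, hr, -, h4⟩ := h
  have hq0 := recip_nonneg q
  have hrh := recip_le_half hr
  have ha : 0 ≤ σ * (1 - 2 * recip r) := mul_nonneg hσ.le (by linarith)
  rcases eq_or_lt_of_le ha with h0 | h0
  · exact ⟨1, zero_le_one, le_rfl, by linarith⟩
  · exact ⟨2 * recip q / (σ * (1 - 2 * recip r)), by positivity, (div_le_one h0).2 h4,
      div_mul_cancel₀ _ h0.ne'⟩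

lemma rpow_le_of_one_le {a b : ℝ≥0∞} (hab : a ≤ b) (hb : 1 ≤ b) {x : ℝ} (h0 : 0 ≤ x) (h1 : x ≤ 1) :
    a ^ x ≤ b :=
  (ENNReal.rpow_le_rpow hab h0).trans
    ((ENNReal.rpow_le_rpow_of_exponent_le hb h1).trans_eq (ENNReal.rpow_one b))

lemma ofReal_rpow_le_max {C x : ℝ} (h0 : 0 ≤ x) (h1 : x ≤ 1) :
    ENNReal.ofReal C ^ x ≤ ENNReal.ofReal (max 1 C) :=
  rpow_le_of_one_le (ENNReal.ofReal_le_ofReal (le_max_right _ _))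
    (by rw [← ENNReal.ofReal_one]; exact ENNReal.ofReal_le_ofReal (le_max_left _ _)) h0 h1

lemma ofReal_mul_toReal {C : ℝ} (hC : 0 ≤ C) {S : ℝ≥0∞} (hS : S ≠ ∞) :
    ENNReal.ofReal (C * S.toReal) = ENNReal.ofReal C * S := by
  rw [ENNReal.ofReal_mul hC, ENNReal.ofReal_toReal hS]

lemma ofReal_sqrt_eq {D : ℝ} (hD : 0 ≤ D) :
    ENNReal.ofReal √D = ENNReal.ofReal D ^ (1 / 2 : ℝ) := by
  rw [Real.sqrt_eq_rpow, ENNReal.ofReal_rpow_of_nonneg hD (by norm_num)]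

lemma ofReal_mul_rpow_le {C : ℝ} (hC : 0 ≤ C) {S : ℝ≥0∞} (hS : S ≠ ∞) {x : ℝ} (h0 : 0 ≤ x)
    (h1 : x ≤ 1) : ENNReal.ofReal (C * S.toReal) ^ x ≤ ENNReal.ofReal (max 1 C) * S ^ x := by
  rw [ofReal_mul_toReal hC hS, ENNReal.mul_rpow_of_nonneg _ _ h0]
  gcongr
  exact ofReal_rpow_le_max h0 h1

/-- With the dispersive value of E the powers of D add up to 1/2 and those of μ₁ to 1/2-1/r, because
θσ(1-2/r) = 2/q. The bound no longer depends on θ. -/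
lemma strichConst_le {σ D μ₁ μ₂ θ K : ℝ} {q r : ℝ≥0∞} (hσ : 0 < σ) (hθ : IsTheta σ q r θ)
    (hD : 0 ≤ D) (hμ₁ : 0 < μ₁) (hμ₂ : 0 < μ₂) (hK : 0 ≤ K) :
    strichConst σ D μ₁ μ₂ θ q (ENNReal.ofReal (K * √D * μ₁ ^ (1 / 2 - recip r))) ≤
      ENNReal.ofReal (max 1 K) *
        (ENNReal.ofReal √D * ENNReal.ofReal (μ₁ ^ (1 / 2 - recip r) * μ₂ ^ (-recip q))) := by
  obtain ⟨h0, h1, hθ⟩ := hθ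
  have h1' : 0 ≤ 1 - θ := by linarith
  rw [strichConst, ENNReal.ofReal_rpow_of_nonneg hD (by positivity),
    ENNReal.ofReal_rpow_of_nonneg (by positivity) h1', ← ENNReal.ofReal_mul (by positivity),
    ← ENNReal.ofReal_mul (by positivity), ← ENNReal.ofReal_mul (by positivity),
    ← ENNReal.ofReal_mul (by positivity)]
  apply ENNReal.ofReal_le_ofReal
  have e1 : D ^ (θ / 2) * √D ^ (1 - θ) = √D := by
    rw [Real.sqrt_eq_rpow, ← Real.rpow_mul hD, ← Real.rpow_add_of_nonneg hD (by positivity)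
      (by positivity)]
    congr 1; ring
  have e2 : (μ₁ ^ (1 / 2 - recip r)) ^ (1 - θ) * (μ₁ ^ (1 / σ)) ^ recip q =
      μ₁ ^ (1 / 2 - recip r) := by
    rw [← Real.rpow_mul hμ₁.le, ← Real.rpow_mul hμ₁.le, ← Real.rpow_add hμ₁]
    congr 1
    have : recip q = θ * (σ * (1 - 2 * recip r)) / 2 := by linarith
    rw [this]; field_simp; ring
  rw [Real.mul_rpow (by positivity) (by positivity), Real.mul_rpow hK (by positivity),
    Real.mul_rpow (by positivity) (by positivity), Real.inv_rpow hμ₂.le, ← Real.rpow_neg hμ₂.le]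
  calc _ = K ^ (1 - θ) * ((D ^ (θ / 2) * √D ^ (1 - θ)) *
        (((μ₁ ^ (1 / 2 - recip r)) ^ (1 - θ) * (μ₁ ^ (1 / σ)) ^ recip q) * μ₂ ^ (-recip q))) := by ring
    _ = K ^ (1 - θ) * (√D * (μ₁ ^ (1 / 2 - recip r) * μ₂ ^ (-recip q))) := by rw [e1, e2]
    _ ≤ _ := by
      gcongr
      exact rpow_le_max_one hK h1' (by linarith)

/-- The constant of the retarded estimate with a sharp admissible pair on the right. -/
lemma strichConst_mul_sharp_le {σ C μ₁ μ₂ θ : ℝ} {q q₁ P Q S : ℝ≥0∞} (hC : 0 ≤ C)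
    (hμ₁ : 0 < μ₁) (hμ₂ : 0 < μ₂) (h0 : 0 ≤ θ) (h1 : θ ≤ 1) (hS : S ≠ ∞) :
    strichConst σ (C * S.toReal) μ₁ μ₂ θ q P * strichConst σ (C * S.toReal) μ₁ μ₂ 1 q₁ Q ≤
      ENNReal.ofReal (max 1 C * max 1 C) *
        ((S ^ (1 / 2 : ℝ) * (1 + S ^ (1 / 2 : ℝ)) ^ θ * P ^ (1 - θ)) *
          ENNReal.ofReal ((μ₁ ^ (1 / σ) * μ₂⁻¹) ^ (recip q + recip q₁))) := by
  have e1 : S ^ (θ / 2) ≤ (1 + S ^ (1 / 2 : ℝ)) ^ θ := by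
    rw [show θ / 2 = 1 / 2 * θ by ring, ENNReal.rpow_mul]
    gcongr
    exact le_add_self
  have e2 := ofReal_mul_rpow_le hC hS (x := θ / 2) (by positivity) (by linarith)
  have e3 := ofReal_mul_rpow_le hC hS (x := 1 / 2) (by norm_num) (by norm_num)
  have hx : 0 < μ₁ ^ (1 / σ) * μ₂⁻¹ := by positivity
  rw [strichConst, strichConst, Real.rpow_add hx,
    ENNReal.ofReal_mul (p := max 1 C) (q := max 1 C) (by positivity),
    ENNReal.ofReal_mul (p := (μ₁ ^ (1 / σ) * μ₂⁻¹) ^ recip q) (by positivity), sub_self, ENNReal.rpow_zero, mul_one]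
  calc _ ≤ (ENNReal.ofReal (max 1 C) * (1 + S ^ (1 / 2 : ℝ)) ^ θ) * P ^ (1 - θ) *
        ENNReal.ofReal ((μ₁ ^ (1 / σ) * μ₂⁻¹) ^ recip q) *
        ((ENNReal.ofReal (max 1 C) * S ^ (1 / 2 : ℝ)) *
          ENNReal.ofReal ((μ₁ ^ (1 / σ) * μ₂⁻¹) ^ recip q₁)) := by
        gcongr
        exact e2.trans (by gcongr)
    _ = _ := by ring

/-- The constant of the retarded estimate for two general admissible pairs. -/
lemma strichConst_mul_rpow_mul_rpow_le {σ C μ₁ μ₂ θ θ₁ β : ℝ} {q r q₁ P Q S : ℝ≥0∞} (hσ : 0 < σ)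
    (hC : 0 ≤ C) (hμ₁ : 0 < μ₁) (hμ₂ : 0 < μ₂) (hθ : IsTheta σ q r θ) (hθ₁0 : 0 ≤ θ₁)
    (hθ₁1 : θ₁ ≤ 1) (hS : S ≠ ∞) :
    strichConst σ (C * S.toReal) μ₁ μ₂ θ q P *
      ((ENNReal.ofReal √(C * S.toReal) * ENNReal.ofReal (μ₁ ^ β * μ₂ ^ (-recip q₁))) ^ (1 - θ) *
        strichConst σ (C * S.toReal) μ₁ μ₂ θ₁ q₁ Q ^ θ) ≤
      ENNReal.ofReal (max 1 C * max 1 C) *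
        (((S ^ (1 / 2 : ℝ) * P) ^ (1 - θ) *
          (S ^ (1 / 2 : ℝ) * (1 + S ^ (1 / 2 : ℝ)) * (1 + P + Q)) ^ θ) *
        ENNReal.ofReal (μ₁ ^ (β * (1 - θ) + 1 / σ * (σ * (1 / 2 - recip r) + recip q₁) * θ) *
          μ₂ ^ (-(recip q₁ + recip q)))) := by
  obtain ⟨h0, h1, hθ⟩ := hθ
  have h1' : 0 ≤ 1 - θ := by linarith
  have hD : 0 ≤ C * S.toReal := by positivity
  set c := ENNReal.ofReal (max 1 C) with hc
  have hc1 : 1 ≤ c := by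
    rw [hc, ← ENNReal.ofReal_one]; exact ENNReal.ofReal_le_ofReal (le_max_left _ _)
  have eD : ENNReal.ofReal (C * S.toReal) ^ (θ / 2) *
      (ENNReal.ofReal √(C * S.toReal)) ^ (1 - θ) ≤
      c * ((S ^ (1 / 2 : ℝ)) ^ (1 - θ) * (S ^ (1 / 2 : ℝ)) ^ θ) := by
    rw [ofReal_sqrt_eq hD, ← ENNReal.rpow_mul, ← ENNReal.rpow_add_of_nonneg _ _ (by positivity)
      (by positivity), ← ENNReal.rpow_add_of_nonneg _ _ h1' h0, sub_add_cancel, ENNReal.rpow_one,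
      show θ / 2 + 1 / 2 * (1 - θ) = 1 / 2 by ring]
    exact ofReal_mul_rpow_le hC hS (by norm_num) (by norm_num)
  -- The parameter θ₁ of the pair on the right must not appear in the final constant. The bases are
  -- enlarged to be at least one, and then dominate their powers with exponents in [0,1]. This
  -- accounts for the sums in C₅.
  have eQ : ENNReal.ofReal (C * S.toReal) ^ (θ₁ / 2) * Q ^ (1 - θ₁) ≤
      c * ((1 + S ^ (1 / 2 : ℝ)) * (1 + P + Q)) := by
    rw [← mul_assoc]
    have e4 : S ^ (θ₁ / 2) ≤ 1 + S ^ (1 / 2 : ℝ) := by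
      rw [show θ₁ / 2 = 1 / 2 * θ₁ by ring, ENNReal.rpow_mul]
      exact rpow_le_of_one_le le_add_self le_self_add hθ₁0 hθ₁1
    refine mul_le_mul' ((ofReal_mul_rpow_le hC hS (by positivity) (by linarith)).trans ?_) ?_
    · gcongr
    · refine rpow_le_of_one_le le_add_self ?_ (by linarith) (by linarith)
      rw [add_assoc]; exact le_self_add
  have eQθ : (ENNReal.ofReal (C * S.toReal) ^ (θ₁ / 2) * Q ^ (1 - θ₁)) ^ θ ≤
      c * ((1 + S ^ (1 / 2 : ℝ)) * (1 + P + Q)) ^ θ := by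
    refine (ENNReal.rpow_le_rpow eQ h0).trans ?_
    rw [ENNReal.mul_rpow_of_nonneg _ _ h0]
    gcongr
    exact rpow_le_of_one_le le_rfl hc1 h0 h1
  have hx : 0 < μ₁ ^ (1 / σ) * μ₂⁻¹ := by positivity
  have eμ : ENNReal.ofReal ((μ₁ ^ (1 / σ) * μ₂⁻¹) ^ recip q) *
      (ENNReal.ofReal (μ₁ ^ β * μ₂ ^ (-recip q₁)) ^ (1 - θ) *
        ENNReal.ofReal ((μ₁ ^ (1 / σ) * μ₂⁻¹) ^ recip q₁) ^ θ) =
      ENNReal.ofReal (μ₁ ^ (β * (1 - θ) + 1 / σ * (σ * (1 / 2 - recip r) + recip q₁) * θ) *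
          μ₂ ^ (-(recip q₁ + recip q))) := by
    rw [ENNReal.ofReal_rpow_of_nonneg (by positivity) h1',
      ENNReal.ofReal_rpow_of_nonneg (by positivity) h0, ← ENNReal.ofReal_mul (by positivity),
      ← ENNReal.ofReal_mul (by positivity)]
    congr 1
    have hsplit : ∀ x : ℝ, (μ₁ ^ (1 / σ) * μ₂⁻¹) ^ x = μ₁ ^ (1 / σ * x) * μ₂ ^ (-x) := by
      intro x
      rw [Real.mul_rpow (by positivity) (by positivity), Real.inv_rpow hμ₂.le,
        ← Real.rpow_neg hμ₂.le, ← Real.rpow_mul hμ₁.le]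
    rw [hsplit, hsplit, Real.mul_rpow (by positivity) (by positivity),
      Real.mul_rpow (by positivity) (by positivity), ← Real.rpow_mul hμ₁.le, ← Real.rpow_mul hμ₁.le,
      ← Real.rpow_mul hμ₂.le, ← Real.rpow_mul hμ₂.le]
    -- Here 1/q = θσ(1/2-1/r) is the relation 1/q = θ/q₀.
    have h3 : μ₁ ^ (β * (1 - θ) + 1 / σ * (σ * (1 / 2 - recip r) + recip q₁) * θ) =
        μ₁ ^ (1 / σ * recip q) * (μ₁ ^ (β * (1 - θ)) * μ₁ ^ (1 / σ * recip q₁ * θ)) := by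
      rw [← Real.rpow_add hμ₁, ← Real.rpow_add hμ₁]
      congr 1
      have : recip q = θ * (σ * (1 - 2 * recip r)) / 2 := by linarith
      rw [this]; field_simp; ring
    have h4 : μ₂ ^ (-(recip q₁ + recip q)) =
        μ₂ ^ (-recip q) * (μ₂ ^ (-recip q₁ * (1 - θ)) * μ₂ ^ (-recip q₁ * θ)) := by
      rw [← Real.rpow_add hμ₂, ← Real.rpow_add hμ₂]
      congr 1; ring
    rw [h3, h4]; ring
  rw [strichConst, strichConst, ← eμ, ENNReal.mul_rpow_of_nonneg _ _ h1',
    ENNReal.mul_rpow_of_nonneg _ (ENNReal.ofReal _) h0, ENNReal.mul_rpow_of_nonneg _ P h1',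
    mul_assoc (S ^ (1 / 2 : ℝ)), ENNReal.mul_rpow_of_nonneg (S ^ (1 / 2 : ℝ)) (_ * _) h0,
    ENNReal.ofReal_mul (p := max 1 C) (q := max 1 C) (by positivity), ← hc]
  calc _ = (ENNReal.ofReal (C * S.toReal) ^ (θ / 2) * (ENNReal.ofReal √(C * S.toReal)) ^ (1 - θ)) *
        (ENNReal.ofReal (C * S.toReal) ^ (θ₁ / 2) * Q ^ (1 - θ₁)) ^ θ * P ^ (1 - θ) *
        (ENNReal.ofReal ((μ₁ ^ (1 / σ) * μ₂⁻¹) ^ recip q) *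
        (ENNReal.ofReal (μ₁ ^ β * μ₂ ^ (-recip q₁)) ^ (1 - θ) *
        ENNReal.ofReal ((μ₁ ^ (1 / σ) * μ₂⁻¹) ^ recip q₁) ^ θ)) := by ring
    _ ≤ (c * ((S ^ (1 / 2 : ℝ)) ^ (1 - θ) * (S ^ (1 / 2 : ℝ)) ^ θ)) *
        (c * ((1 + S ^ (1 / 2 : ℝ)) * (1 + P + Q)) ^ θ) * P ^ (1 - θ) *
        (ENNReal.ofReal ((μ₁ ^ (1 / σ) * μ₂⁻¹) ^ recip q) *
        (ENNReal.ofReal (μ₁ ^ β * μ₂ ^ (-recip q₁)) ^ (1 - θ) *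
        ENNReal.ofReal ((μ₁ ^ (1 / σ) * μ₂⁻¹) ^ recip q₁) ^ θ)) := by
        exact mul_le_mul_left (mul_le_mul_left (mul_le_mul' eD eQθ) _) _
    _ = _ := by ring

end Strichartz

/-! ### From propagators to convolution operators. -/

namespace Strichartz

variable {d : ℕ}

/-- The decay estimate shows that m has an inverse transform which is a function, and hence that
`invFourier m` satisfies its specification. Only after this does the finiteness of its L¹ norm say
something about m. -/
lemma exists_kernelBounds_of_propagator {σ C μ₁ μ₂ : ℝ} (hC : 0 ≤ C) (hμ₁ : 0 < μ₁) (hμ₂ : 0 < μ₂)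
    {lam : Space d → ℝ} {m : Space d → ℂ} (hlam : AEMeasurable lam volume)
    (hm : MemLp m ∞ volume)
    (hdecay : ∀ (t : ℝ) (f : 𝓢(Space d, ℂ)), eLpNorm (propagator lam m t f) ∞ volume ≤
      ENNReal.ofReal (C * μ₁ / (1 + μ₂ * |t|) ^ σ) * eLpNorm f 1 volume)
    (henergy : ∀ (t : ℝ) (f : 𝓢(Space d, ℂ)),
      eLpNorm (propagator lam m t f) 2 volume ≤ ENNReal.ofReal C * eLpNorm f 2 volume)
    (hfin : eLpNorm (invFourier m) 1 volume < ∞) :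
    ∃ lam₀ m₀, lam₀ =ᵐ[volume] (fun η => lam ((2 * Real.pi) • η)) ∧
      m₀ =ᵐ[volume] (fun η => m ((2 * Real.pi) • η)) ∧
      KernelBounds σ (C * (eLpNorm (invFourier m) 1 volume).toReal) μ₁ μ₂ lam₀ m₀ ∧
      Integrable (invFourier m) ∧ IsFT (invFourier m) m₀ := by
  obtain ⟨lam₀, hae, h⟩ := exists_multiplierBounds hC hμ₁ hμ₂ hlam hm hdecay henergy
  obtain ⟨k, hk⟩ := h.exists_isFT hC hμ₁
  have hspec : IsFT (invFourier m) fun η => m ((2 * Real.pi) • η) :=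
    isFourierTransform_iff.1 (Classical.epsilon_spec (p := fun f => IsFourierTransform f m)
      ⟨k, isFourierTransform_iff.2 hk⟩)
  have hi : Integrable (invFourier m) :=
    integrable_of_eLpNorm_one_lt_top (MultiplierBounds.aestronglyMeasurable_of_isFT hspec) hfin
  obtain ⟨m₀, hm₀, hb⟩ := h.exists_kernelBounds hC hμ₁ hμ₂ hspec hi
  have e : ∫ x, ‖invFourier m x‖ = (eLpNorm (invFourier m) 1 volume).toReal := by
    rw [eLpNorm_one_eq_lintegral_enorm, integral_norm_eq_lintegral_enorm hi.1]
  rw [e] at hb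
  exact ⟨lam₀, m₀, hae, hm₀, hb, hi, hspec.congr Filter.EventuallyEq.rfl hm₀.symm⟩

/-- The operators `V(t)` act on almost every time slice as convolution operators. -/
lemma exists_ae_V_eq_conv {σ D μ₁ μ₂ : ℝ} {lam lam₀ : Space d → ℝ} {ψ m₀ : Space d → ℂ}
    (hlam : lam₀ =ᵐ[volume] fun η => lam ((2 * Real.pi) • η))
    (hm : m₀ =ᵐ[volume] fun η => ψ ((2 * Real.pi) • η)) (h : KernelBounds σ D μ₁ μ₂ lam₀ m₀)
    {q r : ℝ≥0∞} (hr : 2 ≤ r) {F : ℝ → Space d → ℂ}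
    (hF : MemMixed q.conjExponent r.conjExponent F) :
    ∃ F₀ : ℝ → Space d → ℂ, (Measurable fun p : ℝ × Space d => F₀ p.1 p.2) ∧
      mixedNorm q.conjExponent r.conjExponent F₀ = mixedNorm q.conjExponent r.conjExponent F ∧
      ∀ᵐ s, ∀ t x, V lam ψ t (F s) x = conv lam₀ (fun η => m₀ η * m₀ η) t (F₀ s) x := by
  obtain ⟨hFm, hFt⟩ := hF
  -- A jointly measurable representative. Almost all of its slices agree with those of F up to null
  -- sets, which neither the mixed norm nor the propagator sees.
  set F₀ : ℝ → Space d → ℂ := fun t x => hFm.mk _ (t, x) with hF₀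
  have hmeas : Measurable fun p : ℝ × Space d => F₀ p.1 p.2 := hFm.stronglyMeasurable_mk.measurable
  have hae : ∀ᵐ s, F s =ᵐ[volume] F₀ s := by
    have : ∀ᵐ z : ℝ × Space d ∂(volume.prod volume), F z.1 z.2 = F₀ z.1 z.2 := hFm.ae_eq_mk
    exact Measure.ae_ae_of_ae_prod this
  have hnorm : mixedNorm q.conjExponent r.conjExponent F₀ =
      mixedNorm q.conjExponent r.conjExponent F := by
    refine eLpNorm_congr_ae ?_
    filter_upwards [hae] with s hs
    exact (eLpNorm_congr_ae hs).symm
  refine ⟨F₀, hmeas, hnorm, ?_⟩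
  have hw := h.isWeight_sq
  have hp0 : q.conjExponent ≠ 0 := (zero_lt_one.trans_le (one_le_conjExponent q)).ne'
  filter_upwards [hae, ae_eLpNorm_lt_top_of_mixedNorm hmeas hp0 (hnorm ▸ hFt)] with s hs hst t x
  obtain ⟨g, hg, hgc⟩ := exists_isFT_conv_eq_kern h.measurable_lam hw.integrable hw.memLp_two
    (measurable_slice hmeas s) (one_le_conjExponent r) (conjExponent_le_two hr) hst
    ⟨D, fun η => (hw.norm_eq η).trans_le (h.sq_le η)⟩
  rw [hgc, V]
  refine propagator_eq_kern (hg.congr hs.symm Filter.EventuallyEq.rfl) hlam ?_ t x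
  filter_upwards [hm] with η hη
  rw [hη, sq]

/-- Absolute convergence and estimate of the retarded integral, with the constants of the
underlying convolution operators. -/
lemma exists_mixedNorm_retarded_le (d : ℕ) {σ C : ℝ} (hσ : 0 < σ) (hC : 0 ≤ C) {q r q₁ r₁ : ℝ≥0∞}
    (hqr : Admissible σ q r) (he : ¬ IsEndpoint σ q r) (hqr₁ : Admissible σ q₁ r₁)
    (he₁ : ¬ IsEndpoint σ q₁ r₁) : ∃ K L : ℝ, 0 < K ∧ 0 < L ∧
      ∀ {θ θ₁ : ℝ}, IsTheta σ q r θ → IsTheta σ q₁ r₁ θ₁ →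
      ∀ {lam : Space d → ℝ} {ψ : Space d → ℂ} {μ₁ μ₂ : ℝ}, DispersiveBounds σ C lam ψ μ₁ μ₂ →
      C2 ψ < ∞ → ∀ {F : ℝ → Space d → ℂ}, MemMixed q₁.conjExponent r₁.conjExponent F →
        (∀ t : ℝ, ∀ᵐ x : Space d, IntegrableOn (fun s => V lam ψ (t - s) (F s) x) (Iic t)) ∧
        mixedNorm q r (retarded lam ψ F) ≤ ENNReal.ofReal K *
          (strichConst σ (C * (C2 ψ).toReal) μ₁ μ₂ θ q (C4 ψ r) *
            strichConst σ (C * (C2 ψ).toReal) μ₁ μ₂ θ₁ q₁ (C4 ψ r₁)) *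
          mixedNorm q₁.conjExponent r₁.conjExponent F ∧
        mixedNorm q r (retarded lam ψ F) ≤ ENNReal.ofReal K *
          (strichConst σ (C * (C2 ψ).toReal) μ₁ μ₂ θ q (C4 ψ r) *
            (ENNReal.ofReal L * (ENNReal.ofReal √(C * (C2 ψ).toReal) *
              ENNReal.ofReal (μ₁ ^ (1 / 2 - recip r₁) * μ₂ ^ (-recip q₁))))) *
          mixedNorm q₁.conjExponent r₁.conjExponent F := by
  obtain ⟨K, hK, hKb⟩ := exists_mixedNorm_integral_conv_le d hσ hqr he hqr₁ he₁
  obtain ⟨L, hL, hLb⟩ := exists_spaceBound_of_kernelBounds d σ hqr₁.2.1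
  refine ⟨K, max 1 L, hK, by positivity, ?_⟩
  intro θ θ₁ hθ hθ₁ lam ψ μ₁ μ₂ h hfin F hF
  have hμ₁ := h.mu_one_pos
  have hμ₂ := h.mu_two_pos
  obtain ⟨lam₀, m₀, hlam, hm, hb, hi, hft⟩ := exists_kernelBounds_of_propagator hC hμ₁ hμ₂
    h.measurable_lam h.bounded_psi h.decay_Vtilde h.energy_Vtilde hfin
  change KernelBounds σ (C * (C2 ψ).toReal) μ₁ μ₂ lam₀ m₀ at hb
  obtain ⟨F₀, hF₀m, hF₀n, hF₀⟩ := exists_ae_V_eq_conv hlam hm hb hqr₁.2.1 hF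
  have hF₀t : mixedNorm q₁.conjExponent r₁.conjExponent F₀ < ∞ := hF₀n ▸ hF.2
  have hret : retarded lam ψ F =
      fun t x => ∫ s in Iic t, conv lam₀ (fun η => m₀ η * m₀ η) (t - s) (F₀ s) x := by
    ext t x
    rw [retarded]
    refine integral_congr_ae (ae_restrict_of_ae ?_)
    filter_upwards [hF₀] with s hs using hs (t - s) x
  have hEr : SpaceBound m₀ r (C4 ψ r) := spaceBound_of_isFT hi hft hqr.2.1
  refine ⟨fun t => ?_, ?_, ?_⟩
  · filter_upwards [ae_integrable_conv hσ hqr₁ hb hF₀m hF₀t t] with x hx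
    refine (hx.congr ?_).integrableOn
    filter_upwards [hF₀] with s hs using (hs (t - s) x).symm
  · rw [hret, ← hF₀n]
    exact hKb hθ hθ₁ hb hEr (spaceBound_of_isFT hi hft hqr₁.2.1) hF₀m hF₀t
  · rw [hret, ← hF₀n]
    -- The same estimate with the dispersive value of E for the pair on the right instead of C₄.
    -- Part (iii) is a mean of the two versions.
    refine (hKb hθ hθ₁ hb hEr (hLb hb) hF₀m hF₀t).trans ?_
    gcongr
    exact strichConst_le hσ hθ₁ hb.nonneg hμ₁ hμ₂ hL.le

end Strichartz

/-! ### The three estimates. -/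

namespace Strichartz

/-- The homogeneous estimates. -/
lemma exists_mixedNorm_V_le (d : ℕ) {σ C : ℝ} (hσ : 0 < σ) (hC : 0 ≤ C) {q r : ℝ≥0∞}
    (hqr : Admissible σ q r) (he : ¬ IsEndpoint σ q r) : ∃ K : ℝ, 0 < K ∧
      ∀ (lam : Space d → ℝ) (ψ : Space d → ℂ) (μ₁ μ₂ : ℝ),
        DispersiveBounds σ C lam ψ μ₁ μ₂ → C1 ψ < ∞ →
        ∀ f : Space d → ℂ, MemLp f 2 volume →
          mixedNorm q r (fun t => V lam ψ t f) ≤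
            ENNReal.ofReal K * C1 ψ ^ (1 / 2 : ℝ) *
              ENNReal.ofReal (μ₁ ^ (1 / 2 - recip r) * μ₂ ^ (-recip q)) * eLpNorm f 2 volume := by
  obtain ⟨K, hK, hKb⟩ := exists_mixedNorm_kern_le d hσ hqr he
  obtain ⟨L, hL, hLb⟩ := exists_spaceBound_of_kernelBounds d σ hqr.2.1
  obtain ⟨θ, hθ⟩ := exists_isTheta hσ hqr
  refine ⟨K * (max 1 L * max 1 C), by positivity, ?_⟩
  intro lam ψ μ₁ μ₂ h hfin f hf
  have hμ₁ := h.mu_one_pos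
  have hμ₂ := h.mu_two_pos
  have hψ2 : MemLp (fun ξ => ψ ξ ^ 2) ∞ volume := by
    simp_rw [sq]
    exact h.bounded_psi.mul h.bounded_psi
  -- Here the multiplier is ψ², so that T T* has symbol |ψ|⁴ and D = C·C₁.
  obtain ⟨lam₀, m₀, hlam, hm, hb, -, -⟩ := exists_kernelBounds_of_propagator hC hμ₁ hμ₂
    h.measurable_lam hψ2 h.decay_V h.energy_V hfin
  change KernelBounds σ (C * (C1 ψ).toReal) μ₁ μ₂ lam₀ m₀ at hb
  obtain ⟨g, hg, hg2, hgn⟩ := exists_isFT_of_memLp_two hf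
  have e : (fun t => V lam ψ t f) = kern lam₀ fun η => m₀ η * g η := by
    ext t x
    exact propagator_eq_kern hg hlam hm t x
  rw [e, ← hgn, ENNReal.ofReal_mul hK.le, ENNReal.ofReal_mul (by positivity)]
  refine (hKb hθ hb (hLb hb) hg2).trans ?_
  have hconst : strichConst σ (C * (C1 ψ).toReal) μ₁ μ₂ θ q
      (ENNReal.ofReal (L * √(C * (C1 ψ).toReal) * μ₁ ^ (1 / 2 - recip r))) ≤
      ENNReal.ofReal (max 1 L) * ((ENNReal.ofReal (max 1 C) * C1 ψ ^ (1 / 2 : ℝ)) *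
        ENNReal.ofReal (μ₁ ^ (1 / 2 - recip r) * μ₂ ^ (-recip q))) := by
    refine (strichConst_le hσ hθ hb.nonneg hμ₁ hμ₂ hL.le).trans ?_
    gcongr
    rw [ofReal_sqrt_eq hb.nonneg]
    exact ofReal_mul_rpow_le hC hfin.ne (by norm_num) (by norm_num)
  refine (mul_le_mul_left (mul_le_mul_right hconst _) _).trans_eq ?_
  ring

/-- The retarded estimates with a sharp admissible pair on the right. -/
lemma exists_mixedNorm_retarded_sharp_le (d : ℕ) {σ C : ℝ} (hσ : 0 < σ) (hC : 0 ≤ C)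
    {q r q₁ r₁ : ℝ≥0∞} (hqr : Admissible σ q r) (he : ¬ IsEndpoint σ q r)
    (hqr₁ : SharpAdmissible σ q₁ r₁) (he₁ : ¬ IsEndpoint σ q₁ r₁) : ∃ K : ℝ, 0 < K ∧
      ∀ (θ : ℝ), IsTheta σ q r θ →
      ∀ (lam : Space d → ℝ) (ψ : Space d → ℂ) (μ₁ μ₂ : ℝ),
        DispersiveBounds σ C lam ψ μ₁ μ₂ → C2 ψ < ∞ →
        ∀ F : ℝ → Space d → ℂ, MemMixed q₁.conjExponent r₁.conjExponent F →
          (∀ t : ℝ, ∀ᵐ x : Space d, IntegrableOn (fun s => V lam ψ (t - s) (F s) x) (Iic t)) ∧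
          mixedNorm q r (retarded lam ψ F) ≤
            ENNReal.ofReal K *
              (C2 ψ ^ (1 / 2 : ℝ) * (1 + C2 ψ ^ (1 / 2 : ℝ)) ^ θ * C4 ψ r ^ (1 - θ)) *
              ENNReal.ofReal ((μ₁ ^ (1 / σ) * μ₂⁻¹) ^ (recip q + recip q₁)) *
              mixedNorm q₁.conjExponent r₁.conjExponent F := by
  obtain ⟨K, L, hK, -, hKb⟩ := exists_mixedNorm_retarded_le d hσ hC hqr he hqr₁.1 he₁
  refine ⟨K * (max 1 C * max 1 C), by positivity, ?_⟩
  intro θ hθ lam ψ μ₁ μ₂ h hfin F hF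
  -- For a sharp pair the parameter may be taken to be 1, which removes C₄ of the pair on the right
  -- from the constant.
  have hθ₁ : IsTheta σ q₁ r₁ 1 := ⟨zero_le_one, le_rfl, by rw [one_mul, hqr₁.2]⟩
  obtain ⟨h1, h2, -⟩ := hKb hθ hθ₁ h hfin hF
  refine ⟨h1, h2.trans ((mul_le_mul_left (mul_le_mul_right (strichConst_mul_sharp_le hC
    h.mu_one_pos h.mu_two_pos hθ.1 hθ.2.1 hfin.ne) _) _).trans_eq ?_)⟩
  rw [ENNReal.ofReal_mul hK.le]
  ring

/-- The retarded estimates for two general admissible pairs. -/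
lemma exists_mixedNorm_retarded_general_le (d : ℕ) {σ C : ℝ} (hσ : 0 < σ) (hC : 0 ≤ C)
    {q r q₁ r₁ : ℝ≥0∞} (hqr : Admissible σ q r) (he : ¬ IsEndpoint σ q r)
    (hqr₁ : Admissible σ q₁ r₁) (he₁ : ¬ IsEndpoint σ q₁ r₁) : ∃ K : ℝ, 0 < K ∧
      ∀ (θ : ℝ), IsTheta σ q r θ →
      ∀ (lam : Space d → ℝ) (ψ : Space d → ℂ) (μ₁ μ₂ : ℝ),
        DispersiveBounds σ C lam ψ μ₁ μ₂ → C2 ψ < ∞ →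
        ∀ F : ℝ → Space d → ℂ, MemMixed q₁.conjExponent r₁.conjExponent F →
          (∀ t : ℝ, ∀ᵐ x : Space d, IntegrableOn (fun s => V lam ψ (t - s) (F s) x) (Iic t)) ∧
          mixedNorm q r (retarded lam ψ F) ≤
            ENNReal.ofReal K *
              ((C2 ψ ^ (1 / 2 : ℝ) * C4 ψ r) ^ (1 - θ) * C5 ψ r r₁ ^ θ) *
              ENNReal.ofReal
                (μ₁ ^ ((1 / 2 - recip r₁) * (1 - θ) +
                    1 / σ * (σ * (1 / 2 - recip r) + recip q₁) * θ) *
                  μ₂ ^ (-(recip q₁ + recip q))) *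
              mixedNorm q₁.conjExponent r₁.conjExponent F := by
  obtain ⟨K, L, hK, hL, hKb⟩ := exists_mixedNorm_retarded_le d hσ hC hqr he hqr₁ he₁
  obtain ⟨θ₁, hθ₁⟩ := exists_isTheta hσ hqr₁
  refine ⟨K * (max 1 L * (max 1 C * max 1 C)), by positivity, ?_⟩
  intro θ hθ lam ψ μ₁ μ₂ h hfin F hF
  obtain ⟨h1, h2, h3⟩ := hKb hθ hθ₁ h hfin hF
  refine ⟨h1, ?_⟩
  have h1' : 0 ≤ 1 - θ := by linarith [hθ.2.1]
  have h0 := hθ.1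
  have hconst := strichConst_mul_rpow_mul_rpow_le (β := 1 / 2 - recip r₁) (q₁ := q₁)
    (P := C4 ψ r) (Q := C4 ψ r₁) hσ hC h.mu_one_pos h.mu_two_pos hθ hθ₁.1 hθ₁.2.1 hfin.ne
  set N := mixedNorm q₁.conjExponent r₁.conjExponent F with hN
  set A := strichConst σ (C * (C2 ψ).toReal) μ₁ μ₂ θ q (C4 ψ r) with hA
  set B := strichConst σ (C * (C2 ψ).toReal) μ₁ μ₂ θ₁ q₁ (C4 ψ r₁) with hB
  set M := ENNReal.ofReal √(C * (C2 ψ).toReal) *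
    ENNReal.ofReal (μ₁ ^ (1 / 2 - recip r₁) * μ₂ ^ (-recip q₁)) with hM
  set k := ENNReal.ofReal K with hk
  set l := ENNReal.ofReal L with hl
  have e : (k * (A * (l * M)) * N) ^ (1 - θ) * (k * (A * B) * N) ^ θ =
      (k * A * N) * (l ^ (1 - θ) * (M ^ (1 - θ) * B ^ θ)) := by
    have e1 : k * (A * (l * M)) * N = (k * A * N) * (l * M) := by ring
    have e2 : k * (A * B) * N = (k * A * N) * B := by ring
    have e3 : (k * A * N) ^ (1 - θ) * (k * A * N) ^ θ = k * A * N := by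
      rw [← ENNReal.rpow_add_of_nonneg _ _ h1' h0]; simp
    rw [e1, e2, ENNReal.mul_rpow_of_nonneg _ (l * M) h1', ENNReal.mul_rpow_of_nonneg _ B h0,
      ENNReal.mul_rpow_of_nonneg l M h1']
    calc _ = ((k * A * N) ^ (1 - θ) * (k * A * N) ^ θ) *
          (l ^ (1 - θ) * (M ^ (1 - θ) * B ^ θ)) := by ring
      _ = _ := by rw [e3]
  -- Weight 1-θ goes to the version with the dispersive value of E on the right, weight θ to the
  -- version with C₄. The factors common to both come out unchanged, because the weights add up to
  -- one.
  refine (ENNReal_le_rpow_mul_rpow h0 hθ.2.1 h3 h2).trans ?_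
  rw [e, ENNReal.ofReal_mul hK.le, ENNReal.ofReal_mul (p := max 1 L) (by positivity), C5, ← hk]
  calc _ = k * (l ^ (1 - θ) * (A * (M ^ (1 - θ) * B ^ θ))) * N := by ring
    _ ≤ k * (ENNReal.ofReal (max 1 L) * _) * N :=
        mul_le_mul_left (mul_le_mul_right (mul_le_mul'
          (ofReal_rpow_le_max h1' (by linarith)) hconst) _) _
    _ = _ := by ring

end Strichartz

end

/-! ### The main theorem. -/

open Strichartz in
theorem propositiona1 (d : ℕ) (σ C : ℝ) (hσ : 0 < σ) (hC : 0 < C) :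
    -- (i) homogeneous estimates
    (∀ q r : ℝ≥0∞, Admissible σ q r → ¬ IsEndpoint σ q r →
      ∃ K : ℝ, 0 < K ∧
        ∀ (lam : Space d → ℝ) (ψ : Space d → ℂ) (μ₁ μ₂ : ℝ),
          DispersiveBounds σ C lam ψ μ₁ μ₂ → C1 ψ < ∞ →
          ∀ f : Space d → ℂ, MemLp f 2 volume →
            mixedNorm q r (fun t => V lam ψ t f) ≤
              ENNReal.ofReal K * C1 ψ ^ (1 / 2 : ℝ) *
                ENNReal.ofReal (μ₁ ^ (1 / 2 - recip r) * μ₂ ^ (-recip q)) * eLpNorm f 2 volume) ∧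
    -- (ii) retarded estimates, sharp admissible pair on the right
    (∀ q r q₁ r₁ : ℝ≥0∞, Admissible σ q r → ¬ IsEndpoint σ q r →
      SharpAdmissible σ q₁ r₁ → ¬ IsEndpoint σ q₁ r₁ →
      ∃ K : ℝ, 0 < K ∧
        ∀ (θ : ℝ), IsTheta σ q r θ →
        ∀ (lam : Space d → ℝ) (ψ : Space d → ℂ) (μ₁ μ₂ : ℝ),
          DispersiveBounds σ C lam ψ μ₁ μ₂ → C2 ψ < ∞ →
          ∀ F : ℝ → Space d → ℂ, MemMixed q₁.conjExponent r₁.conjExponent F →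
            (∀ t : ℝ, ∀ᵐ x : Space d, IntegrableOn (fun s => V lam ψ (t - s) (F s) x) (Iic t)) ∧
            mixedNorm q r (retarded lam ψ F) ≤
              ENNReal.ofReal K *
                (C2 ψ ^ (1 / 2 : ℝ) * (1 + C2 ψ ^ (1 / 2 : ℝ)) ^ θ * C4 ψ r ^ (1 - θ)) *
                ENNReal.ofReal ((μ₁ ^ (1 / σ) * μ₂⁻¹) ^ (recip q + recip q₁)) *
                mixedNorm q₁.conjExponent r₁.conjExponent F) ∧
    -- (iii) retarded estimates, general admissible pairs
    (∀ q r q₁ r₁ : ℝ≥0∞, Admissible σ q r → ¬ IsEndpoint σ q r →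
      Admissible σ q₁ r₁ → ¬ IsEndpoint σ q₁ r₁ →
      ∃ K : ℝ, 0 < K ∧
        ∀ (θ : ℝ), IsTheta σ q r θ →
        ∀ (lam : Space d → ℝ) (ψ : Space d → ℂ) (μ₁ μ₂ : ℝ),
          DispersiveBounds σ C lam ψ μ₁ μ₂ → C2 ψ < ∞ →
          ∀ F : ℝ → Space d → ℂ, MemMixed q₁.conjExponent r₁.conjExponent F →
            (∀ t : ℝ, ∀ᵐ x : Space d, IntegrableOn (fun s => V lam ψ (t - s) (F s) x) (Iic t)) ∧
            mixedNorm q r (retarded lam ψ F) ≤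
              ENNReal.ofReal K *
                ((C2 ψ ^ (1 / 2 : ℝ) * C4 ψ r) ^ (1 - θ) * C5 ψ r r₁ ^ θ) *
                -- here `σ * (1 / 2 - recip r)` is `1 / q₀`, where `q₀ = 2r / (σ(r-2))`
                ENNReal.ofReal
                  (μ₁ ^ ((1 / 2 - recip r₁) * (1 - θ) +
                      1 / σ * (σ * (1 / 2 - recip r) + recip q₁) * θ) *
                    μ₂ ^ (-(recip q₁ + recip q))) *
                mixedNorm q₁.conjExponent r₁.conjExponent F) := by
  exact ⟨fun _ _ hqr he => exists_mixedNorm_V_le d hσ hC.le hqr he,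
    fun _ _ _ _ hqr he hqr₁ he₁ => exists_mixedNorm_retarded_sharp_le d hσ hC.le hqr he hqr₁ he₁,
    fun _ _ _ _ hqr he hqr₁ he₁ => exists_mixedNorm_retarded_general_le d hσ hC.le hqr he hqr₁ he₁⟩
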